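/- **Orbispaces.** Let $X$ be a locally connected space. A *$G$-structure* on a connected open set $U\subseteq X$ is a triple $(\widehat U,G_U,\pi_U)$: a connected, locally connected space $\widehat U$, a topological group $G_U$ acting continuously on $\widehat U$, and a continuous map $\pi_U:\widehat U\to U$ inducing a homeomorphism $\widehat U/G_U\cong U$. For a connected open $W\subseteq U$, a component $\widehat W$ of $\pi_U^{-1}(W)$ together with its setwise stabilizer in $G_U$ and $\pi_U|_{\widehat W}$ is a $G$-structure on $W$, called *induced*. An *isomorphism* of $G$-structures on the same set is a pair $(\phi,\lambda)$ of an isomorphism $\lambda$ of topological groups and a $\lambda$-equivariant homeomorphism $\phi$ commuting with the projections. An *orbispace structure* on $X$ is a base $\mathcal U$ of $X$ consisting of connected open sets (the *basic open sets*), which with each member contains all its non-empty connected open subsets, a $G$-structure on each $U\in\mathcal U$, and for all $U,V\in\mathcal U$ a set $Tran(U,V)$ of *transition maps*, non-empty if $U\cap V\neq\emptyset$. Each transition map has an underlying isomorphism $(\phi,\lambda)$ from a $G$-structure of a component of $U\cap V$ induced from $U$ to one induced from $V$ (different transition maps may have the same underlying pair). One requires: * for $t\in Tran(U,V)$, $g\in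 G_U$, $h\in G_V$ there is a transition map $h\circ t\circ g\in Tran(U,V)$ over the composite isomorphism, associatively and unitally in $g,h$; $h^{-1}\circ t\circ g=t$ if and only if $g$ lies in the domain of $\lambda$ and $\lambda(g)=h$; two elements of $Tran(U,V)$ over the same component of $U\cap V$ differ by such a pair $(g,h)$; * $Tran(U,U)$ contains the identity (so that $Tran(U,U)=G_U$); * if $a\in Tran(U,V)$, $b\in Tran(V,W)$ and $x\in\widehat U$ is a point at which the composition of maps $b\circ a$ is defined, there is a transition map $b\circ a\in Tran(U,W)$ whose domain contains $x$ and which agrees with the composition of $a$ and $b$, on spaces and on groups, wherever the latter is defined; it depends on $x$ only through its domain. This composition is associative, and composition with elements of $G_U=Tran(U,U)$ is the one above. $Tran(U,V)$ carries the topology inherited from the groups: a set is open if its preimage under $(h,g)\mapsto h\circ t\circ g$ is open in $G_V\times G_U$ for every $t$. An open subset $Y\subseteq X$ is an *open sub-orbispace*: its basic open sets are those of $X$ contained in $Y$, with the same $G$-structures and transition maps. A *base-point structure* $\underline o=(o,U_o,\hat o)$ consists of $o\in U_o\in\mathcal U$ and $\hat o\in\pi_{U_o}^{-1}(o)$; it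 is one of $Y$ as well if $U_o\subseteq Y$. **Paths and loops.** A *system* from $\underline o_1$ to $\underline o_2$ is $(\{I_k\},\{U_k\},\{f_k\},\{\rho_{k+1,k}\})$, $0\le k\le n$, $n\geq1$: intervals $I_k$, open in $[0,1]$ and covering it, with $0\in I_0$, $1\in I_n$, and $I_k\cap I_l=\emptyset$ if $|k-l|>1$; basic open sets $U_k$ with $U_0=U_{o_1}$, $U_n=U_{o_2}$; continuous maps $f_k:I_k\to\widehat{U_k}$ with $f_0(0)=\hat o_1$, $f_n(1)=\hat o_2$; and $\rho_{k+1,k}\in Tran(U_k,U_{k+1})$ with $f_{k+1}=\rho_{k+1,k}\circ f_k$ on $I_k\cap I_{k+1}$. A system $(\{J_k\},\{V_k\},\{g_k\},\{\xi_{k+1,k}\})$, $0\le k\le m$, *refines* it if there are a map $\theta:\{0,\dots,m\}\to\{0,\dots,n\}$ with $\theta(0)=0$, $\theta(m)=n$, $J_k\subseteq I_{\theta(k)}$, and $\jmath_k\in Tran(V_k,U_{\theta(k)})$ with $\jmath_0$, $\jmath_m$ identities, $\jmath_k\circ g_k=f_{\theta(k)}$ on $J_k$, and $\jmath_{k+1}\circ\xi_{k+1,k}=\rho_{\theta(k+1)\theta(k)}\circ\jmath_k$,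 the compositions being formed at the points $g_k(t)$, $t\in J_k\cap J_{k+1}$ (here $\rho_{ii}$ is the identity and $\rho_{i,i+1}=\rho_{i+1,i}^{-1}$). A *based path* is a class of systems under the equivalence relation generated by refinement. A *based loop* is a based path from $\underline o$ to itself. The set $\Omega(X,\underline o)$ of based loops has the compact-open topology, generated by the following sets $\mathcal O(\sigma,K,V,A)$: $\sigma=(\{I_k\},\{U_k\},\{f_k\},\{\rho_{k+1,k}\})$ is a system, $K_k\subseteq I_k$ is compact, $V_k\subseteq\widehat{U_k}$ is open with $f_k(K_k)\subseteq V_k$, $A_k$ is an open neighbourhood of $\rho_{k+1,k}$ in $Tran(U_k,U_{k+1})$, and $\mathcal O(\sigma,K,V,A)$ is the set of the based loops that have a representative $(\{I'_k\},\{U_k\},\{f'_k\},\{\rho'_{k+1,k}\})$ with $K_k\subseteq I'_k\subseteq I_k$, $f'_k(K_k)\subseteq V_k$ and $\rho'_{k+1,k}\in A_k$. The fundamental group $\pi_1(X,\underline o)$ is the set of path components of $\Omega(X,\underline o)$, with the multiplication $[a][b]=[a\#b]$ induced by concatenation of systems. The inclusions of open sub-orbispaces induce homomorphisms of fundamental groups.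 The orbispace $X$ is *path-connected* if it is non-empty and for any $p,q\in X$ there is a based path between some base-point structures at $p$ and at $q$. **Theorem (Seifert–Van Kampen).** Let $X_1,X_2$ be open sub-orbispaces of an orbispace $X$ with $X=X_1\cup X_2$, such that $X_1$, $X_2$ and $X_{12}:=X_1\cap X_2$ are (non-empty and) path-connected, and let $\underline o=(o,U_o,\hat o)$ be a common base-point structure of them, i.e. $U_o\subseteq X_1\cap X_2$. Let $j_\alpha:\pi_1(X_{12},\underline o)\to\pi_1(X_\alpha,\underline o)$, $\alpha=1,2$, and $i_\alpha:\pi_1(X_\alpha,\underline o)\to\pi_1(X,\underline o)$, $\alpha=1,2,12$, be induced by the inclusions. Then for every group $H$ and all homomorphisms $\rho_\alpha:\pi_1(X_\alpha,\underline o)\to H$, $\alpha=1,2,12$, with $$\rho_1\circ j_1=\rho_{12}=\rho_2\circ j_2$$ there exists a homomorphism $\sigma:\pi_1(X,\underline o)\to H$ such that $\sigma\circ i_\alpha=\rho_\alpha$ for $\alpha=1,2,12$. -/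

import Mathlib

open Set Topology TopologicalSpace
open scoped Pointwise

universe u v

/-- `C` is a connected component of the subset `F`. -/
def IsComponentOf {X : Type*} [TopologicalSpace X] (C F : Set X) : Prop :=
  ∃ x ∈ F, C = connectedComponentIn F x

/-- A `G`-structure `(Û, G_U, π_U)` on the open set `U` of `X`: a connected, locally connected
space `Û` with a continuous action of a topological group `G_U`, and a map `π_U : Û → U` inducing a
homeomorphism `Û / G_U ≅ U`. The map is written with values in `X`; since `U` is open, the last
condition says that it is continuous and open, has range `U`, and that its fibres are the orbits. -/
structure GStructure {X : Type u} [TopologicalSpace X] (U : Opens X) : Type (u + 1) where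
  Cov : Type u
  Grp : Type u
  [topCov : TopologicalSpace Cov]
  [connCov : ConnectedSpace Cov]
  [locConnCov : LocallyConnectedSpace Cov]
  [group : Group Grp]
  [topGrp : TopologicalSpace Grp]
  [isTopGrp : IsTopologicalGroup Grp]
  [action : MulAction Grp Cov]
  [contAction : ContinuousSMul Grp Cov]
  proj : Cov → X
  continuous_proj : Continuous proj
  isOpenMap_proj : IsOpenMap proj
  range_proj : range proj = (U : Set X)
  proj_eq_iff : ∀ x y : Cov, proj x = proj y ↔ ∃ g : Grp, g • x = y

attribute [instance] GStructure.topCov GStructure.connCov GStructure.locConnCov GStructure.group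
  GStructure.topGrp GStructure.isTopGrp GStructure.action GStructure.contAction

/-- An isomorphism `(φ, λ)` from an induced `G`-structure of a connected component `C` of `U ∩ V`
inside `A` to an induced `G`-structure of the same component inside `B`. Here `φ.source` is a
connected component of `π_A⁻¹(C)`, `φ.target` one of `π_B⁻¹(C)` (these sets are open), the groups
of the induced `G`-structures are the setwise stabilizers, and `C = π_A(φ.source)`. -/
structure GStructure.LocalIso {X : Type u} [TopologicalSpace X] {U V : Opens X}
    (A : GStructure U) (B : GStructure V) : Type u where
  φ : OpenPartialHomeomorph A.Cov B.Cov
  lam : MulAction.stabilizer A.Grp φ.source ≃ₜ* MulAction.stabilizer B.Grp φ.target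
  isComponent_base : IsComponentOf (A.proj '' φ.source) ((U : Set X) ∩ V)
  isComponent_source : IsComponentOf φ.source (A.proj ⁻¹' (A.proj '' φ.source))
  isComponent_target : IsComponentOf φ.target (B.proj ⁻¹' (A.proj '' φ.source))
  proj_apply : ∀ x ∈ φ.source, B.proj (φ x) = A.proj x
  equivariant : ∀ (g : MulAction.stabilizer A.Grp φ.source), ∀ x ∈ φ.source,
    φ ((g : A.Grp) • x) = (lam g : B.Grp) • φ x

/-- An orbispace structure on the (locally connected) space `X`. The collection of basic open sets
is the injective family `U : Idx → Opens X`; it is a base consisting of connected open sets and it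
contains every connected open subset of each of its members. -/
structure Orbispace (X : Type u) [TopologicalSpace X] : Type (u + 1) where
  locallyConnected : LocallyConnectedSpace X
  Idx : Type u
  U : Idx → Opens X
  U_injective : Function.Injective U
  isConnected_U : ∀ i, IsConnected (U i : Set X)
  isBasis : IsTopologicalBasis (range fun i => (U i : Set X))
  lower : ∀ (i : Idx) (W : Opens X), IsConnected (W : Set X) → W ≤ U i → ∃ j, U j = W
  /-- the `G`-structure assigned to each basic open set -/
  str : ∀ i, GStructure (U i)
  /-- the set of transition maps from `U i` to `U j`. Two different transition maps may have the
  same underlying pair `(φ, λ)`, so this is a type over the type of such pairs. -/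
  Tran : Idx → Idx → Type u
  iso : ∀ {i j}, Tran i j → (str i).LocalIso (str j)
  tran_nonempty : ∀ i j, ((U i : Set X) ∩ U j).Nonempty → Nonempty (Tran i j)
  /-- `act h t g` is the transition map `h ∘ t ∘ g` -/
  act : ∀ {i j}, (str j).Grp → Tran i j → (str i).Grp → Tran i j
  act_source : ∀ {i j} (h : (str j).Grp) (t : Tran i j) (g : (str i).Grp),
    (iso (act h t g)).φ.source = {x | g • x ∈ (iso t).φ.source}
  act_apply : ∀ {i j} (h : (str j).Grp) (t : Tran i j) (g : (str i).Grp) (x : (str i).Cov),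
    g • x ∈ (iso t).φ.source → (iso (act h t g)).φ x = h • (iso t).φ (g • x)
  act_lam : ∀ {i j} (h : (str j).Grp) (t : Tran i j) (g k : (str i).Grp)
    (hk : k ∈ MulAction.stabilizer (str i).Grp (iso (act h t g)).φ.source)
    (hk' : g * k * g⁻¹ ∈ MulAction.stabilizer (str i).Grp (iso t).φ.source),
    ((iso (act h t g)).lam ⟨k, hk⟩ : (str j).Grp) = h * (iso t).lam ⟨g * k * g⁻¹, hk'⟩ * h⁻¹
  act_one : ∀ {i j} (t : Tran i j), act 1 t 1 = t
  act_act : ∀ {i j} (h h' : (str j).Grp) (t : Tran i j) (g g' : (str i).Grp),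
    act h' (act h t g) g' = act (h' * h) t (g * g')
  act_eq_iff : ∀ {i j} (h : (str j).Grp) (t : Tran i j) (g : (str i).Grp),
    act h⁻¹ t g = t ↔
      ∃ hg : g ∈ MulAction.stabilizer (str i).Grp (iso t).φ.source,
        ((iso t).lam ⟨g, hg⟩ : (str j).Grp) = h
  /-- transition maps over the same component of `U i ∩ U j` differ by group elements -/
  exists_act : ∀ {i j} (t t' : Tran i j),
    (str i).proj '' (iso t').φ.source = (str i).proj '' (iso t).φ.source →
      ∃ (h : (str j).Grp) (g : (str i).Grp), t' = act h⁻¹ t g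
  /-- the identity transition map -/
  one : ∀ i, Tran i i
  one_source : ∀ i, (iso (one i)).φ.source = univ
  one_apply : ∀ i (x : (str i).Cov), (iso (one i)).φ x = x
  one_lam : ∀ i (g : (str i).Grp)
    (hg : g ∈ MulAction.stabilizer (str i).Grp (iso (one i)).φ.source),
    ((iso (one i)).lam ⟨g, hg⟩ : (str i).Grp) = g
  /-- The composition `b ∘ a`, formed at a point `x` at which the composition `b ∘ a` of maps is
  defined. (A transition map has a connected domain; if the composition of maps is defined over
  several components, then there is one composition for each of them, the one whose domain
  contains `x` being meant.) -/
  comp : ∀ {i j k} (b : Tran j k) (a : Tran i j) (x : (str i).Cov),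
    x ∈ ((iso a).φ.trans (iso b).φ).source → Tran i k
  mem_comp_source : ∀ {i j k} (b : Tran j k) (a : Tran i j) (x : (str i).Cov)
    (hx : x ∈ ((iso a).φ.trans (iso b).φ).source), x ∈ (iso (comp b a x hx)).φ.source
  comp_apply : ∀ {i j k} (b : Tran j k) (a : Tran i j) (x y : (str i).Cov)
    (hx : x ∈ ((iso a).φ.trans (iso b).φ).source), y ∈ ((iso a).φ.trans (iso b).φ).source →
    y ∈ (iso (comp b a x hx)).φ.source →
    (iso (comp b a x hx)).φ y = (iso b).φ ((iso a).φ y)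
  comp_lam : ∀ {i j k} (b : Tran j k) (a : Tran i j) (x : (str i).Cov)
    (hx : x ∈ ((iso a).φ.trans (iso b).φ).source) (g : (str i).Grp)
    (hg : g ∈ MulAction.stabilizer (str i).Grp (iso (comp b a x hx)).φ.source)
    (hga : g ∈ MulAction.stabilizer (str i).Grp (iso a).φ.source)
    (hgb : ((iso a).lam ⟨g, hga⟩ : (str j).Grp) ∈
      MulAction.stabilizer (str j).Grp (iso b).φ.source),
    ((iso (comp b a x hx)).lam ⟨g, hg⟩ : (str k).Grp) = (iso b).lam ⟨_, hgb⟩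
  /-- the composition depends on the point only through its domain -/
  comp_eq_of_mem : ∀ {i j k} (b : Tran j k) (a : Tran i j) (x y : (str i).Cov)
    (hx : x ∈ ((iso a).φ.trans (iso b).φ).source)
    (hy : y ∈ ((iso a).φ.trans (iso b).φ).source),
    y ∈ (iso (comp b a x hx)).φ.source → comp b a y hy = comp b a x hx
  comp_assoc : ∀ {i j k l} (c : Tran k l) (b : Tran j k) (a : Tran i j) (x : (str i).Cov)
    (h₁ : x ∈ ((iso a).φ.trans (iso b).φ).source)
    (h₂ : x ∈ ((iso (comp b a x h₁)).φ.trans (iso c).φ).source)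
    (h₃ : (iso a).φ x ∈ ((iso b).φ.trans (iso c).φ).source)
    (h₄ : x ∈ ((iso a).φ.trans (iso (comp c b ((iso a).φ x) h₃)).φ).source),
    comp c (comp b a x h₁) x h₂ = comp (comp c b ((iso a).φ x) h₃) a x h₄
  /-- composition with elements of `Tran i i = G_{U i}` is the usual one -/
  comp_act_one : ∀ {i j} (t : Tran i j) (g : (str i).Grp) (x : (str i).Cov)
    (hx : x ∈ ((iso (act g (one i) 1)).φ.trans (iso t).φ).source),
    comp t (act g (one i) 1) x hx = act 1 t g
  act_one_comp : ∀ {i j} (h : (str j).Grp) (t : Tran i j) (x : (str i).Cov)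
    (hx : x ∈ ((iso t).φ.trans (iso (act h (one j) 1)).φ).source),
    comp (act h (one j) 1) t x hx = act h t 1

namespace Orbispace

section Basic

variable {X : Type u} [TopologicalSpace X]

/-- The disjoint union of all the spaces `Û`, with its disjoint union topology. -/
abbrev Pt (𝒳 : Orbispace X) : Type u := Σ i : 𝒳.Idx, (𝒳.str i).Cov

/-- The set of all transition maps between all the basic open sets. -/
structure Arr (𝒳 : Orbispace X) : Type u where
  src : 𝒳.Idx
  tgt : 𝒳.Idx
  tran : 𝒳.Tran src tgt

/-- The natural topology of `Tran(U_i, U_j)`, inherited from the groups: a set is open if its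
inverse image under each map `(h, g) ↦ h ∘ t ∘ g` is open. -/
instance (𝒳 : Orbispace X) (i j : 𝒳.Idx) : TopologicalSpace (𝒳.Tran i j) :=
  ⨆ t : 𝒳.Tran i j,
    TopologicalSpace.coinduced
      (fun p : (𝒳.str j).Grp × (𝒳.str i).Grp => 𝒳.act p.1 t p.2) inferInstance

/-- The disjoint union topology on the set of all transition maps. -/
instance (𝒳 : Orbispace X) : TopologicalSpace 𝒳.Arr :=
  ⨆ (i : 𝒳.Idx) (j : 𝒳.Idx),
    TopologicalSpace.coinduced (fun t : 𝒳.Tran i j => (⟨i, j, t⟩ : 𝒳.Arr)) inferInstance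

/-- The identity of `Û_i` as a transition map. -/
def oneArr (𝒳 : Orbispace X) (i : 𝒳.Idx) : 𝒳.Arr := ⟨i, i, 𝒳.one i⟩

/-- `x` lies in the domain of the transition map `a`, and `a x = y`. -/
inductive Sends (𝒳 : Orbispace X) : 𝒳.Arr → 𝒳.Pt → 𝒳.Pt → Prop
  | mk {i j : 𝒳.Idx} (t : 𝒳.Tran i j) (x : (𝒳.str i).Cov) (hx : x ∈ (𝒳.iso t).φ.source) :
      Sends 𝒳 ⟨i, j, t⟩ ⟨i, x⟩ ⟨j, (𝒳.iso t).φ x⟩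

/-- `CompAt b a x c`: the transition maps `a` and `b` are composable at the point `x`, and `c` is
their composition `b ∘ a` formed at `x`. -/
inductive CompAt (𝒳 : Orbispace X) : 𝒳.Arr → 𝒳.Arr → 𝒳.Pt → 𝒳.Arr → Prop
  | mk {i j k : 𝒳.Idx} (b : 𝒳.Tran j k) (a : 𝒳.Tran i j) (x : (𝒳.str i).Cov)
      (hx : x ∈ ((𝒳.iso a).φ.trans (𝒳.iso b).φ).source) :
      CompAt 𝒳 ⟨j, k, b⟩ ⟨i, j, a⟩ ⟨i, x⟩ ⟨i, k, 𝒳.comp b a x hx⟩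

/-- A base-point structure `(o, U_o, ô)`. -/
structure BasePoint (𝒳 : Orbispace X) where
  pt : X
  idx : 𝒳.Idx
  lift : (𝒳.str idx).Cov
  proj_lift : (𝒳.str idx).proj lift = pt

/-- The point `ô` of the disjoint union of all the spaces `Û`. -/
def BasePoint.point {𝒳 : Orbispace X} (o : 𝒳.BasePoint) : 𝒳.Pt := ⟨o.idx, o.lift⟩

/-- A system `({I_k}, {U_k}, {f_k}, {ρ_{k+1,k}})`, `k = 0, …, n`, from `[0,1]` to
`(𝒳, o₁, o₂)`, with at least two intervals. The intervals `I_k` are open in `[0,1]`, cover it, and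
`I_k ∩ I_l` can be nonempty only if `|k - l| ≤ 1`; `0 ∈ I_0` and `1 ∈ I_n`; `f_k : I_k → Û_k` is
continuous; `ρ k` is a transition map in `Tran(U_k, U_{k+1})`, and `f_{k+1} = ρ k ∘ f_k` on
`I_k ∩ I_{k+1}`; `f_0(0) = ô₁` (so that `U_0 = U_{o₁}`) and `f_n(1) = ô₂` (so that
`U_n = U_{o₂}`). Only the values at the indices `k ≤ n` (`k < n` for `ρ`) and at the points of `I_k`
are meaningful. -/
structure PathSystem (𝒳 : Orbispace X) (o₁ o₂ : 𝒳.BasePoint) where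
  n : ℕ
  one_le_n : 1 ≤ n
  I : ℕ → Set unitInterval
  isOpen_I : ∀ k ≤ n, IsOpen (I k)
  ordConnected_I : ∀ k ≤ n, (I k).OrdConnected
  cover : ∀ t, ∃ k ≤ n, t ∈ I k
  disjoint : ∀ k l, k + 1 < l → l ≤ n → Disjoint (I k) (I l)
  zero_mem : 0 ∈ I 0
  one_mem : 1 ∈ I n
  chart : ℕ → 𝒳.Idx
  f : ℕ → unitInterval → 𝒳.Pt
  f_chart : ∀ k ≤ n, ∀ t ∈ I k, (f k t).1 = chart k
  continuousOn_f : ∀ k ≤ n, ContinuousOn (f k) (I k)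
  ρ : ℕ → 𝒳.Arr
  ρ_src : ∀ k < n, (ρ k).src = chart k
  ρ_tgt : ∀ k < n, (ρ k).tgt = chart (k + 1)
  ρ_sends : ∀ k < n, ∀ t ∈ I k ∩ I (k + 1), 𝒳.Sends (ρ k) (f k t) (f (k + 1) t)
  f_zero : f 0 0 = o₁.point
  f_one : f n 1 = o₂.point

/-- `κ` is a refinement of `σ`: there are an index map `θ` with `J_k ⊆ I_{θ k}`, `θ 0 = 0`,
`θ m = n`, and transition maps `j_k ∈ Tran(V_k, U_{θ k})`, the first and the last one being
identities, with `g_k = j_k⁻¹ ∘ f_{θ k}` and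
`ξ_{k+1,k} = j_{k+1}⁻¹ ∘ ρ_{θ(k+1),θ(k)} ∘ j_k`. As consecutive intervals meet,
`θ(k+1) - θ(k)` is `0`, `1` or `-1`, and `ρ_{θ(k+1),θ(k)}` is then the identity, the given
transition map, or the inverse of the given one. An isomorphism of systems `(δ_k)` is the case where
`θ` is the identity and `j_k = δ_k⁻¹`. -/
def PathSystem.Refines {𝒳 : Orbispace X} {o₁ o₂ : 𝒳.BasePoint} (κ σ : 𝒳.PathSystem o₁ o₂) :
    Prop :=
  ∃ (θ : ℕ → ℕ) (j : ℕ → 𝒳.Arr),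
    (∀ k ≤ κ.n, θ k ≤ σ.n ∧ κ.I k ⊆ σ.I (θ k)) ∧
    θ 0 = 0 ∧ θ κ.n = σ.n ∧
    j 0 = 𝒳.oneArr o₁.idx ∧ j κ.n = 𝒳.oneArr o₂.idx ∧
    (∀ k ≤ κ.n, (j k).src = κ.chart k ∧ (j k).tgt = σ.chart (θ k)) ∧
    (∀ k ≤ κ.n, ∀ t ∈ κ.I k, 𝒳.Sends (j k) (κ.f k t) (σ.f (θ k) t)) ∧
    ∀ k < κ.n, ∀ t ∈ κ.I k ∩ κ.I (k + 1),
      (θ (k + 1) = θ k → 𝒳.CompAt (j (k + 1)) (κ.ρ k) (κ.f k t) (j k)) ∧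
      (θ (k + 1) = θ k + 1 → ∃ c, 𝒳.CompAt (j (k + 1)) (κ.ρ k) (κ.f k t) c ∧
        𝒳.CompAt (σ.ρ (θ k)) (j k) (κ.f k t) c) ∧
      (θ k = θ (k + 1) + 1 → ∃ c, 𝒳.CompAt (j (k + 1)) (κ.ρ k) (κ.f k t) c ∧
        𝒳.CompAt (σ.ρ (θ (k + 1))) c (κ.f k t) (j k))

/-- The space of based paths from `o₁` to `o₂`: the set of systems modulo the equivalence relation
generated by refinement. -/
def PathSpace (𝒳 : Orbispace X) (o₁ o₂ : 𝒳.BasePoint) : Type u :=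
  Quot (PathSystem.Refines (𝒳 := 𝒳) (o₁ := o₁) (o₂ := o₂))

/-- The class of a system. -/
def PathSystem.cls {𝒳 : Orbispace X} {o₁ o₂ : 𝒳.BasePoint} (σ : 𝒳.PathSystem o₁ o₂) :
    𝒳.PathSpace o₁ o₂ := Quot.mk _ σ

/-- The set `O(σ, K, V, A)` of the based paths that have a representative over the same basic open
sets as `σ`, and over the same intervals up to shrinking them to intervals `I'_k` with
`K_k ⊆ I'_k ⊆ I_k`, such that `f_k(K_k) ⊆ V_k` and `ρ_{k+1,k} ∈ A_k`. (Only the compact sets `K_k`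
are controlled, as in the compact-open topology: the open intervals are not kept fixed.) -/
def PathSystem.nbhd {𝒳 : Orbispace X} {o₁ o₂ : 𝒳.BasePoint} (σ : 𝒳.PathSystem o₁ o₂)
    (K : ℕ → Set unitInterval) (V : ℕ → Set 𝒳.Pt) (A : ℕ → Set 𝒳.Arr) :
    Set (𝒳.PathSpace o₁ o₂) :=
  {a | ∃ τ : 𝒳.PathSystem o₁ o₂, τ.cls = a ∧ τ.n = σ.n ∧
    (∀ k ≤ σ.n, K k ⊆ τ.I k ∧ τ.I k ⊆ σ.I k ∧ τ.chart k = σ.chart k) ∧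
    (∀ k ≤ σ.n, ∀ t ∈ K k, τ.f k t ∈ V k) ∧ ∀ k < σ.n, τ.ρ k ∈ A k}

/-- The "compact-open" topology, generated by the sets `O(σ, K, V, A)` where `K_k ⊆ I_k` is compact,
`V_k` is open with `f_k(K_k) ⊆ V_k`, and `A_k` is an open neighbourhood of `ρ_{k+1,k}`. -/
instance (𝒳 : Orbispace X) (o₁ o₂ : 𝒳.BasePoint) : TopologicalSpace (𝒳.PathSpace o₁ o₂) :=
  TopologicalSpace.generateFrom
    {S | ∃ (σ : 𝒳.PathSystem o₁ o₂) (K : ℕ → Set unitInterval) (V : ℕ → Set 𝒳.Pt)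
      (A : ℕ → Set 𝒳.Arr),
      (∀ k ≤ σ.n, IsCompact (K k) ∧ K k ⊆ σ.I k ∧ IsOpen (V k) ∧ ∀ t ∈ K k, σ.f k t ∈ V k) ∧
      (∀ k < σ.n, IsOpen (A k) ∧ σ.ρ k ∈ A k) ∧ S = σ.nbhd K V A}

/-- The based loop space `Ω(𝒳, o)`. -/
abbrev LoopSpace (𝒳 : Orbispace X) (o : 𝒳.BasePoint) : Type u := 𝒳.PathSpace o o

/-- The set underlying the fundamental group `π₁(𝒳, o) = π₀(Ω(𝒳, o))`: the set of path components
of the based loop space. -/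
abbrev Pi1 (𝒳 : Orbispace X) (o : 𝒳.BasePoint) : Type u := ZerothHomotopy (𝒳.LoopSpace o)

/-- The homotopy class `[a]` of a based loop `a`. -/
def PathSpace.toPi1 {𝒳 : Orbispace X} {o : 𝒳.BasePoint} (a : 𝒳.PathSpace o o) : 𝒳.Pi1 o :=
  Quotient.mk _ a

/-- The orbispace is path-connected: it is not empty, and any two points `p`, `q` are joined by a
morphism `u` from `[0,1]` with `u(0) = p` and `u(1) = q`. -/
def PathConnected (𝒳 : Orbispace X) : Prop :=
  Nonempty X ∧ ∀ p q : X, ∃ o₁ o₂ : 𝒳.BasePoint, o₁.pt = p ∧ o₂.pt = q ∧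
    Nonempty (𝒳.PathSystem o₁ o₂)

/-- The map `t ↦ min (2 t) 1` of `[0,1]`. -/
noncomputable def dblL (t : unitInterval) : unitInterval := projIcc (0 : ℝ) 1 zero_le_one (2 * t)

/-- The map `t ↦ max (2 t - 1) 0` of `[0,1]`. -/
noncomputable def dblR (t : unitInterval) : unitInterval :=
  projIcc (0 : ℝ) 1 zero_le_one (2 * t - 1)

/-- The point `1/2` of `[0,1]`. -/
noncomputable def half : unitInterval := ⟨1 / 2, by norm_num, by norm_num⟩

theorem continuous_dblL : Continuous dblL := by unfold dblL; fun_prop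

theorem continuous_dblR : Continuous dblR := by unfold dblR; fun_prop

theorem monotone_dblL : Monotone dblL := fun s t h =>
  monotone_projIcc _ (by have : (s : ℝ) ≤ t := h; linarith)

theorem monotone_dblR : Monotone dblR := fun s t h =>
  monotone_projIcc _ (by have : (s : ℝ) ≤ t := h; linarith)

theorem dblL_of_le {t : unitInterval} (h : half ≤ t) : dblL t = 1 := by
  have h' : (1 / 2 : ℝ) ≤ t := h
  exact projIcc_of_right_le _ (by linarith)

theorem dblR_of_le {t : unitInterval} (h : t ≤ half) : dblR t = 0 := by
  have h' : (t : ℝ) ≤ 1 / 2 := h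
  exact projIcc_of_le_left _ (by linarith)

theorem half_lt_one : half < 1 := by
  change (1 / 2 : ℝ) < 1
  norm_num

theorem zero_lt_half : 0 < half := by
  change (0 : ℝ) < 1 / 2
  norm_num

theorem dblL_zero : dblL 0 = 0 := projIcc_of_le_left _ (by simp)

theorem dblR_one : dblR 1 = 1 := projIcc_of_right_le _ (by norm_num)

/-- The intervals of a concatenation: those of the first system but the last one, moved to
`[0,1/2)`; the union of the last one of the first system and the first one of the second system,
glued along `1/2`; those of the second system but the first one, moved to `(1/2,1]`. -/
def concatI (m : ℕ) (I J : ℕ → Set unitInterval) (k : ℕ) : Set unitInterval :=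
  {t | (k < m ∧ t < half ∧ dblL t ∈ I k) ∨ (k = m ∧ dblL t ∈ I m ∧ dblR t ∈ J 0) ∨
    (m < k ∧ half < t ∧ dblR t ∈ J (k - m))}

theorem concatI_lt {m k : ℕ} (I J : ℕ → Set unitInterval) (h : k < m) :
    concatI m I J k = Iio half ∩ dblL ⁻¹' I k := by
  ext t; simp [concatI, h, h.ne, h.not_gt]

theorem concatI_eq (m : ℕ) (I J : ℕ → Set unitInterval) :
    concatI m I J m = dblL ⁻¹' I m ∩ dblR ⁻¹' J 0 := by
  ext t; simp [concatI]

theorem concatI_gt {m k : ℕ} (I J : ℕ → Set unitInterval) (h : m < k) :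
    concatI m I J k = Ioi half ∩ dblR ⁻¹' J (k - m) := by
  ext t; simp [concatI, h, h.ne', h.not_gt]

end Basic

section Concat

variable {X : Type u} [TopologicalSpace X] {𝒳 : Orbispace X}

open Classical in
/-- The concatenation `σ # τ`, run through at double speed. The last basic open set of `σ` and the
first one of `τ` are both `U_{o₂}`; they are merged into one, with the map which is `f_n(2t)` for
`t ≤ 1/2` and `g_0(2t-1)` for `t ≥ 1/2`. -/
noncomputable def PathSystem.concat {o₁ o₂ o₃ : 𝒳.BasePoint} (σ : 𝒳.PathSystem o₁ o₂)
    (τ : 𝒳.PathSystem o₂ o₃) : 𝒳.PathSystem o₁ o₃ where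
  n := σ.n + τ.n
  one_le_n := σ.one_le_n.trans (Nat.le_add_right _ _)
  I := concatI σ.n σ.I τ.I
  isOpen_I k hk := by
    rcases lt_trichotomy k σ.n with h | h | h
    · rw [concatI_lt _ _ h]
      exact isOpen_Iio.inter ((σ.isOpen_I k h.le).preimage continuous_dblL)
    · subst h
      rw [concatI_eq]
      exact ((σ.isOpen_I _ le_rfl).preimage continuous_dblL).inter
        ((τ.isOpen_I 0 (Nat.zero_le _)).preimage continuous_dblR)
    · rw [concatI_gt _ _ h]
      exact isOpen_Ioi.inter ((τ.isOpen_I _ (by omega)).preimage continuous_dblR)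
  ordConnected_I k hk := by
    rcases lt_trichotomy k σ.n with h | h | h
    · rw [concatI_lt _ _ h]
      exact ordConnected_Iio.inter ((σ.ordConnected_I k h.le).preimage_mono monotone_dblL)
    · subst h
      rw [concatI_eq]
      exact ((σ.ordConnected_I _ le_rfl).preimage_mono monotone_dblL).inter
        ((τ.ordConnected_I 0 (Nat.zero_le _)).preimage_mono monotone_dblR)
    · rw [concatI_gt _ _ h]
      exact ordConnected_Ioi.inter ((τ.ordConnected_I _ (by omega)).preimage_mono monotone_dblR)
  cover t := by
    rcases le_total t half with h | h
    · have hR := dblR_of_le h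
      by_cases hm : dblL t ∈ σ.I σ.n
      · exact ⟨σ.n, by omega, by rw [concatI_eq]; exact ⟨hm, by simpa [hR] using τ.zero_mem⟩⟩
      · obtain ⟨k, hk, hkt⟩ := σ.cover (dblL t)
        have hlt : k < σ.n := lt_of_le_of_ne hk (by rintro rfl; exact hm hkt)
        refine ⟨k, by omega, ?_⟩
        rw [concatI_lt _ _ hlt]
        refine ⟨lt_of_le_of_ne h ?_, hkt⟩
        rintro rfl
        exact hm (by rw [dblL_of_le le_rfl]; exact σ.one_mem)
    · have hL := dblL_of_le h
      by_cases hm : dblR t ∈ τ.I 0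
      · exact ⟨σ.n, by omega, by rw [concatI_eq]; exact ⟨by simpa [hL] using σ.one_mem, hm⟩⟩
      · obtain ⟨k, hk, hkt⟩ := τ.cover (dblR t)
        have hlt : 0 < k := Nat.pos_of_ne_zero (by rintro rfl; exact hm hkt)
        refine ⟨σ.n + k, by omega, ?_⟩
        rw [concatI_gt _ _ (by omega)]
        refine ⟨lt_of_le_of_ne h ?_, by simpa using hkt⟩
        rintro rfl
        exact hm (by rw [dblR_of_le le_rfl]; exact τ.zero_mem)
  disjoint k l hkl hl := by
    rw [Set.disjoint_left]
    rintro t (⟨h1, h2, h3⟩ | ⟨h1, h2, h3⟩ | ⟨h1, h2, h3⟩) (⟨h1', h2', h3'⟩ | ⟨h1', h2', h3'⟩ | ⟨h1', h2', h3'⟩)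
    · exact Set.disjoint_left.1 (σ.disjoint k l hkl h1'.le) h3 h3'
    · subst h1'
      exact Set.disjoint_left.1 (σ.disjoint k σ.n hkl le_rfl) h3 h2'
    · exact absurd h2 h2'.not_gt
    · omega
    · omega
    · exact Set.disjoint_left.1 (τ.disjoint 0 (l - σ.n) (by omega) (by omega)) h3 h3'
    · omega
    · omega
    · exact Set.disjoint_left.1 (τ.disjoint (k - σ.n) (l - σ.n) (by omega) (by omega)) h3 h3'
  zero_mem := by
    rw [concatI_lt _ _ (by have := σ.one_le_n; omega)]
    exact ⟨zero_lt_half, by simpa [dblL_zero] using σ.zero_mem⟩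
  one_mem := by
    rw [concatI_gt _ _ (by have := τ.one_le_n; omega)]
    exact ⟨half_lt_one, by simpa [dblR_one] using τ.one_mem⟩
  chart k := if k ≤ σ.n then σ.chart k else τ.chart (k - σ.n)
  f k t := if k < σ.n ∨ (k = σ.n ∧ t ≤ half) then σ.f k (dblL t) else τ.f (k - σ.n) (dblR t)
  f_chart k hk t ht := by
    rcases ht with ⟨h1, h2, h3⟩ | ⟨h1, h2, h3⟩ | ⟨h1, h2, h3⟩
    · rw [if_pos (Or.inl h1), if_pos h1.le]
      exact σ.f_chart k h1.le _ h3
    · subst h1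
      rw [if_pos le_rfl]
      by_cases h : t ≤ half
      · rw [if_pos (Or.inr ⟨rfl, h⟩)]
        exact σ.f_chart _ le_rfl _ h2
      · rw [if_neg (by simp [h]), Nat.sub_self, τ.f_chart 0 (Nat.zero_le _) _ h3,
          ← τ.f_chart 0 (Nat.zero_le _) _ τ.zero_mem, τ.f_zero,
          ← σ.f_chart _ le_rfl _ σ.one_mem, σ.f_one]
    · rw [if_neg (by omega), if_neg (by omega)]
      exact τ.f_chart _ (by omega) _ h3
  continuousOn_f k hk := by
    rcases lt_trichotomy k σ.n with h | h | h
    · rw [concatI_lt _ _ h]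
      refine ((σ.continuousOn_f k h.le).comp continuous_dblL.continuousOn
        (fun t ht => ht.2)).congr fun t ht => ?_
      simp [h]
    · subst h
      rw [concatI_eq]
      have e : (fun t => if σ.n < σ.n ∨ (σ.n = σ.n ∧ t ≤ half) then σ.f σ.n (dblL t)
          else τ.f (σ.n - σ.n) (dblR t)) =
          fun t => if t ≤ half then σ.f σ.n (dblL t) else τ.f 0 (dblR t) := by
        funext t; simp
      rw [e]
      refine ContinuousOn.if ?_ ?_ ?_
      · rintro t ⟨_, ht⟩
        have : t = half := by
          have := frontier_le_subset_eq (continuous_id (X := unitInterval)) continuous_const ht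
          simpa using this
        subst this
        rw [dblL_of_le le_rfl, dblR_of_le le_rfl, σ.f_one, τ.f_zero]
      · exact ((σ.continuousOn_f _ le_rfl).comp continuous_dblL.continuousOn
          (fun t ht => ht.1.1))
      · exact ((τ.continuousOn_f 0 (Nat.zero_le _)).comp continuous_dblR.continuousOn
          (fun t ht => ht.1.2))
    · rw [concatI_gt _ _ h]
      refine ((τ.continuousOn_f _ (by omega)).comp continuous_dblR.continuousOn
        (fun t ht => ht.2)).congr fun t ht => ?_
      simp [h.ne', h.not_gt]
  ρ k := if k < σ.n then σ.ρ k else τ.ρ (k - σ.n)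
  ρ_src k hk := by
    rcases lt_trichotomy k σ.n with h | h | h
    · rw [if_pos h, if_pos h.le, σ.ρ_src k h]
    · subst h
      rw [if_neg (lt_irrefl _), if_pos le_rfl, Nat.sub_self, τ.ρ_src 0 (by have := τ.one_le_n; omega),
        ← τ.f_chart 0 (Nat.zero_le _) _ τ.zero_mem, τ.f_zero,
          ← σ.f_chart _ le_rfl _ σ.one_mem, σ.f_one]
    · rw [if_neg (by omega), if_neg (by omega), τ.ρ_src _ (by omega)]
  ρ_tgt k hk := by
    by_cases h : k < σ.n
    · rw [if_pos h, if_pos (by omega), σ.ρ_tgt k h]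
    · rw [if_neg h, if_neg (by omega), τ.ρ_tgt _ (by omega)]
      congr 1; omega
  ρ_sends k hk t ht := by
    obtain ⟨h1 | h1 | h1, h2 | h2 | h2⟩ := ht
    · simpa [h1.1, h2.1] using σ.ρ_sends k h1.1 _ ⟨h1.2.2, h2.2.2⟩
    · have := σ.ρ_sends k h1.1 (dblL t) ⟨h1.2.2, h2.1 ▸ h2.2.1⟩
      simpa [h1.1, h2.1, h1.2.1.le] using this
    · omega
    · omega
    · omega
    · have := τ.ρ_sends 0 (by omega) (dblR t) ⟨h1.2.2, by
        have := h2.2.2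
        rwa [show k + 1 - σ.n = 0 + 1 by omega] at this⟩
      obtain ⟨rfl, -, -⟩ := h1
      have e : σ.n + 1 - σ.n = 0 + 1 := by omega
      simpa [e, h2.2.1.not_ge] using this
    · omega
    · omega
    · have e : k + 1 - σ.n = k - σ.n + 1 := by omega
      have := τ.ρ_sends (k - σ.n) (by omega) (dblR t) ⟨h1.2.2, by
        have := h2.2.2
        rwa [e] at this⟩
      have a1 : ¬ k < σ.n := by omega
      have a2 : ¬ k + 1 < σ.n := by omega
      have a3 : ¬ k = σ.n := by omega
      have a4 : ¬ k + 1 = σ.n := by omega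
      simpa [a1, a2, a3, a4, e] using this
  f_zero := by
    rw [if_pos (Or.inl (by have := σ.one_le_n; omega)), dblL_zero, σ.f_zero]
  f_one := by
    rw [if_neg (by have := τ.one_le_n; omega), dblR_one, Nat.add_sub_cancel_left, τ.f_one]

end Concat

section Quotient

variable {X : Type u} [TopologicalSpace X] {𝒳 : Orbispace X}

theorem Sends.compAt_one_left {a : 𝒳.Arr} {x y : 𝒳.Pt} (h : 𝒳.Sends a x y) :
    𝒳.CompAt (𝒳.oneArr a.tgt) a x a := by
  obtain ⟨t, x, hx⟩ := h
  rename_i i j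
  have hx' : x ∈ ((𝒳.iso t).φ.trans (𝒳.iso (𝒳.one j)).φ).source := by
    rw [OpenPartialHomeomorph.trans_source, 𝒳.one_source]
    exact ⟨hx, trivial⟩
  have key : ∀ (e : 𝒳.Tran j j), e = 𝒳.act 1 (𝒳.one j) 1 →
      ∀ he : x ∈ ((𝒳.iso t).φ.trans (𝒳.iso e).φ).source, 𝒳.comp e t x he = t := by
    rintro e rfl he
    rw [𝒳.act_one_comp, 𝒳.act_one]
  have := CompAt.mk (𝒳.one j) t x hx'
  rwa [key _ (𝒳.act_one _).symm] at this

theorem Sends.compAt_one_right {a : 𝒳.Arr} {x y : 𝒳.Pt} (h : 𝒳.Sends a x y) :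
    𝒳.CompAt a (𝒳.oneArr a.src) x a := by
  obtain ⟨t, x, hx⟩ := h
  rename_i i j
  have hx' : x ∈ ((𝒳.iso (𝒳.one i)).φ.trans (𝒳.iso t).φ).source := by
    rw [OpenPartialHomeomorph.trans_source, 𝒳.one_source]
    refine ⟨trivial, ?_⟩
    change (𝒳.iso (𝒳.one i)).φ x ∈ (𝒳.iso t).φ.source
    rwa [𝒳.one_apply]
  have key : ∀ (e : 𝒳.Tran i i), e = 𝒳.act 1 (𝒳.one i) 1 →
      ∀ he : x ∈ ((𝒳.iso e).φ.trans (𝒳.iso t).φ).source, 𝒳.comp t e x he = t := by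
    rintro e rfl he
    rw [𝒳.comp_act_one, 𝒳.act_one]
  have := CompAt.mk t (𝒳.one i) x hx'
  rwa [key _ (𝒳.act_one _).symm] at this

theorem sends_one (x : 𝒳.Pt) : 𝒳.Sends (𝒳.oneArr x.1) x x := by
  have := Sends.mk (𝒳 := 𝒳) (𝒳.one x.1) x.2 (by rw [𝒳.one_source]; trivial)
  rwa [𝒳.one_apply] at this

namespace PathSystem

variable {o₁ o₂ o₃ : 𝒳.BasePoint}

theorem chart_zero (σ : 𝒳.PathSystem o₁ o₂) : σ.chart 0 = o₁.idx := by
  rw [← σ.f_chart 0 (Nat.zero_le _) _ σ.zero_mem, σ.f_zero]; rfl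

theorem chart_n (σ : 𝒳.PathSystem o₁ o₂) : σ.chart σ.n = o₂.idx := by
  rw [← σ.f_chart _ le_rfl _ σ.one_mem, σ.f_one]; rfl

theorem refines_refl (σ : 𝒳.PathSystem o₁ o₂) : σ.Refines σ := by
  refine ⟨id, fun k => 𝒳.oneArr (σ.chart k), fun k hk => ⟨hk, subset_rfl⟩, rfl, rfl, ?_, ?_,
    fun k _ => ⟨rfl, rfl⟩, fun k hk t ht => ?_, fun k hk t ht => ⟨fun h => ?_, fun _ => ?_,
    fun h => ?_⟩⟩
  · simp only [chart_zero]
  · simp only [chart_n]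
  · simp only [← σ.f_chart k hk t ht]; exact sends_one _
  · exact absurd h (Nat.succ_ne_self k)
  · have h := σ.ρ_sends k hk t ht
    refine ⟨σ.ρ k, ?_, ?_⟩
    · have := h.compAt_one_left
      rwa [σ.ρ_tgt k hk] at this
    · have := h.compAt_one_right
      rwa [σ.ρ_src k hk] at this
  · simp only [id] at h; omega

theorem mem_concat_left {σ : 𝒳.PathSystem o₁ o₂} {τ : 𝒳.PathSystem o₂ o₃} {k : ℕ}
    {t : unitInterval} (ht : t < half) :
    t ∈ (σ.concat τ).I k ↔ k ≤ σ.n ∧ dblL t ∈ σ.I k := by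
  have h0 : (0 : unitInterval) ∈ τ.I 0 := τ.zero_mem
  change t ∈ concatI σ.n σ.I τ.I k ↔ _
  rcases lt_trichotomy k σ.n with h | h | h
  · rw [concatI_lt _ _ h]; simp [h.le, ht]
  · subst h
    rw [concatI_eq]; simp [dblR_of_le ht.le, h0]
  · rw [concatI_gt _ _ h]; simp [h.not_ge, ht.not_gt]

theorem mem_concat_right {σ : 𝒳.PathSystem o₁ o₂} {τ : 𝒳.PathSystem o₂ o₃} {k : ℕ}
    {t : unitInterval} (ht : half < t) :
    t ∈ (σ.concat τ).I k ↔ σ.n ≤ k ∧ dblR t ∈ τ.I (k - σ.n) := by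
  have h0 := σ.one_mem
  change t ∈ concatI σ.n σ.I τ.I k ↔ _
  rcases lt_trichotomy k σ.n with h | h | h
  · rw [concatI_lt _ _ h]; simp [h.not_ge, ht.not_gt]
  · subst h
    rw [concatI_eq]; simp [dblL_of_le ht.le, h0]
  · rw [concatI_gt _ _ h]; simp [h.le, ht]

theorem mem_concat_half {σ : 𝒳.PathSystem o₁ o₂} {τ : 𝒳.PathSystem o₂ o₃} {k : ℕ} :
    half ∈ (σ.concat τ).I k ↔ k = σ.n := by
  have h0 := σ.one_mem
  have h1 := τ.zero_mem
  change half ∈ concatI σ.n σ.I τ.I k ↔ _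
  rcases lt_trichotomy k σ.n with h | h | h
  · rw [concatI_lt _ _ h]; simp [h.ne]
  · subst h
    rw [concatI_eq]; simp [dblL_of_le, dblR_of_le, h0, h1]
  · rw [concatI_gt _ _ h]; simp [h.ne']

theorem concat_f_left {σ : 𝒳.PathSystem o₁ o₂} {τ : 𝒳.PathSystem o₂ o₃} {k : ℕ}
    {t : unitInterval} (ht : t ≤ half) (hk : k ≤ σ.n) :
    (σ.concat τ).f k t = σ.f k (dblL t) := by
  refine if_pos ?_
  rcases hk.lt_or_eq with h | h
  · exact Or.inl h
  · exact Or.inr ⟨h, ht⟩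

theorem concat_f_right {σ : 𝒳.PathSystem o₁ o₂} {τ : 𝒳.PathSystem o₂ o₃} {k : ℕ}
    {t : unitInterval} (ht : half < t) (hk : σ.n ≤ k) :
    (σ.concat τ).f k t = τ.f (k - σ.n) (dblR t) :=
  if_neg (by rintro (h | ⟨_, h⟩); exacts [hk.not_gt h, ht.not_ge h])

theorem concat_chart_left {σ : 𝒳.PathSystem o₁ o₂} {τ : 𝒳.PathSystem o₂ o₃} {k : ℕ}
    (hk : k ≤ σ.n) : (σ.concat τ).chart k = σ.chart k := if_pos hk

theorem concat_chart_right {σ : 𝒳.PathSystem o₁ o₂} {τ : 𝒳.PathSystem o₂ o₃} {k : ℕ}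
    (hk : σ.n ≤ k) : (σ.concat τ).chart k = τ.chart (k - σ.n) := by
  rcases hk.eq_or_lt with rfl | h
  · rw [concat_chart_left le_rfl, chart_n, Nat.sub_self, chart_zero]
  · exact if_neg h.not_ge

theorem concat_rho_left {σ : 𝒳.PathSystem o₁ o₂} {τ : 𝒳.PathSystem o₂ o₃} {k : ℕ}
    (hk : k < σ.n) : (σ.concat τ).ρ k = σ.ρ k := if_pos hk

theorem concat_rho_right {σ : 𝒳.PathSystem o₁ o₂} {τ : 𝒳.PathSystem o₂ o₃} {k : ℕ}
    (hk : σ.n ≤ k) : (σ.concat τ).ρ k = τ.ρ (k - σ.n) := if_neg hk.not_gt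

theorem Refines.concat {κ σ : 𝒳.PathSystem o₁ o₂} {κ' σ' : 𝒳.PathSystem o₂ o₃}
    (h : κ.Refines σ) (h' : κ'.Refines σ') : (κ.concat κ').Refines (σ.concat σ') := by
  obtain ⟨θ, j, hI, hθ0, hθn, hj0, hjn, hst, hs, hc⟩ := h
  obtain ⟨θ', j', hI', hθ0', hθn', hj0', hjn', hst', hs', hc'⟩ := h'
  have hn : (κ.concat κ').n = κ.n + κ'.n := rfl
  have hn' : (σ.concat σ').n = σ.n + σ'.n := rfl
  have h1 := κ.one_le_n
  have h1' := κ'.one_le_n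
  set Θ : ℕ → ℕ := fun k => if k ≤ κ.n then θ k else θ' (k - κ.n) + σ.n with hΘ
  set J : ℕ → 𝒳.Arr := fun k => if k ≤ κ.n then j k else j' (k - κ.n) with hJ
  have ΘL : ∀ k ≤ κ.n, Θ k = θ k := fun k hk => if_pos hk
  have ΘR : ∀ k, κ.n ≤ k → Θ k = θ' (k - κ.n) + σ.n := fun k hk => by
    rcases hk.eq_or_lt with rfl | hk
    · rw [ΘL _ le_rfl, Nat.sub_self, hθ0', hθn, zero_add]
    · exact if_neg hk.not_ge
  have JL : ∀ k ≤ κ.n, J k = j k := fun k hk => if_pos hk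
  have JR : ∀ k, κ.n ≤ k → J k = j' (k - κ.n) := fun k hk => by
    rcases hk.eq_or_lt with rfl | hk
    · rw [JL _ le_rfl, Nat.sub_self, hj0', hjn]
    · exact if_neg hk.not_ge
  refine ⟨Θ, J, fun k hk => ⟨?_, fun t ht => ?_⟩, ?_, ?_, ?_, ?_, fun k hk => ?_,
    fun k hk t ht => ?_, fun k hk t ht => ?_⟩
  · rcases le_total k κ.n with hk' | hk'
    · rw [ΘL k hk']; have := (hI k hk').1; omega
    · rw [ΘR k hk']; have := (hI' (k - κ.n) (by omega)).1; omega
  · rcases lt_trichotomy t half with h | rfl | h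
    · rw [mem_concat_left h] at ht ⊢
      rw [ΘL k ht.1]
      exact ⟨(hI k ht.1).1, (hI k ht.1).2 ht.2⟩
    · rw [mem_concat_half] at ht ⊢
      rw [ht, ΘL _ le_rfl, hθn]
    · rw [mem_concat_right h] at ht ⊢
      rw [ΘR k ht.1, Nat.add_sub_cancel]
      exact ⟨Nat.le_add_left _ _, (hI' (k - κ.n) (by omega)).2 ht.2⟩
  · rw [ΘL _ (Nat.zero_le _), hθ0]
  · rw [ΘR _ (by omega), hn, Nat.add_sub_cancel_left, hθn', hn', add_comm]
  · rw [JL _ (Nat.zero_le _), hj0]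
  · rw [JR _ (by omega), hn, Nat.add_sub_cancel_left, hjn']
  · rcases le_total k κ.n with hk' | hk'
    · rw [JL k hk', ΘL k hk', concat_chart_left hk', concat_chart_left (hI k hk').1]
      exact hst k hk'
    · rw [JR k hk', ΘR k hk', concat_chart_right hk', concat_chart_right (Nat.le_add_left _ _),
        Nat.add_sub_cancel]
      exact hst' _ (by omega)
  · rcases lt_trichotomy t half with h | rfl | h
    · rw [mem_concat_left h] at ht
      rw [JL k ht.1, ΘL k ht.1, concat_f_left h.le ht.1, concat_f_left h.le (hI k ht.1).1]
      exact hs k ht.1 _ ht.2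
    · rw [mem_concat_half] at ht
      subst ht
      rw [JL _ le_rfl, ΘL _ le_rfl, hθn, concat_f_left le_rfl le_rfl,
        concat_f_left le_rfl le_rfl, dblL_of_le le_rfl]
      have := hs κ.n le_rfl 1 κ.one_mem
      rwa [hθn] at this
    · rw [mem_concat_right h] at ht
      rw [JR k ht.1, ΘR k ht.1, concat_f_right h ht.1, concat_f_right h (Nat.le_add_left _ _),
        Nat.add_sub_cancel]
      exact hs' _ (by omega) _ ht.2
  · obtain ⟨ht1, ht2⟩ := ht
    rcases lt_trichotomy t half with h | rfl | h
    · rw [mem_concat_left h] at ht1 ht2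
      have hlt : k < κ.n := ht2.1
      have := hc k hlt (dblL t) ⟨ht1.2, ht2.2⟩
      have b1 := (hI k hlt.le).1
      have b2 := (hI (k + 1) hlt).1
      rw [JL k hlt.le, JL (k + 1) hlt, ΘL k hlt.le, ΘL (k + 1) hlt, concat_rho_left hlt,
        concat_f_left h.le hlt.le]
      refine ⟨this.1, fun e => ?_, fun e => ?_⟩
      · rw [concat_rho_left (by omega)]; exact this.2.1 e
      · rw [concat_rho_left (by omega)]; exact this.2.2 e
    · rw [mem_concat_half] at ht1 ht2; omega
    · rw [mem_concat_right h] at ht1 ht2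
      have e1 : k + 1 - κ.n = k - κ.n + 1 := by omega
      have hlt : k - κ.n < κ'.n := by omega
      rw [e1] at ht2
      have := hc' (k - κ.n) hlt (dblR t) ⟨ht1.2, ht2.2⟩
      rw [JR k ht1.1, JR (k + 1) ht2.1, ΘR k ht1.1, ΘR (k + 1) ht2.1, concat_rho_right ht1.1,
        concat_f_right h ht1.1, e1]
      refine ⟨fun e => this.1 (by omega), fun e => ?_, fun e => ?_⟩
      · rw [concat_rho_right (by omega), Nat.add_sub_cancel]; exact this.2.1 (by omega)
      · rw [concat_rho_right (by omega), Nat.add_sub_cancel]; exact this.2.2 (by omega)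

end PathSystem

/-- The concatenation `a # b` of based paths. -/
noncomputable def PathSpace.concat {o₁ o₂ o₃ : 𝒳.BasePoint} (a : 𝒳.PathSpace o₁ o₂)
    (b : 𝒳.PathSpace o₂ o₃) : 𝒳.PathSpace o₁ o₃ :=
  Quot.map₂ PathSystem.concat
    (fun σ _ _ h => (σ.refines_refl).concat h) (fun _ _ τ h => h.concat τ.refines_refl) a b

end Quotient

/-- A system `({U_α}, {U'_α}, {f_α}, {ρ_βα})` representing a morphism from `𝒴` to `𝒳`, where
`{U_α}` is the cover of `𝒴` by all its basic open sets. -/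
structure System {Y X : Type u} [TopologicalSpace Y] [TopologicalSpace X] (𝒴 : Orbispace Y)
    (𝒳 : Orbispace X) where
  ind : 𝒴.Idx → 𝒳.Idx
  f : ∀ i, (𝒴.str i).Cov → (𝒳.str (ind i)).Cov
  continuous_f : ∀ i, Continuous (f i)
  ρ : ∀ {i j}, 𝒴.Tran i j → 𝒳.Tran (ind i) (ind j)
  continuous_ρ : ∀ i j, Continuous (ρ : 𝒴.Tran i j → 𝒳.Tran (ind i) (ind j))
  map_source : ∀ {i j} (t : 𝒴.Tran i j), ∀ x ∈ (𝒴.iso t).φ.source, f i x ∈ (𝒳.iso (ρ t)).φ.source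
  map_apply : ∀ {i j} (t : 𝒴.Tran i j), ∀ x ∈ (𝒴.iso t).φ.source,
    f j ((𝒴.iso t).φ x) = (𝒳.iso (ρ t)).φ (f i x)
  map_one : ∀ i, ρ (𝒴.one i) = 𝒳.one (ind i)
  map_comp : ∀ {i j k} (b : 𝒴.Tran j k) (a : 𝒴.Tran i j) (x : (𝒴.str i).Cov)
    (hx : x ∈ ((𝒴.iso a).φ.trans (𝒴.iso b).φ).source)
    (hx' : f i x ∈ ((𝒳.iso (ρ a)).φ.trans (𝒳.iso (ρ b)).φ).source),
    ρ (𝒴.comp b a x hx) = 𝒳.comp (ρ b) (ρ a) (f i x) hx'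

section Push

variable {Y X : Type u} [TopologicalSpace Y] [TopologicalSpace X] {𝒴 : Orbispace Y}
  {𝒳 : Orbispace X}

/-- The induced map of the disjoint unions of the spaces `Û`. -/
def System.pt (F : System 𝒴 𝒳) (x : 𝒴.Pt) : 𝒳.Pt := ⟨F.ind x.1, F.f x.1 x.2⟩

/-- The induced map of the transition maps. -/
def System.arr (F : System 𝒴 𝒳) (a : 𝒴.Arr) : 𝒳.Arr := ⟨F.ind a.src, F.ind a.tgt, F.ρ a.tran⟩

theorem System.continuous_pt (F : System 𝒴 𝒳) : Continuous F.pt :=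
  by
  refine continuous_sigma fun i => ?_
  exact (continuous_sigmaMk (σ := fun i => (𝒳.str i).Cov) (i := F.ind i)).comp (F.continuous_f i)

theorem Sends.push (F : System 𝒴 𝒳) {a : 𝒴.Arr} {x y : 𝒴.Pt} (h : 𝒴.Sends a x y) :
    𝒳.Sends (F.arr a) (F.pt x) (F.pt y) := by
  obtain ⟨t, x, hx⟩ := h
  have := Sends.mk (𝒳 := 𝒳) (F.ρ t) (F.f _ x) (F.map_source t x hx)
  rwa [← F.map_apply t x hx] at this

theorem CompAt.push (F : System 𝒴 𝒳) {a b c : 𝒴.Arr} {x : 𝒴.Pt} (h : 𝒴.CompAt b a x c) :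
    𝒳.CompAt (F.arr b) (F.arr a) (F.pt x) (F.arr c) := by
  obtain ⟨b, a, x, hx⟩ := h
  have hx' : F.f _ x ∈ ((𝒳.iso (F.ρ a)).φ.trans (𝒳.iso (F.ρ b)).φ).source := by
    refine ⟨F.map_source a x hx.1, ?_⟩
    have : F.f _ ((𝒴.iso a).φ x) ∈ (𝒳.iso (F.ρ b)).φ.source := F.map_source b _ hx.2
    rwa [F.map_apply a x hx.1] at this
  have := CompAt.mk (𝒳 := 𝒳) (F.ρ b) (F.ρ a) (F.f _ x) hx'
  rwa [← F.map_comp b a x hx hx'] at this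

/-- The composition of a system of paths with a system representing a based morphism. -/
def PathSystem.push (F : System 𝒴 𝒳) {o₁ o₂ : 𝒴.BasePoint} {p₁ p₂ : 𝒳.BasePoint}
    (h₁ : F.pt o₁.point = p₁.point) (h₂ : F.pt o₂.point = p₂.point)
    (σ : 𝒴.PathSystem o₁ o₂) : 𝒳.PathSystem p₁ p₂ where
  n := σ.n
  one_le_n := σ.one_le_n
  I := σ.I
  isOpen_I := σ.isOpen_I
  ordConnected_I := σ.ordConnected_I
  cover := σ.cover
  disjoint := σ.disjoint
  zero_mem := σ.zero_mem
  one_mem := σ.one_mem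
  chart k := F.ind (σ.chart k)
  f k t := F.pt (σ.f k t)
  f_chart k hk t ht := congrArg F.ind (σ.f_chart k hk t ht)
  continuousOn_f k hk := F.continuous_pt.comp_continuousOn (σ.continuousOn_f k hk)
  ρ k := F.arr (σ.ρ k)
  ρ_src k hk := congrArg F.ind (σ.ρ_src k hk)
  ρ_tgt k hk := congrArg F.ind (σ.ρ_tgt k hk)
  ρ_sends k hk t ht := (σ.ρ_sends k hk t ht).push F
  f_zero := by rw [σ.f_zero, h₁]
  f_one := by rw [σ.f_one, h₂]

theorem System.arr_oneArr (F : System 𝒴 𝒳) {o : 𝒴.BasePoint} {p : 𝒳.BasePoint}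
    (h : F.pt o.point = p.point) : F.arr (𝒴.oneArr o.idx) = 𝒳.oneArr p.idx := by
  have e : F.ind o.idx = p.idx := congrArg Sigma.fst h
  rw [← e]
  simp [System.arr, oneArr, F.map_one]

theorem PathSystem.Refines.push (F : System 𝒴 𝒳) {o₁ o₂ : 𝒴.BasePoint} {p₁ p₂ : 𝒳.BasePoint}
    (h₁ : F.pt o₁.point = p₁.point) (h₂ : F.pt o₂.point = p₂.point)
    {κ σ : 𝒴.PathSystem o₁ o₂} (h : κ.Refines σ) :
    (κ.push F h₁ h₂).Refines (σ.push F h₁ h₂) := by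
  obtain ⟨θ, j, hI, hθ0, hθn, hj0, hjn, hst, hs, hc⟩ := h
  refine ⟨θ, fun k => F.arr (j k), hI, hθ0, hθn, ?_, ?_, fun k hk => ?_, fun k hk t ht => ?_,
    fun k hk t ht => ⟨fun e => ?_, fun e => ?_, fun e => ?_⟩⟩
  · simp only [hj0]; exact F.arr_oneArr h₁
  · change F.arr (j κ.n) = _
    rw [hjn]; exact F.arr_oneArr h₂
  · exact ⟨congrArg F.ind (hst k hk).1, congrArg F.ind (hst k hk).2⟩
  · exact (hs k hk t ht).push F
  · exact ((hc k hk t ht).1 e).push F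
  · obtain ⟨c, c1, c2⟩ := (hc k hk t ht).2.1 e
    exact ⟨F.arr c, c1.push F, c2.push F⟩
  · obtain ⟨c, c1, c2⟩ := (hc k hk t ht).2.2 e
    exact ⟨F.arr c, c1.push F, c2.push F⟩

/-- The map `Ω(F)` of based loop spaces induced by a based morphism, the class of a system `F` with
`f_o(ô) = ô'`. -/
def LoopSpace.map (F : System 𝒴 𝒳) {o : 𝒴.BasePoint} {p : 𝒳.BasePoint}
    (h : F.pt o.point = p.point) (a : 𝒴.LoopSpace o) : 𝒳.LoopSpace p :=
  Quot.map (PathSystem.push F h h) (fun _ _ r => r.push F h h) a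

end Push

section Restrict

variable {X : Type u} [TopologicalSpace X]

theorem isComponentOf_preimage_val (Y : Set X) {C F : Set X} (hF : F ⊆ Y)
    (h : IsComponentOf C F) :
    IsComponentOf ((↑) ⁻¹' C : Set Y) ((↑) ⁻¹' F) := by
  obtain ⟨x, hx, rfl⟩ := h
  refine ⟨⟨x, hF hx⟩, hx, subset_antisymm ?_ ?_⟩
  · refine IsPreconnected.subset_connectedComponentIn ?_ (mem_connectedComponentIn hx)
      (preimage_mono (connectedComponentIn_subset F x))
    rw [← IsInducing.subtypeVal.isPreconnected_image, Subtype.image_preimage_coe,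
      inter_eq_right.2 ((connectedComponentIn_subset F x).trans hF)]
    exact isPreconnected_connectedComponentIn
  · rw [← image_subset_iff]
    refine IsPreconnected.subset_connectedComponentIn
      (isPreconnected_connectedComponentIn.image _ continuous_subtype_val.continuousOn)
      ⟨⟨x, hF hx⟩, mem_connectedComponentIn (by exact hx), rfl⟩ ?_
    rw [image_subset_iff]
    exact connectedComponentIn_subset _ _

theorem _root_.GStructure.image_proj_subset {U : Opens X} (A : GStructure U) (S : Set A.Cov) :
    A.proj '' S ⊆ U := by
  rw [← A.range_proj]; exact image_subset_range _ _

theorem image_preimage_opens (Y : Opens X) {S : Set X} (h : S ⊆ Y) :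
    ((↑) '' ((↑) ⁻¹' S : Set Y) : Set X) = S := by
  ext x
  constructor
  · rintro ⟨y, hy, rfl⟩; exact hy
  · exact fun hx => ⟨⟨x, h hx⟩, hx, rfl⟩

/-- The open subset `U ∩ Y` of the space `Y`. -/
abbrev opensIn (U Y : Opens X) : Opens Y := ⟨(↑) ⁻¹' (U : Set X), U.isOpen.preimage continuous_subtype_val⟩

/-- A `G`-structure on an open set contained in `Y`, as a `G`-structure on an open set of the
space `Y`. -/
abbrev _root_.GStructure.restrict {U : Opens X} (A : GStructure U) (Y : Opens X) (h : U ≤ Y) :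
    GStructure (opensIn U Y) where
  Cov := A.Cov
  Grp := A.Grp
  proj x := ⟨A.proj x, h (by rw [← SetLike.mem_coe, ← A.range_proj]; exact mem_range_self x)⟩
  continuous_proj := A.continuous_proj.subtype_mk _
  isOpenMap_proj := fun V hV => by
    have := (A.isOpenMap_proj V hV).preimage (continuous_subtype_val (p := (· ∈ Y)))
    convert this using 1
    ext y
    simp [Subtype.ext_iff]
  range_proj := by
    ext y
    have : (∃ x, A.proj x = y) ↔ (y : X) ∈ U := by
      rw [← SetLike.mem_coe, ← A.range_proj]; rfl
    simpa [Subtype.ext_iff] using this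
  proj_eq_iff x y := by
    rw [← A.proj_eq_iff, Subtype.ext_iff]

theorem _root_.GStructure.restrict_image {U : Opens X} (A : GStructure U) (Y : Opens X)
    (h : U ≤ Y) (S : Set A.Cov) :
    (A.restrict Y h).proj '' S = ((↑) ⁻¹' (A.proj '' S) : Set Y) := by
  ext y
  simp [GStructure.restrict, Subtype.ext_iff]

/-- An isomorphism of induced `G`-structures, for `G`-structures on open sets of the space `Y`. -/
def _root_.GStructure.LocalIso.restrict {U V : Opens X} {A : GStructure U} {B : GStructure V}
    (t : A.LocalIso B) (Y : Opens X) (hU : U ≤ Y) (hV : V ≤ Y) :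
    (A.restrict Y hU).LocalIso (B.restrict Y hV) where
  φ := t.φ
  lam := t.lam
  isComponent_base := by
    have := isComponentOf_preimage_val (Y : Set X) (inter_subset_left.trans hU) t.isComponent_base
    exact (A.restrict_image Y hU _).symm ▸ this
  isComponent_source := by
    have := t.isComponent_source
    exact (A.restrict_image Y hU _).symm ▸ this
  isComponent_target := by
    have := t.isComponent_target
    exact (A.restrict_image Y hU _).symm ▸ this
  proj_apply x hx := Subtype.ext (t.proj_apply x hx)
  equivariant := t.equivariant

/-- The open subset `Y` as a sub-orbispace. As the basic open sets contain the connected open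
subsets of their members, the connected components of `Y ∩ U`, for `U` basic, are the basic open
sets contained in `Y`; their `G`-structures and transition maps are kept. -/
def restrict (𝒳 : Orbispace X) (Y : Opens X) : Orbispace Y where
  locallyConnected := by
    have := 𝒳.locallyConnected
    exact Y.isOpenEmbedding'.locallyConnectedSpace
  Idx := {i : 𝒳.Idx // 𝒳.U i ≤ Y}
  U i := opensIn (𝒳.U i.1) Y
  U_injective i j h := by
    refine Subtype.ext (𝒳.U_injective (Opens.ext ?_))
    have h' : ((↑) ⁻¹' (𝒳.U i.1 : Set X) : Set Y) = (↑) ⁻¹' (𝒳.U j.1 : Set X) :=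
      congrArg (fun W : Opens Y => (W : Set Y)) h
    have h'' := congrArg (fun S : Set Y => ((↑) '' S : Set X)) h'
    exact (image_preimage_opens Y i.2).symm.trans (h''.trans (image_preimage_opens Y j.2))
  isConnected_U i := by
    change IsConnected ((↑) ⁻¹' (𝒳.U i.1 : Set X) : Set Y)
    have := 𝒳.isConnected_U i.1
    refine ⟨?_, ?_⟩
    · obtain ⟨x, hx⟩ := this.1
      exact ⟨⟨x, i.2 hx⟩, hx⟩
    · rw [← IsInducing.subtypeVal.isPreconnected_image]
      exact (image_preimage_opens Y i.2).symm ▸ this.2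
  isBasis := by
    refine isTopologicalBasis_of_isOpen_of_nhds ?_ ?_
    · rintro _ ⟨i, rfl⟩
      exact Opens.isOpen _
    · intro y V hy hV
      obtain ⟨_, ⟨i, rfl⟩, hyi, hi⟩ := 𝒳.isBasis.exists_subset_of_mem_open
        (mem_image_of_mem ((↑) : Y → X) hy) (Y.isOpenEmbedding'.isOpenMap V hV)
      refine ⟨_, ⟨⟨i, hi.trans (Subtype.coe_image_subset _ _)⟩, rfl⟩, hyi, fun z hz => ?_⟩
      obtain ⟨z', hz', e⟩ := hi hz
      rwa [← Subtype.ext e]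
  lower i W hW hWi := by
    obtain ⟨j, hj⟩ := 𝒳.lower i.1 ⟨(↑) '' (W : Set Y), Y.isOpenEmbedding'.isOpenMap W W.isOpen⟩
      (hW.image _ continuous_subtype_val.continuousOn) (by
        rintro _ ⟨y, hy, rfl⟩
        exact hWi hy)
    refine ⟨⟨j, ?_⟩, ?_⟩
    · rw [hj]; exact Subtype.coe_image_subset _ _
    · refine Opens.ext ?_
      change ((↑) ⁻¹' (𝒳.U j : Set X) : Set Y) = W
      rw [hj]
      exact preimage_image_eq _ Subtype.val_injective
  str i := (𝒳.str i.1).restrict Y i.2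
  Tran i j := 𝒳.Tran i.1 j.1
  iso {i j} t := (𝒳.iso t).restrict Y i.2 j.2
  tran_nonempty i j h := by
    obtain ⟨y, hy⟩ := h
    exact 𝒳.tran_nonempty _ _ ⟨y, hy⟩
  act := 𝒳.act
  act_source := 𝒳.act_source
  act_apply := 𝒳.act_apply
  act_lam := 𝒳.act_lam
  act_one := 𝒳.act_one
  act_act := 𝒳.act_act
  act_eq_iff := 𝒳.act_eq_iff
  exists_act {i j} t t' h := by
    refine 𝒳.exists_act t t' ?_
    have h' := congrArg (fun S : Set Y => ((↑) '' S : Set X)) h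
    have e (S : Set (𝒳.str i.1).Cov) := (𝒳.str i.1).restrict_image Y i.2 S
    have e'' (S : Set (𝒳.str i.1).Cov) :
        ((↑) '' (((𝒳.str i.1).restrict Y i.2).proj '' S) : Set X) = (𝒳.str i.1).proj '' S := by
      rw [e]; exact image_preimage_opens Y (((𝒳.str i.1).image_proj_subset S).trans i.2)
    exact (e'' _).symm.trans (h'.trans (e'' _))
  one i := 𝒳.one i.1
  one_source i := 𝒳.one_source i.1
  one_apply i := 𝒳.one_apply i.1
  one_lam i := 𝒳.one_lam i.1
  comp := 𝒳.comp
  mem_comp_source := 𝒳.mem_comp_source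
  comp_apply := 𝒳.comp_apply
  comp_lam := 𝒳.comp_lam
  comp_eq_of_mem := 𝒳.comp_eq_of_mem
  comp_assoc := 𝒳.comp_assoc
  comp_act_one := 𝒳.comp_act_one
  act_one_comp := 𝒳.act_one_comp

/-- The inclusion of an open sub-orbispace. -/
def inclusion (𝒳 : Orbispace X) (Y : Opens X) : System (𝒳.restrict Y) 𝒳 where
  ind i := i.1
  f _ := id
  continuous_f _ := continuous_id
  ρ := id
  continuous_ρ _ _ := continuous_id
  map_source _ _ h := h
  map_apply _ _ _ := rfl
  map_one _ := rfl
  map_comp _ _ _ _ _ := rfl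

/-- The inclusion between two open sub-orbispaces. -/
def inclusionOfLE (𝒳 : Orbispace X) {Y Z : Opens X} (h : Y ≤ Z) :
    System (𝒳.restrict Y) (𝒳.restrict Z) where
  ind i := ⟨i.1, i.2.trans h⟩
  f _ := id
  continuous_f _ := continuous_id
  ρ := id
  continuous_ρ _ _ := continuous_id
  map_source _ _ h := h
  map_apply _ _ _ := rfl
  map_one _ := rfl
  map_comp _ _ _ _ _ := rfl

end Restrict

section FundamentalGroup

variable {X : Type u} [TopologicalSpace X]

/-- A homomorphism from the fundamental group `π₁(𝒳, o)` to the group `H`. The multiplication of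
`π₁(𝒳, o)` is the one induced by concatenation, `[a] * [b] = [a # b]`. -/
structure Pi1Hom (𝒳 : Orbispace X) (o : 𝒳.BasePoint) (H : Type v) [Group H] where
  toFun : 𝒳.Pi1 o → H
  map_mul : ∀ a b : 𝒳.LoopSpace o, toFun (a.concat b).toPi1 = toFun a.toPi1 * toFun b.toPi1

instance (𝒳 : Orbispace X) (o : 𝒳.BasePoint) (H : Type v) [Group H] :
    CoeFun (𝒳.Pi1Hom o H) (fun _ => 𝒳.Pi1 o → H) := ⟨Pi1Hom.toFun⟩

/-- A base-point structure `(o, U_o, ô)` with `U_o ⊆ Y`, as a base-point structure of the open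
sub-orbispace `Y`. -/
def BasePoint.restrict {𝒳 : Orbispace X} (o : 𝒳.BasePoint) (Y : Opens X) (h : 𝒳.U o.idx ≤ Y) :
    (𝒳.restrict Y).BasePoint where
  pt := ⟨o.pt, h (by
    rw [← o.proj_lift, ← SetLike.mem_coe, ← (𝒳.str o.idx).range_proj]
    exact mem_range_self _)⟩
  idx := ⟨o.idx, h⟩
  lift := o.lift
  proj_lift := Subtype.ext o.proj_lift

/-- The map `Ω(Y, o) → Ω(𝒳, o)` induced by the inclusion of an open sub-orbispace `Y`. -/
def LoopSpace.incl {𝒳 : Orbispace X} {o : 𝒳.BasePoint} {Y : Opens X} (h : 𝒳.U o.idx ≤ Y)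
    (a : (𝒳.restrict Y).LoopSpace (o.restrict Y h)) : 𝒳.LoopSpace o :=
  LoopSpace.map (𝒳.inclusion Y) rfl a

/-- The map `Ω(Y, o) → Ω(Z, o)` induced by the inclusion of open sub-orbispaces `Y ⊆ Z`. -/
def LoopSpace.inclOfLE {𝒳 : Orbispace X} {o : 𝒳.BasePoint} {Y Z : Opens X} (hYZ : Y ≤ Z)
    (h : 𝒳.U o.idx ≤ Y) (a : (𝒳.restrict Y).LoopSpace (o.restrict Y h)) :
    (𝒳.restrict Z).LoopSpace (o.restrict Z (h.trans hYZ)) :=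
  LoopSpace.map (𝒳.inclusionOfLE hYZ) rfl a

end FundamentalGroup

end Orbispace

/-! ### The groupoid of transition maps: composition at a point, inverses, common charts. -/

namespace Orbispace

section Groupoid

variable {X : Type u} [TopologicalSpace X] {𝒳 : Orbispace X}

/-! A homomorphism from the fundamental group to `H` is the monodromy of a flat `H`-valued parallel
transport, and parallel transports can be glued. Here a transport is a `LocalSystem`: it gives an
element of `H` for each path in a space `Û` and for each transition map at a point, subject to local
axioms. A homomorphism on `π₁(X_α)` is spread over the fundamental groupoid of `X_α` by choosing a
morphism from the base point to every other base-point structure (`Pi1Hom.rep`), and a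
representation of the groupoid gives a local system by evaluation on paths and on transition maps
(`GroupoidRep.localSystem`). The morphisms are chosen over `X₁₂` and pushed forward, so that the two
local systems agree on the charts contained in `X₁₂`.

For the gluing (`GluingData.glue`), a transition map from a chart in `X₁` to a chart in `X₂` is
defined only over points of `X₁₂`. At such a point it factors through a chart contained in `X₁₂`,
and the product of the transports of the two factors does not depend on the factorisation
(`Val.unique`). Every loop can be refined to a system over charts contained in `X₁` or in `X₂`, and
the required homomorphism sends it to its holonomy. Holonomy does not change under refinement and
takes concatenations to products (`hol_refines`, `hol_concat`). On loops in `X_α` it gives back the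
prescribed homomorphism: the fundamental groupoid is generated by paths and transition maps
(`hom_induction`), so the holonomy of a groupoid representation is that representation
(`GroupoidRep.hol_eq`), and the morphism chosen at the base point is the identity.

The topology of the loop space enters twice. Holonomy has to be constant along a continuous path of
based loops (`holCls_eq_of_joined`). Near a given based path every based path has a representative
with the same charts and the same transition maps, up to a group element at the final point
(`Rep.eventually`). This representative is unique (`Rep.unique`), hence depends continuously on the
based path, and the holonomies are compared by a ladder of squares. In the other direction, the
given homomorphisms live on path components of the loop space, so explicit families of systems must
be shown to be continuous there (`Tends.tendsto`).

Both directions rest on two facts. Two systems represent the same based path exactly if they are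
related by a locally constant family of transition maps (`cls_eq_iff`). A small perturbation of the
transition maps of a system by group elements can be removed by small group elements acting on its
maps (`exists_normalization`). -/

theorem Sends.exists_tran {c : 𝒳.Arr} {x y : 𝒳.Pt} (h : 𝒳.Sends c x y) :
    ∃ (t : 𝒳.Tran x.1 y.1) (_ : x.2 ∈ (𝒳.iso t).φ.source),
      c = ⟨x.1, y.1, t⟩ ∧ y.2 = (𝒳.iso t).φ x.2 := by
  obtain ⟨t, x, hx⟩ := h
  exact ⟨t, hx, rfl, rfl⟩

theorem Sends.unique {a : 𝒳.Arr} {x y z : 𝒳.Pt} (h : 𝒳.Sends a x y) (h' : 𝒳.Sends a x z) :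
    y = z := by
  obtain ⟨t, x, hx⟩ := h
  cases h'
  rfl

theorem Sends.src_eq {a : 𝒳.Arr} {x y : 𝒳.Pt} (h : 𝒳.Sends a x y) : x.1 = a.src := by
  cases h; rfl

theorem Sends.tgt_eq {a : 𝒳.Arr} {x y : 𝒳.Pt} (h : 𝒳.Sends a x y) : y.1 = a.tgt := by
  cases h; rfl

/-- The point of the underlying space below a point of the disjoint union of the spaces `Û`. -/
def base (𝒳 : Orbispace X) (x : 𝒳.Pt) : X := (𝒳.str x.1).proj x.2

theorem base_mem (x : 𝒳.Pt) : 𝒳.base x ∈ 𝒳.U x.1 := by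
  rw [← SetLike.mem_coe, ← (𝒳.str x.1).range_proj]
  exact mem_range_self _

theorem Sends.base_eq {a : 𝒳.Arr} {x y : 𝒳.Pt} (h : 𝒳.Sends a x y) :
    𝒳.base y = 𝒳.base x := by
  obtain ⟨t, x, hx⟩ := h
  exact (𝒳.iso t).proj_apply x hx

theorem CompAt.unique {a b c d : 𝒳.Arr} {x : 𝒳.Pt} (h : 𝒳.CompAt b a x c)
    (h' : 𝒳.CompAt b a x d) : c = d := by
  obtain ⟨b, a, x, hx⟩ := h
  cases h'
  rfl

theorem Sends.exists_compAt {a b : 𝒳.Arr} {x y z : 𝒳.Pt} (h : 𝒳.Sends a x y)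
    (h' : 𝒳.Sends b y z) : ∃ c, 𝒳.CompAt b a x c := by
  obtain ⟨a, x, hx⟩ := h
  obtain ⟨b, _, hy⟩ := h'
  exact ⟨_, CompAt.mk b a x ⟨hx, hy⟩⟩

theorem CompAt.exists_sends {a b c : 𝒳.Arr} {x : 𝒳.Pt} (h : 𝒳.CompAt b a x c) :
    ∃ y z, 𝒳.Sends a x y ∧ 𝒳.Sends b y z ∧ 𝒳.Sends c x z := by
  obtain ⟨b, a, x, hx⟩ := h
  refine ⟨_, _, Sends.mk a x hx.1, Sends.mk b _ hx.2, ?_⟩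
  have := Sends.mk (𝒳.comp b a x hx) x (𝒳.mem_comp_source b a x hx)
  rwa [𝒳.comp_apply b a x x hx hx (𝒳.mem_comp_source b a x hx)] at this

theorem CompAt.sends {a b c : 𝒳.Arr} {x y z : 𝒳.Pt} (h : 𝒳.CompAt b a x c)
    (ha : 𝒳.Sends a x y) (hb : 𝒳.Sends b y z) : 𝒳.Sends c x z := by
  obtain ⟨y', z', h1, h2, h3⟩ := h.exists_sends
  obtain rfl := ha.unique h1
  obtain rfl := hb.unique h2
  exact h3

/-- The composition depends on the point only through its domain. -/
theorem CompAt.of_sends {a b c : 𝒳.Arr} {x x' y' z' w' : 𝒳.Pt} (h : 𝒳.CompAt b a x c)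
    (ha : 𝒳.Sends a x' y') (hb : 𝒳.Sends b y' z') (hc : 𝒳.Sends c x' w') :
    𝒳.CompAt b a x' c := by
  obtain ⟨b, a, x, hx⟩ := h
  obtain ⟨_, x', hx'⟩ := ha
  cases hb with | mk _ _ hy =>
  cases hc with | mk _ _ hc =>
  rw [← 𝒳.comp_eq_of_mem b a x x' hx ⟨hx', hy⟩ hc]
  exact CompAt.mk b a x' ⟨hx', hy⟩

open Classical in
/-- The composition `b ∘ a` formed at the point `x`; meaningful where it is defined. -/
noncomputable def mul (𝒳 : Orbispace X) (b a : 𝒳.Arr) (x : 𝒳.Pt) : 𝒳.Arr :=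
  if h : ∃ c, 𝒳.CompAt b a x c then h.choose else a

theorem CompAt.mul_eq {a b c : 𝒳.Arr} {x : 𝒳.Pt} (h : 𝒳.CompAt b a x c) :
    𝒳.mul b a x = c := by
  have h' : ∃ c, 𝒳.CompAt b a x c := ⟨c, h⟩
  rw [mul, dif_pos h']
  exact h'.choose_spec.unique h

theorem Sends.compAt {a b : 𝒳.Arr} {x y z : 𝒳.Pt} (h : 𝒳.Sends a x y) (h' : 𝒳.Sends b y z) :
    𝒳.CompAt b a x (𝒳.mul b a x) := by
  obtain ⟨c, hc⟩ := h.exists_compAt h'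
  rwa [hc.mul_eq]

theorem Sends.mul {a b : 𝒳.Arr} {x y z : 𝒳.Pt} (h : 𝒳.Sends a x y) (h' : 𝒳.Sends b y z) :
    𝒳.Sends (𝒳.mul b a x) x z := (h.compAt h').sends h h'

theorem mul_assoc' {a b c : 𝒳.Arr} {x y z w : 𝒳.Pt} (ha : 𝒳.Sends a x y) (hb : 𝒳.Sends b y z)
    (hc : 𝒳.Sends c z w) :
    𝒳.mul c (𝒳.mul b a x) x = 𝒳.mul (𝒳.mul c b y) a x := by
  obtain ⟨a, x, hx⟩ := ha
  cases hb with | mk b _ hy =>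
  cases hc with | mk c _ hz =>
  have h1 : x ∈ ((𝒳.iso a).φ.trans (𝒳.iso b).φ).source := ⟨hx, hy⟩
  have h3 : (𝒳.iso a).φ x ∈ ((𝒳.iso b).φ.trans (𝒳.iso c).φ).source := ⟨hy, hz⟩
  have h2 : x ∈ ((𝒳.iso (𝒳.comp b a x h1)).φ.trans (𝒳.iso c).φ).source := by
    refine ⟨𝒳.mem_comp_source _ _ _ _, ?_⟩
    change (𝒳.iso (𝒳.comp b a x h1)).φ x ∈ (𝒳.iso c).φ.source
    rw [𝒳.comp_apply b a x x h1 h1 (𝒳.mem_comp_source _ _ _ _)]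
    exact hz
  have h4 : x ∈ ((𝒳.iso a).φ.trans (𝒳.iso (𝒳.comp c b ((𝒳.iso a).φ x) h3)).φ).source :=
    ⟨hx, 𝒳.mem_comp_source _ _ _ _⟩
  rw [(CompAt.mk b a x h1).mul_eq, (CompAt.mk c b _ h3).mul_eq, (CompAt.mk c _ x h2).mul_eq,
    (CompAt.mk _ a x h4).mul_eq, 𝒳.comp_assoc c b a x h1 h2 h3 h4]

theorem Sends.one_mul {a : 𝒳.Arr} {x y : 𝒳.Pt} (h : 𝒳.Sends a x y) :
    𝒳.mul (𝒳.oneArr y.1) a x = a := by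
  rw [h.tgt_eq]; exact h.compAt_one_left.mul_eq

theorem Sends.mul_one {a : 𝒳.Arr} {x y : 𝒳.Pt} (h : 𝒳.Sends a x y) :
    𝒳.mul a (𝒳.oneArr x.1) x = a := by
  rw [h.src_eq]; exact h.compAt_one_right.mul_eq

/-- The transition map given by an element of the group `G_{U_i}`. -/
def grpArr (𝒳 : Orbispace X) (i : 𝒳.Idx) (g : (𝒳.str i).Grp) : 𝒳.Arr :=
  ⟨i, i, 𝒳.act g (𝒳.one i) 1⟩

theorem grpArr_one (i : 𝒳.Idx) : 𝒳.grpArr i 1 = 𝒳.oneArr i := by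
  rw [grpArr, 𝒳.act_one]; rfl

theorem sends_act {i j : 𝒳.Idx} (h : (𝒳.str j).Grp) (t : 𝒳.Tran i j) (g : (𝒳.str i).Grp)
    {x : (𝒳.str i).Cov} {y : (𝒳.str j).Cov} (hs : 𝒳.Sends ⟨i, j, t⟩ ⟨i, g • x⟩ ⟨j, y⟩) :
    𝒳.Sends ⟨i, j, 𝒳.act h t g⟩ ⟨i, x⟩ ⟨j, h • y⟩ := by
  cases hs with | mk _ _ hx =>
  rw [← 𝒳.act_apply h t g x hx]
  refine Sends.mk _ _ ?_
  rw [𝒳.act_source]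
  exact hx

theorem mem_source_grpArr (i : 𝒳.Idx) (g : (𝒳.str i).Grp) (x : (𝒳.str i).Cov) :
    x ∈ (𝒳.iso (𝒳.act g (𝒳.one i) 1)).φ.source := by
  rw [𝒳.act_source, 𝒳.one_source]; trivial

theorem sends_grpArr (i : 𝒳.Idx) (g : (𝒳.str i).Grp) (x : (𝒳.str i).Cov) :
    𝒳.Sends (𝒳.grpArr i g) ⟨i, x⟩ ⟨i, g • x⟩ := by
  refine sends_act (𝒳 := 𝒳) g (𝒳.one i) 1 ?_
  rw [one_smul]
  exact sends_one (𝒳 := 𝒳) ⟨i, x⟩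

/-- The isomorphism of groups underlying the identity is the identity, so `act_eq_iff` shows that
conjugation by `g` fixes the identity transition map. -/
theorem act_one_right_one (i : 𝒳.Idx) (g : (𝒳.str i).Grp) :
    𝒳.act 1 (𝒳.one i) g = 𝒳.act g (𝒳.one i) 1 := by
  have h : 𝒳.act g⁻¹ (𝒳.one i) g = 𝒳.one i := by
    rw [𝒳.act_eq_iff]
    have hg : g ∈ MulAction.stabilizer (𝒳.str i).Grp (𝒳.iso (𝒳.one i)).φ.source := by
      rw [𝒳.one_source, MulAction.mem_stabilizer_iff, Set.smul_set_univ]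
    exact ⟨hg, 𝒳.one_lam i g hg⟩
  calc 𝒳.act 1 (𝒳.one i) g = 𝒳.act g (𝒳.act g⁻¹ (𝒳.one i) g) 1 := by
        rw [𝒳.act_act]; simp
    _ = _ := by rw [h]

theorem grpArr_mul (i : 𝒳.Idx) (g h : (𝒳.str i).Grp) (x : (𝒳.str i).Cov) :
    𝒳.mul (𝒳.grpArr i g) (𝒳.grpArr i h) ⟨i, x⟩ = 𝒳.grpArr i (g * h) := by
  have hx : x ∈ ((𝒳.iso (𝒳.act h (𝒳.one i) 1)).φ.trans
      (𝒳.iso (𝒳.act g (𝒳.one i) 1)).φ).source := by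
    refine ⟨?_, ?_⟩
    · exact mem_source_grpArr i _ x
    · change (𝒳.iso (𝒳.act h (𝒳.one i) 1)).φ x ∈ (𝒳.iso (𝒳.act g (𝒳.one i) 1)).φ.source
      rw [𝒳.act_source, 𝒳.one_source]; trivial
  rw [grpArr, grpArr, (CompAt.mk _ _ x hx).mul_eq, 𝒳.act_one_comp, 𝒳.act_act]
  simp [grpArr]

theorem mul_grpArr_left {i j : 𝒳.Idx} (t : 𝒳.Tran i j) (h : (𝒳.str j).Grp) {x y : 𝒳.Pt}
    (hs : 𝒳.Sends ⟨i, j, t⟩ x y) :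
    𝒳.mul (𝒳.grpArr j h) ⟨i, j, t⟩ x = ⟨i, j, 𝒳.act h t 1⟩ := by
  obtain ⟨_, x, hx⟩ := hs
  have hx' : x ∈ ((𝒳.iso t).φ.trans (𝒳.iso (𝒳.act h (𝒳.one j) 1)).φ).source := by
    refine ⟨hx, ?_⟩
    change (𝒳.iso t).φ x ∈ (𝒳.iso (𝒳.act h (𝒳.one j) 1)).φ.source
    rw [𝒳.act_source, 𝒳.one_source]; trivial
  rw [grpArr, (CompAt.mk _ _ x hx').mul_eq, 𝒳.act_one_comp]

theorem mul_grpArr_right {i j : 𝒳.Idx} (t : 𝒳.Tran i j) (g : (𝒳.str i).Grp)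
    {x : (𝒳.str i).Cov} {y : 𝒳.Pt} (hs : 𝒳.Sends ⟨i, j, t⟩ ⟨i, g • x⟩ y) :
    𝒳.mul ⟨i, j, t⟩ (𝒳.grpArr i g) ⟨i, x⟩ = ⟨i, j, 𝒳.act 1 t g⟩ := by
  cases hs with | mk _ _ hx =>
  have hx' : x ∈ ((𝒳.iso (𝒳.act g (𝒳.one i) 1)).φ.trans (𝒳.iso t).φ).source := by
    refine ⟨?_, ?_⟩
    · exact mem_source_grpArr i _ x
    · change (𝒳.iso (𝒳.act g (𝒳.one i) 1)).φ x ∈ (𝒳.iso t).φ.source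
      rw [𝒳.act_apply _ _ _ _ (by rw [𝒳.one_source]; trivial), 𝒳.one_apply, one_smul]
      exact hx
  rw [grpArr, (CompAt.mk _ _ x hx').mul_eq, 𝒳.comp_act_one]

theorem IsComponentOf.eq_of_mem {Y : Type*} [TopologicalSpace Y] {C D F : Set Y}
    (hC : IsComponentOf C F) (hD : IsComponentOf D F) {x : Y} (h : x ∈ C) (h' : x ∈ D) :
    C = D := by
  obtain ⟨c, -, rfl⟩ := hC
  obtain ⟨d, -, rfl⟩ := hD
  rw [connectedComponentIn_eq h, connectedComponentIn_eq h']

theorem IsComponentOf.eq_self {Y : Type*} [TopologicalSpace Y] {C F : Set Y}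
    (hC : IsComponentOf C F) (hF : IsPreconnected F) : C = F := by
  obtain ⟨c, hc, rfl⟩ := hC
  exact hF.connectedComponentIn hc

theorem isConnected_image_source {i j : 𝒳.Idx} (t : 𝒳.Tran i j) :
    IsConnected ((𝒳.str i).proj '' (𝒳.iso t).φ.source) := by
  obtain ⟨c, hc, h⟩ := (𝒳.iso t).isComponent_base
  rw [h]
  exact isConnected_connectedComponentIn_iff.2 hc

theorem source_nonempty {i j : 𝒳.Idx} (t : 𝒳.Tran i j) : ((𝒳.iso t).φ.source).Nonempty :=
  (isConnected_image_source t).nonempty.of_image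

/-- A transition map defined at a given point over `U_i ∩ U_j`, if `U_j ⊆ U_i`. -/
theorem exists_sends_of_le (x : 𝒳.Pt) {k : 𝒳.Idx} (hk : 𝒳.U k ≤ 𝒳.U x.1)
    (hx : 𝒳.base x ∈ 𝒳.U k) : ∃ a y, 𝒳.Sends a x y ∧ y.1 = k := by
  obtain ⟨i, x⟩ := x
  obtain ⟨t⟩ := 𝒳.tran_nonempty i k ⟨_, hk hx, hx⟩
  have h : (𝒳.str i).proj '' (𝒳.iso t).φ.source = 𝒳.U k := by
    have := (𝒳.iso t).isComponent_base
    rw [inter_eq_right.2 hk] at this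
    exact IsComponentOf.eq_self this (𝒳.isConnected_U k).isPreconnected
  have hx' : 𝒳.base ⟨i, x⟩ ∈ (𝒳.U k : Set X) := hx
  rw [← h] at hx'
  obtain ⟨x', hx', e⟩ := hx'
  -- The fibres of the projection are orbits, so precomposing `t` with a group element moves its
  -- domain onto the given point.
  obtain ⟨g, hg⟩ := ((𝒳.str i).proj_eq_iff x x').1 e.symm
  exact ⟨_, _, sends_act 1 t g (Sends.mk t _ (hg ▸ hx')), rfl⟩

/-- The intersection of the two charts is now the chart of `x` itself, which is connected; a
transition map therefore lies over all of it, and the orbit argument applies again. -/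
theorem exists_sends_of_ge (x : 𝒳.Pt) {k : 𝒳.Idx} (hk : 𝒳.U x.1 ≤ 𝒳.U k) :
    ∃ a y, 𝒳.Sends a x y ∧ y.1 = k := by
  obtain ⟨i, x⟩ := x
  have hx : 𝒳.base ⟨i, x⟩ ∈ 𝒳.U i := base_mem (𝒳 := 𝒳) ⟨i, x⟩
  obtain ⟨t⟩ := 𝒳.tran_nonempty i k ⟨_, hx, hk hx⟩
  have h : (𝒳.str i).proj '' (𝒳.iso t).φ.source = 𝒳.U i := by
    have := (𝒳.iso t).isComponent_base
    rw [inter_eq_left.2 hk] at this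
    exact IsComponentOf.eq_self this (𝒳.isConnected_U i).isPreconnected
  have hx' : 𝒳.base ⟨i, x⟩ ∈ (𝒳.U i : Set X) := hx
  rw [← h] at hx'
  obtain ⟨x', hx', e⟩ := hx'
  obtain ⟨g, hg⟩ := ((𝒳.str i).proj_eq_iff x x').1 e.symm
  exact ⟨_, _, sends_act 1 t g (Sends.mk t _ (hg ▸ hx')), rfl⟩

/-- Local connectedness makes the component open, and `lower` then makes it a basic open set. This
supplies the common charts used below. -/
theorem exists_idx_component (i j : 𝒳.Idx) {p : X} (hi : p ∈ 𝒳.U i) (hj : p ∈ 𝒳.U j) :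
    ∃ k, (𝒳.U k : Set X) = connectedComponentIn ((𝒳.U i : Set X) ∩ 𝒳.U j) p ∧
      𝒳.U k ≤ 𝒳.U i ∧ 𝒳.U k ≤ 𝒳.U j ∧ p ∈ 𝒳.U k := by
  have := 𝒳.locallyConnected
  have hp : p ∈ (𝒳.U i : Set X) ∩ 𝒳.U j := ⟨hi, hj⟩
  have hs := connectedComponentIn_subset ((𝒳.U i : Set X) ∩ 𝒳.U j) p
  obtain ⟨k, hk⟩ := 𝒳.lower i ⟨connectedComponentIn ((𝒳.U i : Set X) ∩ 𝒳.U j) p,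
    ((𝒳.U i).isOpen.inter (𝒳.U j).isOpen).connectedComponentIn⟩
    (isConnected_connectedComponentIn_iff.2 hp) (fun z hz => (hs hz).1)
  have hk' : (𝒳.U k : Set X) = connectedComponentIn ((𝒳.U i : Set X) ∩ 𝒳.U j) p := by rw [hk]; rfl
  refine ⟨k, hk', ?_, ?_, ?_⟩
  · rw [← SetLike.coe_subset_coe, hk']; exact fun z hz => (hs hz).1
  · rw [← SetLike.coe_subset_coe, hk']; exact fun z hz => (hs hz).2
  · rw [← SetLike.mem_coe, hk']; exact mem_connectedComponentIn hp

/-- Any two points over the same point of `X` are related by a transition map. -/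
theorem exists_sends {x y : 𝒳.Pt} (h : 𝒳.base x = 𝒳.base y) : ∃ a, 𝒳.Sends a x y := by
  -- Go down to a common chart, up to the chart of `y`, and correct the point reached inside its
  -- fibre by a group element.
  obtain ⟨k, -, hki, hkj, hp⟩ := exists_idx_component x.1 y.1 (base_mem x) (h ▸ base_mem y)
  obtain ⟨a, w, ha, hw⟩ := exists_sends_of_le x hki hp
  obtain ⟨b, y', hb, hy'⟩ := exists_sends_of_ge w (k := y.1) (hw ▸ hkj)
  obtain ⟨i, y⟩ := y
  obtain ⟨i', y'⟩ := y'
  obtain rfl : i' = i := hy'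
  have e : (𝒳.str i').proj y' = (𝒳.str i').proj y := by
    have := (hb.base_eq.trans ha.base_eq).trans h
    exact this
  obtain ⟨g, rfl⟩ := ((𝒳.str i').proj_eq_iff _ _).1 e
  exact ⟨_, (ha.mul hb).mul (sends_grpArr i' g y')⟩

/-- Both `U i ∩ U i = U i` and its preimage, the whole cover, are connected, so each is its own only
component. -/
theorem source_eq_univ {i : 𝒳.Idx} (t : 𝒳.Tran i i) : (𝒳.iso t).φ.source = univ := by
  have h1 := (𝒳.iso t).isComponent_base
  rw [inter_self] at h1
  have h2 := IsComponentOf.eq_self h1 (𝒳.isConnected_U i).isPreconnected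
  have h3 := (𝒳.iso t).isComponent_source
  rw [h2, ← (𝒳.str i).range_proj, preimage_range] at h3
  exact IsComponentOf.eq_self h3 isPreconnected_univ

theorem exists_eq_grpArr {i : 𝒳.Idx} (t : 𝒳.Tran i i) :
    ∃ g : (𝒳.str i).Grp, t = 𝒳.act g (𝒳.one i) 1 := by
  obtain ⟨h, g, rfl⟩ := 𝒳.exists_act (𝒳.one i) t (by rw [source_eq_univ, source_eq_univ])
  refine ⟨h⁻¹ * g, ?_⟩
  calc 𝒳.act h⁻¹ (𝒳.one i) g = 𝒳.act h⁻¹ (𝒳.act 1 (𝒳.one i) g) 1 := by rw [𝒳.act_act]; simp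
    _ = _ := by rw [act_one_right_one, 𝒳.act_act]; simp

/-- Any transition map back from `y` to `x` composes with `a` to a group element fixing `x`;
multiplying by the inverse of this element gives a left inverse. -/
theorem Sends.exists_left_inv {a : 𝒳.Arr} {x y : 𝒳.Pt} (h : 𝒳.Sends a x y) :
    ∃ b, 𝒳.Sends b y x ∧ 𝒳.CompAt b a x (𝒳.oneArr x.1) := by
  obtain ⟨b, hb⟩ := exists_sends h.base_eq
  have hc := h.compAt hb
  have hs := h.mul hb
  obtain ⟨i, x⟩ := x
  generalize 𝒳.mul b a ⟨i, x⟩ = c at hc hs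
  obtain ⟨t, hx, rfl, -⟩ := hs.exists_tran
  obtain ⟨g, rfl⟩ := exists_eq_grpArr (𝒳 := 𝒳) (i := i) t
  have h1 := sends_grpArr i g⁻¹ x
  have h2 := sends_grpArr i g x
  have e : g • x = x := by
    have := h2.unique hs
    simp only [Sigma.mk.injEq, heq_eq_eq, true_and] at this
    exact this
  rw [inv_smul_eq_iff.2 e.symm] at h1
  refine ⟨_, hb.mul h1, ?_⟩
  have := h.compAt (hb.mul h1)
  rwa [← mul_assoc' h hb h1, hc.mul_eq, ← grpArr, grpArr_mul, inv_mul_cancel, grpArr_one] at this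

theorem Sends.cancel_right {a b c : 𝒳.Arr} {x y z w : 𝒳.Pt} (ha : 𝒳.Sends a x y)
    (hb : 𝒳.Sends b y z) (hc : 𝒳.Sends c y w) (h : 𝒳.mul b a x = 𝒳.mul c a x) : b = c := by
  obtain ⟨d, hd, hda⟩ := ha.exists_left_inv
  obtain ⟨e, he, hed⟩ := hd.exists_left_inv
  have key : 𝒳.mul a d y = 𝒳.oneArr y.1 := by
    -- `e = a`, since both are inverse to `d`
    have e1 : e = a := by
      have := mul_assoc' ha hd he
      rw [hda.mul_eq, he.mul_one, hed.mul_eq, ha.one_mul] at this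
      exact this
    rw [← e1, hed.mul_eq]
  have e1 := mul_assoc' hd ha hb
  have e2 := mul_assoc' hd ha hc
  rw [key, hb.mul_one] at e1
  rw [key, hc.mul_one] at e2
  rw [e1, e2, h]

theorem target_component {i j : 𝒳.Idx} (t : 𝒳.Tran i j) :
    ∃ C, IsComponentOf C ((𝒳.U i : Set X) ∩ 𝒳.U j) ∧
      IsComponentOf (𝒳.iso t).φ.target ((𝒳.str j).proj ⁻¹' C) ∧
      ∀ y ∈ (𝒳.iso t).φ.target, (𝒳.str j).proj y ∈ C := by
  refine ⟨_, (𝒳.iso t).isComponent_base, (𝒳.iso t).isComponent_target, fun y hy => ?_⟩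
  obtain ⟨c, -, h⟩ := (𝒳.iso t).isComponent_target
  rw [h] at hy
  have := connectedComponentIn_subset _ _ hy
  exact this

theorem source_component {i j : 𝒳.Idx} (t : 𝒳.Tran i j) :
    ∃ C, IsComponentOf C ((𝒳.U i : Set X) ∩ 𝒳.U j) ∧
      IsComponentOf (𝒳.iso t).φ.source ((𝒳.str i).proj ⁻¹' C) ∧
      ∀ y ∈ (𝒳.iso t).φ.source, (𝒳.str i).proj y ∈ C :=
  ⟨_, (𝒳.iso t).isComponent_base, (𝒳.iso t).isComponent_source, fun y hy => ⟨y, hy, rfl⟩⟩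

/-- Every transition map has an inverse. -/
theorem exists_inv (a : 𝒳.Arr) : ∃ b : 𝒳.Arr, ∀ x y, 𝒳.Sends a x y →
    𝒳.Sends b y x ∧ 𝒳.CompAt b a x (𝒳.oneArr x.1) := by
  obtain ⟨i, j, t⟩ := a
  obtain ⟨x, hx⟩ := source_nonempty t
  obtain ⟨b, hb, hc⟩ := (Sends.mk t x hx).exists_left_inv
  refine ⟨b, fun x' y' h => ?_⟩
  obtain ⟨s, hy, rfl, -⟩ := hb.exists_tran
  -- The target of `t` and the source of `s` are components of preimages of components of the same
  -- intersection. They share a point, so they coincide, and the inverse found at one point is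
  -- defined on the whole image of `t`.
  obtain ⟨C, hC, hC', hC''⟩ := target_component t
  obtain ⟨D, hD, hD', hD''⟩ := source_component s
  rw [inter_comm] at hD
  have hyt : (𝒳.iso t).φ x ∈ (𝒳.iso t).φ.target := (𝒳.iso t).φ.map_source hx
  obtain rfl := IsComponentOf.eq_of_mem hC hD (hC'' _ hyt) (hD'' _ hy)
  have e := IsComponentOf.eq_of_mem hC' hD' hyt hy
  cases h with | mk _ x' hx' =>
  have hy' : (𝒳.iso t).φ x' ∈ (𝒳.iso s).φ.source := e ▸ (𝒳.iso t).φ.map_source hx'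
  have h1 := Sends.mk t x' hx'
  have h2 := Sends.mk s _ hy'
  -- A composition depends on the point only through its domain, and the composition found at `x`,
  -- the identity, is defined everywhere.
  have h3 := hc.of_sends h1 h2 (sends_one (𝒳 := 𝒳) ⟨i, x'⟩)
  have h4 := h3.sends h1 h2
  have h5 := h4.unique (sends_one (𝒳 := 𝒳) ⟨i, x'⟩)
  exact ⟨h5 ▸ h2, h3⟩

/-- The inverse transition map. -/
noncomputable def inv (𝒳 : Orbispace X) (a : 𝒳.Arr) : 𝒳.Arr := (exists_inv a).choose

theorem Sends.inv {a : 𝒳.Arr} {x y : 𝒳.Pt} (h : 𝒳.Sends a x y) : 𝒳.Sends (𝒳.inv a) y x :=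
  ((exists_inv a).choose_spec x y h).1

theorem Sends.inv_mul {a : 𝒳.Arr} {x y : 𝒳.Pt} (h : 𝒳.Sends a x y) :
    𝒳.mul (𝒳.inv a) a x = 𝒳.oneArr x.1 :=
  ((exists_inv a).choose_spec x y h).2.mul_eq

theorem Sends.mul_inv {a : 𝒳.Arr} {x y : 𝒳.Pt} (h : 𝒳.Sends a x y) :
    𝒳.mul a (𝒳.inv a) y = 𝒳.oneArr y.1 := by
  refine h.cancel_right (h.inv.mul h) (sends_one y) ?_
  rw [← mul_assoc' h h.inv h, h.inv_mul, h.mul_one, h.one_mul]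

theorem Sends.left_unique {a : 𝒳.Arr} {x x' y : 𝒳.Pt} (h : 𝒳.Sends a x y)
    (h' : 𝒳.Sends a x' y) : x = x' := h.inv.unique h'.inv

theorem Sends.cancel_left {a b c : 𝒳.Arr} {x y y' z z' : 𝒳.Pt} (ha : 𝒳.Sends a x y)
    (hb : 𝒳.Sends b x y') (hc : 𝒳.Sends c y z) (hc' : 𝒳.Sends c y' z')
    (h : 𝒳.mul c a x = 𝒳.mul c b x) : a = b := by
  have e1 : z = z' := by
    have := ha.mul hc
    rw [h] at this
    exact this.unique (hb.mul hc')
  subst e1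
  obtain rfl := hc.left_unique hc'
  have h1 := mul_assoc' ha hc hc.inv
  have h2 := mul_assoc' hb hc hc.inv
  rw [hc.inv_mul, ha.one_mul] at h1
  rw [hc.inv_mul, hb.one_mul] at h2
  rw [← h1, ← h2, h]

open Classical in
/-- The value of the transition map `a` at the point `x` (and `x` outside the domain). -/
noncomputable def app (𝒳 : Orbispace X) (a : 𝒳.Arr) (x : 𝒳.Pt) : 𝒳.Pt :=
  if h : ∃ y, 𝒳.Sends a x y then h.choose else x

/-- The domain of a transition map. -/
def dom (𝒳 : Orbispace X) (a : 𝒳.Arr) : Set 𝒳.Pt := {x | ∃ y, 𝒳.Sends a x y}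

theorem sends_app {a : 𝒳.Arr} {x : 𝒳.Pt} (h : x ∈ 𝒳.dom a) : 𝒳.Sends a x (𝒳.app a x) := by
  have h' : ∃ y, 𝒳.Sends a x y := h
  rw [app, dif_pos h']
  exact h'.choose_spec

theorem Sends.app_eq {a : 𝒳.Arr} {x y : 𝒳.Pt} (h : 𝒳.Sends a x y) : 𝒳.app a x = y :=
  (sends_app ⟨y, h⟩).unique h

theorem Sends.mem_dom {a : 𝒳.Arr} {x y : 𝒳.Pt} (h : 𝒳.Sends a x y) : x ∈ 𝒳.dom a := ⟨y, h⟩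

theorem dom_eq_image (a : 𝒳.Arr) :
    𝒳.dom a = Sigma.mk a.src '' (𝒳.iso a.tran).φ.source := by
  ext x
  constructor
  · rintro ⟨y, h⟩
    obtain ⟨t, x, hx⟩ := h
    exact ⟨x, hx, rfl⟩
  · rintro ⟨x, hx, rfl⟩
    exact ⟨_, Sends.mk a.tran x hx⟩

theorem isOpen_dom (a : 𝒳.Arr) : IsOpen (𝒳.dom a) := by
  rw [dom_eq_image]
  exact isOpenMap_sigmaMk _ (𝒳.iso a.tran).φ.open_source

theorem continuousOn_app (a : 𝒳.Arr) : ContinuousOn (𝒳.app a) (𝒳.dom a) := by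
  obtain ⟨i, j, t⟩ := a
  rw [dom_eq_image]
  have : ContinuousOn (fun x => (⟨j, (𝒳.iso t).φ x⟩ : 𝒳.Pt)) (𝒳.iso t).φ.source :=
    continuous_sigmaMk.comp_continuousOn (𝒳.iso t).φ.continuousOn
  rintro _ ⟨x, hx, rfl⟩
  refine ContinuousAt.continuousWithinAt ?_
  rw [(IsOpenEmbedding.sigmaMk (σ := fun i => (𝒳.str i).Cov) (i := i)).continuousAt_iff.symm]
  exact (this.congr fun x hx => (Sends.mk t x hx).app_eq).continuousAt
    ((𝒳.iso t).φ.open_source.mem_nhds hx)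

theorem continuousAt_app {a : 𝒳.Arr} {x : 𝒳.Pt} (h : x ∈ 𝒳.dom a) : ContinuousAt (𝒳.app a) x :=
  (continuousOn_app a).continuousAt ((isOpen_dom a).mem_nhds h)

theorem isConnected_dom_image (a : 𝒳.Arr) : (𝒳.dom a).Nonempty := by
  rw [dom_eq_image]; exact (source_nonempty a.tran).image _

/-- The composition is locally constant in the point. -/
theorem CompAt.eventually {a b c : 𝒳.Arr} {x : 𝒳.Pt} (h : 𝒳.CompAt b a x c) :
    ∀ᶠ x' in 𝓝 x, 𝒳.CompAt b a x' c := by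
  obtain ⟨y, z, ha, hb, hc⟩ := h.exists_sends
  have h1 := (isOpen_dom a).mem_nhds ha.mem_dom
  have h2 := (isOpen_dom c).mem_nhds hc.mem_dom
  have h3 : ∀ᶠ x' in 𝓝 x, 𝒳.app a x' ∈ 𝒳.dom b := by
    refine (continuousAt_app ha.mem_dom).eventually ?_
    rw [ha.app_eq]
    exact (isOpen_dom b).mem_nhds hb.mem_dom
  filter_upwards [h1, h2, h3] with x' h1 h2 h3
  exact h.of_sends (sends_app h1) (sends_app h3) (sends_app h2)

theorem fst_eventually (x : 𝒳.Pt) : ∀ᶠ y in 𝓝 x, y.1 = x.1 := by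
  have : IsOpen (Sigma.fst ⁻¹' {x.1} : Set 𝒳.Pt) := by
    rw [isOpen_sigma_iff]
    intro i
    by_cases h : i = x.1
    · convert isOpen_univ; ext; simp [h]
    · convert isOpen_empty; ext; simp [h]
  exact this.mem_nhds rfl

end Groupoid

end Orbispace

/-! ### The gauge group and the topology on the set of transition maps. -/

namespace Orbispace

section Gauge

variable {X : Type u} [TopologicalSpace X] {𝒳 : Orbispace X}

/-- The product of all the groups `G_U`, which acts on the disjoint union of the spaces `Û` and on
both sides of the set of transition maps. -/
abbrev Gau (𝒳 : Orbispace X) : Type u := ∀ i, (𝒳.str i).Grp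

/-- The action of the gauge group on points. -/
def gact (g : 𝒳.Gau) (x : 𝒳.Pt) : 𝒳.Pt := ⟨x.1, g x.1 • x.2⟩

theorem continuous_gact : Continuous fun p : 𝒳.Gau × 𝒳.Pt => gact p.1 p.2 := by
  have h : Continuous fun q : (Σ i, (𝒳.str i).Cov × 𝒳.Gau) =>
      (⟨q.1, q.2.2 q.1 • q.2.1⟩ : 𝒳.Pt) := by
    refine continuous_sigma fun i => continuous_sigmaMk.comp ?_
    exact ((continuous_apply i).comp continuous_snd).smul continuous_fst
  exact h.comp ((Homeomorph.sigmaProdDistrib (X := fun i => (𝒳.str i).Cov) (Y := 𝒳.Gau)).continuous.comp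
    continuous_swap)

theorem continuous_gact_left (g : 𝒳.Gau) : Continuous (gact g) :=
  continuous_gact.comp (Continuous.prodMk_right g)

@[simp] theorem gact_one (x : 𝒳.Pt) : gact 1 x = x := by
  simp [gact]

theorem gact_gact (g h : 𝒳.Gau) (x : 𝒳.Pt) : gact g (gact h x) = gact (g * h) x := by
  obtain ⟨i, x⟩ := x
  exact congrArg (Sigma.mk i) (mul_smul (g i) (h i) x).symm

@[simp] theorem gact_inv_gact (g : 𝒳.Gau) (x : 𝒳.Pt) : gact g⁻¹ (gact g x) = x := by
  rw [gact_gact]; simp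

@[simp] theorem gact_gact_inv (g : 𝒳.Gau) (x : 𝒳.Pt) : gact g (gact g⁻¹ x) = x := by
  rw [gact_gact]; simp

/-- The transition map `h ∘ a ∘ g`. -/
def lact (h : 𝒳.Gau) (a : 𝒳.Arr) (g : 𝒳.Gau) : 𝒳.Arr :=
  ⟨a.src, a.tgt, 𝒳.act (h a.tgt) a.tran (g a.src)⟩

@[simp] theorem lact_one_one (a : 𝒳.Arr) : lact 1 a 1 = a := by
  simp [lact, 𝒳.act_one]

theorem lact_lact (h h' : 𝒳.Gau) (a : 𝒳.Arr) (g g' : 𝒳.Gau) :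
    lact h' (lact h a g) g' = lact (h' * h) a (g * g') := by
  simp [lact, 𝒳.act_act]

theorem Sends.lact {h : 𝒳.Gau} {a : 𝒳.Arr} {g : 𝒳.Gau} {x y : 𝒳.Pt}
    (hs : 𝒳.Sends a (gact g x) y) : 𝒳.Sends (lact h a g) x (gact h y) := by
  obtain ⟨i, x⟩ := x
  obtain ⟨t, hx, rfl, e⟩ := hs.exists_tran
  exact sends_act _ t _ hs

theorem Sends.lact_left {h : 𝒳.Gau} {a : 𝒳.Arr} {x y : 𝒳.Pt} (hs : 𝒳.Sends a x y) :
    𝒳.Sends (Orbispace.lact h a 1) x (gact h y) :=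
  Sends.lact (by rwa [gact_one])

theorem Sends.mul_grpArr_left {a : 𝒳.Arr} {x y : 𝒳.Pt} (hs : 𝒳.Sends a x y) (h : 𝒳.Gau) :
    𝒳.mul (𝒳.grpArr y.1 (h y.1)) a x = Orbispace.lact h a 1 := by
  obtain ⟨t, hx, rfl, e⟩ := hs.exists_tran
  exact Orbispace.mul_grpArr_left t (h y.1) hs

theorem sends_grpArr' (x : 𝒳.Pt) (h : 𝒳.Gau) :
    𝒳.Sends (𝒳.grpArr x.1 (h x.1)) x (gact h x) := sends_grpArr x.1 (h x.1) x.2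

theorem Sends.mul_grpArr_right {a : 𝒳.Arr} {x y : 𝒳.Pt} {g : 𝒳.Gau}
    (hs : 𝒳.Sends a (gact g x) y) :
    𝒳.mul a (𝒳.grpArr x.1 (g x.1)) x = Orbispace.lact 1 a g := by
  obtain ⟨i, x⟩ := x
  obtain ⟨t, hx, rfl, e⟩ := hs.exists_tran
  exact Orbispace.mul_grpArr_right t (g i) hs

/-- Once group elements are written as transition maps `grpArr`, the compatibilities of the two
actions with composition are instances of associativity. -/
theorem Sends.lact_mul {a b : 𝒳.Arr} {x y z : 𝒳.Pt} (ha : 𝒳.Sends a x y) (hb : 𝒳.Sends b y z)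
    (h : 𝒳.Gau) : 𝒳.mul (Orbispace.lact h b 1) a x = Orbispace.lact h (𝒳.mul b a x) 1 := by
  rw [← hb.mul_grpArr_left h, ← (ha.mul hb).mul_grpArr_left h]
  exact (mul_assoc' ha hb (sends_grpArr' z h)).symm

theorem Sends.lact_mul_middle {a b : 𝒳.Arr} {x y z : 𝒳.Pt} {g : 𝒳.Gau} (ha : 𝒳.Sends a x y)
    (hb : 𝒳.Sends b (gact g y) z) :
    𝒳.mul (Orbispace.lact 1 b g) a x = 𝒳.mul b (Orbispace.lact g a 1) x := by
  rw [← hb.mul_grpArr_right, ← ha.mul_grpArr_left g]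
  exact (mul_assoc' ha (sends_grpArr' y g) hb).symm

theorem lact_grpArr (i : 𝒳.Idx) (h : 𝒳.Gau) (g : (𝒳.str i).Grp) :
    lact h (𝒳.grpArr i g) 1 = 𝒳.grpArr i (h i * g) := by
  refine congrArg (Arr.mk i i) ((𝒳.act_act (j := i) _ _ _ _ _).trans ?_)
  exact congrArg (𝒳.act (h i * g) (𝒳.one i)) (_root_.mul_one (1 : (𝒳.str i).Grp))

theorem lact_oneArr (i : 𝒳.Idx) (h : 𝒳.Gau) : lact h (𝒳.oneArr i) 1 = 𝒳.grpArr i (h i) := rfl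

/-- By `act_eq_iff` an element that acts trivially on the identity transition map is the image of
`1`. This holds even if the action of the group on `Û` is not effective, and it later makes the
group element at the end of a normal representative unique. -/
theorem grpArr_injective (i : 𝒳.Idx) : Function.Injective (𝒳.grpArr i) := by
  intro g h e
  simp only [grpArr, Arr.mk.injEq, heq_eq_eq, true_and] at e
  have e' : 𝒳.act (h⁻¹ * g) (𝒳.one i) 1 = 𝒳.one i := by
    have := congrArg (fun t => 𝒳.act h⁻¹ t 1) e
    simpa [𝒳.act_act, 𝒳.act_one] using this
  have := (𝒳.act_eq_iff (h⁻¹ * g)⁻¹ (𝒳.one i) 1).1 (by rwa [inv_inv])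
  obtain ⟨hg, hh⟩ := this
  have h1 := 𝒳.one_lam i 1 hg
  rw [h1] at hh
  have := inv_eq_one.1 hh.symm
  exact (inv_mul_eq_one.1 this).symm

/-- Translation by `g` is a homeomorphism preserving the fibres of the projection, so it permutes
the components of the preimage of `C`. -/
theorem smul_isComponentOf {U : Opens X} (A : GStructure U) {S : Set A.Cov} {C : Set X}
    (h : IsComponentOf S (A.proj ⁻¹' C)) (g : A.Grp) : IsComponentOf (g • S) (A.proj ⁻¹' C) := by
  obtain ⟨c, hc, rfl⟩ := h
  have hp : ∀ z : A.Cov, A.proj (g • z) = A.proj z := fun z =>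
    ((A.proj_eq_iff z (g • z)).2 ⟨g, rfl⟩).symm
  have himg : (Homeomorph.smul g : A.Cov ≃ₜ A.Cov) '' (A.proj ⁻¹' C) = A.proj ⁻¹' C := by
    ext z
    constructor
    · rintro ⟨w, hw, rfl⟩
      change A.proj (g • w) ∈ C
      rw [hp]; exact hw
    · intro hz
      refine ⟨g⁻¹ • z, ?_, smul_inv_smul g z⟩
      change A.proj (g⁻¹ • z) ∈ C
      rw [← hp, smul_inv_smul]; exact hz
  refine ⟨g • c, ?_, ?_⟩
  · change A.proj (g • c) ∈ C
    rw [hp]; exact hc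
  · have := (Homeomorph.smul g : A.Cov ≃ₜ A.Cov).image_connectedComponentIn hc
    rw [himg] at this
    exact this

/-- A translate of the source is again a component of the same set, so it equals the source as soon
as the two meet. Hence the stabilizer is open, and elements near `1` can be transported through a
transition map. -/
theorem mem_stabilizer_source_iff {i j : 𝒳.Idx} (t : 𝒳.Tran i j) {x : (𝒳.str i).Cov}
    (hx : x ∈ (𝒳.iso t).φ.source) (g : (𝒳.str i).Grp) :
    g ∈ MulAction.stabilizer (𝒳.str i).Grp (𝒳.iso t).φ.source ↔ g • x ∈ (𝒳.iso t).φ.source := by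
  rw [MulAction.mem_stabilizer_iff]
  constructor
  · intro h
    rw [← h]
    exact smul_mem_smul_set hx
  · intro h
    have h1 := (𝒳.iso t).isComponent_source
    exact IsComponentOf.eq_of_mem (smul_isComponentOf _ h1 g) h1 (smul_mem_smul_set hx) h

theorem isOpen_stabilizer_source {i j : 𝒳.Idx} (t : 𝒳.Tran i j) :
    IsOpen (MulAction.stabilizer (𝒳.str i).Grp (𝒳.iso t).φ.source : Set (𝒳.str i).Grp) := by
  obtain ⟨x, hx⟩ := source_nonempty t
  have : (MulAction.stabilizer (𝒳.str i).Grp (𝒳.iso t).φ.source : Set (𝒳.str i).Grp) =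
      (fun g => g • x) ⁻¹' (𝒳.iso t).φ.source := by
    ext g; exact mem_stabilizer_source_iff t hx g
  rw [this]
  exact (𝒳.iso t).φ.open_source.preimage (continuous_id.smul continuous_const)

open Classical in
/-- The group element by which a transition map transports a gauge transformation (and the neutral
element if the given one does not preserve the domain). -/
noncomputable def lamHat (a : 𝒳.Arr) (g : 𝒳.Gau) : 𝒳.Gau :=
  if hg : g a.src ∈ MulAction.stabilizer (𝒳.str a.src).Grp (𝒳.iso a.tran).φ.source then
    Pi.mulSingle a.tgt ((𝒳.iso a.tran).lam ⟨g a.src, hg⟩ : (𝒳.str a.tgt).Grp) else 1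

theorem lamHat_one (a : 𝒳.Arr) : lamHat a 1 = 1 := by
  classical
  have : (1 : 𝒳.Gau) a.src ∈ MulAction.stabilizer (𝒳.str a.src).Grp (𝒳.iso a.tran).φ.source :=
    one_mem _
  rw [lamHat, dif_pos this]
  have e : (𝒳.iso a.tran).lam ⟨(1 : 𝒳.Gau) a.src, this⟩ = 1 := map_one _
  rw [e]
  simp

/-- The stabilizer of the source is open, so near `1` only the first case of the definition occurs;
there the map is the continuous isomorphism of stabilizers, inserted in one coordinate. -/
theorem continuousAt_lamHat (a : 𝒳.Arr) : ContinuousAt (lamHat a) 1 := by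
  classical
  set S := MulAction.stabilizer (𝒳.str a.src).Grp (𝒳.iso a.tran).φ.source with hS
  have hSo : IsOpen ((fun g : 𝒳.Gau => g a.src) ⁻¹' (S : Set (𝒳.str a.src).Grp)) :=
    (isOpen_stabilizer_source a.tran).preimage
      (continuous_apply (A := fun i => (𝒳.str i).Grp) a.src)
  refine ContinuousOn.continuousAt (s := (fun g : 𝒳.Gau => g a.src) ⁻¹' (S : Set _)) ?_
    (hSo.mem_nhds (one_mem S))
  rw [continuousOn_iff_continuous_domRestrict]
  have : ((fun g : 𝒳.Gau => g a.src) ⁻¹' (S : Set _)).domRestrict (lamHat a) = fun g =>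
      Pi.mulSingle a.tgt ((𝒳.iso a.tran).lam ⟨g.1 a.src, g.2⟩ : (𝒳.str a.tgt).Grp) := by
    funext g
    exact dif_pos g.2
  rw [this]
  refine (continuous_mulSingle (a.tgt)).comp ?_
  refine continuous_subtype_val.comp ((𝒳.iso a.tran).lam.continuous.comp ?_)
  exact ((continuous_apply a.src).comp continuous_subtype_val).subtype_mk _

/-- This is the relation `λ(g) ∘ a ∘ g⁻¹ = a` of `act_eq_iff`: a small group element at the source
can be traded for its transport at the target. -/
theorem lact_lamHat (a : 𝒳.Arr) : ∀ᶠ g in 𝓝 (1 : 𝒳.Gau), lact (lamHat a g) a g⁻¹ = a := by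
  classical
  have hSo := (isOpen_stabilizer_source a.tran).preimage
    (continuous_apply (A := fun i => (𝒳.str i).Grp) a.src)
  filter_upwards [hSo.mem_nhds (one_mem (MulAction.stabilizer (𝒳.str a.src).Grp
    (𝒳.iso a.tran).φ.source))] with g hg
  rw [mem_preimage, SetLike.mem_coe] at hg
  obtain ⟨i, j, t⟩ := a
  simp only [lact, lamHat, dif_pos hg, Pi.mulSingle_eq_same, Pi.inv_apply]
  congr 1
  have := (𝒳.act_eq_iff ((𝒳.iso t).lam ⟨g i, hg⟩ : (𝒳.str j).Grp)⁻¹ t (g i)⁻¹).2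
    ⟨inv_mem hg, by
      have e : (⟨(g i)⁻¹, inv_mem hg⟩ : MulAction.stabilizer (𝒳.str i).Grp (𝒳.iso t).φ.source) =
        (⟨g i, hg⟩ : MulAction.stabilizer (𝒳.str i).Grp (𝒳.iso t).φ.source)⁻¹ := rfl
      rw [e, map_inv]; rfl⟩
  rwa [inv_inv] at this

/-- The topology is tested with elements acting on both sides of an arbitrary `t'`, whereas the set
is described by the action on one side of `t`. Since a small change on the right passes through `t`
to the left by `lact_lamHat`, the left action alone already sweeps out open sets. -/
theorem isOpen_act_image {i j : 𝒳.Idx} (t : 𝒳.Tran i j) {N : Set (𝒳.str j).Grp} (hN : IsOpen N) :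
    IsOpen ((fun h => 𝒳.act h t 1) '' N) := by
  rw [isOpen_iSup_iff]
  intro t'
  rw [isOpen_coinduced, isOpen_iff_mem_nhds]
  rintro ⟨h', g'⟩ ⟨h, hh, e⟩
  simp only at e
  -- `t' = (h'⁻¹ h) ∘ t ∘ g'⁻¹`
  have et : t' = 𝒳.act (h'⁻¹ * h) t g'⁻¹ := by
    have := congrArg (fun s => 𝒳.act h'⁻¹ s g'⁻¹) e
    simpa [𝒳.act_act, 𝒳.act_one] using this.symm
  set a : 𝒳.Arr := ⟨i, j, t⟩
  classical
  -- Up to the left factor, `p.1 ∘ t' ∘ p.2` is `t` followed on its right by `g'⁻¹ * p.2`; `γ p` is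
  -- the inverse of this perturbation and equals `1` at `(h', g')`.
  let γ : (𝒳.str j).Grp × (𝒳.str i).Grp → 𝒳.Gau := fun p => (Pi.mulSingle i (g'⁻¹ * p.2))⁻¹
  have hγ : Continuous γ := by
    have h0 : Continuous fun p : (𝒳.str j).Grp × (𝒳.str i).Grp => g'⁻¹ * p.2 :=
      continuous_const.mul continuous_snd
    exact Continuous.inv ((continuous_mulSingle (A := fun i => (𝒳.str i).Grp) i).comp h0)
  have hγ1 : γ (h', g') = 1 := by simp [γ]
  have ht : Filter.Tendsto γ (𝓝 (h', g')) (𝓝 1) := by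
    rw [← hγ1]; exact hγ.continuousAt
  have h1 := ht.eventually (lact_lamHat a)
  have h2 : ∀ᶠ p : (𝒳.str j).Grp × (𝒳.str i).Grp in 𝓝 (h', g'),
      p.1 * (h'⁻¹ * h) * (lamHat a (γ p) j)⁻¹ ∈ N := by
    have hc : ContinuousAt (fun p : (𝒳.str j).Grp × (𝒳.str i).Grp =>
        p.1 * (h'⁻¹ * h) * (lamHat a (γ p) j)⁻¹) (h', g') := by
      have h3 : ContinuousAt (fun p => lamHat a (γ p)) (h', g') := by
        refine ContinuousAt.comp (g := lamHat a) ?_ hγ.continuousAt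
        rw [hγ1]; exact continuousAt_lamHat a
      have h4 : ContinuousAt (fun p => lamHat a (γ p) j) (h', g') :=
        (continuous_apply j).continuousAt.comp h3
      exact (continuousAt_fst.mul continuousAt_const).mul h4.inv
    refine hc (hN.mem_nhds ?_)
    simp only [hγ1, lamHat_one]
    simpa using hh
  filter_upwards [h1, h2] with p h1 h2
  refine ⟨_, h2, ?_⟩
  simp only
  have h1' : 𝒳.act (lamHat a (γ p) j) t (γ p i)⁻¹ = t := by
    have := h1
    simp only [lact, a, Arr.mk.injEq, heq_eq_eq, true_and] at this
    exact this
  calc 𝒳.act (p.1 * (h'⁻¹ * h) * (lamHat a (γ p) j)⁻¹) t 1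
      = 𝒳.act (p.1 * (h'⁻¹ * h) * (lamHat a (γ p) j)⁻¹)
          (𝒳.act (lamHat a (γ p) j) t (γ p i)⁻¹) 1 := by rw [h1']
    _ = 𝒳.act (p.1 * (h'⁻¹ * h)) t (g'⁻¹ * p.2) := by
        rw [𝒳.act_act]; simp [γ]
    _ = 𝒳.act p.1 t' p.2 := by rw [et, 𝒳.act_act]

theorem isOpen_arr_iff {A : Set 𝒳.Arr} :
    IsOpen A ↔ ∀ i j, IsOpen {t : 𝒳.Tran i j | (⟨i, j, t⟩ : 𝒳.Arr) ∈ A} := by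
  rw [isOpen_iSup_iff]
  refine forall_congr' fun i => ?_
  rw [isOpen_iSup_iff]
  exact forall_congr' fun j => isOpen_coinduced

/-- These are the neighbourhoods of a transition map that `Rep.eventually` uses: a transition map in
one of them is a prescribed one times a small group element. -/
theorem isOpen_lact_image (a : 𝒳.Arr) {N : Set 𝒳.Gau} (hN : IsOpen N) :
    IsOpen ((fun h => lact h a 1) '' N) := by
  obtain ⟨i, j, t⟩ := a
  have hN' : IsOpen ((fun g : 𝒳.Gau => g j) '' N) := isOpenMap_eval j N hN
  have key : ((fun h : 𝒳.Gau => lact h ⟨i, j, t⟩ 1) '' N) =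
      (fun t => (⟨i, j, t⟩ : 𝒳.Arr)) '' ((fun h => 𝒳.act h t 1) '' ((fun g : 𝒳.Gau => g j) '' N)) := by
    simp only [image_image]; rfl
  rw [key, isOpen_arr_iff]
  intro i' j'
  by_cases h : i' = i ∧ j' = j
  · obtain ⟨rfl, rfl⟩ := h
    convert isOpen_act_image t hN' using 1
    ext s; simp
  · convert isOpen_empty
    ext s
    simp only [mem_ofPred_eq, mem_image, mem_empty_iff_false, iff_false]
    rintro ⟨_, _, e⟩
    simp only [Arr.mk.injEq] at e
    exact h ⟨e.1.symm, e.2.1.symm⟩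

theorem continuous_lact (a : 𝒳.Arr) : Continuous fun h : 𝒳.Gau => lact h a 1 := by
  obtain ⟨i, j, t⟩ := a
  have h1 : Continuous fun t : 𝒳.Tran i j => (⟨i, j, t⟩ : 𝒳.Arr) := by
    rw [continuous_def]
    intro A hA
    exact isOpen_arr_iff.1 hA i j
  have h2 : Continuous fun p : (𝒳.str j).Grp × (𝒳.str i).Grp => 𝒳.act p.1 t p.2 := by
    rw [continuous_def]
    intro A hA
    exact isOpen_coinduced.1 (isOpen_iSup_iff.1 hA t)
  exact h1.comp (h2.comp ((continuous_apply (A := fun i => (𝒳.str i).Grp) j).prodMk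
    continuous_const))

end Gauge

end Orbispace

/-! ### Isomorphisms of systems and the equivalence relation generated by refinement. -/

namespace Orbispace

theorem _root_.IsPreconnected.eq_of_eventually_eq {T Y : Type*} [TopologicalSpace T] {S : Set T}
    (hS : IsPreconnected S) {f : T → Y} (h : ∀ t ∈ S, ∀ᶠ t' in 𝓝[S] t, f t' = f t) {s t : T}
    (hs : s ∈ S) (ht : t ∈ S) : f s = f t := by
  let _ : TopologicalSpace Y := ⊥
  have : DiscreteTopology Y := ⟨rfl⟩
  refine hS.constant (f := f) (fun t ht => ?_) hs ht
  rw [ContinuousWithinAt, nhds_discrete, Filter.tendsto_pure]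
  exact h t ht

section Iso

variable {X : Type u} [TopologicalSpace X] {𝒳 : Orbispace X}

theorem Sends.inv_mul_left {a b : 𝒳.Arr} {x y z : 𝒳.Pt} (ha : 𝒳.Sends a x y)
    (hb : 𝒳.Sends b y z) : 𝒳.mul (𝒳.inv (𝒳.mul b a x)) b y = 𝒳.inv a := by
  refine ha.cancel_right (hb.mul (ha.mul hb).inv) ha.inv ?_
  rw [← mul_assoc' ha hb (ha.mul hb).inv, (ha.mul hb).inv_mul, ha.inv_mul]

theorem Sends.mul_inv_right {a b : 𝒳.Arr} {x y z : 𝒳.Pt} (ha : 𝒳.Sends a x y)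
    (hb : 𝒳.Sends b y z) : 𝒳.mul a (𝒳.inv (𝒳.mul b a x)) z = 𝒳.inv b := by
  refine ((ha.mul hb).inv.mul ha).cancel_left hb.inv hb hb ?_
  rw [mul_assoc' (ha.mul hb).inv ha hb, (ha.mul hb).mul_inv, hb.mul_inv]

theorem Sends.inv_mul_cancel {a b : 𝒳.Arr} {x y z : 𝒳.Pt} (ha : 𝒳.Sends a x y)
    (hb : 𝒳.Sends b y z) : 𝒳.mul (𝒳.inv b) (𝒳.mul b a x) x = a := by
  rw [mul_assoc' ha hb hb.inv, hb.inv_mul, ha.one_mul]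

theorem Sends.mul_inv_cancel {a b : 𝒳.Arr} {x y z : 𝒳.Pt} (ha : 𝒳.Sends a x y)
    (hb : 𝒳.Sends b z y) : 𝒳.mul b (𝒳.mul (𝒳.inv b) a x) x = a := by
  rw [mul_assoc' ha hb.inv hb, hb.mul_inv, ha.one_mul]

theorem inv_oneArr (i : 𝒳.Idx) : 𝒳.inv (𝒳.oneArr i) = 𝒳.oneArr i := by
  obtain ⟨x⟩ : Nonempty (𝒳.str i).Cov := inferInstance
  have h := sends_one (𝒳 := 𝒳) ⟨i, x⟩
  rw [← h.inv.mul_one]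
  exact h.inv_mul

theorem sends_oneArr {i : 𝒳.Idx} {x : 𝒳.Pt} (h : x.1 = i) : 𝒳.Sends (𝒳.oneArr i) x x := by
  subst h; exact sends_one x

theorem oneArr_mul_oneArr {i : 𝒳.Idx} {x : 𝒳.Pt} (h : x.1 = i) :
    𝒳.mul (𝒳.oneArr i) (𝒳.oneArr i) x = 𝒳.oneArr i := by
  subst h; exact (sends_one x).one_mul

namespace PathSystem

variable {o₁ o₂ p₁ p₂ q₁ q₂ : 𝒳.BasePoint}

theorem continuousAt_f (σ : 𝒳.PathSystem o₁ o₂) {k : ℕ} (hk : k ≤ σ.n) {t : unitInterval}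
    (ht : t ∈ σ.I k) : ContinuousAt (σ.f k) t :=
  (σ.continuousOn_f k hk).continuousAt ((σ.isOpen_I k hk).mem_nhds ht)

theorem eventually_mem (σ : 𝒳.PathSystem o₁ o₂) {k : ℕ} (hk : k ≤ σ.n) {t : unitInterval}
    (ht : t ∈ σ.I k) : ∀ᶠ s in 𝓝 t, s ∈ σ.I k := (σ.isOpen_I k hk).mem_nhds ht

theorem le_succ_of_mem (σ : 𝒳.PathSystem o₁ o₂) {k l : ℕ} (hl : l ≤ σ.n) {t : unitInterval}
    (ht : t ∈ σ.I k) (ht' : t ∈ σ.I l) : l ≤ k + 1 := by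
  by_contra h
  exact Set.disjoint_left.1 (σ.disjoint k l (by omega) hl) ht ht'

/-- The intervals with index at most `k` and those with larger index form two non-empty open sets
covering the connected `[0,1]`, so they meet; intervals with non-consecutive indices being disjoint,
only `k` and `k + 1` can meet. -/
theorem exists_mem_inter (σ : 𝒳.PathSystem o₁ o₂) {k : ℕ} (hk : k < σ.n) :
    ∃ t, t ∈ σ.I k ∧ t ∈ σ.I (k + 1) := by
  have hA : IsOpen (⋃ j ∈ Iic k, σ.I j) :=
    isOpen_biUnion fun j hj => σ.isOpen_I j (le_trans hj hk.le)
  have hB : IsOpen (⋃ j ∈ Ioc k σ.n, σ.I j) := isOpen_biUnion fun j hj => σ.isOpen_I j hj.2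
  obtain ⟨t, -, htA, htB⟩ := isPreconnected_univ (α := unitInterval) _ _ hA hB (fun t _ => by
      obtain ⟨j, hj, hjt⟩ := σ.cover t
      rcases le_or_gt j k with h | h
      · exact Or.inl (mem_biUnion (show j ∈ Iic k from h) hjt)
      · exact Or.inr (mem_biUnion (show j ∈ Ioc k σ.n from ⟨h, hj⟩) hjt))
    ⟨0, trivial, mem_biUnion (show 0 ∈ Iic k from Nat.zero_le k) σ.zero_mem⟩
    ⟨1, trivial, mem_biUnion (show σ.n ∈ Ioc k σ.n from ⟨hk, le_rfl⟩) σ.one_mem⟩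
  simp only [mem_iUnion, mem_Iic, mem_Ioc, exists_prop] at htA htB
  obtain ⟨j, hj, hjt⟩ := htA
  obtain ⟨l, hl, hlt⟩ := htB
  have := σ.le_succ_of_mem hl.2 hjt hlt
  obtain rfl : j = k := by omega
  obtain rfl : l = j + 1 := by omega
  exact ⟨t, hjt, hlt⟩

theorem I_nonempty (σ : 𝒳.PathSystem o₁ o₂) {k : ℕ} (hk : k ≤ σ.n) : ∃ t, t ∈ σ.I k := by
  rcases hk.lt_or_eq with h | rfl
  · obtain ⟨t, ht, -⟩ := σ.exists_mem_inter h
    exact ⟨t, ht⟩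
  · exact ⟨1, σ.one_mem⟩

/-- An isomorphism between systems: a family of transition maps `J t k l` from `f_k(t)` to
`f'_l(t)`, compatible with the transition maps of the systems and locally constant in `t`. The
systems may have different end points. -/
structure IsIso (σ : 𝒳.PathSystem o₁ o₂) (τ : 𝒳.PathSystem p₁ p₂)
    (J : unitInterval → ℕ → ℕ → 𝒳.Arr) : Prop where
  sends : ∀ t k l, k ≤ σ.n → l ≤ τ.n → t ∈ σ.I k → t ∈ τ.I l → 𝒳.Sends (J t k l) (σ.f k t) (τ.f l t)
  left : ∀ t k l, k < σ.n → l ≤ τ.n → t ∈ σ.I k → t ∈ σ.I (k + 1) → t ∈ τ.I l →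
    𝒳.mul (J t (k + 1) l) (σ.ρ k) (σ.f k t) = J t k l
  right : ∀ t k l, k ≤ σ.n → l < τ.n → t ∈ σ.I k → t ∈ τ.I l → t ∈ τ.I (l + 1) →
    𝒳.mul (τ.ρ l) (J t k l) (σ.f k t) = J t k (l + 1)
  loc : ∀ t k l, k ≤ σ.n → l ≤ τ.n → t ∈ σ.I k → t ∈ τ.I l → ∀ᶠ s in 𝓝 t, J s k l = J t k l

/-- The transition map of a system between the charts with indices `k` and `l`. -/
noncomputable def tr (σ : 𝒳.PathSystem o₁ o₂) (k l : ℕ) : 𝒳.Arr :=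
  -- The last case is meaningful only for `k = l + 1`; intervals with other pairs of indices do not
  -- meet.
  if l = k then 𝒳.oneArr (σ.chart k) else if l = k + 1 then σ.ρ k else 𝒳.inv (σ.ρ l)

theorem tr_self (σ : 𝒳.PathSystem o₁ o₂) (k : ℕ) : σ.tr k k = 𝒳.oneArr (σ.chart k) := if_pos rfl

theorem tr_succ (σ : 𝒳.PathSystem o₁ o₂) (k : ℕ) : σ.tr k (k + 1) = σ.ρ k := by simp [tr]

theorem tr_pred (σ : 𝒳.PathSystem o₁ o₂) (k : ℕ) : σ.tr (k + 1) k = 𝒳.inv (σ.ρ k) := by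
  rw [tr, if_neg (by omega), if_neg (by omega)]

theorem isIso_refl (σ : 𝒳.PathSystem o₁ o₂) : σ.IsIso σ fun _ => σ.tr where
  sends t k l hk hl ht ht' := by
    have h1 := σ.le_succ_of_mem hl ht ht'
    have h2 := σ.le_succ_of_mem hk ht' ht
    obtain rfl | rfl | rfl : l = k ∨ l = k + 1 ∨ k = l + 1 := by omega
    · rw [tr_self]; exact sends_oneArr (σ.f_chart _ hk _ ht)
    · rw [tr_succ]; exact σ.ρ_sends k hl t ⟨ht, ht'⟩
    · rw [tr_pred]; exact (σ.ρ_sends l hk t ⟨ht', ht⟩).inv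
  left t k l hk hl ht ht' htl := by
    have h1 := σ.le_succ_of_mem hl ht htl
    have h2 := σ.le_succ_of_mem hk htl ht'
    have hs := σ.ρ_sends k hk t ⟨ht, ht'⟩
    obtain rfl | rfl : l = k ∨ l = k + 1 := by omega
    · rw [tr_self, tr_pred, hs.inv_mul, σ.f_chart _ hl _ ht]
    · rw [tr_self, tr_succ, ← σ.f_chart _ hk _ ht', hs.one_mul]
  right t k l hk hl htk ht ht' := by
    have h1 := σ.le_succ_of_mem hk ht htk
    have h2 := σ.le_succ_of_mem hl htk ht'
    have hs := σ.ρ_sends l hl t ⟨ht, ht'⟩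
    obtain rfl | rfl : k = l ∨ k = l + 1 := by omega
    · rw [tr_self, tr_succ, ← σ.f_chart _ hk _ ht, hs.mul_one]
    · rw [tr_self, tr_pred, hs.mul_inv, σ.f_chart _ hk _ htk]
  loc _ _ _ _ _ _ _ := Filter.Eventually.of_forall fun _ => rfl

theorem IsIso.symm {σ : 𝒳.PathSystem o₁ o₂} {τ : 𝒳.PathSystem p₁ p₂}
    {J : unitInterval → ℕ → ℕ → 𝒳.Arr} (h : σ.IsIso τ J) :
    τ.IsIso σ fun t l k => 𝒳.inv (J t k l) where
  sends t l k hl hk htl htk := (h.sends t k l hk hl htk htl).inv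
  left t l k hl hk htl htl' htk := by
    rw [← h.right t k l hk hl htk htl htl']
    exact (h.sends t k l hk hl.le htk htl).inv_mul_left (τ.ρ_sends l hl t ⟨htl, htl'⟩)
  right t l k hl hk htl htk htk' := by
    rw [← h.left t k l hk hl htk htk' htl]
    exact (σ.ρ_sends k hk t ⟨htk, htk'⟩).mul_inv_right (h.sends t (k + 1) l hk hl htk' htl)
  loc t l k hl hk htl htk := (h.loc t k l hk hl htk htl).mono fun s hs => by rw [hs]

/-- An index of an interval containing `t`. -/
noncomputable def ix (σ : 𝒳.PathSystem o₁ o₂) (t : unitInterval) : ℕ := (σ.cover t).choose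

theorem ix_le (σ : 𝒳.PathSystem o₁ o₂) (t : unitInterval) : σ.ix t ≤ σ.n :=
  (σ.cover t).choose_spec.1

theorem mem_ix (σ : 𝒳.PathSystem o₁ o₂) (t : unitInterval) : t ∈ σ.I (σ.ix t) :=
  (σ.cover t).choose_spec.2

/-- A relation between indices of intervals containing `t` which holds between consecutive ones and
is symmetric holds always. -/
theorem index_induction (σ : 𝒳.PathSystem o₁ o₂) {t : unitInterval} {Y : Type*} (F : ℕ → Y)
    (h : ∀ k < σ.n, t ∈ σ.I k → t ∈ σ.I (k + 1) → F k = F (k + 1)) {k l : ℕ} (hk : k ≤ σ.n)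
    (hl : l ≤ σ.n) (htk : t ∈ σ.I k) (htl : t ∈ σ.I l) : F k = F l := by
  have h1 := σ.le_succ_of_mem hl htk htl
  have h2 := σ.le_succ_of_mem hk htl htk
  obtain rfl | rfl | rfl : l = k ∨ l = k + 1 ∨ k = l + 1 := by omega
  · rfl
  · exact h k hl htk htl
  · exact (h l hk htl htk).symm

/-- Passing from `l` to `l + 1` multiplies the first factor by `τ.ρ l` and removes the same map from
the second, so the composite does not depend on the intermediate chart. -/
theorem IsIso.mul_eq_mul {σ : 𝒳.PathSystem o₁ o₂} {τ : 𝒳.PathSystem p₁ p₂}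
    {κ : 𝒳.PathSystem q₁ q₂} {J J' : unitInterval → ℕ → ℕ → 𝒳.Arr} (h : σ.IsIso τ J)
    (h' : τ.IsIso κ J') {t : unitInterval} {k l l' m : ℕ} (hk : k ≤ σ.n) (hl : l ≤ τ.n)
    (hl' : l' ≤ τ.n) (hm : m ≤ κ.n) (htk : t ∈ σ.I k) (htl : t ∈ τ.I l) (htl' : t ∈ τ.I l')
    (htm : t ∈ κ.I m) :
    𝒳.mul (J' t l m) (J t k l) (σ.f k t) = 𝒳.mul (J' t l' m) (J t k l') (σ.f k t) := by
  refine τ.index_induction (fun l => 𝒳.mul (J' t l m) (J t k l) (σ.f k t)) (fun l hl h1 h2 => ?_)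
    hl hl' htl htl'
  have e1 := h.right t k l hk hl htk h1 h2
  have e2 := h'.left t l m hl hm h1 h2 htm
  rw [← e1, ← e2]
  exact (mul_assoc' (h.sends t k l hk hl.le htk h1) (τ.ρ_sends l hl t ⟨h1, h2⟩)
    (h'.sends t (l + 1) m hl hm h2 htm)).symm

theorem IsIso.trans {σ : 𝒳.PathSystem o₁ o₂} {τ : 𝒳.PathSystem p₁ p₂} {κ : 𝒳.PathSystem q₁ q₂}
    {J J' : unitInterval → ℕ → ℕ → 𝒳.Arr} (h : σ.IsIso τ J) (h' : τ.IsIso κ J') :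
    σ.IsIso κ fun t k m => 𝒳.mul (J' t (τ.ix t) m) (J t k (τ.ix t)) (σ.f k t) where
  sends t k m hk hm htk htm :=
    (h.sends t k _ hk (τ.ix_le t) htk (τ.mem_ix t)).mul
      (h'.sends t _ m (τ.ix_le t) hm (τ.mem_ix t) htm)
  left t k m hk hm htk htk' htm := by
    have hl := τ.ix_le t
    have htl := τ.mem_ix t
    have s1 := σ.ρ_sends k hk t ⟨htk, htk'⟩
    rw [← h.left t k _ hk hl htk htk' htl,
      mul_assoc' s1 (h.sends t (k + 1) _ hk hl htk' htl) (h'.sends t _ m hl hm htl htm)]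
  right t k m hk hm htk htm htm' := by
    have hl := τ.ix_le t
    have htl := τ.mem_ix t
    rw [← h'.right t _ m hl hm htl htm htm',
      mul_assoc' (h.sends t k _ hk hl htk htl) (h'.sends t _ m hl hm.le htl htm)
        (κ.ρ_sends m hm t ⟨htm, htm'⟩)]
  loc t k m hk hm htk htm := by
    have hl := τ.ix_le t
    have htl := τ.mem_ix t
    have hc := ((h.sends t k _ hk hl htk htl).compAt (h'.sends t _ m hl hm htl htm)).eventually
    filter_upwards [h.loc t k _ hk hl htk htl, h'.loc t _ m hl hm htl htm, σ.eventually_mem hk htk,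
      τ.eventually_mem hl htl, κ.eventually_mem hm htm, (σ.continuousAt_f hk htk).eventually hc]
      with s h1 h2 h3 h4 h5 h6
    -- The index `τ.ix s` jumps with `s`; replacing it by the fixed index `τ.ix t` makes local
    -- constancy visible.
    rw [h.mul_eq_mul h' hk (τ.ix_le s) hl hm h3 (τ.mem_ix s) h4 h5, h1, h2, h6.mul_eq]

/-- The intersection of two intervals is connected, so a locally constant family on it is constant.
-/
theorem IsIso.congr {σ : 𝒳.PathSystem o₁ o₂} {τ : 𝒳.PathSystem p₁ p₂}
    {J : unitInterval → ℕ → ℕ → 𝒳.Arr} (h : σ.IsIso τ J) {s t : unitInterval} {k l : ℕ}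
    (hk : k ≤ σ.n) (hl : l ≤ τ.n) (hsk : s ∈ σ.I k) (hsl : s ∈ τ.I l) (htk : t ∈ σ.I k)
    (htl : t ∈ τ.I l) : J s k l = J t k l := by
  have hc : IsPreconnected (σ.I k ∩ τ.I l) :=
    ((σ.ordConnected_I k hk).inter (τ.ordConnected_I l hl)).isPreconnected
  exact hc.eq_of_eventually_eq (f := fun t => J t k l)
    (fun t ht => (h.loc t k l hk hl ht.1 ht.2).filter_mono nhdsWithin_le_nhds) ⟨hsk, hsl⟩ ⟨htk, htl⟩

/-- Isomorphic systems with the same end points, the isomorphism being the identity at these. -/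
def Equiv (σ τ : 𝒳.PathSystem o₁ o₂) : Prop :=
  ∃ J, σ.IsIso τ J ∧ J 0 0 0 = 𝒳.oneArr o₁.idx ∧ J 1 σ.n τ.n = 𝒳.oneArr o₂.idx

theorem Equiv.symm {σ τ : 𝒳.PathSystem o₁ o₂} (h : σ.Equiv τ) : τ.Equiv σ := by
  obtain ⟨J, h, h0, h1⟩ := h
  exact ⟨_, h.symm, by simp only [h0, inv_oneArr], by simp only [h1, inv_oneArr]⟩

theorem Equiv.trans {σ τ κ : 𝒳.PathSystem o₁ o₂} (h : σ.Equiv τ) (h' : τ.Equiv κ) :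
    σ.Equiv κ := by
  obtain ⟨J, h, h0, h1⟩ := h
  obtain ⟨J', h', h0', h1'⟩ := h'
  refine ⟨_, h.trans h', ?_, ?_⟩
  · rw [h.mul_eq_mul h' (Nat.zero_le _) (τ.ix_le 0) (Nat.zero_le _) (Nat.zero_le _) σ.zero_mem
      (τ.mem_ix 0) τ.zero_mem κ.zero_mem, h0, h0', oneArr_mul_oneArr (by rw [σ.f_zero]; rfl)]
  · rw [h.mul_eq_mul h' le_rfl (τ.ix_le 1) le_rfl le_rfl σ.one_mem
      (τ.mem_ix 1) τ.one_mem κ.one_mem, h1, h1', oneArr_mul_oneArr (by rw [σ.f_one]; rfl)]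

theorem Equiv.refl (σ : 𝒳.PathSystem o₁ o₂) : σ.Equiv σ :=
  ⟨_, σ.isIso_refl, by simp only [tr_self, chart_zero], by simp only [tr_self, chart_n]⟩

/-- The isomorphism is the refinement map `j k`, into the chart `θ k`, followed by the transition
map of `σ` from there to the chart `l`. The three cases in the definition of refinement are what
makes it compatible with the transition maps of `κ`. -/
theorem Refines.equiv {κ σ : 𝒳.PathSystem o₁ o₂} (h : κ.Refines σ) : κ.Equiv σ := by
  obtain ⟨θ, j, hI, hθ0, hθn, hj0, hjn, -, hs, hc⟩ := h
  have hr := σ.isIso_refl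
  refine ⟨fun t k l => 𝒳.mul (σ.tr (θ k) l) (j k) (κ.f k t), ⟨?_, ?_, ?_, ?_⟩, ?_, ?_⟩
  · intro t k l hk hl htk htl
    exact (hs k hk t htk).mul (hr.sends t _ l (hI k hk).1 hl ((hI k hk).2 htk) htl)
  · intro t k l hk hl htk htk' htl
    have hs1 := hs k hk.le t htk
    have hs2 := hs (k + 1) hk t htk'
    have hρ := κ.ρ_sends k hk t ⟨htk, htk'⟩
    obtain ⟨b1, m1⟩ := hI k hk.le
    obtain ⟨b2, m2⟩ := hI (k + 1) hk
    have i1 := m1 htk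
    have i2 := m2 htk'
    have c1 := σ.le_succ_of_mem b2 i1 i2
    have c2 := σ.le_succ_of_mem b1 i2 i1
    rw [← mul_assoc' hρ hs2 (hr.sends t _ l b2 hl i2 htl)]
    obtain ⟨h1, h2, h3⟩ := hc k hk t ⟨htk, htk'⟩
    obtain e | e | e : θ (k + 1) = θ k ∨ θ (k + 1) = θ k + 1 ∨ θ k = θ (k + 1) + 1 := by omega
    · rw [(h1 e).mul_eq, e]
    · obtain ⟨c, hc1, hc2⟩ := h2 e
      rw [hc1.mul_eq, ← hc2.mul_eq, e]
      rw [e] at b2 i2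
      rw [mul_assoc' hs1 (σ.ρ_sends _ b2 t ⟨i1, i2⟩) (hr.sends t _ l b2 hl i2 htl),
        hr.left t _ l b2 hl i1 i2 htl]
    · obtain ⟨c, hc1, hc2⟩ := h3 e
      have hcs := hc1.sends hρ hs2
      rw [hc1.mul_eq, ← hc2.mul_eq, e]
      rw [e] at b1 i1
      rw [mul_assoc' hcs (σ.ρ_sends _ b1 t ⟨i2, i1⟩) (hr.sends t _ l b1 hl i1 htl),
        hr.left t _ l b1 hl i2 i1 htl]
  · intro t k l hk hl htk htl htl'
    obtain ⟨b1, m1⟩ := hI k hk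
    have i1 := m1 htk
    rw [mul_assoc' (hs k hk t htk) (hr.sends t _ l b1 hl.le i1 htl) (σ.ρ_sends l hl t ⟨htl, htl'⟩),
      hr.right t _ l b1 hl i1 htl htl']
  · intro t k l hk hl htk htl
    obtain ⟨b1, m1⟩ := hI k hk
    have hc := ((hs k hk t htk).compAt (hr.sends t _ l b1 hl (m1 htk) htl)).eventually
    exact ((κ.continuousAt_f hk htk).eventually hc).mono fun s h => h.mul_eq
  · simp only
    rw [hθ0, hj0, tr_self, chart_zero, oneArr_mul_oneArr (by rw [κ.f_zero]; rfl)]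
  · simp only
    rw [hθn, hjn, tr_self, chart_n, oneArr_mul_oneArr (by rw [κ.f_one]; rfl)]

/-- An isomorphism from a sufficiently fine system is a refinement. -/
theorem Equiv.refines {κ σ : 𝒳.PathSystem o₁ o₂} (h : κ.Equiv σ) (θ : ℕ → ℕ)
    (hI : ∀ k ≤ κ.n, θ k ≤ σ.n ∧ κ.I k ⊆ σ.I (θ k)) (hθ0 : θ 0 = 0) (hθn : θ κ.n = σ.n) :
    κ.Refines σ := by
  obtain ⟨J, h, h0, h1⟩ := h
  -- The isomorphism is constant on `κ.I k`, which lies in `σ.I (θ k)`; its value at any sample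
  -- point `p k` can serve as the transition map of the refinement.
  have hne : ∀ k, ∃ t, k ≤ κ.n → t ∈ κ.I k := fun k => by
    by_cases hk : k ≤ κ.n
    · obtain ⟨t, ht⟩ := κ.I_nonempty hk
      exact ⟨t, fun _ => ht⟩
    · exact ⟨0, fun h => absurd h hk⟩
  choose p hp using hne
  have hj : ∀ k ≤ κ.n, ∀ t ∈ κ.I k, J (p k) k (θ k) = J t k (θ k) := fun k hk t ht =>
    h.congr hk (hI k hk).1 (hp k hk) ((hI k hk).2 (hp k hk)) ht ((hI k hk).2 ht)
  have hs : ∀ k ≤ κ.n, ∀ t ∈ κ.I k, 𝒳.Sends (J (p k) k (θ k)) (κ.f k t) (σ.f (θ k) t) :=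
    fun k hk t ht => by
      rw [hj k hk t ht]
      exact h.sends t k _ hk (hI k hk).1 ht ((hI k hk).2 ht)
  refine ⟨θ, fun k => J (p k) k (θ k), hI, hθ0, hθn, ?_, ?_, fun k hk => ?_, hs,
    fun k hk t ht => ?_⟩
  · simp only
    rw [hj 0 (Nat.zero_le _) 0 κ.zero_mem, hθ0, h0]
  · simp only
    rw [hj _ le_rfl 1 κ.one_mem, hθn, h1]
  · have := hs k hk _ (hp k hk)
    rw [← this.src_eq, ← this.tgt_eq, κ.f_chart k hk _ (hp k hk),
      σ.f_chart _ (hI k hk).1 _ ((hI k hk).2 (hp k hk))]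
    exact ⟨rfl, rfl⟩
  · obtain ⟨ht, ht'⟩ := ht
    obtain ⟨b1, m1⟩ := hI k hk.le
    obtain ⟨b2, m2⟩ := hI (k + 1) hk
    have i1 := m1 ht
    have i2 := m2 ht'
    have hρ := κ.ρ_sends k hk t ⟨ht, ht'⟩
    have hc : ∀ l ≤ σ.n, t ∈ σ.I l → 𝒳.CompAt (J t (k + 1) l) (κ.ρ k) (κ.f k t) (J t k l) :=
      fun l hl hl' => by
        have := hρ.compAt (h.sends t (k + 1) l hk hl ht' hl')
        rwa [h.left t k l hk hl ht ht' hl'] at this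
    have hc' : ∀ l < σ.n, t ∈ σ.I l → t ∈ σ.I (l + 1) →
        𝒳.CompAt (σ.ρ l) (J t k l) (κ.f k t) (J t k (l + 1)) := fun l hl hl1 hl2 => by
      have := (h.sends t k l hk.le hl.le ht hl1).compAt (σ.ρ_sends l hl t ⟨hl1, hl2⟩)
      rwa [h.right t k l hk.le hl ht hl1 hl2] at this
    simp only
    rw [hj k hk.le t ht, hj (k + 1) hk t ht']
    refine ⟨fun e => ?_, fun e => ?_, fun e => ?_⟩
    · rw [e]; exact hc _ b1 i1
    · rw [e] at b2 i2 ⊢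
      exact ⟨_, hc _ b2 i2, hc' _ b2 i1 i2⟩
    · rw [e] at b1 i1 ⊢
      exact ⟨_, hc _ b2 i2, hc' _ b1 i2 i1⟩

/-- The intervals of the equidistant cover. -/
def gridI (n m : ℕ) : Set unitInterval :=
  {t | (m : ℝ) - 1 / 3 < (n + 1) * (t : ℝ) ∧ (n + 1) * (t : ℝ) < m + 4 / 3}

theorem isOpen_gridI (n m : ℕ) : IsOpen (gridI n m) :=
  (isOpen_lt continuous_const (continuous_const.mul continuous_subtype_val)).inter
    (isOpen_lt (continuous_const.mul continuous_subtype_val) continuous_const)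

theorem ordConnected_gridI (n m : ℕ) : (gridI n m).OrdConnected := by
  refine ⟨fun a ha b hb t ht => ?_⟩
  have h1 : (a : ℝ) ≤ t := ht.1
  have h2 : (t : ℝ) ≤ b := ht.2
  have h0 : (0 : ℝ) ≤ n + 1 := by positivity
  exact ⟨ha.1.trans_le (mul_le_mul_of_nonneg_left h1 h0),
    (mul_le_mul_of_nonneg_left h2 h0).trans_lt hb.2⟩

theorem exists_mem_gridI (n : ℕ) (t : unitInterval) : ∃ m ≤ n, t ∈ gridI n m := by
  have h0 : (0 : ℝ) ≤ (n + 1) * (t : ℝ) := mul_nonneg (by positivity) t.2.1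
  have h1 : (n + 1) * (t : ℝ) ≤ n + 1 := mul_le_of_le_one_right (by positivity) t.2.2
  rcases le_or_gt ⌊(n + 1) * (t : ℝ)⌋₊ n with h | h
  · exact ⟨_, h, by have := Nat.floor_le h0; linarith, by
      have := Nat.lt_floor_add_one ((n + 1) * (t : ℝ)); linarith⟩
  · have := Nat.floor_le h0
    have h' : ((n : ℝ) + 1) ≤ ⌊(n + 1) * (t : ℝ)⌋₊ := by exact_mod_cast h
    exact ⟨n, le_rfl, by linarith, by linarith⟩

/-- Each cell is a subinterval of length `1/(n+1)` enlarged on both sides by a third of that length.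
Consecutive cells then overlap, while cells two steps apart stay disjoint because `4/3 < 2 - 1/3`.
-/
theorem disjoint_gridI (n : ℕ) {k l : ℕ} (h : k + 1 < l) : Disjoint (gridI n k) (gridI n l) := by
  rw [Set.disjoint_left]
  rintro t ⟨-, h1⟩ ⟨h2, -⟩
  have : (k : ℝ) + 2 ≤ l := by exact_mod_cast h
  linarith

theorem dist_lt_of_mem_gridI {n m : ℕ} {s t : unitInterval} (hs : s ∈ gridI n m)
    (ht : t ∈ gridI n m) : dist s t < 2 / (n + 1) := by
  have h0 : (0 : ℝ) < n + 1 := by positivity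
  rw [Subtype.dist_eq, Real.dist_eq, lt_div_iff₀ h0]
  rw [show |(s : ℝ) - t| * (n + 1) = |((s : ℝ) - t) * (n + 1)| by
    rw [abs_mul, abs_of_pos h0], abs_lt]
  constructor <;> linarith [hs.1, hs.2, ht.1, ht.2]

/-- Existence of fine refinements, with prescribed local data. -/
theorem exists_refines (σ : 𝒳.PathSystem o₁ o₂) (k : unitInterval → ℕ) (e : unitInterval → 𝒳.Arr)
    (W : unitInterval → Set unitInterval) (hk : ∀ t, k t ≤ σ.n) (hW : ∀ t, W t ∈ 𝓝 t)
    (hWI : ∀ t, W t ⊆ σ.I (k t)) (hWe : ∀ t, ∀ s ∈ W t, σ.f (k t) s ∈ 𝒳.dom (e t))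
    (hk0 : k 0 = 0) (he0 : e 0 = 𝒳.oneArr o₁.idx) (hk1 : k 1 = σ.n)
    (he1 : e 1 = 𝒳.oneArr o₂.idx) :
    ∃ (κ : 𝒳.PathSystem o₁ o₂) (p : ℕ → unitInterval), κ.Refines σ ∧ p 0 = 0 ∧ p κ.n = 1 ∧
      ∀ m ≤ κ.n, κ.I m ⊆ W (p m) ∧ κ.chart m = (e (p m)).tgt := by
  -- Only the neighbourhoods belonging to `0` and `1` may contain these points. This forces the
  -- first and last cells to use the data prescribed at the two ends.
  let W' : unitInterval → Set unitInterval := fun t =>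
    W t ∩ {s | (s = 0 → t = 0) ∧ (s = 1 → t = 1)}
  have hW' : ∀ t ∈ (univ : Set unitInterval), W' t ∈ 𝓝 t := by
    intro t _
    refine Filter.inter_mem (hW t) ?_
    have h0 : ∀ᶠ s in 𝓝 t, (s = 0 → t = 0) := by
      by_cases ht : t = 0
      · simp [ht]
      · filter_upwards [isOpen_ne.mem_nhds ht] with s hs h using absurd h hs
    have h1 : ∀ᶠ s in 𝓝 t, (s = 1 → t = 1) := by
      by_cases ht : t = 1
      · simp [ht]
      · filter_upwards [isOpen_ne.mem_nhds ht] with s hs h using absurd h hs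
    exact h0.and h1
  obtain ⟨δ, hδ, hL⟩ := lebesgue_number_lemma_of_metric (c := fun t => interior (W' t))
    isCompact_univ (fun _ => isOpen_interior)
    (fun t _ => mem_iUnion.2 ⟨t, mem_interior_iff_mem_nhds.2 (hW' t trivial)⟩)
  obtain ⟨n, hn⟩ : ∃ n : ℕ, 1 ≤ n ∧ 2 / ((n : ℝ) + 1) < δ := by
    obtain ⟨n, hn⟩ := exists_nat_gt (2 / δ)
    refine ⟨n + 1, by omega, ?_⟩
    rw [div_lt_iff₀ (by positivity)]
    rw [div_lt_iff₀ hδ] at hn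
    push_cast
    nlinarith
  obtain ⟨hn1, hn⟩ := hn
  have hpos : (0 : ℝ) < n + 1 := by positivity
  have hp : ∀ m, ∃ p, m ≤ n → gridI n m ⊆ W' p := by
    intro m
    by_cases hm : ∃ s, s ∈ gridI n m
    · obtain ⟨s, hs⟩ := hm
      obtain ⟨p, hp⟩ := hL s trivial
      exact ⟨p, fun _ t ht => interior_subset (hp ((dist_lt_of_mem_gridI ht hs).trans hn))⟩
    · exact ⟨0, fun _ t ht => absurd ⟨t, ht⟩ hm⟩
  choose p hp using hp
  have m0 : (0 : unitInterval) ∈ gridI n 0 := by constructor <;> norm_num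
  have m1 : (1 : unitInterval) ∈ gridI n n := by constructor <;> norm_num; linarith
  have hp0 : p 0 = 0 := (hp 0 (Nat.zero_le _) m0).2.1 rfl
  have hpn : p n = 1 := (hp n le_rfl m1).2.2 rfl
  have hmid : ∀ m, ∃ t, m < n → t ∈ gridI n m ∧ t ∈ gridI n (m + 1) := by
    intro m
    by_cases hm : m < n
    · have hm' : ((m : ℝ) + 1) ≤ n := by exact_mod_cast hm
      have e1 : ((n : ℝ) + 1) * ((m + 1) / (n + 1)) = m + 1 := by field_simp
      refine ⟨⟨(m + 1) / (n + 1), by positivity, by rw [div_le_one hpos]; linarith⟩, fun _ =>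
        ⟨⟨?_, ?_⟩, ⟨?_, ?_⟩⟩⟩ <;> simp only [e1] <;> push_cast <;> linarith
    · exact ⟨0, fun h => absurd h hm⟩
  choose q hq using hmid
  have hI : ∀ m ≤ n, gridI n m ⊆ σ.I (k (p m)) := fun m hm t ht => hWI _ (hp m hm ht).1
  have hse : ∀ m ≤ n, ∀ t ∈ gridI n m, 𝒳.Sends (e (p m)) (σ.f (k (p m)) t)
      (𝒳.app (e (p m)) (σ.f (k (p m)) t)) := fun m hm t ht =>
    sends_app (hWe _ t (hp m hm ht).1)
  set g : ℕ → unitInterval → 𝒳.Pt := fun m t => 𝒳.app (e (p m)) (σ.f (k (p m)) t) with hg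
  have hr := σ.isIso_refl
  -- Undo the change of chart on cell `m`, then follow `σ` to the chart used on cell `m + 1`; the
  -- transition map of the refined system is this followed by the next change of chart.
  set c : ℕ → unitInterval → 𝒳.Arr := fun m t =>
    𝒳.mul (σ.tr (k (p m)) (k (p (m + 1)))) (𝒳.inv (e (p m))) (g m t) with hc
  have hcs : ∀ m < n, ∀ t ∈ gridI n m ∩ gridI n (m + 1),
      𝒳.Sends (c m t) (g m t) (σ.f (k (p (m + 1))) t) := fun m hm t ht =>
    (hse m hm.le t ht.1).inv.mul (hr.sends t _ _ (hk _) (hk _) (hI m hm.le ht.1)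
      (hI (m + 1) hm ht.2))
  set r : ℕ → unitInterval → 𝒳.Arr := fun m t => 𝒳.mul (e (p (m + 1))) (c m t) (g m t) with hr'
  have hrs : ∀ m < n, ∀ t ∈ gridI n m ∩ gridI n (m + 1), 𝒳.Sends (r m t) (g m t) (g (m + 1) t) :=
    fun m hm t ht => (hcs m hm t ht).mul (hse (m + 1) hm t ht.2)
  have hgc : ∀ m ≤ n, ∀ t ∈ gridI n m, ContinuousAt (g m) t := fun m hm t ht =>
    ContinuousAt.comp (continuousAt_app (hse m hm t ht).mem_dom)
      (σ.continuousAt_f (hk _) (hI m hm ht))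
  -- The composite is formed separately at each point; being locally constant on a connected overlap
  -- it is one transition map, its value at a sample point.
  have hrc : ∀ m < n, ∀ t ∈ gridI n m ∩ gridI n (m + 1), r m (q m) = r m t := by
    intro m hm t ht
    have hpc : IsPreconnected (gridI n m ∩ gridI n (m + 1)) :=
      ((ordConnected_gridI n m).inter (ordConnected_gridI n (m + 1))).isPreconnected
    refine hpc.eq_of_eventually_eq (fun t ht => nhdsWithin_le_nhds ?_) (hq m hm) ht
    have h1 := ((hse m hm.le t ht.1).inv.compAt (hr.sends t _ _ (hk _) (hk _) (hI m hm.le ht.1)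
      (hI (m + 1) hm ht.2))).eventually
    have h2 := ((hcs m hm t ht).compAt (hse (m + 1) hm t ht.2)).eventually
    filter_upwards [(hgc m hm.le t ht.1).eventually h1, (hgc m hm.le t ht.1).eventually h2]
      with s h1 h2
    simp only [hr', hc]
    rw [h1.mul_eq, h2.mul_eq]
  let κ : 𝒳.PathSystem o₁ o₂ :=
    { n := n
      one_le_n := hn1
      I := gridI n
      isOpen_I := fun m _ => isOpen_gridI n m
      ordConnected_I := fun m _ => ordConnected_gridI n m
      cover := exists_mem_gridI n
      disjoint := fun _ _ h _ => disjoint_gridI n h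
      zero_mem := m0
      one_mem := m1
      chart := fun m => (e (p m)).tgt
      f := g
      f_chart := fun m hm t ht => (hse m hm t ht).tgt_eq
      continuousOn_f := fun m hm t ht => (hgc m hm t ht).continuousWithinAt
      ρ := fun m => r m (q m)
      ρ_src := fun m hm => by
        rw [← (hrs m hm _ (hq m hm)).src_eq]
        exact (hse m hm.le _ (hq m hm).1).tgt_eq
      ρ_tgt := fun m hm => by
        rw [← (hrs m hm _ (hq m hm)).tgt_eq]
        exact (hse (m + 1) hm _ (hq m hm).2).tgt_eq
      ρ_sends := fun m hm t ht => by
        rw [hrc m hm t ht]; exact hrs m hm t ht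
      f_zero := by
        simp only [hg]
        rw [hp0, hk0, he0, σ.f_zero]
        exact (sends_oneArr (x := o₁.point) rfl).app_eq
      f_one := by
        simp only [hg]
        rw [hpn, hk1, he1, σ.f_one]
        exact (sends_oneArr (x := o₂.point) rfl).app_eq }
  refine ⟨κ, p, ⟨fun m => k (p m), fun m => 𝒳.inv (e (p m)), fun m hm => ⟨hk _, hI m hm⟩, ?_, ?_,
    ?_, ?_, fun m hm => ?_, fun m hm t ht => (hse m hm t ht).inv, fun m hm t ht => ?_⟩, hp0, hpn,
    fun m hm => ⟨fun t ht => (hp m hm ht).1, rfl⟩⟩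
  · simp only [hp0, hk0]
  · change k (p n) = σ.n
    rw [hpn, hk1]
  · simp only [hp0, he0, inv_oneArr]
  · change 𝒳.inv (e (p n)) = _
    rw [hpn, he1, inv_oneArr]
  · obtain ⟨t, ht⟩ := κ.I_nonempty hm
    have := (hse m hm t ht).inv
    rw [← this.src_eq, ← this.tgt_eq, σ.f_chart _ (hk _) _ (hI m hm ht)]
    exact ⟨(hse m hm t ht).tgt_eq, rfl⟩
  · have hs1 := (hse m hm.le t ht.1).inv
    have hs2 := hse (m + 1) hm t ht.2
    have hcc : 𝒳.CompAt (𝒳.inv (e (p (m + 1)))) (κ.ρ m) (κ.f m t) (c m t) := by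
      have := (hrs m hm t ht).compAt hs2.inv
      have e1 : 𝒳.mul (𝒳.inv (e (p (m + 1)))) (r m t) (g m t) = c m t :=
        (hcs m hm t ht).inv_mul_cancel hs2
      rw [e1] at this
      change 𝒳.CompAt _ (r m (q m)) _ _
      rwa [hrc m hm t ht]
    have i1 := hI m hm.le ht.1
    have i2 := hI (m + 1) hm ht.2
    have b1 := hk (p m)
    have b2 := hk (p (m + 1))
    refine ⟨fun (e' : k (p (m + 1)) = k (p m)) => ?_,
      fun (e' : k (p (m + 1)) = k (p m) + 1) => ⟨c m t, hcc, ?_⟩,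
      fun (e' : k (p m) = k (p (m + 1)) + 1) => ⟨c m t, hcc, ?_⟩⟩
    · have : c m t = 𝒳.inv (e (p m)) := by
        simp only [hc]
        rw [e', tr_self, ← σ.f_chart _ b1 _ i1]
        exact hs1.one_mul
      rwa [this] at hcc
    · rw [e'] at b2 i2
      have := hs1.compAt (σ.ρ_sends _ b2 t ⟨i1, i2⟩)
      have h2 : c m t = 𝒳.mul (σ.ρ (k (p m))) (𝒳.inv (e (p m))) (g m t) := by
        simp only [hc]
        rw [e', tr_succ]
      rwa [h2]
    · rw [e'] at b1 i1
      have hρ := σ.ρ_sends _ b1 t ⟨i2, i1⟩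
      have := (hcs m hm t ht).compAt hρ
      have h2 : c m t = 𝒳.mul (𝒳.inv (σ.ρ (k (p (m + 1))))) (𝒳.inv (e (p m))) (g m t) := by
        simp only [hc]
        rw [e', tr_pred]
      have hs1' : 𝒳.Sends (𝒳.inv (e (p m))) (g m t) (σ.f (k (p (m + 1)) + 1) t) := by
        rw [← e']; exact hs1
      have h3 : 𝒳.mul (σ.ρ (k (p (m + 1)))) (c m t) (g m t) = 𝒳.inv (e (p m)) := by
        rw [h2]
        exact hs1'.mul_inv_cancel hρ
      rwa [h3] at this

theorem cls_eq_of_refines {κ σ : 𝒳.PathSystem o₁ o₂} (h : κ.Refines σ) : κ.cls = σ.cls :=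
  Quot.sound h

/-- Refine `σ`, without changing charts, so finely that each interval lies in an interval of `σ` and
in an interval of `τ`. The refinement is still isomorphic to `τ`, and by `Equiv.refines` an
isomorphism from such a fine system is a refinement. -/
theorem Equiv.exists_common_refinement {σ τ : 𝒳.PathSystem o₁ o₂} (h : σ.Equiv τ) :
    ∃ κ : 𝒳.PathSystem o₁ o₂, κ.Refines σ ∧ κ.Refines τ ∧
      ∀ m ≤ κ.n, ∃ k ≤ σ.n, κ.chart m = σ.chart k := by
  have hx : ∀ t : unitInterval, ∃ k l : ℕ, k ≤ σ.n ∧ l ≤ τ.n ∧ t ∈ σ.I k ∧ t ∈ τ.I l ∧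
      (t = 0 → k = 0 ∧ l = 0) ∧ (t = 1 → k = σ.n ∧ l = τ.n) := by
    intro t
    by_cases h0 : t = 0
    · subst h0
      exact ⟨0, 0, Nat.zero_le _, Nat.zero_le _, σ.zero_mem, τ.zero_mem, by simp, by simp⟩
    by_cases h1 : t = 1
    · subst h1
      exact ⟨_, _, le_rfl, le_rfl, σ.one_mem, τ.one_mem, by simp, by simp⟩
    obtain ⟨k, hk, hk'⟩ := σ.cover t
    obtain ⟨l, hl, hl'⟩ := τ.cover t
    exact ⟨k, l, hk, hl, hk', hl', by simp [h0], by simp [h1]⟩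
  choose k l hk hl hkt hlt hx0 hx1 using hx
  have hk0 := (hx0 0 rfl).1
  have hk1 := (hx1 1 rfl).1
  obtain ⟨κ, p, hκ, hp0, hp1, hp⟩ := σ.exists_refines k (fun t => 𝒳.oneArr (σ.chart (k t)))
    (fun t => σ.I (k t) ∩ τ.I (l t)) hk
    (fun t => Filter.inter_mem (σ.eventually_mem (hk t) (hkt t)) (τ.eventually_mem (hl t) (hlt t)))
    (fun t => inter_subset_left)
    (fun t s hs => (sends_oneArr (σ.f_chart _ (hk t) _ hs.1)).mem_dom) hk0
    (by simp only [hk0, chart_zero]) hk1 (by simp only [hk1, chart_n])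
  have h2 : κ.Refines τ := (hκ.equiv.trans h).refines (fun m => l (p m))
    (fun m hm => ⟨hl _, fun t ht => ((hp m hm).1 ht).2⟩) (by simp only [hp0]; exact (hx0 0 rfl).2)
    (by simp only [hp1]; exact (hx1 1 rfl).2)
  exact ⟨κ, hκ, h2, fun m hm => ⟨_, hk (p m), (hp m hm).2⟩⟩

theorem Equiv.cls_eq {σ τ : 𝒳.PathSystem o₁ o₂} (h : σ.Equiv τ) : σ.cls = τ.cls := by
  obtain ⟨κ, h1, h2, -⟩ := h.exists_common_refinement
  rw [← cls_eq_of_refines h1, cls_eq_of_refines h2]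

/-- A chain of refinements in alternating directions collapses to a single isomorphism, since
isomorphisms compose and invert. Equality of based paths thereby becomes something that can be
computed with. -/
theorem cls_eq_iff {σ τ : 𝒳.PathSystem o₁ o₂} : σ.cls = τ.cls ↔ σ.Equiv τ := by
  refine ⟨fun h => ?_, Equiv.cls_eq⟩
  have h' : Relation.EqvGen PathSystem.Refines σ τ := Quot.eqvGen_exact h
  clear h
  induction h' with
  | rel _ _ h => exact h.equiv
  | refl σ => exact Equiv.refl σ
  | symm _ _ _ ih => exact ih.symm
  | trans _ _ _ _ _ ih1 ih2 => exact ih1.trans ih2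

end PathSystem

end Iso

end Orbispace

/-! ### Gauge transformations of systems, normalisation of transition maps, shrinking of intervals.
-/

namespace Orbispace

section Normal

variable {X : Type u} [TopologicalSpace X] {𝒳 : Orbispace X}

theorem inv_inv (a : 𝒳.Arr) : 𝒳.inv (𝒳.inv a) = a := by
  obtain ⟨x, y, h⟩ := isConnected_dom_image a
  rw [← h.inv.inv.mul_one, ← h.inv_mul, mul_assoc' h h.inv h.inv.inv, h.inv.inv_mul, h.one_mul]

/-- The point of the disjoint union of the spaces `Û` as a base-point structure. -/
def ptBase (x : 𝒳.Pt) : 𝒳.BasePoint := ⟨𝒳.base x, x.1, x.2, rfl⟩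

@[simp] theorem ptBase_point (x : 𝒳.Pt) : (ptBase x).point = x := rfl

/-- This is the tube lemma for the compact set `{1} × C` and the continuous action. -/
theorem exists_gact_subset {C V : Set 𝒳.Pt} (hC : IsCompact C) (hV : IsOpen V) (hCV : C ⊆ V) :
    ∃ M ∈ 𝓝 (1 : 𝒳.Gau), ∃ V', IsOpen V' ∧ C ⊆ V' ∧ ∀ g ∈ M, ∀ x ∈ V', gact g x ∈ V := by
  obtain ⟨M, V', hM, hV', hM1, hCV', h⟩ := generalized_tube_lemma (isCompact_singleton (x := (1 : 𝒳.Gau)))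
    hC (hV.preimage continuous_gact) (by
      rintro ⟨g, x⟩ ⟨hg, hx⟩
      obtain rfl : g = 1 := hg
      simpa using hCV hx)
  exact ⟨M, hM.mem_nhds (hM1 rfl), V', hV', hCV', fun g hg x hx => by
    have := h (show (g, x) ∈ M ×ˢ V' from ⟨hg, hx⟩)
    exact this⟩

namespace PathSystem

variable {o₁ o₂ p₁ p₂ q₁ q₂ : 𝒳.BasePoint}

/-- The system obtained by applying group elements to the maps `f_k`. -/
def gauge (τ : 𝒳.PathSystem o₁ o₂) (g : ℕ → 𝒳.Gau) (h₁ : p₁.point = gact (g 0) o₁.point)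
    (h₂ : p₂.point = gact (g τ.n) o₂.point) : 𝒳.PathSystem p₁ p₂ where
  n := τ.n
  one_le_n := τ.one_le_n
  I := τ.I
  isOpen_I := τ.isOpen_I
  ordConnected_I := τ.ordConnected_I
  cover := τ.cover
  disjoint := τ.disjoint
  zero_mem := τ.zero_mem
  one_mem := τ.one_mem
  chart := τ.chart
  f k t := gact (g k) (τ.f k t)
  f_chart := τ.f_chart
  continuousOn_f k hk := (continuous_gact_left (g k)).comp_continuousOn (τ.continuousOn_f k hk)
  ρ k := lact (g (k + 1)) (τ.ρ k) (g k)⁻¹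
  ρ_src := τ.ρ_src
  ρ_tgt := τ.ρ_tgt
  ρ_sends k hk t ht := Sends.lact (by rw [gact_inv_gact]; exact τ.ρ_sends k hk t ht)
  f_zero := by rw [τ.f_zero, h₁]
  f_one := by rw [τ.f_one, h₂]

/-- The isomorphism follows `τ` from one chart to the other and then applies the group element of
the second; the factor `(g l)⁻¹` in the new transition map cancels the one applied before it. -/
theorem isIso_gauge (τ : 𝒳.PathSystem o₁ o₂) (g : ℕ → 𝒳.Gau)
    (h₁ : p₁.point = gact (g 0) o₁.point) (h₂ : p₂.point = gact (g τ.n) o₂.point) :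
    τ.IsIso (τ.gauge g h₁ h₂) fun _ k l => lact (g l) (τ.tr k l) 1 where
  sends t k l hk hl htk htl := (τ.isIso_refl.sends t k l hk hl htk htl).lact_left
  left t k l hk hl htk htk' htl := by
    rw [(τ.ρ_sends k hk t ⟨htk, htk'⟩).lact_mul (τ.isIso_refl.sends t _ l hk hl htk' htl),
      τ.isIso_refl.left t k l hk hl htk htk' htl]
  right t k l hk hl htk htl htl' := by
    have h1 := τ.isIso_refl.sends t k l hk hl.le htk htl
    have h2 : 𝒳.Sends (τ.ρ l) (gact (g l)⁻¹ (gact (g l) (τ.f l t))) (τ.f (l + 1) t) := by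
      rw [gact_inv_gact]; exact τ.ρ_sends l hl t ⟨htl, htl'⟩
    have e : lact (g (l + 1)) (τ.ρ l) (g l)⁻¹ = lact (g (l + 1)) (lact 1 (τ.ρ l) (g l)⁻¹) 1 := by
      rw [lact_lact]; simp
    change 𝒳.mul (lact (g (l + 1)) (τ.ρ l) (g l)⁻¹) _ _ = _
    have h3 : 𝒳.Sends (lact 1 (τ.ρ l) (g l)⁻¹) (gact (g l) (τ.f l t)) (gact 1 (τ.f (l + 1) t)) :=
      Sends.lact h2
    rw [e, h1.lact_left.lact_mul h3, h1.lact_left.lact_mul_middle h2, lact_lact]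
    simp only [inv_mul_cancel, _root_.mul_one, lact_one_one]
    rw [τ.isIso_refl.right t k l hk hl htk htl htl']
  loc t k l _ _ _ _ := Filter.Eventually.of_forall fun _ => rfl

theorem IsIso.trans_zero {σ : 𝒳.PathSystem o₁ o₂} {τ : 𝒳.PathSystem p₁ p₂}
    {κ : 𝒳.PathSystem q₁ q₂} {J J' : unitInterval → ℕ → ℕ → 𝒳.Arr} (h : σ.IsIso τ J)
    (h' : τ.IsIso κ J') : 𝒳.mul (J' 0 (τ.ix 0) 0) (J 0 0 (τ.ix 0)) (σ.f 0 0) =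
      𝒳.mul (J' 0 0 0) (J 0 0 0) o₁.point := by
  rw [h.mul_eq_mul h' (Nat.zero_le _) (τ.ix_le 0) (Nat.zero_le _) (Nat.zero_le _) σ.zero_mem
      (τ.mem_ix 0) τ.zero_mem κ.zero_mem, σ.f_zero]

theorem IsIso.trans_one {σ : 𝒳.PathSystem o₁ o₂} {τ : 𝒳.PathSystem p₁ p₂}
    {κ : 𝒳.PathSystem q₁ q₂} {J J' : unitInterval → ℕ → ℕ → 𝒳.Arr} (h : σ.IsIso τ J)
    (h' : τ.IsIso κ J') : 𝒳.mul (J' 1 (τ.ix 1) κ.n) (J 1 σ.n (τ.ix 1)) (σ.f σ.n 1) =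
      𝒳.mul (J' 1 τ.n κ.n) (J 1 σ.n τ.n) o₂.point := by
  rw [h.mul_eq_mul h' le_rfl (τ.ix_le 1) le_rfl le_rfl σ.one_mem
      (τ.mem_ix 1) τ.one_mem κ.one_mem, σ.f_one]

/-- Gauge transformations over systems with nearly the same transition maps. -/
theorem exists_normalization (ρ : ℕ → 𝒳.Arr) (n : ℕ) {M : Set 𝒳.Gau} (hM : M ∈ 𝓝 1) :
    ∃ N ∈ 𝓝 (1 : 𝒳.Gau), ∀ h : ℕ → 𝒳.Gau, (∀ k < n, h k ∈ N) → ∃ δ : ℕ → 𝒳.Gau, δ 0 = 1 ∧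
      (∀ k ≤ n, δ k ∈ M) ∧
      ∀ k < n, lact (δ (k + 1)) (lact (h k) (ρ k) 1) (δ k)⁻¹ = ρ k := by
  induction n generalizing M with
  | zero => exact ⟨univ, Filter.univ_mem, fun h _ => ⟨1, rfl, fun k hk => mem_of_mem_nhds hM,
      fun k hk => absurd hk (by omega)⟩⟩
  | succ m ih =>
    have hc : ContinuousAt (fun p : 𝒳.Gau × 𝒳.Gau => lamHat (ρ m) p.1 * p.2⁻¹) (1, 1) := by
      have h1 : ContinuousAt (fun p : 𝒳.Gau × 𝒳.Gau => lamHat (ρ m) p.1) (1, 1) :=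
        ContinuousAt.comp (g := lamHat (ρ m)) (continuousAt_lamHat (ρ m)) continuousAt_fst
      exact h1.mul continuousAt_snd.inv
    have h2 : (fun p : 𝒳.Gau × 𝒳.Gau => lamHat (ρ m) p.1 * p.2⁻¹) ⁻¹' M ∈
        𝓝 ((1, 1) : 𝒳.Gau × 𝒳.Gau) := by
      refine hc ?_
      simp only [lamHat_one, inv_one, _root_.mul_one]
      exact hM
    rw [nhds_prod_eq, Filter.mem_prod_iff] at h2
    obtain ⟨M2, hM2, N2, hN2, h2⟩ := h2
    -- The earlier elements are asked to be even smaller: `δ m` must be transportable through `ρ m`,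
    -- and the element computed from it must still lie in `M`.
    obtain ⟨N, hN, H⟩ := ih (Filter.inter_mem (Filter.inter_mem hM hM2) (lact_lamHat (ρ m)))
    refine ⟨N ∩ N2, Filter.inter_mem hN hN2, fun h hh => ?_⟩
    obtain ⟨δ, h0, hδ, hl⟩ := H h fun k hk => (hh k (by omega)).1
    -- This solves the required equation for `δ (m + 1)`: the factor `(h m)⁻¹` removes the
    -- perturbation, and what remains is the relation `lact_lamHat`.
    refine ⟨Function.update δ (m + 1) (lamHat (ρ m) (δ m) * (h m)⁻¹), ?_, fun k hk => ?_,
      fun k hk => ?_⟩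
    · rw [Function.update_of_ne (by omega), h0]
    · rcases hk.lt_or_eq with hk | rfl
      · rw [Function.update_of_ne (by omega)]
        exact (hδ k (by omega)).1.1
      · rw [Function.update_self]
        exact h2 (show (δ m, h m) ∈ M2 ×ˢ N2 from ⟨(hδ m le_rfl).1.2, (hh m (by omega)).2⟩)
    · rw [Function.update_of_ne (show k ≠ m + 1 by omega)]
      rcases (show k ≤ m by omega).lt_or_eq with hk | rfl
      · rw [Function.update_of_ne (by omega)]
        exact hl k hk
      · rw [Function.update_self, lact_lact]
        simpa using (hδ k le_rfl).2

/-- The system with smaller intervals. -/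
def shrink (σ : 𝒳.PathSystem o₁ o₂) (I' : ℕ → Set unitInterval)
    (ho : ∀ k ≤ σ.n, IsOpen (I' k)) (hc : ∀ k ≤ σ.n, (I' k).OrdConnected)
    (hI : ∀ k ≤ σ.n, I' k ⊆ σ.I k) (hcov : ∀ t, ∃ k ≤ σ.n, t ∈ I' k) (h0 : 0 ∈ I' 0)
    (h1 : 1 ∈ I' σ.n) : 𝒳.PathSystem o₁ o₂ where
  n := σ.n
  one_le_n := σ.one_le_n
  I := I'
  isOpen_I := ho
  ordConnected_I := hc
  cover := hcov
  disjoint k l hkl hl := (σ.disjoint k l hkl hl).mono (hI k (by omega)) (hI l hl)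
  zero_mem := h0
  one_mem := h1
  chart := σ.chart
  f := σ.f
  f_chart k hk t ht := σ.f_chart k hk t (hI k hk ht)
  continuousOn_f k hk := (σ.continuousOn_f k hk).mono (hI k hk)
  ρ := σ.ρ
  ρ_src := σ.ρ_src
  ρ_tgt := σ.ρ_tgt
  ρ_sends k hk t ht := σ.ρ_sends k hk t ⟨hI k hk.le ht.1, hI (k + 1) hk ht.2⟩
  f_zero := σ.f_zero
  f_one := σ.f_one

/-- Systems with the same charts, transition maps and maps, but smaller intervals, are
refinements. -/
theorem refines_of_subset {κ σ : 𝒳.PathSystem o₁ o₂} (hn : κ.n = σ.n)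
    (hI : ∀ k ≤ σ.n, κ.I k ⊆ σ.I k) (hc : ∀ k ≤ σ.n, κ.chart k = σ.chart k)
    (hf : ∀ k ≤ σ.n, ∀ t ∈ κ.I k, κ.f k t = σ.f k t) (hρ : ∀ k < σ.n, κ.ρ k = σ.ρ k) :
    κ.Refines σ := by
  refine ⟨id, fun k => 𝒳.oneArr (σ.chart k), fun k hk => ⟨hn ▸ hk, hI k (hn ▸ hk)⟩, rfl, hn, ?_, ?_,
    fun k hk => ⟨(hc k (hn ▸ hk)).symm, rfl⟩, fun k hk t ht => ?_, fun k hk t ht =>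
      ⟨fun h => absurd h (Nat.succ_ne_self k), fun _ => ⟨κ.ρ k, ?_, ?_⟩, fun h => by
        simp only [id] at h; omega⟩⟩
  · simp only [chart_zero]
  · simp only [hn, chart_n]
  · rw [hf k (hn ▸ hk) t ht]
    exact sends_oneArr (σ.f_chart k (hn ▸ hk) t (hI k (hn ▸ hk) ht))
  · have := (κ.ρ_sends k hk t ht).compAt_one_left
    rwa [κ.ρ_tgt k hk, hc (k + 1) (by omega)] at this
  · have := (κ.ρ_sends k hk t ht).compAt_one_right
    have e := hρ k (by omega)
    rw [κ.ρ_src k hk, hc k (by omega)] at this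
    change 𝒳.CompAt (σ.ρ k) (𝒳.oneArr (σ.chart k)) _ _
    rw [← e]
    exact this

/-- Compact intervals inside the intervals of a system whose interiors still cover. -/
theorem exists_shrinking (σ : 𝒳.PathSystem o₁ o₂) (K : ℕ → Set unitInterval)
    (hK : ∀ k ≤ σ.n, IsCompact (K k) ∧ K k ⊆ σ.I k) :
    ∃ I' L : ℕ → Set unitInterval, (∀ k ≤ σ.n, IsOpen (I' k) ∧ (I' k).OrdConnected ∧ K k ⊆ I' k ∧
      I' k ⊆ L k ∧ IsCompact (L k) ∧ L k ⊆ σ.I k) ∧ (∀ t, ∃ k ≤ σ.n, t ∈ I' k) ∧ 0 ∈ I' 0 ∧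
      1 ∈ I' σ.n := by
  classical
  -- The distance to the complement is taken with extended values, so that an interval equal to all
  -- of `[0,1]` needs no separate treatment. The sets wanted are `{δ < E k}` and `{δ ≤ E k}` for a
  -- small `δ`.
  let E : ℕ → unitInterval → ENNReal := fun k t => Metric.infEDist t (σ.I k)ᶜ
  have hE : ∀ k, Continuous (E k) := fun k => Metric.continuous_infEDist
  have hpos : ∀ k ≤ σ.n, ∀ t ∈ σ.I k, 0 < E k t := fun k hk t ht => by
    rw [pos_iff_ne_zero, Ne, ← Metric.mem_closure_iff_infEDist_zero,
      (σ.isOpen_I k hk).isClosed_compl.closure_eq]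
    exact fun h => h ht
  -- a lower bound on the compact sets
  have hKδ : ∀ k ≤ σ.n, ∀ C : Set unitInterval, IsCompact C → C ⊆ σ.I k →
      ∃ δ > 0, ∀ t ∈ C, δ < E k t := by
    intro k hk C hC hCI
    rcases C.eq_empty_or_nonempty with rfl | hne
    · exact ⟨1, one_pos, by simp⟩
    · obtain ⟨t, ht, h⟩ := hC.exists_isMinOn hne (hE k).continuousOn
      obtain ⟨δ, hδ, h'⟩ := exists_between (hpos k hk t (hCI ht))
      exact ⟨δ, hδ, fun s hs => h'.trans_le (h hs)⟩
  have hc : ∃ δ > 0, ∀ t, ∃ k ≤ σ.n, δ < E k t := by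
    obtain ⟨δ, hδ, h⟩ := lebesgue_number_lemma_of_metric (c := fun k : Fin (σ.n + 1) => σ.I k)
      isCompact_univ (fun k => σ.isOpen_I k (Nat.lt_succ_iff.1 k.2)) (fun t _ => by
        obtain ⟨k, hk, ht⟩ := σ.cover t
        exact mem_iUnion.2 ⟨⟨k, Nat.lt_succ_iff.2 hk⟩, ht⟩)
    have hd : (0 : ENNReal) < ENNReal.ofReal δ := ENNReal.ofReal_pos.2 hδ
    obtain ⟨δ', hδ', hlt⟩ := exists_between hd
    refine ⟨δ', hδ', fun t => ?_⟩
    obtain ⟨k, hk⟩ := h t trivial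
    refine ⟨k, Nat.lt_succ_iff.1 k.2, hlt.trans_le ?_⟩
    refine Metric.le_infEDist.2 fun y hy => ?_
    by_contra hlt'
    refine hy (hk ?_)
    rw [not_le, edist_dist, ENNReal.ofReal_lt_ofReal_iff hδ] at hlt'
    rwa [Metric.mem_ball, dist_comm]
  obtain ⟨δc, hδc, hc⟩ := hc
  have hall : ∃ δ > 0, (∀ k ≤ σ.n, ∀ t ∈ K k, δ < E k t) := by
    have : ∀ k, ∃ δ > 0, k ≤ σ.n → ∀ t ∈ K k, δ < E k t := fun k => by
      by_cases hk : k ≤ σ.n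
      · obtain ⟨δ, hδ, h⟩ := hKδ k hk _ (hK k hk).1 (hK k hk).2
        exact ⟨δ, hδ, fun _ => h⟩
      · exact ⟨1, one_pos, fun h => absurd h hk⟩
    choose δ hδ h using this
    refine ⟨(Finset.range (σ.n + 1)).inf' ⟨0, by simp⟩ δ, ?_, fun k hk t ht => ?_⟩
    · exact (Finset.lt_inf'_iff _).2 fun k _ => hδ k
    · exact (Finset.inf'_le _ (by simp; omega)).trans_lt (h k hk t ht)
  obtain ⟨δK, hδK, hKE⟩ := hall
  obtain ⟨δ0, hδ0, h0⟩ := hKδ 0 (Nat.zero_le _) {0} isCompact_singleton (by simpa using σ.zero_mem)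
  obtain ⟨δ1, hδ1, h1⟩ := hKδ σ.n le_rfl {1} isCompact_singleton (by simpa using σ.one_mem)
  -- The four bounds ensure, in this order, that the smaller intervals still cover, that they
  -- contain the sets `K k`, and that the first and the last contain `0` and `1`.
  set δ := min (min δc δK) (min δ0 δ1) with hδdef
  have hδ : 0 < δ := lt_min (lt_min hδc hδK) (lt_min hδ0 hδ1)
  have l1 : δ ≤ δc := (min_le_left _ _).trans (min_le_left _ _)
  have l2 : δ ≤ δK := (min_le_left _ _).trans (min_le_right _ _)
  have l3 : δ ≤ δ0 := (min_le_right _ _).trans (min_le_left _ _)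
  have l4 : δ ≤ δ1 := (min_le_right _ _).trans (min_le_right _ _)
  have hmem : ∀ k, ∀ t, δ ≤ E k t → t ∈ σ.I k := fun k t ht => by
    by_contra h
    have := Metric.infEDist_zero_of_mem (s := (σ.I k)ᶜ) h
    exact absurd (ht.trans this.le) (not_le.2 hδ)
  refine ⟨fun k => {t | δ < E k t}, fun k => {t | δ ≤ E k t}, fun k hk => ⟨?_, ?_, fun t ht => ?_,
    fun t (ht : δ < E k t) => ht.le, ?_, fun t ht => hmem k t ht⟩, fun t => ?_, ?_, ?_⟩
  · exact isOpen_lt continuous_const (hE k)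
  · refine ⟨fun a ha b hb t ht => ?_⟩
    have hab : ∀ s ∈ Icc a b, s ∈ σ.I k := fun s hs =>
      (σ.ordConnected_I k hk).out (hmem k a (le_of_lt ha)) (hmem k b (le_of_lt hb)) hs
    -- A point outside the interval lies to the left of `a` or to the right of `b`, hence is at
    -- least as far from `t` as from that end; this is why the superlevel sets are intervals.
    have h1 : min (E k a) (E k b) ≤ E k t := by
      refine Metric.le_infEDist.2 fun y hy => ?_
      have hat : (a : ℝ) ≤ t := ht.1
      have htb : (t : ℝ) ≤ b := ht.2
      rcases lt_or_ge y a with h | h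
      · refine (min_le_left _ _).trans ((Metric.infEDist_le_edist_of_mem hy).trans ?_)
        have h' : (y : ℝ) < a := h
        rw [edist_dist, edist_dist]
        refine ENNReal.ofReal_le_ofReal ?_
        rw [Subtype.dist_eq, Subtype.dist_eq, Real.dist_eq, Real.dist_eq, abs_of_pos (by linarith),
          abs_of_pos (by linarith)]
        linarith
      · have h2 : b < y := by
          by_contra h3
          exact hy (hab y ⟨h, not_lt.1 h3⟩)
        refine (min_le_right _ _).trans ((Metric.infEDist_le_edist_of_mem hy).trans ?_)
        have h' : (b : ℝ) < y := h2
        rw [edist_dist, edist_dist]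
        refine ENNReal.ofReal_le_ofReal ?_
        rw [Subtype.dist_eq, Subtype.dist_eq, Real.dist_eq, Real.dist_eq, abs_of_neg (by linarith),
          abs_of_neg (by linarith)]
        linarith
    exact (lt_min ha hb).trans_le h1
  · exact l2.trans_lt (hKE k hk t ht)
  · exact (isClosed_le continuous_const (hE k)).isCompact
  · obtain ⟨k, hk, h⟩ := hc t
    exact ⟨k, hk, l1.trans_lt h⟩
  · exact l3.trans_lt (h0 0 rfl)
  · exact l4.trans_lt (h1 1 rfl)

end PathSystem

end Normal

end Orbispace

/-! ### Convergence of systems implies convergence of based paths. -/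

namespace Orbispace

section Convergence

variable {X : Type u} [TopologicalSpace X] {𝒳 : Orbispace X}

theorem inv_grpArr (i : 𝒳.Idx) (g : (𝒳.str i).Grp) :
    𝒳.inv (𝒳.grpArr i g) = 𝒳.grpArr i g⁻¹ := by
  obtain ⟨x⟩ : Nonempty (𝒳.str i).Cov := inferInstance
  have h := sends_grpArr i g x
  have h' := sends_grpArr i g⁻¹ (g • x)
  refine h.cancel_right h.inv h' ?_
  rw [h.inv_mul, grpArr_mul, inv_mul_cancel, grpArr_one]

namespace PathSystem

variable {o₁ o₂ p₁ p₂ q₁ q₂ : 𝒳.BasePoint}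

/-- Isomorphic systems, the isomorphism being given by group elements at the end points. -/
def IsoVia (σ : 𝒳.PathSystem o₁ o₂) (τ : 𝒳.PathSystem p₁ p₂) (g h : 𝒳.Gau) : Prop :=
  ∃ J, σ.IsIso τ J ∧ J 0 0 0 = 𝒳.grpArr o₁.idx (g o₁.idx) ∧
    J 1 σ.n τ.n = 𝒳.grpArr o₂.idx (h o₂.idx)

theorem isoVia_one_iff {σ τ : 𝒳.PathSystem o₁ o₂} : σ.IsoVia τ 1 1 ↔ σ.Equiv τ := by
  simp only [IsoVia, Equiv, Pi.one_apply, grpArr_one]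

theorem IsIso.sends_zero {σ : 𝒳.PathSystem o₁ o₂} {τ : 𝒳.PathSystem p₁ p₂}
    {J : unitInterval → ℕ → ℕ → 𝒳.Arr} (h : σ.IsIso τ J) :
    𝒳.Sends (J 0 0 0) o₁.point p₁.point := by
  rw [← σ.f_zero, ← τ.f_zero]
  exact h.sends 0 0 0 (Nat.zero_le _) (Nat.zero_le _) σ.zero_mem τ.zero_mem

theorem IsIso.sends_one {σ : 𝒳.PathSystem o₁ o₂} {τ : 𝒳.PathSystem p₁ p₂}
    {J : unitInterval → ℕ → ℕ → 𝒳.Arr} (h : σ.IsIso τ J) :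
    𝒳.Sends (J 1 σ.n τ.n) o₂.point p₂.point := by
  rw [← σ.f_one, ← τ.f_one]
  exact h.sends 1 σ.n τ.n le_rfl le_rfl σ.one_mem τ.one_mem

theorem IsoVia.point_eq {σ : 𝒳.PathSystem o₁ o₂} {τ : 𝒳.PathSystem p₁ p₂} {g h : 𝒳.Gau}
    (H : σ.IsoVia τ g h) : p₁.point = gact g o₁.point ∧ p₂.point = gact h o₂.point := by
  obtain ⟨J, hJ, h0, h1⟩ := H
  have s0 := hJ.sends_zero
  have s1 := hJ.sends_one
  rw [h0] at s0
  rw [h1] at s1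
  exact ⟨s0.unique (sends_grpArr' o₁.point g), s1.unique (sends_grpArr' o₂.point h)⟩

theorem IsoVia.idx_eq {σ : 𝒳.PathSystem o₁ o₂} {τ : 𝒳.PathSystem p₁ p₂} {g h : 𝒳.Gau}
    (H : σ.IsoVia τ g h) : p₁.idx = o₁.idx ∧ p₂.idx = o₂.idx :=
  ⟨congrArg Sigma.fst H.point_eq.1, congrArg Sigma.fst H.point_eq.2⟩

theorem IsoVia.symm {σ : 𝒳.PathSystem o₁ o₂} {τ : 𝒳.PathSystem p₁ p₂} {g h : 𝒳.Gau}
    (H : σ.IsoVia τ g h) : τ.IsoVia σ g⁻¹ h⁻¹ := by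
  obtain ⟨e1, e2⟩ := H.idx_eq
  obtain ⟨J, hJ, h0, h1⟩ := H
  refine ⟨_, hJ.symm, ?_, ?_⟩
  · simp only [h0, inv_grpArr, Pi.inv_apply]
    exact congrArg (fun i => 𝒳.grpArr i (g i)⁻¹) e1.symm
  · simp only [h1, inv_grpArr, Pi.inv_apply]
    exact congrArg (fun i => 𝒳.grpArr i (h i)⁻¹) e2.symm

theorem IsoVia.trans {σ : 𝒳.PathSystem o₁ o₂} {τ : 𝒳.PathSystem p₁ p₂}
    {κ : 𝒳.PathSystem q₁ q₂} {g h g' h' : 𝒳.Gau} (H : σ.IsoVia τ g h) (H' : τ.IsoVia κ g' h') :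
    σ.IsoVia κ (g' * g) (h' * h) := by
  obtain ⟨J, hJ, h0, h1⟩ := H
  obtain ⟨J', hJ', h0', h1'⟩ := H'
  refine ⟨_, hJ.trans hJ', ?_, ?_⟩
  · rw [hJ.trans_zero hJ', h0']
    have := hJ.sends_zero.mul_grpArr_left g'
    rw [h0, lact_grpArr] at this
    rw [h0]
    exact this
  · rw [hJ.trans_one hJ', h1']
    have := hJ.sends_one.mul_grpArr_left h'
    rw [h1, lact_grpArr] at this
    rw [h1]
    exact this

theorem isoVia_gauge (τ : 𝒳.PathSystem o₁ o₂) (g : ℕ → 𝒳.Gau)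
    (h₁ : p₁.point = gact (g 0) o₁.point) (h₂ : p₂.point = gact (g τ.n) o₂.point) :
    τ.IsoVia (τ.gauge g h₁ h₂) (g 0) (g τ.n) := by
  refine ⟨_, τ.isIso_gauge g h₁ h₂, ?_, ?_⟩
  · rw [tr_self, chart_zero, lact_oneArr]
  · change lact (g τ.n) (τ.tr τ.n τ.n) 1 = _
    rw [tr_self, chart_n, lact_oneArr]

/-- A system isomorphic to `σ`, over the intervals and charts of `τ`. -/
theorem exists_carry (σ : 𝒳.PathSystem o₁ o₂) (τ : 𝒳.PathSystem p₁ p₂) (C : ℕ → ℕ → 𝒳.Arr)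
    (h1 : ∀ k ≤ σ.n, ∀ l ≤ τ.n, ∀ t ∈ σ.I k, t ∈ τ.I l →
      σ.f k t ∈ 𝒳.dom (C k l) ∧ (C k l).tgt = τ.chart l)
    (h2 : ∀ k < σ.n, ∀ l ≤ τ.n, ∀ t ∈ σ.I k, t ∈ σ.I (k + 1) → t ∈ τ.I l →
      𝒳.CompAt (C (k + 1) l) (σ.ρ k) (σ.f k t) (C k l))
    (h3 : ∀ k ≤ σ.n, ∀ l < τ.n, ∀ t ∈ σ.I k, t ∈ τ.I l → t ∈ τ.I (l + 1) →
      𝒳.CompAt (τ.ρ l) (C k l) (σ.f k t) (C k (l + 1)))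
    (hq₁ : 𝒳.Sends (C 0 0) o₁.point q₁.point) (hq₂ : 𝒳.Sends (C σ.n τ.n) o₂.point q₂.point) :
    ∃ Λ : 𝒳.PathSystem q₁ q₂, Λ.n = τ.n ∧ Λ.I = τ.I ∧ Λ.chart = τ.chart ∧ Λ.ρ = τ.ρ ∧
      σ.IsIso Λ fun _ => C := by
  -- The image of `σ` under the maps `C k l` does not depend on the chart `k` in which it is
  -- computed, so it defines the new map on the interval `l`.
  have key : ∀ t, ∀ l ≤ τ.n, t ∈ τ.I l → ∀ k ≤ σ.n, t ∈ σ.I k →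
      𝒳.app (C (σ.ix t) l) (σ.f (σ.ix t) t) = 𝒳.app (C k l) (σ.f k t) := by
    intro t l hl htl k hk htk
    refine σ.index_induction (fun k => 𝒳.app (C k l) (σ.f k t)) (fun k hk ht ht' => ?_)
      (σ.ix_le t) hk (σ.mem_ix t) htk
    have s := (h2 k hk l hl t ht ht' htl).sends (σ.ρ_sends k hk t ⟨ht, ht'⟩)
      (sends_app (h1 (k + 1) hk l hl t ht' htl).1)
    exact s.app_eq
  have hs : ∀ k ≤ σ.n, ∀ l ≤ τ.n, ∀ t ∈ σ.I k, t ∈ τ.I l →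
      𝒳.Sends (C k l) (σ.f k t) (𝒳.app (C (σ.ix t) l) (σ.f (σ.ix t) t)) :=
    fun k hk l hl t htk htl => by
      rw [key t l hl htl k hk htk]
      exact sends_app (h1 k hk l hl t htk htl).1
  refine ⟨{ n := τ.n
            one_le_n := τ.one_le_n
            I := τ.I
            isOpen_I := τ.isOpen_I
            ordConnected_I := τ.ordConnected_I
            cover := τ.cover
            disjoint := τ.disjoint
            zero_mem := τ.zero_mem
            one_mem := τ.one_mem
            chart := τ.chart
            f := fun l t => 𝒳.app (C (σ.ix t) l) (σ.f (σ.ix t) t)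
            f_chart := fun l hl t ht => ?_
            continuousOn_f := fun l hl t ht => ?_
            ρ := τ.ρ
            ρ_src := τ.ρ_src
            ρ_tgt := τ.ρ_tgt
            ρ_sends := fun l hl t ht => ?_
            f_zero := ?_
            f_one := ?_ }, rfl, rfl, rfl, rfl, ?_, ?_, ?_, ?_⟩
  · rw [(hs _ (σ.ix_le t) l hl t (σ.mem_ix t) ht).tgt_eq]
    exact (h1 _ (σ.ix_le t) l hl t (σ.mem_ix t) ht).2
  · refine ContinuousAt.continuousWithinAt ?_
    have hk := σ.ix_le t
    have htk := σ.mem_ix t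
    have : ContinuousAt (fun s => 𝒳.app (C (σ.ix t) l) (σ.f (σ.ix t) s)) t :=
      ContinuousAt.comp (f := σ.f (σ.ix t)) (continuousAt_app (h1 _ hk l hl t htk ht).1)
        (σ.continuousAt_f hk htk)
    refine this.congr ?_
    filter_upwards [σ.eventually_mem hk htk, τ.eventually_mem hl ht] with s hs1 hs2
    exact (key s l hl hs2 _ hk hs1).symm
  · have h := hs _ (σ.ix_le t) l hl.le t (σ.mem_ix t) ht.1
    have h' := hs _ (σ.ix_le t) (l + 1) hl t (σ.mem_ix t) ht.2
    obtain ⟨y, z, hy, hz, hyz⟩ := (h3 _ (σ.ix_le t) l hl t (σ.mem_ix t) ht.1 ht.2).exists_sends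
    rw [h.unique hy, h'.unique hyz]
    exact hz
  · have := hs 0 (Nat.zero_le _) 0 (Nat.zero_le _) 0 σ.zero_mem τ.zero_mem
    rw [σ.f_zero] at this
    exact this.unique hq₁
  · have := hs _ le_rfl _ le_rfl 1 σ.one_mem τ.one_mem
    rw [σ.f_one] at this
    exact this.unique hq₂
  · exact fun t k l hk hl htk htl => hs k hk l hl t htk htl
  · exact fun t k l hk hl htk htk' htl => (h2 k hk l hl t htk htk' htl).mul_eq
  · exact fun t k l hk hl htk htl htl' => (h3 k hk l hl t htk htl htl').mul_eq
  · exact fun t k l _ _ _ _ => Filter.Eventually.of_forall fun _ => rfl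

/-- Convergence of systems with the same charts: uniform convergence of the maps on compact sets,
and convergence of the transition maps. -/
structure Tends {ι : Type*} (F : Filter ι) (Φ : ι → 𝒳.PathSystem o₁ o₂)
    (σ : 𝒳.PathSystem o₁ o₂) : Prop where
  shape : ∀ᶠ i in F, (Φ i).n = σ.n ∧ ∀ k ≤ σ.n, (Φ i).chart k = σ.chart k
  rho : ∀ M ∈ 𝓝 (1 : 𝒳.Gau), ∀ᶠ i in F, ∀ k < σ.n, ∃ h ∈ M, (Φ i).ρ k = lact h (σ.ρ k) 1
  maps : ∀ k ≤ σ.n, ∀ K, IsCompact K → K ⊆ σ.I k → ∀ V, IsOpen V → (∀ t ∈ K, σ.f k t ∈ V) →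
    ∀ᶠ i in F, K ⊆ (Φ i).I k ∧ ∀ t ∈ K, (Φ i).f k t ∈ V

/-- Open conditions on compact pieces survive both the passage to a nearby system and the action of
a small group element. The second is needed because nearby systems are normalised before being used.
-/
theorem Tends.eventually_gact {ι : Type*} {F : Filter ι} {Φ : ι → 𝒳.PathSystem o₁ o₂}
    {σ : 𝒳.PathSystem o₁ o₂} (h : Tends F Φ σ) {k : ℕ} (hk : k ≤ σ.n) {K : Set unitInterval}
    (hK : IsCompact K) (hKI : K ⊆ σ.I k) {V : Set 𝒳.Pt} (hV : IsOpen V)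
    (hKV : ∀ t ∈ K, σ.f k t ∈ V) :
    ∀ᶠ p in F ×ˢ 𝓝 (1 : 𝒳.Gau), ∀ t ∈ K, gact p.2 ((Φ p.1).f k t) ∈ V := by
  obtain ⟨M, hM, V', hV', hCV', hg⟩ := exists_gact_subset
    (hK.image_of_continuousOn ((σ.continuousOn_f k hk).mono hKI)) hV (image_subset_iff.2 hKV)
  filter_upwards [((h.maps k hk K hK hKI V' hV' fun t ht => hCV' ⟨t, ht, rfl⟩)).prod_mk
    (Filter.eventually_mem_set.2 hM)] with p hp t ht
  exact hg _ hp.2 _ (hp.1.2 t ht)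

theorem isOpen_nbhd (σ : 𝒳.PathSystem o₁ o₂) (K : ℕ → Set unitInterval) (V : ℕ → Set 𝒳.Pt)
    (A : ℕ → Set 𝒳.Arr)
    (h : ∀ k ≤ σ.n, IsCompact (K k) ∧ K k ⊆ σ.I k ∧ IsOpen (V k) ∧ ∀ t ∈ K k, σ.f k t ∈ V k)
    (h' : ∀ k < σ.n, IsOpen (A k) ∧ σ.ρ k ∈ A k) : IsOpen (σ.nbhd K V A) :=
  isOpen_generateFrom_of_mem ⟨σ, K, V, A, h, h', rfl⟩

/-- An isomorphism is constant on each overlap; freezing it into transition maps that do not depend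
on `t` makes it applicable to other systems near `σ`. -/
theorem IsIso.exists_const {σ : 𝒳.PathSystem o₁ o₂} {τ : 𝒳.PathSystem p₁ p₂}
    {J : unitInterval → ℕ → ℕ → 𝒳.Arr} (h : σ.IsIso τ J) :
    ∃ C : ℕ → ℕ → 𝒳.Arr, ∀ t k l, k ≤ σ.n → l ≤ τ.n → t ∈ σ.I k → t ∈ τ.I l → J t k l = C k l := by
  have : ∀ k l, ∃ a, ∀ t, k ≤ σ.n → l ≤ τ.n → t ∈ σ.I k → t ∈ τ.I l → J t k l = a := fun k l => by
    by_cases hex : ∃ s, k ≤ σ.n ∧ l ≤ τ.n ∧ s ∈ σ.I k ∧ s ∈ τ.I l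
    · obtain ⟨s, hk, hl, hsk, hsl⟩ := hex
      exact ⟨J s k l, fun t _ _ htk htl => h.congr hk hl htk htl hsk hsl⟩
    · exact ⟨J 0 k l, fun t hk hl htk htl => absurd ⟨t, hk, hl, htk, htl⟩ hex⟩
  choose C hC using this
  exact ⟨C, fun t k l => hC k l t⟩

/-- Convergence of systems implies convergence in the space of based paths. -/
theorem Tends.tendsto {ι : Type*} {F : Filter ι} {Φ : ι → 𝒳.PathSystem o₁ o₂}
    {σ : 𝒳.PathSystem o₁ o₂} (h : Tends F Φ σ) :
    Filter.Tendsto (fun i => (Φ i).cls) F (𝓝 σ.cls) := by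
  classical
  refine tendsto_nhds_generateFrom_iff.2 ?_
  rintro _ ⟨κ, K, V, A, hKV, hA, rfl⟩ ⟨τ, hτσ, hn, hKI, hfV, hρA⟩
  -- Membership in the given basic set is witnessed by a representative `τ` whose charts may differ
  -- from those of `σ`. A nearby `Φ i` will be carried to the charts of `τ` by the maps `C k l` of
  -- the isomorphism; for this its transition maps must first be made equal to those of `σ`, and its
  -- end point restored afterwards.
  obtain ⟨J, hJ, hJ0, hJ1⟩ := cls_eq_iff.1 hτσ.symm
  obtain ⟨C, hC⟩ := hJ.exists_const
  rw [hC 0 0 0 (Nat.zero_le _) (Nat.zero_le _) σ.zero_mem τ.zero_mem] at hJ0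
  rw [hC 1 _ _ le_rfl le_rfl σ.one_mem τ.one_mem] at hJ1
  rw [← hn] at hKV hA hKI hfV hρA
  obtain ⟨I', L, hIL, hcov, hI0, hI1⟩ := σ.exists_shrinking (fun _ => ∅)
    fun k _ => ⟨isCompact_empty, empty_subset _⟩
  obtain ⟨I₁, L₁, hIL₁, hcov₁, hI0₁, hI1₁⟩ := τ.exists_shrinking K
    fun k hk => ⟨(hKV k hk).1, (hKI k hk).1⟩
  -- neighbourhoods in which the last point may be moved back
  have hW : ∀ l, ∃ M ∈ 𝓝 (1 : 𝒳.Gau), ∃ W, IsOpen W ∧ (l ≤ τ.n → τ.f l '' K l ⊆ W ∧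
      ∀ g ∈ M, ∀ x ∈ W, gact g x ∈ V l) := fun l => by
    by_cases hl : l ≤ τ.n
    · obtain ⟨M, hM, W, hW, h1, h2⟩ := exists_gact_subset
        ((hKV l hl).1.image_of_continuousOn ((τ.continuousOn_f l hl).mono (hKI l hl).1))
        (hKV l hl).2.2.1 (image_subset_iff.2 (hfV l hl))
      exact ⟨M, hM, W, hW, fun _ => ⟨h1, h2⟩⟩
    · exact ⟨univ, Filter.univ_mem, univ, isOpen_univ, fun h => absurd h hl⟩
  choose M hM W hWo hW using hW
  -- All that `exists_carry` needs, together with the condition on the sets `K l`, is open in the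
  -- point and is required only on compact sets.
  have ev1 : ∀ᶠ p in F ×ˢ 𝓝 (1 : 𝒳.Gau), ∀ k ∈ Iic σ.n, ∀ l ∈ Iic τ.n,
      (∀ t ∈ L k ∩ L₁ l, gact p.2 ((Φ p.1).f k t) ∈ 𝒳.dom (C k l)) ∧
      (∀ t ∈ L k ∩ K l, gact p.2 ((Φ p.1).f k t) ∈ 𝒳.dom (C k l) ∩ 𝒳.app (C k l) ⁻¹' W l) ∧
      (k < σ.n → ∀ t ∈ L k ∩ L (k + 1) ∩ L₁ l,
        gact p.2 ((Φ p.1).f k t) ∈ {x | 𝒳.CompAt (C (k + 1) l) (σ.ρ k) x (C k l)}) ∧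
      (l < τ.n → ∀ t ∈ L k ∩ (L₁ l ∩ L₁ (l + 1)),
        gact p.2 ((Φ p.1).f k t) ∈ {x | 𝒳.CompAt (τ.ρ l) (C k l) x (C k (l + 1))}) := by
    have hopen : ∀ a b c : 𝒳.Arr, IsOpen {x | 𝒳.CompAt b a x c} := fun a b c =>
      isOpen_iff_mem_nhds.2 fun x hx => CompAt.eventually hx
    rw [Filter.eventually_all_finite (Set.finite_Iic _)]
    intro k hk
    rw [Filter.eventually_all_finite (Set.finite_Iic _)]
    intro l hl
    obtain ⟨-, -, -, -, hLc, hLI⟩ := hIL k hk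
    obtain ⟨-, -, hKI₁, hI₁L₁, hLc₁, hLI₁⟩ := hIL₁ l hl
    have hdom : ∀ t, t ∈ σ.I k → t ∈ τ.I l → 𝒳.Sends (C k l) (σ.f k t) (τ.f l t) :=
      fun t ht ht' => by
        rw [← hC t k l hk hl ht ht']; exact hJ.sends t k l hk hl ht ht'
    refine Filter.Eventually.and ?_ (Filter.Eventually.and ?_ (Filter.Eventually.and ?_ ?_))
    · exact h.eventually_gact hk (hLc.inter hLc₁) (fun t ht => hLI ht.1) (isOpen_dom _)
        fun t ht => (hdom t (hLI ht.1) (hLI₁ ht.2)).mem_dom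
    · refine h.eventually_gact hk (hLc.inter (hKV l hl).1) (fun t ht => hLI ht.1)
        ((continuousOn_app _).isOpen_inter_preimage (isOpen_dom _) (hWo l)) fun t ht => ?_
      have := hdom t (hLI ht.1) (hKI l hl |>.1 ht.2)
      refine ⟨this.mem_dom, ?_⟩
      rw [mem_preimage, this.app_eq]
      exact (hW l hl).1 ⟨t, ht.2, rfl⟩
    · rw [Filter.eventually_imp_distrib_left]
      intro hk'
      obtain ⟨-, -, -, -, hLc', hLI'⟩ := hIL (k + 1) hk'
      refine h.eventually_gact hk ((hLc.inter hLc').inter hLc₁) (fun t ht => hLI ht.1.1)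
        (hopen _ _ _) fun t ht => ?_
      have e := hJ.left t k l hk' hl (hLI ht.1.1) (hLI' ht.1.2) (hLI₁ ht.2)
      have s := hJ.sends t (k + 1) l hk' hl (hLI' ht.1.2) (hLI₁ ht.2)
      rw [hC t _ _ hk' hl (hLI' ht.1.2) (hLI₁ ht.2)] at e s
      rw [hC t _ _ hk hl (hLI ht.1.1) (hLI₁ ht.2)] at e
      have := (σ.ρ_sends k hk' t ⟨hLI ht.1.1, hLI' ht.1.2⟩).compAt s
      rwa [e] at this
    · rw [Filter.eventually_imp_distrib_left]
      intro hl'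
      obtain ⟨-, -, -, -, hLc', hLI'⟩ := hIL₁ (l + 1) hl'
      refine h.eventually_gact hk (hLc.inter (hLc₁.inter hLc')) (fun t ht => hLI ht.1)
        (hopen _ _ _) fun t ht => ?_
      have e := hJ.right t k l hk hl' (hLI ht.1) (hLI₁ ht.2.1) (hLI' ht.2.2)
      rw [hC t _ _ hk hl (hLI ht.1) (hLI₁ ht.2.1)] at e
      rw [hC t _ _ hk hl' (hLI ht.1) (hLI' ht.2.2)] at e
      have := (hdom t (hLI ht.1) (hLI₁ ht.2.1)).compAt (τ.ρ_sends l hl' t ⟨hLI₁ ht.2.1, hLI' ht.2.2⟩)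
      rwa [e] at this
  -- Restoring the end point will multiply the last map and the last transition map by `δ⁻¹`; these
  -- must remain in the prescribed open sets.
  have ev2 : ∀ᶠ δ in 𝓝 (1 : 𝒳.Gau), ∀ l ∈ Iic τ.n, δ⁻¹ ∈ M l ∧
      (l < τ.n → lact δ⁻¹ (τ.ρ l) 1 ∈ A l) := by
    rw [Filter.eventually_all_finite (Set.finite_Iic _)]
    intro l hl
    have hi : Filter.Tendsto (fun δ : 𝒳.Gau => δ⁻¹) (𝓝 1) (𝓝 1) := by
      simpa using (continuous_inv (G := 𝒳.Gau)).tendsto 1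
    refine (hi.eventually (hM l)).and ?_
    rw [Filter.eventually_imp_distrib_left]
    intro hl'
    refine hi.eventually (((continuous_lact (τ.ρ l)).continuousAt (x := 1)).eventually ?_)
    refine (hA l hl').1.mem_nhds ?_
    simp only [lact_one_one]
    exact hρA l hl'
  have ev3 : ∀ᶠ i in F, ∀ k ∈ Iic σ.n, L k ⊆ (Φ i).I k := by
    rw [Filter.eventually_all_finite (Set.finite_Iic _)]
    intro k hk
    obtain ⟨-, -, -, -, hLc, hLI⟩ := hIL k hk
    exact (h.maps k hk (L k) hLc hLI univ isOpen_univ fun _ _ => trivial).mono fun _ h => h.1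
  obtain ⟨P, hP, Q, hQ, hPQ⟩ := Filter.eventually_prod_iff.1 ev1
  obtain ⟨N, hN, hnorm⟩ := exists_normalization σ.ρ σ.n (Filter.inter_mem hQ ev2)
  filter_upwards [hP, h.rho N hN, ev3, h.shape] with i hPi hρ hL hsh
  obtain ⟨hin, hic⟩ := hsh
  have hex : ∀ k, ∃ g : 𝒳.Gau, k < σ.n → g ∈ N ∧ (Φ i).ρ k = lact g (σ.ρ k) 1 := fun k => by
    by_cases hk : k < σ.n
    · obtain ⟨g, h1, h2⟩ := hρ k hk
      exact ⟨g, fun _ => ⟨h1, h2⟩⟩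
    · exact ⟨1, fun h => absurd h hk⟩
  choose η hη using hex
  -- After gauging by `δ` the transition maps are exactly those of `σ`. The initial point is
  -- unchanged because `δ 0 = 1`, whereas the final point is moved by `δ σ.n`.
  obtain ⟨δ, hδ0, hδ, hδρ⟩ := hnorm η fun k hk => (hη k hk).1
  have hσn := σ.one_le_n
  have hτn := τ.one_le_n
  -- the normalised system, over small intervals
  let Ψ : 𝒳.PathSystem o₁ o₂ := (Φ i).shrink I' (fun k hk => (hIL k (hin ▸ hk)).1)
    (fun k hk => (hIL k (hin ▸ hk)).2.1)
    (fun k hk => (hIL k (hin ▸ hk)).2.2.2.1.trans (hL k (hin ▸ hk)))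
    (by rwa [hin]) hI0 (by rwa [hin])
  have hΨ : Ψ.Equiv (Φ i) := Refines.equiv (refines_of_subset rfl
    (fun k hk => (hIL k (hin ▸ hk)).2.2.2.1.trans (hL k (hin ▸ hk))) (fun _ _ => rfl)
    (fun _ _ _ _ => rfl) fun _ _ => rfl)
  let q : 𝒳.BasePoint := ptBase (gact (δ σ.n) o₂.point)
  have hΨn : Ψ.n = σ.n := hin
  have hd1 : o₁.point = gact (δ 0) o₁.point := by rw [hδ0, gact_one]
  have hd2 : q.point = gact (δ Ψ.n) o₂.point := by rw [hΨn]; rfl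
  let Ψ' : 𝒳.PathSystem o₁ q := Ψ.gauge δ hd1 hd2
  have hΨ' : Ψ.IsoVia Ψ' (δ 0) (δ Ψ.n) := Ψ.isoVia_gauge δ hd1 hd2
  have hΨ'n : Ψ'.n = σ.n := hin
  have hΨ'ρ : ∀ k < σ.n, Ψ'.ρ k = σ.ρ k := fun k hk => by
    rw [← hδρ k hk, ← (hη k hk).2]; rfl
  let τ' : 𝒳.PathSystem o₁ o₂ := τ.shrink I₁ (fun k hk => (hIL₁ k hk).1)
    (fun k hk => (hIL₁ k hk).2.1) (fun k hk => (hIL₁ k hk).2.2.2.1.trans (hIL₁ k hk).2.2.2.2.2)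
    hcov₁ hI0₁ hI1₁
  have hev : ∀ k ≤ σ.n, ∀ l ≤ τ.n, _ := fun k hk l hl => hPQ hPi (hδ k hk).1 k hk l hl
  have hI'L : ∀ k ≤ σ.n, ∀ t ∈ I' k, t ∈ L k := fun k hk t ht => (hIL k hk).2.2.2.1 ht
  have hI₁L : ∀ k ≤ τ.n, ∀ t ∈ I₁ k, t ∈ L₁ k := fun k hk t ht => (hIL₁ k hk).2.2.2.1 ht
  obtain ⟨Λ, hΛn, hΛI, hΛc, hΛρ, hΛ⟩ := exists_carry (q₁ := o₁) (q₂ := q) Ψ' τ' C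
    (fun k hk l hl t ht ht' => by
      rw [hΨ'n] at hk
      refine ⟨(hev k hk l hl).1 t ⟨hI'L k hk t ht, hI₁L l hl t ht'⟩, ?_⟩
      have h1 : t ∈ σ.I k := (hIL k hk).2.2.2.2.2 (hI'L k hk t ht)
      have h2 : t ∈ τ.I l := (hIL₁ l hl).2.2.2.2.2 (hI₁L l hl t ht')
      rw [← hC t k l hk hl h1 h2, ← (hJ.sends t k l hk hl h1 h2).tgt_eq]
      exact τ.f_chart l hl t h2)
    (fun k hk l hl t ht ht' ht'' => by
      rw [hΨ'n] at hk
      rw [hΨ'ρ k hk]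
      exact (hev k hk.le l hl).2.2.1 hk t ⟨⟨hI'L k hk.le t ht, hI'L (k + 1) hk t ht'⟩,
        hI₁L l hl t ht''⟩)
    (fun k hk l hl t ht ht' ht'' => by
      rw [hΨ'n] at hk
      exact (hev k hk l (le_of_lt hl)).2.2.2 hl t ⟨hI'L k hk t ht, hI₁L l (le_of_lt hl) t ht',
        hI₁L (l + 1) hl t ht''⟩)
    (by rw [hJ0]; exact sends_one o₁.point)
    (by
      rw [hΨ'n]
      change 𝒳.Sends (C σ.n τ.n) _ _
      rw [hJ1]; exact sends_one (gact (δ σ.n) o₂.point))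
  have hΛn' : Λ.n = τ.n := hΛn
  have hΨΛ : Ψ'.IsoVia Λ 1 1 := ⟨_, hΛ, by simp only [hJ0, Pi.one_apply, grpArr_one], by
    simp only [hΛn', hΨ'n, hJ1, Pi.one_apply, grpArr_one]; rfl⟩
  -- The displacement of the end point is undone in the last chart only, so the total isomorphism
  -- from `Φ i` is the identity at both ends.
  let G : ℕ → 𝒳.Gau := fun l => if l = τ.n then (δ σ.n)⁻¹ else 1
  have hG0 : G 0 = 1 := if_neg (by omega)
  have hGn : G Λ.n = (δ σ.n)⁻¹ := if_pos hΛn'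
  have hg1 : o₁.point = gact (G 0) o₁.point := by rw [hG0, gact_one]
  have hg2 : o₂.point = gact (G Λ.n) q.point := by
    rw [hGn]; exact (gact_inv_gact _ _).symm
  have hfin := (hΨ'.trans hΨΛ).trans (Λ.isoVia_gauge G hg1 hg2)
  rw [hδ0, hG0, hGn, hΨn, _root_.one_mul, _root_.one_mul, _root_.one_mul, inv_mul_cancel,
    isoVia_one_iff] at hfin
  refine ⟨Λ.gauge G hg1 hg2, (hΨ.symm.trans hfin).cls_eq.symm, hΛn'.trans hn, ?_, ?_, ?_⟩
  · rw [← hn]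
    intro l hl
    change K l ⊆ Λ.I l ∧ Λ.I l ⊆ κ.I l ∧ Λ.chart l = κ.chart l
    rw [hΛI, hΛc]
    exact ⟨(hIL₁ l hl).2.2.1, ((hIL₁ l hl).2.2.2.1.trans (hIL₁ l hl).2.2.2.2.2).trans
      (hKI l hl).2.1, (hKI l hl).2.2⟩
  · rw [← hn]
    intro l hl t ht
    have ht' : t ∈ Λ.I l := by rw [hΛI]; exact (hIL₁ l hl).2.2.1 ht
    have hk := Ψ'.ix_le t
    have htk := Ψ'.mem_ix t
    have s := hΛ.sends t _ l hk (hΛn' ▸ hl) htk ht'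
    rw [hΨ'n] at hk
    have := ((hev _ hk l hl).2.1 t ⟨hI'L _ hk t htk, ht⟩).2
    change 𝒳.app (C (Ψ'.ix t) l) (Ψ'.f (Ψ'.ix t) t) ∈ W l at this
    rw [s.app_eq] at this
    refine (hW l hl).2 (G l) ?_ _ this
    by_cases e : l = τ.n
    · rw [show G l = (δ σ.n)⁻¹ from if_pos e]
      exact ((hδ σ.n le_rfl).2 l hl).1
    · rw [show G l = 1 from if_neg e]
      exact mem_of_mem_nhds (hM l)
  · rw [← hn]
    intro l hl
    change lact (G (l + 1)) (Λ.ρ l) (G l)⁻¹ ∈ A l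
    rw [show G l = 1 from if_neg hl.ne, inv_one, hΛρ]
    change lact (G (l + 1)) (τ.ρ l) 1 ∈ A l
    by_cases e : l + 1 = τ.n
    · rw [show G (l + 1) = (δ σ.n)⁻¹ from if_pos e]
      exact ((hδ σ.n le_rfl).2 l hl.le).2 hl
    · rw [show G (l + 1) = 1 from if_neg e, lact_one_one]
      exact hρA l hl

end PathSystem

end Convergence

end Orbispace

/-! ### Normal representatives: same charts and transition maps, a group element at the end. -/

namespace Orbispace

section Representative

variable {X : Type u} [TopologicalSpace X] {𝒳 : Orbispace X}

namespace PathSystem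

variable {o₁ o₂ p₁ p₂ q₁ q₂ : 𝒳.BasePoint}

/-- The system `τ` has the same charts and transition maps as `σ`, and smaller intervals. -/
structure IsNormal (σ : 𝒳.PathSystem o₁ o₂) (τ : 𝒳.PathSystem p₁ p₂) : Prop where
  n_eq : τ.n = σ.n
  I_subset : ∀ k ≤ σ.n, τ.I k ⊆ σ.I k
  chart_eq : ∀ k ≤ σ.n, τ.chart k = σ.chart k
  ρ_eq : ∀ k < σ.n, τ.ρ k = σ.ρ k

/-- The system `τ`, with the last point moved back by `g`, represents the based path `a`. -/
def Rep (a : 𝒳.PathSpace o₁ o₂) (τ : 𝒳.PathSystem p₁ p₂) (g : 𝒳.Gau) : Prop :=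
  ∃ ω : 𝒳.PathSystem o₁ o₂, ω.cls = a ∧ ω.IsoVia τ 1 g

theorem inv_tr (σ : 𝒳.PathSystem o₁ o₂) {k l : ℕ} (h : l ≤ k + 1) (h' : k ≤ l + 1) :
    𝒳.inv (σ.tr k l) = σ.tr l k := by
  obtain rfl | rfl | rfl : l = k ∨ l = k + 1 ∨ k = l + 1 := by omega
  · rw [tr_self, inv_oneArr]
  · rw [tr_succ, tr_pred]
  · rw [tr_succ, tr_pred, inv_inv]

/-- Both systems have the transition maps of `σ`, and these are invertible, so the value of the
isomorphism at `l` determines the one at `l + 1` and conversely, in the same way as for `tr`. -/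
theorem IsNormal.right_iff {σ : 𝒳.PathSystem o₁ o₂} {τ : 𝒳.PathSystem p₁ p₂}
    {τ' : 𝒳.PathSystem q₁ q₂} (h : σ.IsNormal τ) (h' : σ.IsNormal τ')
    {J : unitInterval → ℕ → ℕ → 𝒳.Arr} (hJ : τ.IsIso τ' J) {t : unitInterval} {k l : ℕ}
    (hk : k ≤ σ.n) (hl : l < σ.n) (htk : t ∈ τ.I k) (htl : t ∈ τ'.I l) (htl' : t ∈ τ'.I (l + 1)) :
    J t k l = σ.tr k l ↔ J t k (l + 1) = σ.tr k (l + 1) := by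
  have a1 := σ.le_succ_of_mem hk (h'.I_subset l hl.le htl) (h.I_subset k hk htk)
  have a2 := σ.le_succ_of_mem hl (h.I_subset k hk htk) (h'.I_subset (l + 1) hl htl')
  have hs := hJ.sends t k l (by rwa [h.n_eq]) (by rw [h'.n_eq]; exact hl.le) htk htl
  have hs' := hJ.sends t k (l + 1) (by rwa [h.n_eq]) (by rw [h'.n_eq]; exact hl) htk htl'
  have e := hJ.right t k l (by rwa [h.n_eq]) (by rwa [h'.n_eq]) htk htl htl'
  have hρ := τ'.ρ_sends l (by rwa [h'.n_eq]) t ⟨htl, htl'⟩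
  rw [h'.ρ_eq l hl] at e hρ
  have hc := h.chart_eq k hk
  have hx : (τ.f k t).1 = σ.chart k := by rw [τ.f_chart k (by rwa [h.n_eq]) t htk, hc]
  obtain rfl | rfl : k = l ∨ k = l + 1 := by omega
  · rw [tr_self, tr_succ]
    constructor
    · intro h1
      have hx' := (sends_oneArr hx).unique (h1 ▸ hs)
      rw [← e, h1, ← hx]
      exact Sends.mul_one (y := τ'.f (k + 1) t) (by rw [hx']; exact hρ)
    · intro h1
      rw [h1] at hs' e
      refine hs.cancel_left (sends_oneArr hx) hρ hs' ?_
      rw [e, ← hx, hs'.mul_one]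
  · rw [tr_self, tr_pred]
    constructor
    · intro h1
      have hx' : τ'.f (l + 1) t = τ.f (l + 1) t := by
        have := hs.inv
        rw [h1, inv_inv] at this
        exact hρ.unique this
      rw [← e, h1, ← hx]
      exact Sends.mul_inv (x := τ'.f l t) (by rw [← hx']; exact hρ)
    · intro h1
      have hx' := (sends_oneArr hx).unique (h1 ▸ hs')
      rw [← hx'] at hρ
      refine hs.cancel_left hρ.inv hρ hρ ?_
      rw [e, h1, hρ.mul_inv, hx]

/-- Whether the isomorphism agrees with the transition maps of `σ` at `t` does not depend on the
indices chosen and is locally constant in `t`. Agreement at `0` therefore spreads over `[0,1]`: an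
isomorphism of normal systems is rigid. -/
theorem IsNormal.iso_eq_tr {σ : 𝒳.PathSystem o₁ o₂} {τ : 𝒳.PathSystem p₁ p₂}
    {τ' : 𝒳.PathSystem q₁ q₂} (h : σ.IsNormal τ) (h' : σ.IsNormal τ')
    {J : unitInterval → ℕ → ℕ → 𝒳.Arr} (hJ : τ.IsIso τ' J) (h0 : J 0 0 0 = σ.tr 0 0)
    {t : unitInterval} {k l : ℕ} (hk : k ≤ σ.n) (hl : l ≤ σ.n) (htk : t ∈ τ.I k)
    (htl : t ∈ τ'.I l) : J t k l = σ.tr k l := by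
  have hn := h.n_eq
  have hn' := h'.n_eq
  have right : ∀ t, ∀ k ≤ σ.n, t ∈ τ.I k → ∀ l ≤ σ.n, t ∈ τ'.I l → ∀ l' ≤ σ.n, t ∈ τ'.I l' →
      (J t k l = σ.tr k l) = (J t k l' = σ.tr k l') := by
    intro t k hk htk l hl htl l' hl' htl'
    exact τ'.index_induction (fun l => J t k l = σ.tr k l) (fun l hl h1 h2 =>
      propext (h.right_iff h' hJ hk (hn' ▸ hl) htk h1 h2)) (hn'.symm ▸ hl) (hn'.symm ▸ hl') htl htl'
  have left : ∀ t, ∀ l ≤ σ.n, t ∈ τ'.I l → ∀ k ≤ σ.n, t ∈ τ.I k → ∀ k' ≤ σ.n, t ∈ τ.I k' →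
      (J t k l = σ.tr k l) = (J t k' l = σ.tr k' l) := by
    -- Independence of the first index follows from that of the second one, applied to the inverse
    -- isomorphism.
    have hi : ∀ t, ∀ l ≤ σ.n, t ∈ τ'.I l → ∀ k ≤ σ.n, t ∈ τ.I k →
        (J t k l = σ.tr k l ↔ 𝒳.inv (J t k l) = σ.tr l k) := by
      intro t l hl htl k hk htk
      have a1 := σ.le_succ_of_mem hk (h'.I_subset l hl htl) (h.I_subset k hk htk)
      have a2 := σ.le_succ_of_mem hl (h.I_subset k hk htk) (h'.I_subset l hl htl)
      rw [← σ.inv_tr a2 a1]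
      exact ⟨congrArg _, fun e => by rw [← inv_inv (J t k l), e, inv_inv]⟩
    intro t l hl htl k hk htk k' hk' htk'
    rw [propext (hi t l hl htl k hk htk), propext (hi t l hl htl k' hk' htk')]
    exact τ.index_induction (fun k => 𝒳.inv (J t k l) = σ.tr l k) (fun k hk h1 h2 =>
      propext (h'.right_iff h hJ.symm hl (hn ▸ hk) htl h1 h2)) (hn.symm ▸ hk) (hn.symm ▸ hk')
      htk htk'
  have both : ∀ t, ∀ k ≤ σ.n, t ∈ τ.I k → ∀ l ≤ σ.n, t ∈ τ'.I l → ∀ k' ≤ σ.n, t ∈ τ.I k' →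
      ∀ l' ≤ σ.n, t ∈ τ'.I l' → (J t k l = σ.tr k l) = (J t k' l' = σ.tr k' l') :=
    fun t k hk htk l hl htl k' hk' htk' l' hl' htl' =>
      (right t k hk htk l hl htl l' hl' htl').trans (left t l' hl' htl' k hk htk k' hk' htk')
  have hix : ∀ t, τ.ix t ≤ σ.n := fun t => hn ▸ τ.ix_le t
  have hix' : ∀ t, τ'.ix t ≤ σ.n := fun t => hn' ▸ τ'.ix_le t
  -- The locally constant function takes propositions as its values.
  have hc := (isPreconnected_univ (α := unitInterval)).eq_of_eventually_eq
    (f := fun t => J t (τ.ix t) (τ'.ix t) = σ.tr (τ.ix t) (τ'.ix t)) (fun t _ => by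
      rw [nhdsWithin_univ]
      filter_upwards [hJ.loc t _ _ (τ.ix_le t) (τ'.ix_le t) (τ.mem_ix t) (τ'.mem_ix t),
        τ.eventually_mem (τ.ix_le t) (τ.mem_ix t), τ'.eventually_mem (τ'.ix_le t) (τ'.mem_ix t)]
        with s h1 h2 h3
      rw [both s _ (hix s) (τ.mem_ix s) _ (hix' s) (τ'.mem_ix s) _ (hix t) h2 _ (hix' t) h3, h1])
    (mem_univ 0) (mem_univ t)
  rw [both t k hk htk l hl htl _ (hix t) (τ.mem_ix t) _ (hix' t) (τ'.mem_ix t)]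
  refine hc.mp ?_
  rw [← both 0 0 (Nat.zero_le _) τ.zero_mem 0 (Nat.zero_le _) τ'.zero_mem _ (hix 0) (τ.mem_ix 0)
    _ (hix' 0) (τ'.mem_ix 0)]
  exact h0

/-- Normal representatives are unique. -/
theorem Rep.unique {σ : 𝒳.PathSystem o₁ o₂} {a : 𝒳.PathSpace o₁ o₂} {τ : 𝒳.PathSystem p₁ p₂}
    {τ' : 𝒳.PathSystem q₁ q₂} {g g' : 𝒳.Gau} (h : σ.IsNormal τ) (h' : σ.IsNormal τ')
    (hr : Rep a τ g) (hr' : Rep a τ' g') :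
    (∀ k ≤ σ.n, ∀ t ∈ τ.I k, t ∈ τ'.I k → τ.f k t = τ'.f k t) ∧ g o₂.idx = g' o₂.idx := by
  obtain ⟨ω, hω, hi⟩ := hr
  obtain ⟨ω', hω', hi'⟩ := hr'
  have hωω' : ω.IsoVia ω' 1 1 := isoVia_one_iff.2 (cls_eq_iff.1 (hω.trans hω'.symm))
  have e1 := hi.idx_eq
  have H := (hi.symm.trans hωω').trans hi'
  simp only [inv_one, _root_.mul_one] at H
  obtain ⟨J, hJ, h0, h1⟩ := H
  have hn := h.n_eq
  have hn' := h'.n_eq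
  have h0' : J 0 0 0 = σ.tr 0 0 := by
    rw [h0, tr_self, Pi.one_apply, grpArr_one, ← h.chart_eq 0 (Nat.zero_le _), chart_zero]
  have hall : ∀ {t k l}, k ≤ σ.n → l ≤ σ.n → t ∈ τ.I k → t ∈ τ'.I l → J t k l = σ.tr k l :=
    h.iso_eq_tr h' hJ h0'
  constructor
  · intro k hk t ht ht'
    have hs := hJ.sends t k k (hn.symm ▸ hk) (hn'.symm ▸ hk) ht ht'
    rw [hall hk hk ht ht', tr_self] at hs
    exact (sends_oneArr (by rw [τ.f_chart k (hn.symm ▸ hk) t ht, h.chart_eq k hk])).unique hs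
  · have hone : (1 : unitInterval) ∈ τ.I σ.n := hn ▸ τ.one_mem
    have hone' : (1 : unitInterval) ∈ τ'.I σ.n := hn' ▸ τ'.one_mem
    -- At `t = 1` the isomorphism is given by the quotient of `g'` and `g`, and by rigidity it is
    -- also the identity.
    rw [hn, hn', hall le_rfl le_rfl hone hone', tr_self, chart_n, ← e1.2, ← grpArr_one] at h1
    have := grpArr_injective _ h1
    rw [_root_.one_mul, Pi.mul_apply, Pi.inv_apply, eq_comm, mul_inv_eq_one] at this
    rw [← e1.2]
    exact this.symm

theorem rep_self (σ : 𝒳.PathSystem o₁ o₂) : Rep σ.cls σ 1 :=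
  ⟨σ, rfl, isoVia_one_iff.2 (Equiv.refl σ)⟩

theorem isNormal_self (σ : 𝒳.PathSystem o₁ o₂) : σ.IsNormal σ :=
  ⟨rfl, fun _ _ => subset_rfl, fun _ _ => rfl, fun _ _ => rfl⟩

/-- Based paths near a given one have normal representatives near a given normal representative. -/
theorem Rep.eventually {σ : 𝒳.PathSystem o₁ o₂} {a₁ : 𝒳.PathSpace o₁ o₂}
    {τ₁ : 𝒳.PathSystem o₁ p₂} {g₁ : 𝒳.Gau} (h : σ.IsNormal τ₁) (hr : Rep a₁ τ₁ g₁)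
    {K : ℕ → Set unitInterval} {V : ℕ → Set 𝒳.Pt} {U : Set 𝒳.Gau}
    (hK : ∀ k ≤ σ.n, IsCompact (K k) ∧ K k ⊆ τ₁.I k ∧ IsOpen (V k) ∧ ∀ t ∈ K k, τ₁.f k t ∈ V k)
    (hU : U ∈ 𝓝 g₁) :
    ∀ᶠ a in 𝓝 a₁, ∃ (q : 𝒳.BasePoint) (τ : 𝒳.PathSystem o₁ q) (g : 𝒳.Gau), σ.IsNormal τ ∧
      Rep a τ g ∧ g ∈ U ∧ ∀ k ≤ σ.n, K k ⊆ τ.I k ∧ ∀ t ∈ K k, τ.f k t ∈ V k := by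
  classical
  obtain ⟨ω, rfl, hi⟩ := hr
  have hn := h.n_eq
  have hσn := σ.one_le_n
  -- Moving the end of the normal representative back yields an honest system `ω₁` in the class,
  -- around which a basic neighbourhood can be taken.
  let e : ℕ → 𝒳.Gau := fun k => if k = σ.n then g₁⁻¹ else 1
  have he0 : e 0 = 1 := if_neg (by omega)
  have hen : e τ₁.n = g₁⁻¹ := if_pos hn
  have hp1 : o₁.point = gact (e 0) o₁.point := by rw [he0, gact_one]
  have hp2 : o₂.point = gact (e τ₁.n) p₂.point := by
    rw [hen, hi.point_eq.2, gact_inv_gact]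
  let ω₁ : 𝒳.PathSystem o₁ o₂ := τ₁.gauge e hp1 hp2
  have hω₁ : ω.Equiv ω₁ := by
    have := hi.trans (τ₁.isoVia_gauge e hp1 hp2)
    rwa [he0, hen, _root_.one_mul, inv_mul_cancel, isoVia_one_iff] at this
  have hω₁n : ω₁.n = σ.n := hn
  have hW : ∀ k, ∃ M ∈ 𝓝 (1 : 𝒳.Gau), ∃ W, IsOpen W ∧ (k ≤ σ.n → (∀ t ∈ K k, ω₁.f k t ∈ W) ∧
      ∀ g ∈ M, ∀ x ∈ W, gact (e k)⁻¹ (gact g x) ∈ V k) := fun k => by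
    by_cases hk : k ≤ σ.n
    · obtain ⟨hc, hI, hV, hfV⟩ := hK k hk
      obtain ⟨M, hM, W, hW, h1, h2⟩ := exists_gact_subset (C := ω₁.f k '' K k)
        (V := gact (e k)⁻¹ ⁻¹' V k)
        (hc.image_of_continuousOn ((ω₁.continuousOn_f k (hω₁n.symm ▸ hk)).mono hI))
        (hV.preimage (continuous_gact_left _)) (by
          rintro _ ⟨t, ht, rfl⟩
          change gact (e k)⁻¹ (gact (e k) (τ₁.f k t)) ∈ V k
          rw [gact_inv_gact]
          exact hfV t ht)
      exact ⟨M, hM, W, hW, fun _ => ⟨fun t ht => h1 ⟨t, ht, rfl⟩, h2⟩⟩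
    · exact ⟨univ, Filter.univ_mem, univ, isOpen_univ, fun h => absurd h hk⟩
  choose M hM W hWo hW using hW
  have hMn : {δ : 𝒳.Gau | (∀ k ∈ Iic σ.n, δ ∈ M k) ∧ g₁ * δ ∈ U} ∈ 𝓝 (1 : 𝒳.Gau) := by
    refine Filter.Eventually.and ((Filter.eventually_all_finite (Set.finite_Iic _)).2
      fun k _ => hM k) ?_
    have : Filter.Tendsto (fun δ : 𝒳.Gau => g₁ * δ) (𝓝 1) (𝓝 g₁) := by
      simpa using (continuous_const_mul g₁).tendsto (1 : 𝒳.Gau)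
    exact this hU
  obtain ⟨N, hN, hnorm⟩ := exists_normalization ω₁.ρ σ.n hMn
  obtain ⟨N', hN'N, hN', h1N'⟩ := mem_nhds_iff.1 hN
  -- The openness of these sets of transition maps is `isOpen_lact_image`; membership provides the
  -- small factors which `exists_normalization` removes.
  have hopen : IsOpen (ω₁.nbhd K W fun k => (fun g => lact g (ω₁.ρ k) 1) '' N') := by
    refine isOpen_nbhd _ _ _ _ (fun k hk => ?_) fun k hk => ?_
    · rw [hω₁n] at hk
      exact ⟨(hK k hk).1, (hK k hk).2.1, hWo k, (hW k hk).1⟩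
    · exact ⟨isOpen_lact_image _ hN', 1, h1N', lact_one_one _⟩
  have hmem : ω.cls ∈ ω₁.nbhd K W fun k => (fun g => lact g (ω₁.ρ k) 1) '' N' :=
    ⟨ω₁, hω₁.cls_eq.symm, rfl, fun k hk => by
      rw [hω₁n] at hk
      exact ⟨(hK k hk).2.1, subset_rfl, rfl⟩, fun k hk => by
      rw [hω₁n] at hk
      exact (hW k hk).1, fun k hk => ⟨1, h1N', lact_one_one _⟩⟩
  filter_upwards [hopen.mem_nhds hmem]
  rintro _ ⟨φ, rfl, hφn, hφI, hφV, hφρ⟩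
  rw [hω₁n] at hφn hφI hφV hφρ
  have hex : ∀ k, ∃ g : 𝒳.Gau, k < σ.n → g ∈ N' ∧ lact g (ω₁.ρ k) 1 = φ.ρ k := fun k => by
    by_cases hk : k < σ.n
    · obtain ⟨g, h1, h2⟩ := hφρ k hk
      exact ⟨g, fun _ => ⟨h1, h2⟩⟩
    · exact ⟨1, fun h => absurd h hk⟩
  choose η hη using hex
  obtain ⟨δ, hδ0, hδ, hδρ⟩ := hnorm η fun k hk => hN'N (hη k hk).1
  -- First restore the transition maps of `ω₁` by `δ`, then undo `e` to return to those of `σ`. The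
  -- end point is moved by `g₁ * δ σ.n`, which is close to `g₁`.
  let G : ℕ → 𝒳.Gau := fun k => (e k)⁻¹ * δ k
  have hG0 : G 0 = 1 := by simp only [G, he0, hδ0, inv_one, _root_.mul_one]
  have hGn : G σ.n = g₁ * δ σ.n := by simp only [G, e, if_true, _root_.inv_inv]
  let q : 𝒳.BasePoint := ptBase (gact (G φ.n) o₂.point)
  have hq1 : o₁.point = gact (G 0) o₁.point := by rw [hG0, gact_one]
  refine ⟨q, φ.gauge G hq1 rfl, G φ.n, ⟨hφn, fun k hk => ?_, fun k hk => ?_, fun k hk => ?_⟩,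
    ⟨φ, rfl, ?_⟩, ?_, fun k hk => ⟨(hφI k hk).1, fun t ht => ?_⟩⟩
  · exact (hφI k hk).2.1.trans (h.I_subset k hk)
  · exact (hφI k hk).2.2.trans (h.chart_eq k hk)
  · change lact ((e (k + 1))⁻¹ * δ (k + 1)) (φ.ρ k) ((e k)⁻¹ * δ k)⁻¹ = σ.ρ k
    rw [mul_inv_rev, _root_.inv_inv, ← lact_lact, ← (hη k hk).2, hδρ k hk]
    change lact _ (lact (e (k + 1)) (τ₁.ρ k) (e k)⁻¹) _ = _
    rw [lact_lact, inv_mul_cancel, inv_mul_cancel, lact_one_one, h.ρ_eq k hk]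
  · have := φ.isoVia_gauge (p₁ := o₁) (p₂ := q) G hq1 rfl
    rwa [hG0] at this
  · rw [hφn, hGn]
    exact (hδ σ.n le_rfl).2
  · change gact ((e k)⁻¹ * δ k) (φ.f k t) ∈ V k
    rw [← gact_gact]
    exact (hW k hk).2 _ ((hδ k hk).1 k hk) _ (hφV k hk t ht)

end PathSystem

end Representative

end Orbispace

/-! ### Local systems with values in a group, and their holonomy along systems. -/

namespace Orbispace

section Interval

/-- The point `(1 - r) s + r t`. -/
noncomputable def lerp (s t r : unitInterval) : unitInterval :=
  ⟨(1 - r) * s + r * t, by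
    have h1 := r.2.1; have h2 := r.2.2; have h3 := s.2.1; have h4 := t.2.1
    have h5 : (0 : ℝ) ≤ 1 - r := by linarith
    positivity, by
    have h1 := r.2.1; have h2 := r.2.2; have h3 := s.2.2; have h4 := t.2.2
    nlinarith⟩

theorem coe_lerp (s t r : unitInterval) : (lerp s t r : ℝ) = (1 - r) * s + r * t := rfl

@[simp] theorem lerp_zero (s t : unitInterval) : lerp s t 0 = s := by
  ext; simp [coe_lerp]

@[simp] theorem lerp_one (s t : unitInterval) : lerp s t 1 = t := by
  ext; simp [coe_lerp]

@[simp] theorem lerp_self (s r : unitInterval) : lerp s s r = s := by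
  ext; simp [coe_lerp]; ring

theorem continuous_lerp :
    Continuous fun p : unitInterval × unitInterval × unitInterval => lerp p.1 p.2.1 p.2.2 :=
  Continuous.subtype_mk (by fun_prop) _

theorem _root_.Continuous.lerp {Z : Type*} [TopologicalSpace Z] {f g h : Z → unitInterval}
    (hf : Continuous f) (hg : Continuous g) (hh : Continuous h) :
    Continuous fun z => Orbispace.lerp (f z) (g z) (h z) :=
  continuous_lerp.comp (hf.prodMk (hg.prodMk hh))

theorem lerp_mem_uIcc (s t r : unitInterval) : lerp s t r ∈ uIcc s t := by
  have h1 := r.2.1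
  have h2 := r.2.2
  rcases le_total s t with h | h
  · rw [uIcc_of_le h]
    have h' : (s : ℝ) ≤ t := h
    constructor
    · change (s : ℝ) ≤ (1 - r) * s + r * t
      nlinarith
    · change (1 - r) * s + r * t ≤ (t : ℝ)
      nlinarith
  · rw [uIcc_of_ge h]
    have h' : (t : ℝ) ≤ s := h
    constructor
    · change (t : ℝ) ≤ (1 - r) * s + r * t
      nlinarith
    · change (1 - r) * s + r * t ≤ (s : ℝ)
      nlinarith

theorem lerp_mem {J : Set unitInterval} (hJ : J.OrdConnected) {s t : unitInterval} (hs : s ∈ J)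
    (ht : t ∈ J) (r : unitInterval) : lerp s t r ∈ J :=
  hJ.uIcc_subset hs ht (lerp_mem_uIcc s t r)

/-- The part of a path between the parameters `s` and `t`. -/
noncomputable def seg {Y : Type*} (f : unitInterval → Y) (s t r : unitInterval) : Y :=
  f (lerp s t r)

theorem continuous_seg {Y : Type*} [TopologicalSpace Y] {f : unitInterval → Y}
    {J : Set unitInterval} (hf : ContinuousOn f J) (hJ : J.OrdConnected) {s t : unitInterval}
    (hs : s ∈ J) (ht : t ∈ J) : Continuous (seg f s t) :=
  hf.comp_continuous (continuous_const.lerp continuous_const continuous_id)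
    fun r => lerp_mem hJ hs ht r

end Interval

/-- A local system with values in the group `H` on the charts in `S`: parallel transport `T` along
transition maps and `P` along paths in the spaces `Û`, invariant under homotopies. -/
structure LocalSystem {X : Type u} [TopologicalSpace X] (𝒳 : Orbispace X) (S : Set 𝒳.Idx)
    (H : Type v) [Group H] where
  T : 𝒳.Arr → 𝒳.Pt → H
  P : (unitInterval → 𝒳.Pt) → H
  square : ∀ Q : unitInterval × unitInterval → 𝒳.Pt, Continuous Q → (∀ p, (Q p).1 ∈ S) →
    P (fun t => Q (t, 0)) * P (fun t => Q (1, t)) = P (fun t => Q (0, t)) * P (fun t => Q (t, 1))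
  arr : ∀ (a : 𝒳.Arr) (f g : unitInterval → 𝒳.Pt), Continuous f → Continuous g →
    (∀ t, (f t).1 ∈ S) → (∀ t, (g t).1 ∈ S) → (∀ t, 𝒳.Sends a (f t) (g t)) →
    P f * T a (f 1) = T a (f 0) * P g
  comp : ∀ {a b : 𝒳.Arr} {x y z : 𝒳.Pt}, x.1 ∈ S → y.1 ∈ S → z.1 ∈ S → 𝒳.Sends a x y →
    𝒳.Sends b y z → T (𝒳.mul b a x) x = T a x * T b y
  -- This axiom accounts for the topology of the groups: the group element at the end of a normal
  -- representative may vary during a homotopy, and the path it sweeps out must be transported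
  -- consistently.
  grp : ∀ i ∈ S, ∀ (x : (𝒳.str i).Cov) (h : unitInterval → (𝒳.str i).Grp), Continuous h →
    P (fun t => ⟨i, h t • x⟩) = (T (𝒳.grpArr i (h 0)) ⟨i, x⟩)⁻¹ * T (𝒳.grpArr i (h 1)) ⟨i, x⟩

section Holonomy

variable {X : Type u} [TopologicalSpace X] {𝒳 : Orbispace X} {S : Set 𝒳.Idx} {H : Type v} [Group H]
  (D : LocalSystem 𝒳 S H)

namespace LocalSystem

theorem T_one {x : 𝒳.Pt} (hx : x.1 ∈ S) : D.T (𝒳.oneArr x.1) x = 1 := by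
  have := D.comp hx hx hx (sends_one x) (sends_one x)
  rw [(sends_one x).one_mul] at this
  exact left_eq_mul.1 this

/-- A constant path is the orbit path of the constant group element `1`. -/
theorem P_const {x : 𝒳.Pt} (hx : x.1 ∈ S) : D.P (fun _ => x) = 1 := by
  have := D.grp x.1 hx x.2 (fun _ => 1) continuous_const
  simpa only [one_smul, grpArr_one, D.T_one hx, inv_one, mul_one] using this

/-- A triangle is a square with one side collapsed to a point; here it is degenerate, with all its
values on the path `f`. -/
theorem P_seg_mul {f : unitInterval → 𝒳.Pt} {J : Set unitInterval} (hf : ContinuousOn f J)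
    (hJ : J.OrdConnected) (hS : ∀ t ∈ J, (f t).1 ∈ S) {r s t : unitInterval} (hr : r ∈ J)
    (hs : s ∈ J) (ht : t ∈ J) : D.P (seg f r s) * D.P (seg f s t) = D.P (seg f r t) := by
  have hm : ∀ p : unitInterval × unitInterval, lerp r (lerp s t p.2) p.1 ∈ J := fun p =>
    lerp_mem hJ hr (lerp_mem hJ hs ht _) _
  have := D.square (fun p => f (lerp r (lerp s t p.2) p.1))
    (hf.comp_continuous (continuous_const.lerp
      (continuous_const.lerp continuous_const continuous_snd) continuous_fst) hm)
    fun p => hS _ (hm p)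
  simp only [lerp_zero, lerp_one] at this
  rw [D.P_const (hS r hr), one_mul] at this
  exact this

/-- A parallel section of the local system along a system of paths. -/
structure IsTransport {o₁ o₂ : 𝒳.BasePoint} (σ : 𝒳.PathSystem o₁ o₂)
    (u : ℕ → unitInterval → H) : Prop where
  path : ∀ k ≤ σ.n, ∀ s ∈ σ.I k, ∀ t ∈ σ.I k, u k t = u k s * D.P (seg (σ.f k) s t)
  jump : ∀ k < σ.n, ∀ t, t ∈ σ.I k → t ∈ σ.I (k + 1) → u (k + 1) t = u k t * D.T (σ.ρ k) (σ.f k t)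

end LocalSystem

/-- The charts of a system belong to `S`. -/
def PathSystem.InCharts {o₁ o₂ : 𝒳.BasePoint} (σ : 𝒳.PathSystem o₁ o₂) (S : Set 𝒳.Idx) : Prop :=
  ∀ k ≤ σ.n, σ.chart k ∈ S

theorem PathSystem.InCharts.mem {o₁ o₂ : 𝒳.BasePoint} {σ : 𝒳.PathSystem o₁ o₂}
    (hσ : σ.InCharts S) {k : ℕ} (hk : k ≤ σ.n) {t : unitInterval} (ht : t ∈ σ.I k) :
    (σ.f k t).1 ∈ S := by
  rw [σ.f_chart k hk t ht]; exact hσ k hk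

namespace LocalSystem

variable {D} {o₁ o₂ o₃ p₁ p₂ : 𝒳.BasePoint}

/-- Transport within each interval from a chosen point, and jump at a chosen point of each overlap.
That the jump condition then holds on the whole overlap is the naturality axiom `arr`. -/
theorem exists_isTransport {σ : 𝒳.PathSystem o₁ o₂} (hσ : σ.InCharts S) :
    ∃ u, D.IsTransport σ u ∧ u 0 0 = 1 := by
  have hm : ∀ k, ∃ t, k < σ.n → t ∈ σ.I k ∧ t ∈ σ.I (k + 1) := fun k => by
    by_cases hk : k < σ.n
    · obtain ⟨t, h⟩ := σ.exists_mem_inter hk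
      exact ⟨t, fun _ => h⟩
    · exact ⟨0, fun h => absurd h hk⟩
  choose m hm using hm
  -- The point `m k` lies in the overlap of the intervals `k` and `k + 1`; accordingly the interval
  -- `k + 1` starts from `m k`, and the interval `0` from `0`.
  let b : ℕ → unitInterval := fun k => Nat.casesOn k 0 m
  let c : ℕ → H := fun k => Nat.rec 1 (fun k c =>
    c * D.P (seg (σ.f k) (b k) (m k)) * D.T (σ.ρ k) (σ.f k (m k))) k
  have hb : ∀ k ≤ σ.n, b k ∈ σ.I k := by
    intro k hk
    cases k with
    | zero => exact σ.zero_mem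
    | succ k => exact (hm k hk).2
  have hadd : ∀ k ≤ σ.n, ∀ r ∈ σ.I k, ∀ s ∈ σ.I k, ∀ t ∈ σ.I k,
      D.P (seg (σ.f k) r s) * D.P (seg (σ.f k) s t) = D.P (seg (σ.f k) r t) :=
    fun k hk r hr s hs t ht => D.P_seg_mul (σ.continuousOn_f k hk) (σ.ordConnected_I k hk)
      (fun t ht => hσ.mem hk ht) hr hs ht
  refine ⟨fun k t => c k * D.P (seg (σ.f k) (b k) t), ⟨fun k hk s hs t ht => ?_,
    fun k hk t ht ht' => ?_⟩, ?_⟩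
  · rw [mul_assoc, hadd k hk _ (hb k hk) s hs t ht]
  · change c k * D.P (seg (σ.f k) (b k) (m k)) * D.T (σ.ρ k) (σ.f k (m k)) *
      D.P (seg (σ.f (k + 1)) (m k) t) = c k * D.P (seg (σ.f k) (b k) t) * D.T (σ.ρ k) (σ.f k t)
    have hJ := σ.ordConnected_I k hk.le
    have hJ' := σ.ordConnected_I (k + 1) hk
    obtain ⟨h1, h2⟩ := hm k hk
    have := D.arr (σ.ρ k) (seg (σ.f k) (m k) t) (seg (σ.f (k + 1)) (m k) t)
      (continuous_seg (σ.continuousOn_f k hk.le) hJ h1 ht)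
      (continuous_seg (σ.continuousOn_f (k + 1) hk) hJ' h2 ht')
      (fun r => hσ.mem hk.le (lerp_mem hJ h1 ht r)) (fun r => hσ.mem hk (lerp_mem hJ' h2 ht' r))
      (fun r => σ.ρ_sends k hk _ ⟨lerp_mem hJ h1 ht r, lerp_mem hJ' h2 ht' r⟩)
    simp only [seg, lerp_zero, lerp_one] at this
    rw [mul_assoc (c k * _), ← this, ← hadd k hk.le _ (hb k hk.le) _ h1 t ht]
    simp only [mul_assoc]
  · change 1 * D.P (seg (σ.f 0) 0 0) = 1
    have : seg (σ.f 0) 0 0 = fun _ => σ.f 0 0 := funext fun r => by rw [seg, lerp_self]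
    rw [one_mul, this, D.P_const (hσ.mem (Nat.zero_le _) σ.zero_mem)]

theorem IsTransport.mul_left {σ : 𝒳.PathSystem o₁ o₂} {u : ℕ → unitInterval → H}
    (hu : D.IsTransport σ u) (c : H) : D.IsTransport σ fun k t => c * u k t where
  path k hk s hs t ht := by rw [hu.path k hk s hs t ht, mul_assoc]
  jump k hk t ht ht' := by rw [hu.jump k hk t ht ht', mul_assoc]

/-- Consecutive intervals meet, so the value at `0` propagates through all of them. Holonomy can
therefore be computed from any parallel section. -/
theorem IsTransport.unique {σ : 𝒳.PathSystem o₁ o₂} {u u' : ℕ → unitInterval → H}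
    (hu : D.IsTransport σ u) (hu' : D.IsTransport σ u') (h0 : u 0 0 = u' 0 0) :
    ∀ k ≤ σ.n, ∀ t ∈ σ.I k, u k t = u' k t := by
  intro k
  induction k with
  | zero =>
    intro hk t ht
    rw [hu.path 0 hk 0 σ.zero_mem t ht, hu'.path 0 hk 0 σ.zero_mem t ht, h0]
  | succ k ih =>
    intro hk t ht
    obtain ⟨s, hs, hs'⟩ := σ.exists_mem_inter hk
    rw [hu.path _ hk s hs' t ht, hu'.path _ hk s hs' t ht, hu.jump k hk s hs hs',
      hu'.jump k hk s hs hs', ih (Nat.le_of_succ_le hk) s hs]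

variable (D) in
open Classical in
/-- The holonomy along a system with charts in `S`. -/
noncomputable def hol (σ : 𝒳.PathSystem o₁ o₂) : H :=
  if h : σ.InCharts S then (exists_isTransport (D := D) h).choose σ.n 1 else 1

theorem IsTransport.hol_eq {σ : 𝒳.PathSystem o₁ o₂} (hσ : σ.InCharts S)
    {u : ℕ → unitInterval → H} (hu : D.IsTransport σ u) :
    D.hol σ = (u 0 0)⁻¹ * u σ.n 1 := by
  rw [hol, dif_pos hσ]
  obtain ⟨h1, h2⟩ := (exists_isTransport (D := D) hσ).choose_spec
  exact h1.unique (hu.mul_left (u 0 0)⁻¹) (by rw [h2, inv_mul_cancel]) _ le_rfl 1 σ.one_mem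

/-- A parallel section of `σ`, multiplied by the inverse transport along the maps `j k`, is parallel
along `κ`. It has the same values at both ends because `j` is the identity there. -/
theorem hol_refines {κ σ : 𝒳.PathSystem o₁ o₂} (hκ : κ.InCharts S) (hσ : σ.InCharts S)
    (h : κ.Refines σ) : D.hol κ = D.hol σ := by
  obtain ⟨θ, j, hI, hθ0, hθn, hj0, hjn, hst, hs, hc⟩ := h
  obtain ⟨u, hu, -⟩ := exists_isTransport (D := D) hσ
  have h0 : o₁.point.1 ∈ S := by
    rw [← σ.f_zero]; exact hσ.mem (Nat.zero_le _) σ.zero_mem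
  have h1 : o₂.point.1 ∈ S := by
    rw [← σ.f_one]; exact hσ.mem le_rfl σ.one_mem
  have hw : D.IsTransport κ fun k t => u (θ k) t * (D.T (j k) (κ.f k t))⁻¹ := by
    refine ⟨fun k hk s hs' t ht => ?_, fun k hk t ht ht' => ?_⟩
    · obtain ⟨hle, hsub⟩ := hI k hk
      have hJ := κ.ordConnected_I k hk
      have hJ' := σ.ordConnected_I (θ k) hle
      have := D.arr (j k) (seg (κ.f k) s t) (seg (σ.f (θ k)) s t)
        (continuous_seg (κ.continuousOn_f k hk) hJ hs' ht)
        (continuous_seg (σ.continuousOn_f _ hle) hJ' (hsub hs') (hsub ht))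
        (fun r => hκ.mem hk (lerp_mem hJ hs' ht r))
        (fun r => hσ.mem hle (lerp_mem hJ' (hsub hs') (hsub ht) r))
        (fun r => hs k hk _ (lerp_mem hJ hs' ht r))
      simp only [seg, lerp_zero, lerp_one] at this
      rw [hu.path _ hle s (hsub hs') t (hsub ht), mul_assoc, mul_assoc]
      congr 1
      rw [eq_inv_mul_iff_mul_eq, ← mul_assoc, mul_inv_eq_iff_eq_mul]
      exact this.symm
    · obtain ⟨b1, m1⟩ := hI k hk.le
      obtain ⟨b2, m2⟩ := hI (k + 1) hk
      have i1 := m1 ht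
      have i2 := m2 ht'
      have c1 := σ.le_succ_of_mem b2 i1 i2
      have c2 := σ.le_succ_of_mem b1 i2 i1
      have hρ := κ.ρ_sends k hk t ⟨ht, ht'⟩
      have s1 := hs k hk.le t ht
      have s2 := hs (k + 1) hk t ht'
      have k1 := hκ.mem hk.le ht
      have k2 := hκ.mem hk ht'
      have k3 := hσ.mem b1 i1
      have k4 := hσ.mem b2 i2
      have e2 := D.comp k1 k2 k4 hρ s2
      obtain ⟨q1, q2, q3⟩ := hc k hk t ⟨ht, ht'⟩
      obtain e | e | e : θ (k + 1) = θ k ∨ θ (k + 1) = θ k + 1 ∨ θ k = θ (k + 1) + 1 := by omega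
      · rw [(q1 e).mul_eq] at e2
        rw [e, e2]; group
      · obtain ⟨c, hc1, hc2⟩ := q2 e
        rw [hc1.mul_eq] at e2
        rw [e] at b2 i2
        have s3 := σ.ρ_sends _ b2 t ⟨i1, i2⟩
        have e3 := D.comp k1 k3 (by rw [σ.f_chart _ b2 t i2]; exact hσ _ b2) s1 s3
        rw [hc2.mul_eq, e2] at e3
        rw [e, hu.jump _ b2 t i1 i2, mul_inv_eq_iff_eq_mul, mul_assoc, e3]
        group
      · obtain ⟨c, hc1, hc2⟩ := q3 e
        rw [hc1.mul_eq] at e2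
        rw [e] at b1 i1 k3
        have s3 := σ.ρ_sends _ b1 t ⟨i2, i1⟩
        have e3 := D.comp k1 k4 k3 (hc1.sends hρ s2) s3
        rw [hc2.mul_eq, e2] at e3
        rw [e, hu.jump _ b1 t i2 i1, e3]
        group
  rw [hw.hol_eq hκ, hu.hol_eq hσ, hθ0, hθn, hj0, hjn, κ.f_zero, κ.f_one]
  change (u 0 0 * (D.T (𝒳.oneArr o₁.point.1) _)⁻¹)⁻¹ * (_ * (D.T (𝒳.oneArr o₂.point.1) _)⁻¹) = _
  rw [D.T_one h0, D.T_one h1, inv_one, mul_one, mul_one]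

theorem hol_eq_of_cls_eq {σ τ : 𝒳.PathSystem o₁ o₂} (hσ : σ.InCharts S) (hτ : τ.InCharts S)
    (h : σ.cls = τ.cls) : D.hol σ = D.hol τ := by
  obtain ⟨κ, h1, h2, h3⟩ := (PathSystem.cls_eq_iff.1 h).exists_common_refinement
  have hκ : κ.InCharts S := fun k hk => by
    obtain ⟨l, hl, e⟩ := h3 k hk
    rw [e]; exact hσ l hl
  rw [← hol_refines hκ hσ h1, hol_refines hκ hτ h2]

theorem seg_dblL {Y : Type*} (f : unitInterval → Y) {s t : unitInterval} (hs : s ≤ half)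
    (ht : t ≤ half) : seg (fun r => f (dblL r)) s t = seg f (dblL s) (dblL t) := by
  have hd : ∀ r ≤ half, (dblL r : ℝ) = 2 * r := fun r hr => by
    have h1 : (r : ℝ) ≤ 1 / 2 := hr
    have h2 := r.2.1
    exact congrArg Subtype.val (projIcc_of_mem (zero_le_one' ℝ) (x := 2 * (r : ℝ))
      ⟨by linarith, by linarith⟩)
  funext r
  refine congrArg f (Subtype.ext ?_)
  have hm : lerp s t r ≤ half := (ordConnected_Iic (a := half)).uIcc_subset hs ht
    (lerp_mem_uIcc s t r)
  rw [hd _ hm, coe_lerp, coe_lerp, hd s hs, hd t ht]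
  ring

theorem seg_dblR {Y : Type*} (f : unitInterval → Y) {s t : unitInterval} (hs : half ≤ s)
    (ht : half ≤ t) : seg (fun r => f (dblR r)) s t = seg f (dblR s) (dblR t) := by
  have hd : ∀ r, half ≤ r → (dblR r : ℝ) = 2 * r - 1 := fun r hr => by
    have h1 : 1 / 2 ≤ (r : ℝ) := hr
    have h2 := r.2.2
    exact congrArg Subtype.val (projIcc_of_mem (zero_le_one' ℝ) (x := 2 * (r : ℝ) - 1)
      ⟨by linarith, by linarith⟩)
  funext r
  refine congrArg f (Subtype.ext ?_)
  have hm : half ≤ lerp s t r := (ordConnected_Ici (a := half)).uIcc_subset hs ht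
    (lerp_mem_uIcc s t r)
  rw [hd _ hm, coe_lerp, coe_lerp, hd s hs, hd t ht]
  ring

theorem inCharts_concat {σ : 𝒳.PathSystem o₁ o₂} {τ : 𝒳.PathSystem o₂ o₃} (hσ : σ.InCharts S)
    (hτ : τ.InCharts S) : (σ.concat τ).InCharts S := by
  intro k hk
  have hk' : k ≤ σ.n + τ.n := hk
  rcases le_total k σ.n with h | h
  · rw [PathSystem.concat_chart_left h]; exact hσ k h
  · rw [PathSystem.concat_chart_right h]; exact hτ _ (by omega)

theorem _root_.Orbispace.PathSystem.mem_concat_le {σ : 𝒳.PathSystem o₁ o₂}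
    {τ : 𝒳.PathSystem o₂ o₃} {k : ℕ} {t : unitInterval} (ht : t ≤ half)
    (h : t ∈ (σ.concat τ).I k) : k ≤ σ.n ∧ dblL t ∈ σ.I k := by
  rcases ht.lt_or_eq with ht | rfl
  · exact (PathSystem.mem_concat_left ht).1 h
  · obtain rfl := PathSystem.mem_concat_half.1 h
    rw [dblL_of_le le_rfl]
    exact ⟨le_rfl, σ.one_mem⟩

theorem _root_.Orbispace.PathSystem.mem_concat_ge {σ : 𝒳.PathSystem o₁ o₂}
    {τ : 𝒳.PathSystem o₂ o₃} {k : ℕ} {t : unitInterval} (ht : half ≤ t)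
    (h : t ∈ (σ.concat τ).I k) :
    σ.n ≤ k ∧ dblR t ∈ τ.I (k - σ.n) ∧ (k = σ.n ∨ half < t) := by
  rcases ht.eq_or_lt with rfl | ht
  · obtain rfl := PathSystem.mem_concat_half.1 h
    rw [dblR_of_le le_rfl, Nat.sub_self]
    exact ⟨le_rfl, τ.zero_mem, Or.inl rfl⟩
  · have := (PathSystem.mem_concat_right ht).1 h
    exact ⟨this.1, this.2, Or.inr ht⟩

theorem _root_.Orbispace.PathSystem.concat_f_ge {σ : 𝒳.PathSystem o₁ o₂}
    {τ : 𝒳.PathSystem o₂ o₃} {k : ℕ} {t : unitInterval} (ht : half ≤ t)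
    (h : t ∈ (σ.concat τ).I k) : (σ.concat τ).f k t = τ.f (k - σ.n) (dblR t) := by
  rcases ht.eq_or_lt with rfl | ht'
  · obtain rfl := PathSystem.mem_concat_half.1 h
    rw [PathSystem.concat_f_left le_rfl le_rfl, dblL_of_le le_rfl, dblR_of_le le_rfl,
      Nat.sub_self, σ.f_one, τ.f_zero]
  · exact PathSystem.concat_f_right ht' (PathSystem.mem_concat_ge ht h).1

/-- Parallel sections of the two systems are placed side by side, each at double speed. The new work
is in the merged middle interval, where transport is split at `1/2`. -/
theorem hol_concat {σ : 𝒳.PathSystem o₁ o₂} {τ : 𝒳.PathSystem o₂ o₃} (hσ : σ.InCharts S)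
    (hτ : τ.InCharts S) : D.hol (σ.concat τ) = D.hol σ * D.hol τ := by
  classical
  obtain ⟨u, hu, hu0⟩ := exists_isTransport (D := D) hσ
  obtain ⟨v', hv', hv0'⟩ := exists_isTransport (D := D) hτ
  -- The second section is rescaled so that it starts where the first one ends.
  obtain ⟨v, hv, hv0⟩ : ∃ v, D.IsTransport τ v ∧ v 0 0 = u σ.n 1 :=
    ⟨_, hv'.mul_left (u σ.n 1), by simp only [hv0', mul_one]⟩
  have hn : (σ.concat τ).n = σ.n + τ.n := rfl
  have hS := inCharts_concat hσ hτ
  let w : ℕ → unitInterval → H := fun k t =>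
    if k < σ.n ∨ (k = σ.n ∧ t ≤ half) then u k (dblL t) else v (k - σ.n) (dblR t)
  have wL : ∀ k ≤ σ.n, ∀ t ≤ half, w k t = u k (dblL t) := fun k hk t ht =>
    if_pos (hk.lt_or_eq.imp id fun h => ⟨h, ht⟩)
  have wR : ∀ k, σ.n ≤ k → ∀ t, half ≤ t → (k = σ.n ∨ half < t) → w k t = v (k - σ.n) (dblR t) := by
    intro k hk t ht h
    rcases ht.eq_or_lt with rfl | ht
    · obtain rfl : k = σ.n := h.resolve_right (lt_irrefl _)
      rw [wL _ le_rfl _ le_rfl, dblL_of_le le_rfl, dblR_of_le le_rfl, Nat.sub_self, hv0]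
    · exact if_neg (by rintro (h | ⟨_, h⟩); exacts [hk.not_gt h, ht.not_ge h])
  have pL : ∀ k ≤ (σ.concat τ).n, ∀ s ∈ (σ.concat τ).I k, ∀ t ∈ (σ.concat τ).I k, s ≤ half →
      t ≤ half → w k t = w k s * D.P (seg ((σ.concat τ).f k) s t) := by
    intro k hk s hs t ht h1 h2
    obtain ⟨hk', hs'⟩ := PathSystem.mem_concat_le h1 hs
    obtain ⟨-, ht'⟩ := PathSystem.mem_concat_le h2 ht
    have e : seg ((σ.concat τ).f k) s t = seg (fun r => σ.f k (dblL r)) s t := by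
      funext r
      refine PathSystem.concat_f_left ?_ hk'
      exact (ordConnected_Iic (a := half)).uIcc_subset h1 h2 (lerp_mem_uIcc s t r)
    rw [e, seg_dblL _ h1 h2, wL k hk' t h2, wL k hk' s h1, hu.path k hk' _ hs' _ ht']
  have pR : ∀ k ≤ (σ.concat τ).n, ∀ s ∈ (σ.concat τ).I k, ∀ t ∈ (σ.concat τ).I k, half ≤ s →
      half ≤ t → w k t = w k s * D.P (seg ((σ.concat τ).f k) s t) := by
    intro k hk s hs t ht h1 h2
    obtain ⟨hk', hs', hor⟩ := PathSystem.mem_concat_ge h1 hs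
    obtain ⟨-, ht', hor'⟩ := PathSystem.mem_concat_ge h2 ht
    have e : seg ((σ.concat τ).f k) s t = seg (fun r => τ.f (k - σ.n) (dblR r)) s t := by
      funext r
      have hm := (ordConnected_Ici (a := half)).uIcc_subset h1 h2 (lerp_mem_uIcc s t r)
      have hI := lerp_mem ((σ.concat τ).ordConnected_I k hk) hs ht r
      exact PathSystem.concat_f_ge hm hI
    rw [e, seg_dblR _ h1 h2, wR k hk' t h2 hor', wR k hk' s h1 hor,
      hv.path _ (by omega) _ hs' _ ht']
  have hadd : ∀ k ≤ (σ.concat τ).n, ∀ r ∈ (σ.concat τ).I k, ∀ s ∈ (σ.concat τ).I k,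
      ∀ t ∈ (σ.concat τ).I k, D.P (seg ((σ.concat τ).f k) r s) * D.P (seg ((σ.concat τ).f k) s t) =
        D.P (seg ((σ.concat τ).f k) r t) :=
    fun k hk r hr s hs t ht => D.P_seg_mul ((σ.concat τ).continuousOn_f k hk)
      ((σ.concat τ).ordConnected_I k hk) (fun t ht => hS.mem hk ht) hr hs ht
  have hw : D.IsTransport (σ.concat τ) w := by
    refine ⟨fun k hk s hs t ht => ?_, fun k hk t ht ht' => ?_⟩
    · rcases le_total s half with h1 | h1 <;> rcases le_total t half with h2 | h2
      · exact pL k hk s hs t ht h1 h2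
      · have hh := ((σ.concat τ).ordConnected_I k hk).out hs ht ⟨h1, h2⟩
        rw [pR k hk _ hh t ht le_rfl h2, pL k hk s hs _ hh h1 le_rfl, mul_assoc,
          hadd k hk s hs _ hh t ht]
      · have hh := ((σ.concat τ).ordConnected_I k hk).out ht hs ⟨h2, h1⟩
        rw [pL k hk _ hh t ht le_rfl h2, pR k hk s hs _ hh h1 le_rfl, mul_assoc,
          hadd k hk s hs _ hh t ht]
      · exact pR k hk s hs t ht h1 h2
    -- No jump takes place at `1/2`, which lies in the merged interval alone.
    · have hne : t ≠ half := by
        rintro rfl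
        have := PathSystem.mem_concat_half.1 ht
        have := PathSystem.mem_concat_half.1 ht'
        omega
      rcases lt_or_gt_of_ne hne with h | h
      · obtain ⟨h1, h2⟩ := PathSystem.mem_concat_le h.le ht
        obtain ⟨h3, h4⟩ := PathSystem.mem_concat_le h.le ht'
        rw [wL _ h3 t h.le, wL k h1 t h.le, hu.jump k h3 _ h2 h4, PathSystem.concat_rho_left h3,
          PathSystem.concat_f_left h.le h1]
      · obtain ⟨h1, h2, h5⟩ := PathSystem.mem_concat_ge h.le ht
        obtain ⟨h3, h4, h6⟩ := PathSystem.mem_concat_ge h.le ht'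
        rw [wR _ h3 t h.le h6, wR k h1 t h.le h5, PathSystem.concat_rho_right h1,
          PathSystem.concat_f_right h h1]
        rw [Nat.succ_sub h1] at h4 ⊢
        exact hv.jump _ (by omega) _ h2 h4
  have hpos := τ.one_le_n
  rw [hw.hol_eq hS, hu.hol_eq hσ, hv.hol_eq hτ, wL 0 (Nat.zero_le _) 0 zero_lt_half.le, hn,
    wR (σ.n + τ.n) (by omega) 1 half_lt_one.le (Or.inr half_lt_one), dblL_zero, dblR_one,
    Nat.add_sub_cancel_left, hv0]
  group

end LocalSystem

end Holonomy

end Orbispace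

/-! ### Homotopy invariance of the holonomy. -/

namespace Orbispace

section Invariance

variable {X : Type u} [TopologicalSpace X] {𝒳 : Orbispace X} {S : Set 𝒳.Idx} {H : Type v} [Group H]
  {D : LocalSystem 𝒳 S H} {o₁ o₂ p₁ p₂ : 𝒳.BasePoint}

namespace PathSystem

/-- Systems have refinements by small charts. -/
theorem exists_inCharts_refinement (hS : ∀ p : X, ∃ i ∈ S, p ∈ 𝒳.U i)
    (hS' : ∀ i ∈ S, ∀ j, 𝒳.U j ≤ 𝒳.U i → j ∈ S) (h₁ : o₁.idx ∈ S) (h₂ : o₂.idx ∈ S)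
    (σ : 𝒳.PathSystem o₁ o₂) : ∃ κ : 𝒳.PathSystem o₁ o₂, κ.Refines σ ∧ κ.InCharts S := by
  have hx : ∀ t : unitInterval, ∃ (k : ℕ) (e : 𝒳.Arr), k ≤ σ.n ∧ t ∈ σ.I k ∧ σ.f k t ∈ 𝒳.dom e ∧
      e.tgt ∈ S ∧ (t = 0 → k = 0 ∧ e = 𝒳.oneArr o₁.idx) ∧
      (t = 1 → k = σ.n ∧ e = 𝒳.oneArr o₂.idx) := by
    intro t
    by_cases h0 : t = 0
    · subst h0
      exact ⟨0, 𝒳.oneArr o₁.idx, Nat.zero_le _, σ.zero_mem, by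
        rw [σ.f_zero]; exact (sends_one o₁.point).mem_dom, h₁, by simp, by simp⟩
    by_cases h1 : t = 1
    · subst h1
      exact ⟨σ.n, 𝒳.oneArr o₂.idx, le_rfl, σ.one_mem, by
        rw [σ.f_one]; exact (sends_one o₂.point).mem_dom, h₂, by simp, by simp⟩
    -- At inner points one passes to a component of the intersection with a chart in `S`, which is
    -- again in `S`. At the two ends the charts cannot be changed, which is why they are assumed to
    -- be in `S`.
    obtain ⟨i, hi, hp⟩ := hS (𝒳.base (σ.f (σ.ix t) t))
    obtain ⟨j, -, hj1, hj2, hpj⟩ := exists_idx_component _ i (base_mem (σ.f (σ.ix t) t)) hp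
    obtain ⟨e, y, he, hy⟩ := exists_sends_of_le _ hj1 hpj
    exact ⟨σ.ix t, e, σ.ix_le t, σ.mem_ix t, he.mem_dom, by
      rw [← he.tgt_eq, hy]; exact hS' i hi j hj2, by simp [h0], by simp [h1]⟩
  choose k e hk hkt hd he h0 h1 using hx
  obtain ⟨κ, p, hκ, -, -, hp⟩ := σ.exists_refines k e
    (fun t => σ.I (k t) ∩ σ.f (k t) ⁻¹' 𝒳.dom (e t)) hk
    (fun t => Filter.inter_mem (σ.eventually_mem (hk t) (hkt t))
      ((σ.continuousAt_f (hk t) (hkt t)).preimage_mem_nhds ((isOpen_dom _).mem_nhds (hd t))))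
    (fun t => inter_subset_left) (fun t s hs => hs.2) (h0 0 rfl).1 (h0 0 rfl).2 (h1 1 rfl).1
    (h1 1 rfl).2
  exact ⟨κ, hκ, fun m hm => by rw [(hp m hm).2]; exact he _⟩

/-- Applying `g⁻¹` in the last chart only turns the normal representative into an actual system of
the class. -/
theorem Rep.exists_gauge {a : 𝒳.PathSpace o₁ o₂} {τ : 𝒳.PathSystem o₁ p₂} {g : 𝒳.Gau}
    (hr : Rep a τ g) : ∃ (e : ℕ → 𝒳.Gau) (h₁ : o₁.point = gact (e 0) o₁.point)
      (h₂ : o₂.point = gact (e τ.n) p₂.point), (τ.gauge e h₁ h₂).cls = a ∧ e 0 = 1 ∧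
      e τ.n = g⁻¹ := by
  obtain ⟨ω, rfl, hi⟩ := hr
  have hn := τ.one_le_n
  let e : ℕ → 𝒳.Gau := fun k => if k = τ.n then g⁻¹ else 1
  have he0 : e 0 = 1 := if_neg (by omega)
  have hen : e τ.n = g⁻¹ := if_pos rfl
  have hp1 : o₁.point = gact (e 0) o₁.point := by rw [he0, gact_one]
  have hp2 : o₂.point = gact (e τ.n) p₂.point := by
    rw [hen, hi.point_eq.2, gact_inv_gact]
  refine ⟨e, hp1, hp2, Equiv.cls_eq (Equiv.symm ?_), he0, hen⟩
  have := hi.trans (τ.isoVia_gauge e hp1 hp2)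
  rwa [he0, hen, _root_.one_mul, inv_mul_cancel, isoVia_one_iff] at this

theorem exists_subdivision (σ : 𝒳.PathSystem o₁ o₂) : ∃ b : ℕ → unitInterval, b 0 = 0 ∧
    b (σ.n + 1) = 1 ∧ ∀ k ≤ σ.n, b k ∈ σ.I k ∧ b (k + 1) ∈ σ.I k := by
  have hm : ∀ k, ∃ t, (k < σ.n → t ∈ σ.I k ∧ t ∈ σ.I (k + 1)) ∧ (k = σ.n → t = 1) := fun k => by
    by_cases hk : k < σ.n
    · obtain ⟨t, h⟩ := σ.exists_mem_inter hk
      exact ⟨t, fun _ => h, fun h => absurd h hk.ne⟩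
    · exact ⟨1, fun h => absurd h hk, fun _ => rfl⟩
  choose m hm hm1 using hm
  refine ⟨fun k => Nat.casesOn k 0 m, rfl, hm1 _ rfl, fun k hk => ⟨?_, ?_⟩⟩
  · cases k with
    | zero => exact σ.zero_mem
    | succ k => exact (hm k hk).2
  · change m k ∈ σ.I k
    rcases hk.lt_or_eq with h | rfl
    · exact (hm k h).1
    · rw [hm1 _ rfl]; exact σ.one_mem

end PathSystem

namespace LocalSystem

/-- Both sides are the transport along the single transition map `h ∘ a`, factored in two ways. -/
theorem T_lact {x y : 𝒳.Pt} (hx : x.1 ∈ S) (hy : y.1 ∈ S) {a : 𝒳.Arr} (ha : 𝒳.Sends a x y)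
    (g h : 𝒳.Gau) : D.T (𝒳.grpArr x.1 (g x.1)) x * D.T (lact h a g⁻¹) (gact g x) =
      D.T a x * D.T (𝒳.grpArr y.1 (h y.1)) y := by
  have s : 𝒳.Sends (lact h a g⁻¹) (gact g x) (gact h y) :=
    Sends.lact (by rwa [gact_inv_gact])
  rw [← D.comp (z := gact h y) hx hy hy ha (sends_grpArr' y h),
    ← D.comp (y := gact g x) (z := gact h y) hx hx hy (sends_grpArr' x g) s,
    ha.mul_grpArr_left, s.mul_grpArr_right, lact_lact, inv_mul_cancel, one_mul]

/-- Multiplying a parallel section by the transport of the group elements gives a parallel section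
of the gauged system, so only the factors at the two ends remain. -/
theorem hol_gauge {τ : 𝒳.PathSystem o₁ o₂} (hτ : τ.InCharts S) (e : ℕ → 𝒳.Gau)
    (h₁ : p₁.point = gact (e 0) o₁.point) (h₂ : p₂.point = gact (e τ.n) o₂.point) :
    D.hol (τ.gauge e h₁ h₂) = (D.T (𝒳.grpArr o₁.idx (e 0 o₁.idx)) o₁.point)⁻¹ * D.hol τ *
      D.T (𝒳.grpArr o₂.idx (e τ.n o₂.idx)) o₂.point := by
  obtain ⟨u, hu, hu0⟩ := exists_isTransport (D := D) hτ
  have hg : (τ.gauge e h₁ h₂).InCharts S := hτ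
  have hs : ∀ k ≤ τ.n, ∀ t ∈ τ.I k,
      𝒳.Sends (𝒳.grpArr (τ.chart k) (e k (τ.chart k))) (τ.f k t) (gact (e k) (τ.f k t)) :=
    fun k hk t ht => by rw [← τ.f_chart k hk t ht]; exact sends_grpArr' _ _
  have hw : D.IsTransport (τ.gauge e h₁ h₂) fun k t =>
      u k t * D.T (𝒳.grpArr (τ.chart k) (e k (τ.chart k))) (τ.f k t) := by
    refine ⟨fun k hk s hs' t ht => ?_, fun k hk t ht ht' => ?_⟩
    · have hJ := τ.ordConnected_I k hk
      have := D.arr (𝒳.grpArr (τ.chart k) (e k (τ.chart k))) (seg (τ.f k) s t)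
        (seg ((τ.gauge e h₁ h₂).f k) s t)
        (continuous_seg (τ.continuousOn_f k hk) hJ hs' ht)
        (continuous_seg ((τ.gauge e h₁ h₂).continuousOn_f k hk) hJ hs' ht)
        (fun r => hτ.mem hk (lerp_mem hJ hs' ht r)) (fun r => hg.mem hk (lerp_mem hJ hs' ht r))
        (fun r => hs k hk _ (lerp_mem hJ hs' ht r))
      simp only [seg, lerp_zero, lerp_one] at this
      rw [hu.path k hk s hs' t ht, mul_assoc, mul_assoc]
      congr 1
    · have := T_lact (D := D) (hτ.mem (Nat.le_of_lt hk) ht) (hτ.mem hk ht')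
        (τ.ρ_sends k hk t ⟨ht, ht'⟩) (e k) (e (k + 1))
      rw [τ.f_chart k (Nat.le_of_lt hk) t ht, τ.f_chart (k + 1) hk t ht'] at this
      rw [hu.jump k hk t ht ht', mul_assoc, ← this, ← mul_assoc]
      rfl
  rw [hw.hol_eq hg, hu.hol_eq hτ, hu0, τ.f_zero]
  change _ * (u τ.n 1 * D.T (𝒳.grpArr (τ.chart τ.n) (e τ.n (τ.chart τ.n))) (τ.f τ.n 1)) = _
  rw [τ.f_one, τ.chart_zero, τ.chart_n]
  group

variable (D) in
open Classical in
/-- The holonomy along a based path. -/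
noncomputable def holCls (a : 𝒳.PathSpace o₁ o₂) : H :=
  if h : ∃ κ : 𝒳.PathSystem o₁ o₂, κ.cls = a ∧ κ.InCharts S then D.hol h.choose else 1

theorem holCls_cls {σ : 𝒳.PathSystem o₁ o₂} (hσ : σ.InCharts S) : D.holCls σ.cls = D.hol σ := by
  have h : ∃ κ : 𝒳.PathSystem o₁ o₂, κ.cls = σ.cls ∧ κ.InCharts S := ⟨σ, rfl, hσ⟩
  rw [holCls, dif_pos h]
  exact hol_eq_of_cls_eq h.choose_spec.2 hσ h.choose_spec.1

/-- A normal representative ends at a translate of the end point, and its holonomy exceeds that of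
the class by the transport of the translating element. -/
theorem holCls_rep {a : 𝒳.PathSpace o₁ o₂} {τ : 𝒳.PathSystem o₁ p₂} {g : 𝒳.Gau}
    (hτ : τ.InCharts S) (hr : PathSystem.Rep a τ g) :
    D.holCls a * D.T (𝒳.grpArr o₂.idx (g o₂.idx)) o₂.point = D.hol τ := by
  obtain ⟨e, h1, h2, rfl, he0, hen⟩ := hr.exists_gauge
  have hp : p₂.point = gact g o₂.point := by
    rw [h2, hen, gact_gact_inv]
  have hi : p₂.idx = o₂.idx := congrArg Sigma.fst hp
  have hS1 : o₁.point.1 ∈ S := by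
    rw [← τ.f_zero]; exact hτ.mem (Nat.zero_le _) τ.zero_mem
  have hS2 : p₂.point.1 ∈ S := by
    rw [← τ.f_one]; exact hτ.mem le_rfl τ.one_mem
  have hS3 : o₂.point.1 ∈ S := by rw [hp] at hS2; exact hS2
  have hgg := D.comp hS3 hS2 hS3 (hp ▸ sends_grpArr' o₂.point g) (by
    have := sends_grpArr' p₂.point g⁻¹
    have e' : gact g⁻¹ p₂.point = o₂.point := by rw [hp, gact_inv_gact]
    rwa [e'] at this)
  have hgm : 𝒳.mul (𝒳.grpArr p₂.point.1 (g⁻¹ p₂.point.1)) (𝒳.grpArr o₂.point.1 (g o₂.point.1))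
      o₂.point = 𝒳.oneArr o₂.point.1 := by
    have := (sends_grpArr' o₂.point g).mul_grpArr_left g⁻¹
    rw [lact_grpArr] at this
    rw [hp]
    refine this.trans ?_
    rw [Pi.inv_apply, inv_mul_cancel, grpArr_one]
  rw [hgm, D.T_one hS3] at hgg
  rw [holCls_cls (show (τ.gauge e h1 h2).InCharts S from hτ), hol_gauge hτ, he0, hen, Pi.one_apply,
    grpArr_one]
  have t1 : D.T (𝒳.oneArr o₁.idx) o₁.point = 1 := D.T_one hS1
  have t2 : D.T (𝒳.grpArr p₂.idx (g⁻¹ p₂.idx)) p₂.point =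
      (D.T (𝒳.grpArr o₂.idx (g o₂.idx)) o₂.point)⁻¹ := eq_inv_of_mul_eq_one_right hgg.symm
  rw [t1, t2, inv_one, one_mul, inv_mul_cancel_right]

theorem lerp_mem_ball {s₀ s : unitInterval} {ε : ℝ} (hs : s ∈ Metric.ball s₀ ε) (r : unitInterval) :
    lerp s₀ s r ∈ Metric.ball s₀ ε := by
  rw [Metric.mem_ball, Subtype.dist_eq, Real.dist_eq] at *
  rw [coe_lerp, show (1 - (r : ℝ)) * s₀ + r * s - s₀ = r * (s - s₀) by ring, abs_mul,
    abs_of_nonneg r.2.1]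
  exact (mul_le_of_le_one_left (abs_nonneg _) r.2.2).trans_lt hs

open PathSystem in
-- For `s` near `s₀` the based path `a s` has a normal representative over `σ`. Uniqueness makes its
-- maps and its final group element continuous in `s`, so the representatives form a homotopy with
-- fixed transition maps. Holonomies are compared chart by chart: a square inside each chart,
-- naturality across each transition map, and the axiom `grp` for the motion of the end point.
theorem holCls_eventually {a : unitInterval → 𝒳.PathSpace o₁ o₂} (ha : Continuous a)
    {s₀ : unitInterval} {σ : 𝒳.PathSystem o₁ o₂} (hσ : σ.InCharts S) (hσa : σ.cls = a s₀) :
    ∀ᶠ s in 𝓝 s₀, D.holCls (a s) = D.holCls (a s₀) := by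
  classical
  obtain ⟨b, hb0, hb1, hb⟩ := σ.exists_subdivision
  -- Control is needed only on these compact pieces, whose end points lie in the overlaps and are
  -- the places where the ladder changes charts.
  let K : ℕ → Set unitInterval := fun k => uIcc (b k) (b (k + 1))
  have hev := Rep.eventually (K := K) (V := fun _ => univ) (U := univ) σ.isNormal_self
    (hσa ▸ σ.rep_self) (fun k hk => ⟨isCompact_uIcc,
      (σ.ordConnected_I k hk).uIcc_subset (hb k hk).1 (hb k hk).2, isOpen_univ,
      fun _ _ => trivial⟩) Filter.univ_mem
  obtain ⟨ε, hε, hball⟩ := Metric.eventually_nhds_iff_ball.1 (ha.continuousAt.eventually hev)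
  set N := Metric.ball s₀ ε with hN
  -- The representatives are chosen independently for different `s`; outside `N` the value is
  -- irrelevant.
  have hex : ∀ s, ∃ (q : 𝒳.BasePoint) (τ : 𝒳.PathSystem o₁ q) (g : 𝒳.Gau), s ∈ N →
      σ.IsNormal τ ∧ Rep (a s) τ g ∧ ∀ k ≤ σ.n, K k ⊆ τ.I k := by
    intro s
    by_cases hs : s ∈ N
    · obtain ⟨q, τ, g, h1, h2, -, h3⟩ := hball s hs
      exact ⟨q, τ, g, fun _ => ⟨h1, h2, fun k hk => (h3 k hk).1⟩⟩
    · exact ⟨o₂, σ, 1, fun h => absurd h hs⟩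
  choose q τ g hτ using hex
  have hNo : IsOpen N := Metric.isOpen_ball
  -- Joint continuity holds in spite of the arbitrary choices: for `s` near `s₁` some normal
  -- representative maps a compact neighbourhood of `t₁` into `V`, and by uniqueness it agrees with
  -- the chosen one.
  have hcont : ∀ k ≤ σ.n,
      ContinuousOn (fun p : unitInterval × unitInterval => (τ p.1).f k p.2) (N ×ˢ K k) := by
    rintro k hk ⟨s₁, t₁⟩ ⟨hs₁, ht₁⟩
    change s₁ ∈ N at hs₁
    change t₁ ∈ K k at ht₁
    obtain ⟨h1, h2, h3⟩ := hτ s₁ hs₁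
    have hk' : k ≤ (τ s₁).n := by rw [h1.n_eq]; exact hk
    rw [ContinuousWithinAt, (nhds_basis_opens _).tendsto_right_iff]
    rintro V ⟨hV1, hV2⟩
    obtain ⟨C, hC, hCs, hCc⟩ := local_compact_nhds (Filter.inter_mem
      ((τ s₁).eventually_mem hk' (h3 k hk ht₁))
      (((τ s₁).continuousAt_f hk' (h3 k hk ht₁)).preimage_mem_nhds (hV2.mem_nhds hV1)))
    have hev := Rep.eventually (K := fun j => if j = k then C else ∅)
      (V := fun j => if j = k then V else univ) (U := univ) h1 h2 (fun j hj => by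
        by_cases e : j = k
        · subst e
          simp only [if_true]
          exact ⟨hCc, fun t ht => (hCs ht).1, hV2, fun t ht => (hCs ht).2⟩
        · simp [e]) Filter.univ_mem
    have hev' := (ha.continuousAt (x := s₁)).eventually hev
    have hpr : ∀ᶠ p in 𝓝 (s₁, t₁), p.1 ∈ {s | ∃ (q : 𝒳.BasePoint) (τ : 𝒳.PathSystem o₁ q)
        (g : 𝒳.Gau), σ.IsNormal τ ∧ Rep (a s) τ g ∧ g ∈ univ ∧ ∀ j ≤ σ.n,
          (if j = k then C else ∅) ⊆ τ.I j ∧ ∀ t ∈ (if j = k then C else ∅),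
            τ.f j t ∈ if j = k then V else univ} ∧ p.2 ∈ C := by
      rw [nhds_prod_eq]
      exact hev'.prod_mk hC
    filter_upwards [nhdsWithin_le_nhds hpr, self_mem_nhdsWithin]
    rintro ⟨s, t⟩ ⟨⟨q', τ', g', n', r', -, h'⟩, htC⟩ ⟨hs, ht⟩
    obtain ⟨n, r, hK⟩ := hτ s hs
    have h'' := h' k hk
    simp only [if_true] at h''
    have := (r.unique n n' r').1 k hk t (hK k hk ht) (h''.1 htC)
    change (τ s).f k t ∈ V
    rw [this]
    exact h''.2 t htC
  have hgcont : ContinuousOn (fun s => g s o₂.idx) N := by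
    intro s₁ hs₁
    obtain ⟨h1, h2, h3⟩ := hτ s₁ hs₁
    rw [ContinuousWithinAt, Filter.tendsto_def]
    intro U hU
    have hev := Rep.eventually (K := fun _ => ∅) (V := fun _ => univ)
      (U := (fun g : 𝒳.Gau => g o₂.idx) ⁻¹' U) h1 h2 (fun j hj => by simp)
      ((continuous_apply (A := fun i => (𝒳.str i).Grp) o₂.idx).continuousAt.preimage_mem_nhds hU)
    filter_upwards [nhdsWithin_le_nhds ((ha.continuousAt (x := s₁)).eventually hev),
      self_mem_nhdsWithin]
    rintro s ⟨q', τ', g', n', r', hg', -⟩ hs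
    obtain ⟨n, r, hK⟩ := hτ s hs
    have := (r.unique n n' r').2
    rw [mem_preimage, this]
    exact hg'
  have hch : ∀ s ∈ N, (τ s).InCharts S := fun s hs k hk => by
    rw [(hτ s hs).1.n_eq] at hk
    rw [(hτ s hs).1.chart_eq k hk]
    exact hσ k hk
  have hs₀ : s₀ ∈ N := Metric.mem_ball_self hε
  filter_upwards [hNo.mem_nhds hs₀] with s hs
  have hL : ∀ r, lerp s₀ s r ∈ N := lerp_mem_ball hs
  obtain ⟨u, hu, hu0⟩ := exists_isTransport (D := D) (hch s₀ hs₀)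
  obtain ⟨w, hw, hw0⟩ := exists_isTransport (D := D) (hch s hs)
  have hn : ∀ s ∈ N, (τ s).n = σ.n := fun s hs => (hτ s hs).1.n_eq
  have hKI : ∀ s ∈ N, ∀ k ≤ σ.n, K k ⊆ (τ s).I k := fun s hs => (hτ s hs).2.2
  have hbK : ∀ k, b k ∈ K k := fun k => left_mem_uIcc
  have hbK' : ∀ k, b (k + 1) ∈ K k := fun k => right_mem_uIcc
  have hcL : Continuous fun r => lerp s₀ s r :=
    continuous_const.lerp continuous_const continuous_id
  have hvert : ∀ k ≤ σ.n, ∀ t ∈ K k, Continuous fun r => (τ (lerp s₀ s r)).f k t :=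
    fun k hk t ht => (hcont k hk).comp_continuous (hcL.prodMk continuous_const)
      fun r => ⟨hL r, ht⟩
  have hmem : ∀ k ≤ σ.n, ∀ t ∈ K k, ∀ s ∈ N, ((τ s).f k t).1 ∈ S := fun k hk t ht s hs =>
    (hch s hs).mem (by rwa [hn s hs]) (hKI s hs k hk ht)
  have e0 : ∀ k t, (τ (lerp s₀ s 0)).f k t = (τ s₀).f k t := fun k t => by rw [lerp_zero]
  have e1 : ∀ k t, (τ (lerp s₀ s 1)).f k t = (τ s).f k t := fun k t => by rw [lerp_one]
  -- Across one rung: the square axiom moves the comparison from the left to the right end of the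
  -- piece `K k`.
  have hDE : ∀ k ≤ σ.n,
      u k (b k) * D.P (fun r => (τ (lerp s₀ s r)).f k (b k)) = w k (b k) →
      u k (b (k + 1)) * D.P (fun r => (τ (lerp s₀ s r)).f k (b (k + 1))) = w k (b (k + 1)) := by
    intro k hk hD
    have hm : ∀ r, lerp (b k) (b (k + 1)) r ∈ K k := fun r => lerp_mem_uIcc _ _ r
    have := D.square (fun p => (τ (lerp s₀ s p.2)).f k (lerp (b k) (b (k + 1)) p.1))
      ((hcont k hk).comp_continuous ((continuous_const.lerp continuous_const continuous_snd).prodMk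
        (continuous_const.lerp continuous_const continuous_fst)) fun p => ⟨hL _, hm _⟩)
      fun p => hmem k hk _ (hm _) _ (hL _)
    simp only [e0, e1, lerp_zero, lerp_one] at this
    rw [hu.path k (by rwa [hn s₀ hs₀]) _ (hKI s₀ hs₀ k hk (hbK k)) _ (hKI s₀ hs₀ k hk (hbK' k)),
      hw.path k (by rwa [hn s hs]) _ (hKI s hs k hk (hbK k)) _ (hKI s hs k hk (hbK' k)), ← hD,
      mul_assoc, mul_assoc]
    exact congrArg _ this
  -- The transition map is the same for all `s`, so it relates the vertical paths in the two charts,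
  -- and the axiom `arr` applies.
  have hED : ∀ k < σ.n,
      u k (b (k + 1)) * D.P (fun r => (τ (lerp s₀ s r)).f k (b (k + 1))) = w k (b (k + 1)) →
      u (k + 1) (b (k + 1)) * D.P (fun r => (τ (lerp s₀ s r)).f (k + 1) (b (k + 1))) =
        w (k + 1) (b (k + 1)) := by
    intro k hk hE
    have hk' : k + 1 ≤ σ.n := hk
    have hρ : ∀ s ∈ N, 𝒳.Sends (σ.ρ k) ((τ s).f k (b (k + 1))) ((τ s).f (k + 1) (b (k + 1))) :=
      fun s hs => by
        rw [← (hτ s hs).1.ρ_eq k hk]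
        exact (τ s).ρ_sends k (by rwa [hn s hs]) _
          ⟨hKI s hs k hk.le (hbK' k), hKI s hs (k + 1) hk' (hbK _)⟩
    have := D.arr (σ.ρ k) _ _ (hvert k hk.le _ (hbK' k)) (hvert (k + 1) hk' _ (hbK _))
      (fun r => hmem k hk.le _ (hbK' k) _ (hL r)) (fun r => hmem (k + 1) hk' _ (hbK _) _ (hL r))
      (fun r => hρ _ (hL r))
    simp only [e0, e1] at this
    rw [hu.jump k (by rwa [hn s₀ hs₀]) _ (hKI s₀ hs₀ k hk.le (hbK' k))
      (hKI s₀ hs₀ (k + 1) hk' (hbK _)), hw.jump k (by rwa [hn s hs]) _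
      (hKI s hs k hk.le (hbK' k)) (hKI s hs (k + 1) hk' (hbK _)), ← hE, (hτ s₀ hs₀).1.ρ_eq k hk,
      (hτ s hs).1.ρ_eq k hk, mul_assoc, mul_assoc, this]
  have hD : ∀ k ≤ σ.n,
      u k (b k) * D.P (fun r => (τ (lerp s₀ s r)).f k (b k)) = w k (b k) := by
    intro k
    induction k with
    | zero =>
      intro _
      have : (fun r => (τ (lerp s₀ s r)).f 0 (b 0)) = fun _ => o₁.point :=
        funext fun r => by rw [hb0, (τ _).f_zero]
      rw [this, D.P_const, mul_one, hb0, hu0, hw0]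
      have := hmem 0 (Nat.zero_le _) _ (hbK 0) s₀ hs₀
      rwa [hb0, (τ s₀).f_zero] at this
    | succ k ih => exact fun hk => hED k hk (hDE k (Nat.le_of_succ_le hk) (ih (Nat.le_of_succ_le hk)))
  have hE := hDE σ.n le_rfl (hD σ.n le_rfl)
  rw [hb1] at hE
  have hq : ∀ s ∈ N, (τ s).f σ.n 1 = ⟨o₂.idx, g s o₂.idx • o₂.lift⟩ := fun s hs => by
    obtain ⟨ω, -, hi⟩ := (hτ s hs).2.1
    rw [← hn s hs, (τ s).f_one]
    exact hi.point_eq.2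
  have hi₂ : o₂.idx ∈ S := by
    have := hmem σ.n le_rfl _ (hbK' σ.n) s₀ hs₀
    rwa [hb1, hq s₀ hs₀] at this
  -- The last vertical path is the orbit path of the end point under the varying group elements. Its
  -- transport cancels against the end corrections in `holCls_rep`.
  have hP : (fun r => (τ (lerp s₀ s r)).f σ.n 1) =
      fun r => ⟨o₂.idx, g (lerp s₀ s r) o₂.idx • o₂.lift⟩ := funext fun r => hq _ (hL r)
  have hgrp := D.grp o₂.idx hi₂ o₂.lift (fun r => g (lerp s₀ s r) o₂.idx)
    (hgcont.comp_continuous hcL hL)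
  rw [hP, hgrp, lerp_zero, lerp_one] at hE
  have h1 := holCls_rep (D := D) (hch s₀ hs₀) (hτ s₀ hs₀).2.1
  have h2 := holCls_rep (D := D) (hch s hs) (hτ s hs).2.1
  rw [hu.hol_eq (hch s₀ hs₀), hu0, inv_one, one_mul, hn s₀ hs₀] at h1
  rw [hw.hol_eq (hch s hs), hw0, inv_one, one_mul, hn s hs, ← hE, ← h1] at h2
  refine mul_right_cancel (h2.trans ?_)
  rw [mul_assoc]
  exact congrArg (D.holCls (a s₀) * ·) (mul_inv_cancel_left _ _)

/-- The holonomy is invariant under homotopies. -/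
theorem holCls_eq_of_joined (hS : ∀ p : X, ∃ i ∈ S, p ∈ 𝒳.U i)
    (hS' : ∀ i ∈ S, ∀ j, 𝒳.U j ≤ 𝒳.U i → j ∈ S) (h₁ : o₁.idx ∈ S) (h₂ : o₂.idx ∈ S)
    {a b : 𝒳.PathSpace o₁ o₂} (h : Joined a b) : D.holCls a = D.holCls b := by
  obtain ⟨γ⟩ := h
  have := (isPreconnected_univ (α := unitInterval)).eq_of_eventually_eq
    (f := fun s => D.holCls (γ s)) (fun s _ => by
      rw [nhdsWithin_univ]
      obtain ⟨σ, hσ⟩ := Quot.exists_rep (γ s)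
      obtain ⟨κ, hκ, hκS⟩ := σ.exists_inCharts_refinement hS hS' h₁ h₂
      exact holCls_eventually γ.continuous hκS ((PathSystem.cls_eq_of_refines hκ).trans hσ))
    (mem_univ 0) (mem_univ 1)
  simpa using this

end LocalSystem

end Invariance

end Orbispace

/-! ### Continuous families of systems, reparametrisation, associativity of concatenation. -/

namespace Orbispace

section Families

variable {X : Type u} [TopologicalSpace X] {𝒳 : Orbispace X} {o₁ o₂ o₃ o₄ : 𝒳.BasePoint}

namespace PathSystem

theorem tends_const {ι : Type*} (F : Filter ι) (σ : 𝒳.PathSystem o₁ o₂) :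
    Tends F (fun _ => σ) σ where
  shape := Filter.Eventually.of_forall fun _ => ⟨rfl, fun _ _ => rfl⟩
  rho M hM := Filter.Eventually.of_forall fun _ _ _ => ⟨1, mem_of_mem_nhds hM, (lact_one_one _).symm⟩
  maps k _ K _ hKI V _ hV := Filter.Eventually.of_forall fun _ => ⟨hKI, hV⟩

/-- A compact set of parameters is cut at `1/2`; the two halves are compact and are treated in the
two factors. -/
theorem Tends.concat {ι : Type*} {F : Filter ι} {Φ : ι → 𝒳.PathSystem o₁ o₂}
    {Ψ : ι → 𝒳.PathSystem o₂ o₃} {σ : 𝒳.PathSystem o₁ o₂} {τ : 𝒳.PathSystem o₂ o₃}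
    (h : Tends F Φ σ) (h' : Tends F Ψ τ) : Tends F (fun i => (Φ i).concat (Ψ i)) (σ.concat τ) where
  shape := by
    filter_upwards [h.shape, h'.shape] with i ⟨h1, h2⟩ ⟨h3, h4⟩
    refine ⟨congrArg₂ (· + ·) h1 h3, fun k hk => ?_⟩
    have hk' : k ≤ σ.n + τ.n := hk
    rcases le_total k σ.n with hl | hl
    · rw [concat_chart_left hl, concat_chart_left (by rwa [h1]), h2 k hl]
    · rw [concat_chart_right hl, concat_chart_right (by rwa [h1]), h1, h4 _ (by omega)]
  rho M hM := by
    filter_upwards [h.shape, h.rho M hM, h'.rho M hM] with i ⟨h1, h2⟩ h3 h4 k hk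
    have hk' : k < σ.n + τ.n := hk
    rcases lt_or_ge k σ.n with hl | hl
    · rw [concat_rho_left hl, concat_rho_left (by rwa [h1])]
      exact h3 k hl
    · rw [concat_rho_right hl, concat_rho_right (by rwa [h1]), h1]
      exact h4 _ (by omega)
  maps k hk K hK hKI V hV hfV := by
    have hk' : k ≤ σ.n + τ.n := hk
    have hL : ∀ᶠ i in F, k ≤ σ.n → dblL '' (K ∩ Iic half) ⊆ (Φ i).I k ∧
        ∀ t ∈ dblL '' (K ∩ Iic half), (Φ i).f k t ∈ V := by
      rw [Filter.eventually_imp_distrib_left]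
      intro hl
      refine h.maps k hl _ ((hK.inter_right isClosed_Iic).image continuous_dblL) ?_ V hV ?_
      · rintro _ ⟨t, ht, rfl⟩
        exact (mem_concat_le ht.2 (hKI ht.1)).2
      · rintro _ ⟨t, ht, rfl⟩
        rw [← concat_f_left (τ := τ) ht.2 hl]
        exact hfV t ht.1
    have hR : ∀ᶠ i in F, σ.n ≤ k → dblR '' (K ∩ Ici half) ⊆ (Ψ i).I (k - σ.n) ∧
        ∀ t ∈ dblR '' (K ∩ Ici half), (Ψ i).f (k - σ.n) t ∈ V := by
      rw [Filter.eventually_imp_distrib_left]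
      intro hl
      refine h'.maps _ (by omega) _ ((hK.inter_right isClosed_Ici).image continuous_dblR) ?_ V hV ?_
      · rintro _ ⟨t, ht, rfl⟩
        exact (mem_concat_ge ht.2 (hKI ht.1)).2.1
      · rintro _ ⟨t, ht, rfl⟩
        rw [← concat_f_ge ht.2 (hKI ht.1)]
        exact hfV t ht.1
    filter_upwards [h.shape, hL, hR] with i ⟨hn, _⟩ h1 h2
    have key : ∀ t ∈ K, t ∈ ((Φ i).concat (Ψ i)).I k := by
      intro t ht
      rcases lt_trichotomy t half with hlt | rfl | hlt
      · have := (mem_concat_left hlt).1 (hKI ht)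
        exact (mem_concat_left hlt).2 ⟨by rw [hn]; exact this.1,
          (h1 this.1).1 ⟨t, ⟨ht, hlt.le⟩, rfl⟩⟩
      · rw [mem_concat_half, hn]
        exact mem_concat_half.1 (hKI ht)
      · have := (mem_concat_right hlt).1 (hKI ht)
        refine (mem_concat_right hlt).2 ⟨by rw [hn]; exact this.1, ?_⟩
        rw [hn]
        exact (h2 this.1).1 ⟨t, ⟨ht, hlt.le⟩, rfl⟩
    refine ⟨key, fun t ht => ?_⟩
    rcases le_total t half with hlt | hlt
    · have := (mem_concat_le hlt (hKI ht)).1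
      rw [concat_f_left hlt (by rwa [hn])]
      exact (h1 this).2 _ ⟨t, ⟨ht, hlt⟩, rfl⟩
    · have := (mem_concat_ge hlt (hKI ht)).1
      rw [concat_f_ge hlt (key t ht), hn]
      exact (h2 this).2 _ ⟨t, ⟨ht, hlt⟩, rfl⟩

/-- Compactness of `K` turns joint continuity at each point `(s, t)` into a statement uniform in `t
∈ K`. -/
theorem tends_of_continuousAt {Z : Type*} [TopologicalSpace Z] {Φ : Z → 𝒳.PathSystem o₁ o₂} {s : Z}
    (hn : ∀ z, (Φ z).n = (Φ s).n) (hc : ∀ z k, (Φ z).chart k = (Φ s).chart k)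
    (hρ : ∀ M ∈ 𝓝 (1 : 𝒳.Gau), ∀ᶠ z in 𝓝 s, ∀ k < (Φ s).n, ∃ h ∈ M,
      (Φ z).ρ k = lact h ((Φ s).ρ k) 1)
    (hf : ∀ k ≤ (Φ s).n, ∀ t ∈ (Φ s).I k, (∀ᶠ p in 𝓝 (s, t), p.2 ∈ (Φ p.1).I k) ∧
      ContinuousAt (fun p : Z × unitInterval => (Φ p.1).f k p.2) (s, t)) :
    Tends (𝓝 s) Φ (Φ s) where
  shape := Filter.Eventually.of_forall fun z => ⟨hn z, fun k _ => hc z k⟩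
  rho := hρ
  maps k hk K hK hKI V hV hfV := by
    have := hK.eventually_forall_of_forall_eventually (x₀ := s)
      (P := fun z t => t ∈ (Φ z).I k ∧ (Φ z).f k t ∈ V) fun t ht =>
        (hf k hk t (hKI ht)).1.and ((hf k hk t (hKI ht)).2.eventually (hV.mem_nhds (hfV t ht)))
    exact this.mono fun z hz => ⟨fun t ht => (hz t ht).1, fun t ht => (hz t ht).2⟩

/-- Elementary homotopies. -/
def HtpyStep (σ τ : 𝒳.PathSystem o₁ o₂) : Prop :=
  σ.Refines τ ∨ ∃ Φ : unitInterval → 𝒳.PathSystem o₁ o₂, Φ 0 = σ ∧ Φ 1 = τ ∧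
    ∀ s, Tends (𝓝 s) Φ (Φ s)

/-- By `Tends.tendsto` an explicit family of systems is a path in the space of based paths. This is
how homotopies written down by hand reach the path components. -/
theorem HtpyStep.joined {σ τ : 𝒳.PathSystem o₁ o₂} (h : σ.HtpyStep τ) : Joined σ.cls τ.cls := by
  obtain h | ⟨Φ, rfl, rfl, h⟩ := h
  · rw [cls_eq_of_refines h]
  · exact ⟨⟨⟨fun s => (Φ s).cls, continuous_iff_continuousAt.2 fun s => (h s).tendsto⟩, rfl, rfl⟩⟩

theorem HtpyStep.concat_right {σ σ' : 𝒳.PathSystem o₁ o₂} (h : σ.HtpyStep σ')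
    (τ : 𝒳.PathSystem o₂ o₃) : (σ.concat τ).HtpyStep (σ'.concat τ) := by
  obtain h | ⟨Φ, rfl, rfl, h⟩ := h
  · exact Or.inl (h.concat τ.refines_refl)
  · exact Or.inr ⟨fun s => (Φ s).concat τ, rfl, rfl, fun s => (h s).concat (tends_const _ τ)⟩

theorem HtpyStep.concat_left {τ τ' : 𝒳.PathSystem o₂ o₃} (σ : 𝒳.PathSystem o₁ o₂)
    (h : τ.HtpyStep τ') : (σ.concat τ).HtpyStep (σ.concat τ') := by
  obtain h | ⟨Φ, rfl, rfl, h⟩ := h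
  · exact Or.inl (σ.refines_refl.concat h)
  · exact Or.inr ⟨fun s => σ.concat (Φ s), rfl, rfl, fun s => (tends_const _ σ).concat (h s)⟩

/-- A criterion for being a refinement. -/
theorem refines_of_map {κ σ : 𝒳.PathSystem o₁ o₂} (θ : ℕ → ℕ) (hθ0 : θ 0 = 0) (hθn : θ κ.n = σ.n)
    (hθ : ∀ k ≤ κ.n, θ k ≤ σ.n ∧ κ.chart k = σ.chart (θ k))
    (hf : ∀ k ≤ κ.n, ∀ t ∈ κ.I k, t ∈ σ.I (θ k) ∧ κ.f k t = σ.f (θ k) t)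
    (hρ : ∀ k < κ.n, (θ (k + 1) = θ k ∧ κ.ρ k = 𝒳.oneArr (κ.chart k)) ∨
      (θ (k + 1) = θ k + 1 ∧ κ.ρ k = σ.ρ (θ k))) : κ.Refines σ := by
  refine ⟨θ, fun k => 𝒳.oneArr (κ.chart k), fun k hk => ⟨(hθ k hk).1, fun t ht => (hf k hk t ht).1⟩,
    hθ0, hθn, ?_, ?_, fun k hk => ⟨rfl, (hθ k hk).2⟩, fun k hk t ht => ?_, fun k hk t ht => ?_⟩
  · simp only [chart_zero]
  · simp only [chart_n]
  · rw [← (hf k hk t ht).2]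
    exact sends_oneArr (κ.f_chart k hk t ht)
  · have hs := κ.ρ_sends k hk t ht
    have c1 := hs.compAt_one_left
    have c2 := hs.compAt_one_right
    rw [κ.ρ_tgt k hk] at c1
    rw [κ.ρ_src k hk] at c2
    rcases hρ k hk with ⟨e, e'⟩ | ⟨e, e'⟩
    · refine ⟨fun _ => ?_, fun h => by omega, fun h => by omega⟩
      change 𝒳.CompAt (𝒳.oneArr (κ.chart (k + 1))) (κ.ρ k) (κ.f k t) (𝒳.oneArr (κ.chart k))
      rw [← e']; exact c1
    · refine ⟨fun h => by omega, fun _ => ⟨κ.ρ k, c1, ?_⟩, fun h => by omega⟩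
      change 𝒳.CompAt (σ.ρ (θ k)) (𝒳.oneArr (κ.chart k)) (κ.f k t) (κ.ρ k)
      rw [← e']; exact c2

/-- A change of parameter. -/
def reparam (σ : 𝒳.PathSystem o₁ o₂) (φ : unitInterval → unitInterval) (hφ : Continuous φ)
    (hm : Monotone φ) (h0 : φ 0 = 0) (h1 : φ 1 = 1) : 𝒳.PathSystem o₁ o₂ where
  n := σ.n
  one_le_n := σ.one_le_n
  I k := φ ⁻¹' σ.I k
  isOpen_I k hk := (σ.isOpen_I k hk).preimage hφ
  ordConnected_I k hk := (σ.ordConnected_I k hk).preimage_mono hm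
  cover t := σ.cover (φ t)
  disjoint k l hkl hl := (σ.disjoint k l hkl hl).preimage φ
  zero_mem := by rw [mem_preimage, h0]; exact σ.zero_mem
  one_mem := by rw [mem_preimage, h1]; exact σ.one_mem
  chart := σ.chart
  f k t := σ.f k (φ t)
  f_chart k hk t ht := σ.f_chart k hk _ ht
  continuousOn_f k hk := (σ.continuousOn_f k hk).comp hφ.continuousOn fun _ ht => ht
  ρ := σ.ρ
  ρ_src := σ.ρ_src
  ρ_tgt := σ.ρ_tgt
  ρ_sends k hk t ht := σ.ρ_sends k hk _ ht
  f_zero := by rw [h0, σ.f_zero]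
  f_one := by rw [h1, σ.f_one]

/-- The straight-line homotopy from `φ` to the identity runs through monotone maps fixing `0` and
`1`, so preimages of intervals remain intervals throughout. -/
theorem htpyStep_reparam (σ : 𝒳.PathSystem o₁ o₂) (φ : unitInterval → unitInterval)
    (hφ : Continuous φ) (hm : Monotone φ) (h0 : φ 0 = 0) (h1 : φ 1 = 1) :
    (σ.reparam φ hφ hm h0 h1).HtpyStep σ := by
  have hc : Continuous fun p : unitInterval × unitInterval => lerp (φ p.2) p.2 p.1 :=
    (hφ.comp continuous_snd).lerp continuous_snd continuous_fst
  have hmono : ∀ s, Monotone fun t => lerp (φ t) t s := by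
    intro s t t' h
    change (1 - s) * (φ t : ℝ) + s * t ≤ (1 - s) * (φ t' : ℝ) + s * t'
    have a1 : (φ t : ℝ) ≤ φ t' := hm h
    have a2 : (t : ℝ) ≤ t' := h
    have a3 := s.2.1
    have a4 : (0 : ℝ) ≤ 1 - s := by linarith [s.2.2]
    gcongr
  let Φ : unitInterval → 𝒳.PathSystem o₁ o₂ := fun s => σ.reparam (fun t => lerp (φ t) t s)
    (hc.comp (Continuous.prodMk_right s)) (hmono s) (by rw [h0, lerp_self]) (by rw [h1, lerp_self])
  have e0 : Φ 0 = σ.reparam φ hφ hm h0 h1 := by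
    simp only [Φ, lerp_zero]
  have e1' : Φ 1 = σ := by
    simp only [Φ, lerp_one]; rfl
  refine Or.inr ⟨Φ, e0, e1', fun s => tends_of_continuousAt (fun _ => rfl) (fun _ _ => rfl)
    (fun M hM => Filter.Eventually.of_forall fun _ k _ =>
      ⟨1, mem_of_mem_nhds hM, (lact_one_one _).symm⟩) fun k hk t ht => ⟨?_, ?_⟩⟩
  · exact (hc.continuousAt (x := (s, t))).eventually (σ.eventually_mem hk ht)
  · exact ContinuousAt.comp (f := fun p : unitInterval × unitInterval => lerp (φ p.2) p.2 p.1)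
      (g := σ.f k) (x := (s, t)) (σ.continuousAt_f hk ht) hc.continuousAt

/-- The system given by a path `f` in the domain of a transition map `a`, followed by `a`. -/
def elem (a : 𝒳.Arr) (f g : unitInterval → 𝒳.Pt) (hf : Continuous f) (hg : Continuous g)
    (h : ∀ t, 𝒳.Sends a (f t) (g t)) (h₁ : f 0 = o₁.point) (h₂ : g 1 = o₂.point) :
    𝒳.PathSystem o₁ o₂ where
  n := 1
  one_le_n := le_rfl
  I _ := univ
  isOpen_I _ _ := isOpen_univ
  ordConnected_I _ _ := ordConnected_univ
  cover _ := ⟨0, zero_le_one, trivial⟩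
  disjoint k l hkl hl := by omega
  zero_mem := trivial
  one_mem := trivial
  chart k := if k = 0 then a.src else a.tgt
  f k := if k = 0 then f else g
  f_chart k _ t _ := by
    split_ifs
    · exact (h t).src_eq
    · exact (h t).tgt_eq
  continuousOn_f k _ := by
    split_ifs
    · exact hf.continuousOn
    · exact hg.continuousOn
  ρ _ := a
  ρ_src k hk := by simp [Nat.lt_one_iff.1 hk]
  ρ_tgt k _ := by simp
  ρ_sends k hk t _ := by simpa [Nat.lt_one_iff.1 hk] using h t
  f_zero := h₁
  f_one := h₂

end PathSystem

theorem coe_dblL (t : unitInterval) : (dblL t : ℝ) = min 1 (2 * (t : ℝ)) := by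
  rw [dblL, coe_projIcc, max_eq_right]
  exact le_min zero_le_one (mul_nonneg zero_le_two t.2.1)

theorem coe_dblR (t : unitInterval) : (dblR t : ℝ) = max 0 (2 * (t : ℝ) - 1) := by
  rw [dblR, coe_projIcc, min_eq_right]
  linarith [t.2.2]

/-- The change of parameters between the two ways to concatenate three paths. -/
noncomputable def assocParam (t : unitInterval) : unitInterval :=
  -- The piecewise linear map with slopes `2`, `1`, `1/2` taking `1/4` to `1/2` and `1/2` to `3/4`
  -- is concave, hence the minimum of its three linear pieces.
  ⟨min (2 * (t : ℝ)) (min (t + 1 / 4) ((t + 1) / 2)), by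
    have h1 := t.2.1
    refine le_min ?_ (le_min ?_ ?_) <;> linarith, by
    have h2 := t.2.2
    refine (min_le_right _ _).trans ((min_le_right _ _).trans ?_)
    linarith⟩

theorem coe_assocParam (t : unitInterval) :
    (assocParam t : ℝ) = min (2 * (t : ℝ)) (min (t + 1 / 4) ((t + 1) / 2)) := rfl

theorem continuous_assocParam : Continuous assocParam := Continuous.subtype_mk (by fun_prop) _

theorem monotone_assocParam : Monotone assocParam := by
  intro s t h
  have h' : (s : ℝ) ≤ t := h
  change (assocParam s : ℝ) ≤ assocParam t
  rw [coe_assocParam, coe_assocParam]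
  gcongr

theorem assocParam_zero : assocParam 0 = 0 := by
  ext; rw [coe_assocParam]; norm_num

theorem assocParam_one : assocParam 1 = 1 := by
  ext; rw [coe_assocParam]; norm_num

theorem dblL_assocParam (t : unitInterval) : dblL (assocParam t) = dblL (dblL t) := by
  ext
  have h1 := t.2.1
  have h2 := t.2.2
  rw [coe_dblL, coe_dblL, coe_dblL, coe_assocParam]
  simp only [min_def]
  split_ifs <;> linarith

theorem dblR_dblR_assocParam (t : unitInterval) : dblR (dblR (assocParam t)) = dblR t := by
  ext
  have h1 := t.2.1
  have h2 := t.2.2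
  rw [coe_dblR, coe_dblR, coe_dblR, coe_assocParam]
  simp only [min_def, max_def]
  split_ifs <;> linarith

theorem dblL_dblR_assocParam (t : unitInterval) : dblL (dblR (assocParam t)) = dblR (dblL t) := by
  ext
  have h1 := t.2.1
  have h2 := t.2.2
  rw [coe_dblL, coe_dblR, coe_dblR, coe_dblL, coe_assocParam]
  simp only [min_def, max_def]
  split_ifs <;> linarith

theorem lt_half_iff {t : unitInterval} : t < half ↔ (t : ℝ) < 1 / 2 := Iff.rfl

theorem half_lt_iff {t : unitInterval} : half < t ↔ (1 / 2 : ℝ) < t := Iff.rfl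

namespace PathSystem

/-- Both bracketings list the same charts and transition maps in the same order, so the index map is
the identity. Only the parameters differ, and these are compared on the pieces cut out by `1/4` and
`1/2`. -/
theorem concat_assoc_refines (σ : 𝒳.PathSystem o₁ o₂) (τ : 𝒳.PathSystem o₂ o₃)
    (κ : 𝒳.PathSystem o₃ o₄) : ((σ.concat τ).concat κ).Refines
      ((σ.concat (τ.concat κ)).reparam assocParam continuous_assocParam monotone_assocParam
        assocParam_zero assocParam_one) := by
  have n1 : (σ.concat τ).n = σ.n + τ.n := rfl
  have n2 : (τ.concat κ).n = τ.n + κ.n := rfl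
  have n3 : ((σ.concat τ).concat κ).n = σ.n + τ.n + κ.n := rfl
  have n4 : (σ.concat (τ.concat κ)).n = σ.n + (τ.n + κ.n) := rfl
  have key : ∀ k t, t ∈ ((σ.concat τ).concat κ).I k →
      assocParam t ∈ (σ.concat (τ.concat κ)).I k ∧
        ((σ.concat τ).concat κ).f k t = (σ.concat (τ.concat κ)).f k (assocParam t) := by
    intro k t ht
    have h0 := t.2.1
    have h1 := t.2.2
    have hA := coe_assocParam t
    have hR := coe_dblR (assocParam t)
    have hL := coe_dblL t
    rcases le_or_gt (t : ℝ) (1 / 2) with hlt | hlt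
    · have hlt' : t ≤ half := hlt
      obtain ⟨hk, hm⟩ := mem_concat_le hlt' ht
      rw [n1] at hk
      rw [concat_f_left hlt' hk]
      rcases lt_trichotomy (t : ℝ) (1 / 4) with hq | hq | hq
      · have a1 : assocParam t < half := by
          rw [lt_half_iff, hA]; exact (min_le_left _ _).trans_lt (by linarith)
        have a2 : dblL t < half := by
          rw [lt_half_iff, hL]; exact (min_le_right _ _).trans_lt (by linarith)
        obtain ⟨hk', hm'⟩ := (mem_concat_left a2).1 hm
        rw [concat_f_left a2.le hk', concat_f_left a1.le hk', dblL_assocParam]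
        refine ⟨(mem_concat_left a1).2 ⟨hk', ?_⟩, rfl⟩
        rw [dblL_assocParam]
        exact hm'
      · have a1 : assocParam t = half := by
          ext; rw [hA, hq]; norm_num [half]
        have a2 : dblL t = half := by
          ext; rw [hL, hq]; norm_num [half]
        rw [a2] at hm ⊢
        have hk' := mem_concat_half.1 hm
        rw [a1, concat_f_left le_rfl hk'.le, concat_f_left le_rfl hk'.le]
        exact ⟨mem_concat_half.2 hk', rfl⟩
      · have a1 : half < assocParam t := by
          rw [half_lt_iff, hA]
          refine lt_min ?_ (lt_min ?_ ?_) <;> linarith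
        have a2 : half < dblL t := by
          rw [half_lt_iff, hL]
          refine lt_min ?_ ?_ <;> linarith
        have a3 : dblR (assocParam t) ≤ half := by
          change (dblR (assocParam t) : ℝ) ≤ 1 / 2
          rw [hR]
          have : (assocParam t : ℝ) ≤ t + 1 / 4 := by
            rw [hA]; exact (min_le_right _ _).trans (min_le_left _ _)
          refine max_le ?_ ?_ <;> linarith
        obtain ⟨hk', hm'⟩ := (mem_concat_right a2).1 hm
        have hmem : dblR (assocParam t) ∈ (τ.concat κ).I (k - σ.n) := by
          rcases a3.lt_or_eq with a4 | a4
          · refine (mem_concat_left a4).2 ⟨by omega, ?_⟩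
            rw [dblL_dblR_assocParam]
            exact hm'
          -- On this piece the parameter of the inner concatenation reaches its midpoint only for `t
          -- = 1/2`, where the index is forced on both sides.
          · rw [a4]
            have : t = half := by
              have e : (dblR (assocParam t) : ℝ) = 1 / 2 := congrArg Subtype.val a4
              have h2 : (assocParam t : ℝ) ≤ t + 1 / 4 := by
                rw [hA]; exact (min_le_right _ _).trans (min_le_left _ _)
              rw [hR] at e
              ext
              change (t : ℝ) = 1 / 2
              rcases max_choice (0 : ℝ) (2 * (assocParam t : ℝ) - 1) with h | h <;> rw [h] at e
              · norm_num at e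
              · linarith
            rw [this] at ht
            have := mem_concat_half.1 ht
            rw [mem_concat_half]
            omega
        refine ⟨(mem_concat_right a1).2 ⟨hk', hmem⟩, ?_⟩
        rw [concat_f_right a2 hk', concat_f_right a1 hk', concat_f_left a3 (by omega),
          dblL_dblR_assocParam]
    · have hlt' : half < t := hlt
      obtain ⟨hk, hm⟩ := (mem_concat_right hlt').1 ht
      rw [n1] at hk hm
      have b1 : (3 / 4 : ℝ) < assocParam t := by
        rw [hA]
        refine lt_min ?_ (lt_min ?_ ?_) <;> linarith
      have a1 : half < assocParam t := by
        rw [half_lt_iff]; linarith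
      have a2 : half < dblR (assocParam t) := by
        rw [half_lt_iff, hR]
        exact lt_max_of_lt_right (by linarith)
      have e : k - (σ.n + τ.n) = k - σ.n - τ.n := by omega
      refine ⟨(mem_concat_right a1).2 ⟨by omega, (mem_concat_right a2).2 ⟨by omega, ?_⟩⟩, ?_⟩
      · rw [dblR_dblR_assocParam, ← e]
        exact hm
      · rw [concat_f_right hlt' hk, concat_f_right a1 (by omega), concat_f_right a2 (by omega),
          dblR_dblR_assocParam, n1, e]
  refine refines_of_map id rfl (Nat.add_assoc _ _ _) (fun k hk => ⟨by
    rw [n3] at hk; change k ≤ (σ.concat (τ.concat κ)).n; omega, ?_⟩) (fun k _ t ht => key k t ht)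
    fun k hk => Or.inr ⟨rfl, ?_⟩
  · change _ = (σ.concat (τ.concat κ)).chart k
    rcases le_total k σ.n with h | h
    · rw [concat_chart_left (by rw [n1]; omega), concat_chart_left h, concat_chart_left h]
    · rw [concat_chart_right (τ := τ.concat κ) h]
      rcases le_total k (σ.n + τ.n) with h' | h'
      · rw [concat_chart_left (by rwa [n1]), concat_chart_right h, concat_chart_left (by omega)]
      · rw [concat_chart_right (by rwa [n1]), concat_chart_right (by omega), n1]
        congr 1; omega
  · change _ = (σ.concat (τ.concat κ)).ρ k
    rcases lt_or_ge k σ.n with h | h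
    · rw [concat_rho_left (by rw [n1]; omega), concat_rho_left h, concat_rho_left h]
    · rw [concat_rho_right (τ := τ.concat κ) h]
      rcases lt_or_ge k (σ.n + τ.n) with h' | h'
      · rw [concat_rho_left (by rwa [n1]), concat_rho_right h, concat_rho_left (by omega)]
      · rw [concat_rho_right (by rwa [n1]), concat_rho_right (by omega), n1]
        congr 1; omega

end PathSystem

end Families

end Orbispace

/-! ### The fundamental groupoid and the relations between paths and transition maps. -/

namespace Orbispace

open CategoryTheory

section Groupoid

variable {X : Type u} [TopologicalSpace X] {𝒳 : Orbispace X}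

/-- Charts are open and closed in the disjoint union, so a path stays in one of them. -/
theorem fst_eq_of_continuous {f : unitInterval → 𝒳.Pt} (hf : Continuous f) (s t : unitInterval) :
    (f s).1 = (f t).1 :=
  isPreconnected_univ.eq_of_eventually_eq (f := fun t => (f t).1) (fun t _ => by
    rw [nhdsWithin_univ]
    exact hf.continuousAt.eventually (fst_eventually (f t))) (mem_univ s) (mem_univ t)

theorem BasePoint.eq_of_point_eq {x y : 𝒳.BasePoint} (h : x.point = y.point) : x = y := by
  obtain ⟨p, i, l, rfl⟩ := x
  obtain ⟨q, j, m, rfl⟩ := y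
  obtain ⟨rfl, h⟩ := Sigma.mk.inj_iff.1 h
  obtain rfl := eq_of_heq h
  rfl

namespace PathSystem

variable {o₁ o₂ o₃ : 𝒳.BasePoint}

theorem elem_n {a : 𝒳.Arr} {f g : unitInterval → 𝒳.Pt} (hf : Continuous f) (hg : Continuous g)
    (h : ∀ t, 𝒳.Sends a (f t) (g t)) (h₁ : f 0 = o₁.point) (h₂ : g 1 = o₂.point) :
    (elem a f g hf hg h h₁ h₂).n = 1 := rfl

/-- The constant system. -/
def const (o : 𝒳.BasePoint) : 𝒳.PathSystem o o :=
  elem (𝒳.oneArr o.idx) (fun _ => o.point) (fun _ => o.point) continuous_const continuous_const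
    (fun _ => sends_oneArr rfl) rfl rfl

/-- The index `1` of the concatenation is the merged middle chart. Truncated subtraction sends both
`0` and `1` to the first chart of `σ`, where the additional transition map is the identity. -/
theorem const_concat_refines (σ : 𝒳.PathSystem o₁ o₂) : ((const o₁).concat σ).Refines
    (σ.reparam dblR continuous_dblR monotone_dblR (dblR_of_le zero_lt_half.le) dblR_one) := by
  have n1 : (const o₁).n = 1 := rfl
  have n2 : ((const o₁).concat σ).n = 1 + σ.n := rfl
  refine refines_of_map (fun k => k - 1) rfl (by rw [n2]; exact Nat.add_sub_cancel_left ..)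
    (fun k hk => ⟨?_, ?_⟩) (fun k hk t ht => ?_) fun k hk => ?_
  · change k - 1 ≤ σ.n
    omega
  · change _ = σ.chart (k - 1)
    rcases le_total k 1 with h | h
    · rw [concat_chart_left h]
      have : k - 1 = 0 := by omega
      rw [this, chart_zero]
      change (if k = 0 then _ else _) = _
      split_ifs <;> rfl
    · rw [concat_chart_right h, n1]
  · change dblR t ∈ σ.I (k - 1) ∧ _ = σ.f (k - 1) (dblR t)
    rcases le_total t half with h | h
    · obtain ⟨h1, -⟩ := mem_concat_le h ht
      rw [n1] at h1
      have e : k - 1 = 0 := by omega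
      rw [concat_f_left h h1, dblR_of_le h, e, σ.f_zero]
      refine ⟨σ.zero_mem, ?_⟩
      change (if k = 0 then _ else _ : unitInterval → 𝒳.Pt) _ = _
      split_ifs <;> rfl
    · rw [concat_f_ge h ht]
      exact ⟨(mem_concat_ge h ht).2.1, rfl⟩
  · rcases Nat.eq_zero_or_pos k with rfl | h
    · left
      refine ⟨rfl, ?_⟩
      rw [concat_rho_left (by rw [n1]; exact one_pos), chart_zero]
      rfl
    · right
      refine ⟨by omega, ?_⟩
      rw [concat_rho_right (by rw [n1]; exact h)]
      rfl

theorem concat_const_refines (σ : 𝒳.PathSystem o₁ o₂) : (σ.concat (const o₂)).Refines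
    (σ.reparam dblL continuous_dblL monotone_dblL dblL_zero (dblL_of_le half_lt_one.le)) := by
  have n2 : (σ.concat (const o₂)).n = σ.n + 1 := rfl
  refine refines_of_map (fun k => min k σ.n) (Nat.zero_min _) (by
      rw [n2]; exact min_eq_right (Nat.le_succ _))
    (fun k hk => ⟨min_le_right _ _, ?_⟩) (fun k hk t ht => ?_) fun k hk => ?_
  · change _ = σ.chart (min k σ.n)
    rcases le_total k σ.n with h | h
    · rw [concat_chart_left h, min_eq_left h]
    · rw [concat_chart_right h, min_eq_right h, chart_n]
      change (if _ then _ else _) = _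
      split_ifs <;> rfl
  · change dblL t ∈ σ.I (min k σ.n) ∧ _ = σ.f (min k σ.n) (dblL t)
    rcases le_total t half with h | h
    · obtain ⟨h1, h2⟩ := mem_concat_le h ht
      rw [concat_f_left h h1, min_eq_left h1]
      exact ⟨h2, rfl⟩
    · obtain ⟨h1, -⟩ := mem_concat_ge h ht
      rw [concat_f_ge h ht, min_eq_right h1, dblL_of_le h, σ.f_one]
      refine ⟨σ.one_mem, ?_⟩
      change (if k - σ.n = 0 then _ else _ : unitInterval → 𝒳.Pt) _ = _
      split_ifs <;> rfl
  · rw [n2] at hk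
    rcases Nat.lt_or_ge k σ.n with h | h
    · right
      change min (k + 1) σ.n = min k σ.n + 1 ∧ _ = σ.ρ (min k σ.n)
      rw [concat_rho_left h, min_eq_left h.le]
      exact ⟨min_eq_left h, rfl⟩
    · obtain rfl : k = σ.n := by omega
      left
      refine ⟨by rw [min_self]; exact min_eq_right (Nat.le_succ _), ?_⟩
      rw [concat_rho_right le_rfl, concat_chart_left le_rfl, chart_n]
      rfl

end PathSystem

/-- Homotopy classes of systems. -/
def Hom (x y : 𝒳.BasePoint) : Type u := Quot (PathSystem.HtpyStep (o₁ := x) (o₂ := y))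

/-- The homotopy class of a system. -/
def PathSystem.hom {x y : 𝒳.BasePoint} (σ : 𝒳.PathSystem x y) : Hom x y := Quot.mk _ σ

theorem PathSystem.Refines.hom_eq {x y : 𝒳.BasePoint} {σ τ : 𝒳.PathSystem x y}
    (h : σ.Refines τ) : σ.hom = τ.hom := Quot.sound (Or.inl h)

theorem PathSystem.hom_reparam {x y : 𝒳.BasePoint} (σ : 𝒳.PathSystem x y)
    (φ : unitInterval → unitInterval) (hφ : Continuous φ) (hm : Monotone φ) (h0 : φ 0 = 0)
    (h1 : φ 1 = 1) : (σ.reparam φ hφ hm h0 h1).hom = σ.hom :=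
  Quot.sound (σ.htpyStep_reparam φ hφ hm h0 h1)

/-- The fundamental groupoid. -/
noncomputable instance : Category.{u} 𝒳.BasePoint where
  Hom := Hom
  id x := (PathSystem.const x).hom
  comp := Quot.map₂ PathSystem.concat (fun σ _ _ h => h.concat_left σ)
    (fun _ _ τ h => h.concat_right τ)
  id_comp α := by
    obtain ⟨σ⟩ := α
    exact σ.const_concat_refines.hom_eq.trans (σ.hom_reparam ..)
  comp_id α := by
    obtain ⟨σ⟩ := α
    exact σ.concat_const_refines.hom_eq.trans (σ.hom_reparam ..)
  assoc α β γ := by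
    obtain ⟨σ⟩ := α
    obtain ⟨τ⟩ := β
    obtain ⟨κ⟩ := γ
    exact (σ.concat_assoc_refines τ κ).hom_eq.trans (PathSystem.hom_reparam ..)

variable {x y z w : 𝒳.BasePoint}

/-- The homotopy class of a system, as a morphism. -/
def PathSystem.mor (σ : 𝒳.PathSystem x y) : x ⟶ y := σ.hom

theorem PathSystem.mor_surjective (α : x ⟶ y) : ∃ σ : 𝒳.PathSystem x y, σ.mor = α :=
  Quot.exists_rep α

theorem PathSystem.HtpyStep.mor_eq {σ τ : 𝒳.PathSystem x y} (h : σ.HtpyStep τ) :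
    σ.mor = τ.mor := Quot.sound h

/-- The morphism given by a path, followed by a transition map. -/
def elemHom (a : 𝒳.Arr) (f g : unitInterval → 𝒳.Pt) (hf : Continuous f) (hg : Continuous g)
    (h : ∀ t, 𝒳.Sends a (f t) (g t)) (h₁ : f 0 = x.point) (h₂ : g 1 = y.point) : x ⟶ y :=
  (PathSystem.elem a f g hf hg h h₁ h₂).mor

theorem elemHom_congr {a a' : 𝒳.Arr} {f f' g g' : unitInterval → 𝒳.Pt} {hf : Continuous f}
    {hg : Continuous g} {h : ∀ t, 𝒳.Sends a (f t) (g t)} {h₁ : f 0 = x.point} {h₂ : g 1 = y.point}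
    {hf' : Continuous f'} {hg' : Continuous g'} {h' : ∀ t, 𝒳.Sends a' (f' t) (g' t)}
    {h₁' : f' 0 = x.point} {h₂' : g' 1 = y.point} (ha : a = a') (hff : ∀ t, f t = f' t)
    (hgg : ∀ t, g t = g' t) : elemHom a f g hf hg h h₁ h₂ = elemHom a' f' g' hf' hg' h' h₁' h₂' := by
  subst ha
  obtain rfl := funext hff
  obtain rfl := funext hgg
  rfl

/-- The morphism given by a transition map. -/
def arrHom (a : 𝒳.Arr) (h : 𝒳.Sends a x.point y.point) : x ⟶ y :=
  elemHom a (fun _ => x.point) (fun _ => y.point) continuous_const continuous_const (fun _ => h)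
    rfl rfl

/-- The morphism given by a path. -/
def pathHom (f : unitInterval → 𝒳.Pt) (hf : Continuous f) (h₁ : f 0 = x.point)
    (h₂ : f 1 = y.point) : x ⟶ y :=
  elemHom (𝒳.oneArr x.idx) f f hf hf (fun t => sends_oneArr (by
    rw [fst_eq_of_continuous hf t 0, h₁]; rfl)) h₁ h₂

theorem pathHom_const : pathHom (fun _ => x.point) continuous_const rfl rfl = 𝟙 x := rfl

theorem pathHom_comp_arrHom (a : 𝒳.Arr) (f g : unitInterval → 𝒳.Pt) (hf : Continuous f)
    (hg : Continuous g) (h : ∀ t, 𝒳.Sends a (f t) (g t)) (h₁ : f 0 = x.point)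
    (h₂ : f 1 = y.point) (h₃ : g 1 = z.point) (h' : 𝒳.Sends a y.point z.point) :
    pathHom f hf h₁ h₂ ≫ arrHom a h' = elemHom a f g hf hg h h₁ h₃ := by
  refine Eq.trans (PathSystem.Refines.hom_eq ?_) (PathSystem.hom_reparam (φ := dblL) _
    continuous_dblL monotone_dblL dblL_zero (dblL_of_le half_lt_one.le))
  have e : x.idx = a.src := by
    rw [← (h 0).src_eq, h₁]; rfl
  have e' : y.idx = a.src := h'.src_eq
  refine PathSystem.refines_of_map (fun k => k - 1) rfl rfl (fun k hk => ?_) (fun k hk t ht => ?_)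
    fun k hk => ?_
  · have hk : k ≤ 2 := hk
    interval_cases k
    · exact ⟨zero_le_one, e⟩
    · exact ⟨zero_le_one, e⟩
    · exact ⟨le_rfl, rfl⟩
  · refine ⟨trivial, ?_⟩
    have hk : k ≤ 2 := hk
    rcases le_total t half with h5 | h5
    · obtain ⟨h6, -⟩ := PathSystem.mem_concat_le h5 ht
      have h6 : k ≤ 1 := h6
      rw [PathSystem.concat_f_left h5 h6]
      interval_cases k <;> rfl
    · obtain ⟨h6, -⟩ := PathSystem.mem_concat_ge h5 ht
      have h6 : 1 ≤ k := h6
      rw [PathSystem.concat_f_ge h5 ht]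
      interval_cases k
      · change y.point = f (dblL t)
        rw [dblL_of_le h5, h₂]
      · change z.point = g (dblL t)
        rw [dblL_of_le h5, h₃]
  · have hk : k < 2 := hk
    interval_cases k
    · exact Or.inl ⟨rfl, rfl⟩
    · exact Or.inr ⟨rfl, rfl⟩

/-- Together with `pathHom_comp_arrHom` this is naturality: along a path in the domain of `a`,
moving first and applying `a` first give the same `elemHom`. -/
theorem arrHom_comp_pathHom (a : 𝒳.Arr) (f g : unitInterval → 𝒳.Pt) (hf : Continuous f)
    (hg : Continuous g) (h : ∀ t, 𝒳.Sends a (f t) (g t)) (h₁ : f 0 = x.point)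
    (h₂ : g 0 = y.point) (h₃ : g 1 = z.point) (h' : 𝒳.Sends a x.point y.point) :
    arrHom a h' ≫ pathHom g hg h₂ h₃ = elemHom a f g hf hg h h₁ h₃ := by
  refine Eq.trans (PathSystem.Refines.hom_eq ?_) (PathSystem.hom_reparam (φ := dblR) _
    continuous_dblR monotone_dblR (dblR_of_le zero_lt_half.le) dblR_one)
  have e : y.idx = a.tgt := h'.tgt_eq
  refine PathSystem.refines_of_map (fun k => min k 1) rfl rfl (fun k hk => ?_)
    (fun k hk t ht => ?_) fun k hk => ?_
  · have hk : k ≤ 2 := hk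
    interval_cases k
    · exact ⟨zero_le_one, rfl⟩
    · exact ⟨le_rfl, rfl⟩
    · exact ⟨le_rfl, e⟩
  · refine ⟨trivial, ?_⟩
    have hk : k ≤ 2 := hk
    rcases le_total t half with h5 | h5
    · obtain ⟨h6, -⟩ := PathSystem.mem_concat_le h5 ht
      have h6 : k ≤ 1 := h6
      rw [PathSystem.concat_f_left h5 h6]
      interval_cases k
      · change x.point = f (dblR t)
        rw [dblR_of_le h5, h₁]
      · change y.point = g (dblR t)
        rw [dblR_of_le h5, h₂]
    · obtain ⟨h6, -⟩ := PathSystem.mem_concat_ge h5 ht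
      have h6 : 1 ≤ k := h6
      rw [PathSystem.concat_f_ge h5 ht]
      interval_cases k <;> rfl
  · have hk : k < 2 := hk
    interval_cases k
    · exact Or.inr ⟨rfl, rfl⟩
    · exact Or.inl ⟨rfl, congrArg 𝒳.oneArr e⟩

/-- The concatenation has three charts; the middle one is absorbed into the last by taking `b`
itself as its refinement map. -/
theorem arrHom_comp_arrHom {a b : 𝒳.Arr} (h : 𝒳.Sends a x.point y.point)
    (h' : 𝒳.Sends b y.point z.point) :
    arrHom a h ≫ arrHom b h' = arrHom (𝒳.mul b a x.point) (h.mul h') := by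
  refine PathSystem.Refines.hom_eq ?_
  have hc := h.compAt h'
  have hs := h.mul h'
  have e0 : x.idx = a.src := h.src_eq
  have e1 : b.tgt = z.idx := h'.tgt_eq.symm
  have e2 : y.idx = a.tgt := h.tgt_eq
  have e3 : y.idx = b.src := h'.src_eq
  refine ⟨fun k => min k 1, fun k => if k = 0 then 𝒳.oneArr x.idx else if k = 1 then b else
    𝒳.oneArr z.idx, fun k hk => ⟨min_le_right _ _, subset_univ _⟩, rfl, rfl, rfl, rfl,
    fun k hk => ?_, fun k hk t ht => ?_, fun k hk t ht => ?_⟩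
  · have hk : k ≤ 2 := hk
    interval_cases k
    · exact ⟨e0, hs.src_eq⟩
    · exact ⟨e3.symm.trans e2, e1.trans hs.tgt_eq⟩
    · exact ⟨e1.symm, hs.tgt_eq⟩
  · have hk : k ≤ 2 := hk
    rcases le_total t half with h5 | h5
    · obtain ⟨h6, -⟩ := PathSystem.mem_concat_le h5 ht
      have h6 : k ≤ 1 := h6
      rw [PathSystem.concat_f_left h5 h6]
      interval_cases k
      · exact sends_oneArr rfl
      · exact h'
    · obtain ⟨h6, -⟩ := PathSystem.mem_concat_ge h5 ht
      have h6 : 1 ≤ k := h6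
      rw [PathSystem.concat_f_ge h5 ht]
      interval_cases k
      · exact h'
      · exact sends_oneArr rfl
  · have hk : k < 2 := hk
    interval_cases k
    · have h5 : t ≤ half := by
        by_contra h5
        exact absurd (PathSystem.mem_concat_ge (not_le.1 h5).le ht.1).1 (Nat.not_succ_le_zero 0)
      rw [PathSystem.concat_f_left h5 (Nat.zero_le _), PathSystem.concat_rho_left Nat.one_pos]
      refine ⟨fun h => absurd h one_ne_zero, fun _ => ⟨𝒳.mul b a x.point, hc, ?_⟩,
        fun h => absurd h (by decide)⟩
      have := hs.compAt_one_right
      rwa [← hs.src_eq] at this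
    · have h5 : half ≤ t := by
        by_contra h5
        exact absurd (PathSystem.mem_concat_le (not_le.1 h5).le ht.2).1 (by simp [PathSystem.elem_n])
      rw [PathSystem.concat_f_ge h5 ht.1, PathSystem.concat_rho_right (Nat.le_refl 1)]
      refine ⟨fun _ => ?_, fun h => absurd h (by decide), fun h => absurd h (by decide)⟩
      have := h'.compAt_one_left
      rwa [e1] at this

theorem pathHom_eq_of_homotopy (F : unitInterval × unitInterval → 𝒳.Pt) (hF : Continuous F)
    (h₁ : ∀ s, F (s, 0) = x.point) (h₂ : ∀ s, F (s, 1) = y.point) :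
    pathHom (fun t => F (0, t)) (hF.comp (Continuous.prodMk_right 0)) (h₁ 0) (h₂ 0) =
      pathHom (fun t => F (1, t)) (hF.comp (Continuous.prodMk_right 1)) (h₁ 1) (h₂ 1) := by
  refine PathSystem.HtpyStep.mor_eq (Or.inr ⟨fun s => PathSystem.elem (𝒳.oneArr x.idx)
    (fun t => F (s, t)) (fun t => F (s, t)) (hF.comp (Continuous.prodMk_right s))
    (hF.comp (Continuous.prodMk_right s)) (fun t => sends_oneArr ?_) (h₁ s) (h₂ s), rfl, rfl,
    fun s => PathSystem.tends_of_continuousAt (fun _ => rfl) (fun _ _ => rfl)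
      (fun M hM => Filter.Eventually.of_forall fun _ k _ =>
        ⟨1, mem_of_mem_nhds hM, (lact_one_one _).symm⟩) fun k hk t ht => ⟨?_, ?_⟩⟩)
  · rw [fst_eq_of_continuous (f := fun t => F (s, t)) (hF.comp (Continuous.prodMk_right s)) t 0,
      h₁]
    rfl
  · exact Filter.Eventually.of_forall fun _ => trivial
  · rcases Nat.eq_zero_or_pos k with rfl | hk'
    · exact hF.continuousAt
    · obtain rfl : k = 1 := by
        have hk : k ≤ 1 := hk
        omega
      exact hF.continuousAt

theorem pathHom_comp_pathHom (f g : unitInterval → 𝒳.Pt) (hf : Continuous f) (hg : Continuous g)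
    (h₁ : f 0 = x.point) (h₂ : f 1 = y.point) (h₃ : g 0 = y.point) (h₄ : g 1 = z.point)
    (F : unitInterval → 𝒳.Pt) (hF : Continuous F) (hl : ∀ t ≤ half, F t = f (dblL t))
    (hr : ∀ t, half ≤ t → F t = g (dblR t)) (h₅ : F 0 = x.point) (h₆ : F 1 = z.point) :
    pathHom f hf h₁ h₂ ≫ pathHom g hg h₃ h₄ = pathHom F hF h₅ h₆ := by
  have e : y.idx = x.idx := by
    have := fst_eq_of_continuous hf 1 0
    rwa [h₁, h₂] at this
  refine PathSystem.Refines.hom_eq (PathSystem.refines_of_map (fun k => min k 1) rfl rfl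
    (fun k hk => ⟨min_le_right _ _, ?_⟩) (fun k hk t ht => ⟨trivial, ?_⟩) fun k hk => ?_)
  · have hk : k ≤ 2 := hk
    interval_cases k
    · rfl
    · rfl
    · exact e
  · have hk : k ≤ 2 := hk
    have hF' : ∀ l, (PathSystem.elem (𝒳.oneArr x.idx) F F hF hF (fun t => sends_oneArr (by
        rw [fst_eq_of_continuous hF t 0, h₅]; rfl)) h₅ h₆ : 𝒳.PathSystem x z).f l t = F t := by
      intro l
      change (if l = 0 then F else F) t = F t
      rw [ite_self]
    refine Eq.trans ?_ (hF' _).symm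
    rcases le_total t half with h5 | h5
    · obtain ⟨h6, -⟩ := PathSystem.mem_concat_le h5 ht
      have h6 : k ≤ 1 := h6
      rw [PathSystem.concat_f_left h5 h6, hl t h5]
      interval_cases k <;> rfl
    · obtain ⟨h6, -⟩ := PathSystem.mem_concat_ge h5 ht
      have h6 : 1 ≤ k := h6
      rw [PathSystem.concat_f_ge h5 ht, hr t h5]
      interval_cases k <;> rfl
  · have hk : k < 2 := hk
    interval_cases k
    · exact Or.inr ⟨rfl, rfl⟩
    · exact Or.inl ⟨rfl, congrArg 𝒳.oneArr e⟩

/-- The two ways around the square are `(dblL t, dblR t)` and `(dblR t, dblL t)`; interpolating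
linearly between them keeps both corners fixed. -/
theorem pathHom_square (Q : unitInterval × unitInterval → 𝒳.Pt) (hQ : Continuous Q)
    (h₁ : Q (0, 0) = x.point) (h₂ : Q (1, 0) = y.point) (h₃ : Q (0, 1) = z.point)
    (h₄ : Q (1, 1) = w.point) :
    pathHom (fun t => Q (t, 0)) (hQ.comp (Continuous.prodMk_left 0)) h₁ h₂ ≫
        pathHom (fun t => Q (1, t)) (hQ.comp (Continuous.prodMk_right 1)) h₂ h₄ =
      pathHom (fun t => Q (0, t)) (hQ.comp (Continuous.prodMk_right 0)) h₁ h₃ ≫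
        pathHom (fun t => Q (t, 1)) (hQ.comp (Continuous.prodMk_left 1)) h₃ h₄ := by
  have hL := dblL_zero
  have hR := dblR_one
  have hL' := dblL_of_le half_lt_one.le
  have hR' := dblR_of_le zero_lt_half.le
  have hF : Continuous fun p : unitInterval × unitInterval =>
      Q (lerp (dblL p.2) (dblR p.2) p.1, lerp (dblR p.2) (dblL p.2) p.1) :=
    hQ.comp (((continuous_dblL.comp continuous_snd).lerp (continuous_dblR.comp continuous_snd)
      continuous_fst).prodMk ((continuous_dblR.comp continuous_snd).lerp
        (continuous_dblL.comp continuous_snd) continuous_fst))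
  have key := pathHom_eq_of_homotopy (x := x) (y := w) _ hF (fun s => by
    simp only [hL, hR', lerp_self, h₁]) (fun s => by simp only [hL', hR, lerp_self, h₄])
  rw [pathHom_comp_pathHom (F := fun t => Q (lerp (dblL t) (dblR t) 0, lerp (dblR t) (dblL t) 0))
      (hF := hF.comp (Continuous.prodMk_right 0)) (h₅ := by simp only [hL, hR', lerp_self, h₁])
      (h₆ := by simp only [hL', hR, lerp_self, h₄]),
    pathHom_comp_pathHom (F := fun t => Q (lerp (dblL t) (dblR t) 1, lerp (dblR t) (dblL t) 1))
      (hF := hF.comp (Continuous.prodMk_right 1)) (h₅ := by simp only [hL, hR', lerp_self, h₁])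
      (h₆ := by simp only [hL', hR, lerp_self, h₄])]
  · exact key
  · intro t ht
    simp only [lerp_one, dblR_of_le ht]
  · intro t ht
    simp only [lerp_one, dblL_of_le ht]
  · intro t ht
    simp only [lerp_zero, dblR_of_le ht]
  · intro t ht
    simp only [lerp_zero, dblL_of_le ht]

/-- Let the transition map itself move: at stage `s` it is `h s`, followed by the remaining part of
the orbit path. At `s = 0` this is the left side, and at `s = 1` no path remains. The family is
continuous because transition maps carry the topology of the groups. -/
theorem arrHom_comp_pathHom_smul {i : 𝒳.Idx} (p : (𝒳.str i).Cov)
    (h : unitInterval → (𝒳.str i).Grp) (hh : Continuous h) (hx : x.point = ⟨i, p⟩)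
    (hy : y.point = ⟨i, h 0 • p⟩) (hz : z.point = ⟨i, h 1 • p⟩)
    (h₀ : 𝒳.Sends (𝒳.grpArr i (h 0)) x.point y.point)
    (h₁ : 𝒳.Sends (𝒳.grpArr i (h 1)) x.point z.point)
    (hc : Continuous fun t => (⟨i, h t • p⟩ : 𝒳.Pt)) :
    arrHom (𝒳.grpArr i (h 0)) h₀ ≫ pathHom (fun t => ⟨i, h t • p⟩) hc hy.symm hz.symm =
      arrHom (𝒳.grpArr i (h 1)) h₁ := by
  have hl : Continuous fun q : unitInterval × unitInterval => h (lerp q.1 1 q.2) :=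
    hh.comp (continuous_fst.lerp continuous_const continuous_snd)
  have hg : Continuous fun q : unitInterval × unitInterval =>
      (⟨i, h (lerp q.1 1 q.2) • p⟩ : 𝒳.Pt) :=
    continuous_sigmaMk.comp (hl.smul continuous_const)
  have hf : Continuous fun q : unitInterval × unitInterval =>
      (⟨i, ((h q.1)⁻¹ * h (lerp q.1 1 q.2)) • p⟩ : 𝒳.Pt) :=
    continuous_sigmaMk.comp (((hh.comp continuous_fst).inv.mul hl).smul continuous_const)
  have hs : ∀ q : unitInterval × unitInterval, 𝒳.Sends (𝒳.grpArr i (h q.1))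
      ⟨i, ((h q.1)⁻¹ * h (lerp q.1 1 q.2)) • p⟩ ⟨i, h (lerp q.1 1 q.2) • p⟩ := fun q => by
    have := sends_grpArr i (h q.1) (((h q.1)⁻¹ * h (lerp q.1 1 q.2)) • p)
    rwa [smul_smul, mul_inv_cancel_left] at this
  let Φ : unitInterval → 𝒳.PathSystem x z := fun s => PathSystem.elem (𝒳.grpArr i (h s)) _ _
    (hf.comp (Continuous.prodMk_right s)) (hg.comp (Continuous.prodMk_right s))
    (fun t => hs (s, t)) (by simp [hx]) (by simp [hz])
  have h0 : arrHom (𝒳.grpArr i (h 0)) h₀ ≫ pathHom (fun t => ⟨i, h t • p⟩) hc hy.symm hz.symm =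
      (Φ 0).mor := by
    have e : ∀ t, lerp 0 1 t = t := fun t => by ext; simp [coe_lerp]
    refine (arrHom_comp_pathHom _ _ _ (hf.comp (Continuous.prodMk_right 0)) hc (fun t => ?_) ?_ _ _
      _).trans (elemHom_congr rfl (fun _ => rfl) fun t => ?_)
    · have := hs (0, t)
      simp only [e] at this
      simpa only [Function.comp_def, e] using this
    · simp [hx]
    · simp only [Function.comp_def, e]
  have h1 : arrHom (𝒳.grpArr i (h 1)) h₁ = (Φ 1).mor :=
    elemHom_congr rfl (fun t => by simp [hx]) fun t => by simp [hz]
  rw [h0, h1]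
  refine PathSystem.HtpyStep.mor_eq (Or.inr ⟨Φ, rfl, rfl, fun s =>
    PathSystem.tends_of_continuousAt (fun _ => rfl) (fun s' k => ?_) (fun M hM => ?_)
      fun k hk t ht => ⟨Filter.Eventually.of_forall fun _ => trivial, ?_⟩⟩)
  · rfl
  · classical
    have hm : Continuous fun s' => (Pi.mulSingle i (h s' * (h s)⁻¹) : 𝒳.Gau) :=
      (continuous_mulSingle i).comp (hh.mul continuous_const)
    have := hm.continuousAt (x := s)
    rw [ContinuousAt, mul_inv_cancel, Pi.mulSingle_one] at this
    filter_upwards [this hM] with s' hs' k hk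
    refine ⟨Pi.mulSingle i (h s' * (h s)⁻¹), hs', ?_⟩
    change 𝒳.grpArr i (h s') = lact _ (𝒳.grpArr i (h s)) 1
    rw [lact_grpArr, Pi.mulSingle_eq_same, inv_mul_cancel_right]
  · rcases Nat.eq_zero_or_pos k with rfl | hk'
    · exact hf.continuousAt
    · obtain rfl : k = 1 := by
        have hk : k ≤ 1 := hk
        omega
      exact hg.continuousAt

theorem isIso_arrHom {a : 𝒳.Arr} (h : 𝒳.Sends a x.point y.point) : IsIso (arrHom a h) := by
  refine ⟨arrHom _ h.inv, ?_, ?_⟩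
  · rw [arrHom_comp_arrHom]
    exact elemHom_congr h.inv_mul (fun _ => rfl) fun _ => rfl
  · rw [arrHom_comp_arrHom]
    exact elemHom_congr h.mul_inv (fun _ => rfl) fun _ => rfl

/-- Apply `pathHom_square` to `f (p₁ (1 - p₂))`: two adjacent sides are `f` and its reverse, the
other two are constant. -/
theorem pathHom_comp_symm (f : unitInterval → 𝒳.Pt) (hf : Continuous f) (h₁ : f 0 = x.point)
    (h₂ : f 1 = y.point) (h₃ : f (unitInterval.symm 0) = y.point)
    (h₄ : f (unitInterval.symm 1) = x.point) :
    pathHom f hf h₁ h₂ ≫ pathHom (fun t => f (unitInterval.symm t))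
      (hf.comp unitInterval.continuous_symm) h₃ h₄ = 𝟙 x := by
  have hQ : Continuous fun p : unitInterval × unitInterval => f (p.1 * unitInterval.symm p.2) :=
    hf.comp (continuous_fst.mul (unitInterval.continuous_symm.comp continuous_snd))
  have key := pathHom_square (x := x) (y := y) (z := x) (w := x) _ hQ (by simp [h₁]) (by simp [h₂])
    (by simp [h₁]) (by simp [h₁])
  refine Eq.trans (congrArg₂ _ ?_ ?_) (key.trans (Eq.trans (congrArg₂ _ ?_ ?_)
    (Category.comp_id (𝟙 x))))
  · exact elemHom_congr rfl (fun t => by simp) fun t => by simp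
  · exact elemHom_congr rfl (fun t => by simp) fun t => by simp
  · rw [← pathHom_const]
    exact elemHom_congr rfl (fun t => by simp [h₁]) fun t => by simp [h₁]
  · rw [← pathHom_const]
    exact elemHom_congr rfl (fun t => by simp [h₁]) fun t => by simp [h₁]

theorem isIso_pathHom (f : unitInterval → 𝒳.Pt) (hf : Continuous f) (h₁ : f 0 = x.point)
    (h₂ : f 1 = y.point) : IsIso (pathHom f hf h₁ h₂) := by
  have h₃ : f (unitInterval.symm 0) = y.point := by rw [unitInterval.symm_zero, h₂]
  have h₄ : f (unitInterval.symm 1) = x.point := by rw [unitInterval.symm_one, h₁]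
  refine ⟨_, pathHom_comp_symm f hf h₁ h₂ h₃ h₄, ?_⟩
  have := pathHom_comp_symm (fun t => f (unitInterval.symm t))
    (hf.comp unitInterval.continuous_symm) h₃ h₄ (by simp [h₁]) (by simp [h₂])
  refine Eq.trans (congrArg _ (elemHom_congr rfl (fun t => ?_) fun t => ?_)) this
  · simp
  · simp

end Groupoid

end Orbispace

/-! ### Generation of the fundamental groupoid by paths and transition maps. -/

namespace Orbispace

open CategoryTheory

section Generation

variable {X : Type u} [TopologicalSpace X] {𝒳 : Orbispace X} {x y z w : 𝒳.BasePoint}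

namespace PathSystem

/-- The union of the intervals up to `k` is itself an interval, contains `0` and `s`, and misses the
interval `l`; a point `t ≤ s` would belong to it. -/
theorem lt_of_mem (σ : 𝒳.PathSystem x y) {k l : ℕ} (hkl : k + 1 < l) (hl : l ≤ σ.n)
    {s t : unitInterval} (hs : s ∈ σ.I k) (ht : t ∈ σ.I l) : s < t := by
  have hc : _root_.IsPreconnected (⋃ j ∈ Iic k, σ.I j) := by
    refine _root_.IsPreconnected.biUnion_of_chain ordConnected_Iic (fun j hj => ?_) fun j hj hj' => ?_
    · have hj : j ≤ k := hj
      exact (σ.ordConnected_I j (by omega)).isPreconnected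
    · have hj : j ≤ k := hj
      exact σ.exists_mem_inter (by omega)
  by_contra hlt
  have hm := hc.ordConnected.out (mem_biUnion (mem_Iic.2 (Nat.zero_le k)) σ.zero_mem)
    (mem_biUnion (mem_Iic.2 le_rfl) hs) ⟨t.2.1, not_lt.1 hlt⟩
  obtain ⟨j, hj, htj⟩ := mem_iUnion₂.1 hm
  have hj : j ≤ k := hj
  exact disjoint_left.1 (σ.disjoint j l (by omega) hl) htj ht

/-- The system `τ` follows `σ` up to the point `m` of the interval `k`. -/
def Follows (σ : 𝒳.PathSystem x y) (k : ℕ) (m : unitInterval) (τ : 𝒳.PathSystem x z) : Prop :=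
  ∃ (φ : unitInterval → unitInterval) (θ : ℕ → ℕ), Continuous φ ∧ Monotone φ ∧ φ 0 = 0 ∧ φ 1 = m ∧
    θ 0 = 0 ∧ θ τ.n = k ∧ (∀ j ≤ τ.n, θ j ≤ σ.n ∧ τ.chart j = σ.chart (θ j)) ∧
    (∀ j ≤ τ.n, ∀ t ∈ τ.I j, φ t ∈ σ.I (θ j) ∧ τ.f j t = σ.f (θ j) (φ t)) ∧
    ∀ j < τ.n, (θ (j + 1) = θ j ∧ τ.ρ j = 𝒳.oneArr (τ.chart j)) ∨
      (θ (j + 1) = θ j + 1 ∧ τ.ρ j = σ.ρ (θ j))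

theorem Follows.mor_eq {σ τ : 𝒳.PathSystem x y} (h : σ.Follows σ.n 1 τ) : τ.mor = σ.mor := by
  obtain ⟨φ, θ, hφ, hm, h0, h1, hθ0, hθn, hθ, hf, hρ⟩ := h
  have : τ.Refines (σ.reparam φ hφ hm h0 h1) := refines_of_map θ hθ0 hθn hθ hf hρ
  exact this.hom_eq.trans (σ.hom_reparam ..)

/-- In the first half the old parametrisation is run at double speed, in the second half the
parameter moves linearly from `m` to `m'`. The new chart is either the current one or the next one
of `σ`. -/
theorem Follows.concat {σ : 𝒳.PathSystem x y} {k k' : ℕ} {m m' : unitInterval}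
    {τ : 𝒳.PathSystem x z} {ε : 𝒳.PathSystem z w} (h : σ.Follows k m τ) (hmm : m ≤ m')
    (hn : ε.n = 1) (hk : k' ≤ σ.n) (hc : ε.chart 1 = σ.chart k')
    (hρ : (k' = k ∧ ε.ρ 0 = 𝒳.oneArr (ε.chart 0)) ∨ (k' = k + 1 ∧ ε.ρ 0 = σ.ρ k))
    (hf₀ : ∀ t, lerp m m' t ∈ σ.I k ∧ ε.f 0 t = σ.f k (lerp m m' t))
    (hf₁ : ∀ t, lerp m m' t ∈ σ.I k' ∧ ε.f 1 t = σ.f k' (lerp m m' t)) :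
    σ.Follows k' m' (τ.concat ε) := by
  obtain ⟨φ, θ, hφ, hm, h0, h1, hθ0, hθn, hθ, hf, hρ'⟩ := h
  have n2 : (τ.concat ε).n = τ.n + 1 := congrArg (τ.n + ·) hn
  have hle : ∀ t, φ t ≤ m' := fun t => (h1 ▸ hm t.2.2 : φ t ≤ m).trans hmm
  have θL : ∀ j ≤ τ.n, (if j ≤ τ.n then θ j else k') = θ j := fun j hj => if_pos hj
  have θR : (if τ.n + 1 ≤ τ.n then θ (τ.n + 1) else k') = k' := if_neg (by omega)
  have φL : ∀ t ≤ half, lerp (φ (dblL t)) m' (dblR t) = φ (dblL t) := fun t ht => by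
    rw [dblR_of_le ht, lerp_zero]
  have φR : ∀ t, half ≤ t → lerp (φ (dblL t)) m' (dblR t) = lerp m m' (dblR t) := fun t ht => by
    rw [dblL_of_le ht, h1]
  refine ⟨fun t => lerp (φ (dblL t)) m' (dblR t), fun j => if j ≤ τ.n then θ j else k',
    (hφ.comp continuous_dblL).lerp continuous_const continuous_dblR, ?_, ?_, ?_, ?_, ?_,
    fun j hj => ?_, fun j hj t ht => ?_, fun j hj => ?_⟩
  · intro s t hst
    have a1 : (φ (dblL s) : ℝ) ≤ φ (dblL t) := hm (monotone_dblL hst)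
    have a2 : (φ (dblL t) : ℝ) ≤ m' := hle _
    have a3 : (dblR s : ℝ) ≤ dblR t := monotone_dblR hst
    have a4 : (dblR s : ℝ) ≤ 1 := (dblR s).2.2
    change (1 - (dblR s : ℝ)) * φ (dblL s) + dblR s * m' ≤
      (1 - (dblR t : ℝ)) * φ (dblL t) + dblR t * m'
    have a5 := mul_le_mul_of_nonneg_left a1 (sub_nonneg.2 a4)
    have a6 := mul_nonneg (sub_nonneg.2 a3) (sub_nonneg.2 a2)
    linarith
  · simp only [dblL_zero, dblR_of_le zero_lt_half.le, lerp_zero, h0]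
  · simp only [dblR_one, lerp_one]
  · exact (θL 0 (Nat.zero_le _)).trans hθ0
  · rw [n2]; exact θR
  · rw [n2] at hj
    rcases Nat.lt_or_ge τ.n j with h | h
    · obtain rfl : j = τ.n + 1 := by omega
      simp only [θR]
      rw [concat_chart_right (Nat.le_succ _), Nat.succ_sub le_rfl, Nat.sub_self]
      exact ⟨hk, hc⟩
    · simp only [θL j h]
      rw [concat_chart_left h]
      exact hθ j h
  · rcases le_total t half with h | h
    · obtain ⟨h2, h3⟩ := mem_concat_le h ht
      simp only [θL j h2, φL t h]
      rw [concat_f_left h h2]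
      exact hf j h2 _ h3
    · obtain ⟨h2, h3, -⟩ := mem_concat_ge h ht
      rw [n2] at hj
      simp only [φR t h]
      rw [concat_f_ge h ht]
      rcases h2.eq_or_lt with rfl | h2
      · rw [θL _ le_rfl, hθn, Nat.sub_self]
        exact hf₀ _
      · obtain rfl : j = τ.n + 1 := by omega
        rw [θR, Nat.add_sub_cancel_left]
        exact hf₁ _
  · rw [n2] at hj
    rcases Nat.lt_or_ge j τ.n with h | h
    · simp only [θL j h.le, θL (j + 1) h]
      rw [concat_rho_left h, concat_chart_left h.le]
      exact hρ' j h
    · obtain rfl : j = τ.n := by omega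
      simp only [θR, le_refl, if_true, hθn]
      rw [concat_rho_right le_rfl, concat_chart_right le_rfl, Nat.sub_self]
      exact hρ

end PathSystem

/-- The fundamental groupoid is generated by the transition maps and the paths. -/
theorem hom_induction {C : ∀ {x y : 𝒳.BasePoint}, (x ⟶ y) → Prop}
    (hcomp : ∀ {x y z : 𝒳.BasePoint} (α : x ⟶ y) (β : y ⟶ z), C α → C β → C (α ≫ β))
    (harr : ∀ {x y : 𝒳.BasePoint} (a : 𝒳.Arr) (h : 𝒳.Sends a x.point y.point), C (arrHom a h))
    (hpath : ∀ {x y : 𝒳.BasePoint} (f : unitInterval → 𝒳.Pt) (hf : Continuous f)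
      (h₁ : f 0 = x.point) (h₂ : f 1 = y.point), C (pathHom f hf h₁ h₂)) {x y : 𝒳.BasePoint}
    (α : x ⟶ y) : C α := by
  obtain ⟨σ, rfl⟩ := PathSystem.mor_surjective α
  -- Extension by a path inside one chart. The relation `Follows` keeps track of which initial part
  -- of `σ` has been rebuilt, up to parametrisation and repeated charts.
  have hstep : ∀ k ≤ σ.n, ∀ (m m' : unitInterval), m ∈ σ.I k → m' ∈ σ.I k → m ≤ m' →
      ∀ (p : 𝒳.BasePoint), p.point = σ.f k m → ∀ (q : 𝒳.BasePoint), q.point = σ.f k m' →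
      (∃ τ : 𝒳.PathSystem x p, σ.Follows k m τ ∧ C τ.mor) →
      ∃ τ : 𝒳.PathSystem x q, σ.Follows k m' τ ∧ C τ.mor := by
    rintro k hk m m' hm hm' hmm p hp q hq ⟨τ, hτ, hC⟩
    have hJ := σ.ordConnected_I k hk
    have hcont := continuous_seg (σ.continuousOn_f k hk) hJ hm hm'
    have e0 : seg (σ.f k) m m' 0 = p.point := by rw [seg, lerp_zero, hp]
    have e1 : seg (σ.f k) m m' 1 = q.point := by rw [seg, lerp_one, hq]
    have hpi : p.idx = σ.chart k := by
      rw [← σ.f_chart k hk m hm, ← hp]; rfl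
    refine ⟨τ.concat (PathSystem.elem (𝒳.oneArr p.idx) _ _ hcont hcont (fun t => sends_oneArr
      (by rw [fst_eq_of_continuous hcont t 0, e0]; rfl)) e0 e1), ?_, hcomp _ _ hC
        (hpath _ hcont e0 e1)⟩
    exact hτ.concat hmm rfl hk hpi (Or.inl ⟨rfl, rfl⟩) (fun t => ⟨lerp_mem hJ hm hm' t, rfl⟩)
      fun t => ⟨lerp_mem hJ hm hm' t, rfl⟩
  have hm : ∀ k, ∃ t, (k < σ.n → t ∈ σ.I k ∧ t ∈ σ.I (k + 1)) ∧ (k = σ.n → t = 1) := fun k => by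
    by_cases hk : k < σ.n
    · obtain ⟨t, h⟩ := σ.exists_mem_inter hk
      exact ⟨t, fun _ => h, fun h => absurd h hk.ne⟩
    · exact ⟨1, fun h => absurd h hk, fun _ => rfl⟩
  choose m hm hmn using hm
  have hmk : ∀ k ≤ σ.n, m k ∈ σ.I k := fun k hk => by
    rcases hk.eq_or_lt with rfl | hk
    · rw [hmn _ rfl]; exact σ.one_mem
    · exact (hm k hk).1
  -- Initial parts of `σ` are rebuilt up to the chosen points of the overlaps: a transition map at
  -- `m k`, then a path from `m k` to `m (k + 1)` in the next chart. The last of these points is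
  -- `1`.
  have key : ∀ k ≤ σ.n, ∀ p : 𝒳.BasePoint, p.point = σ.f k (m k) →
      ∃ τ : 𝒳.PathSystem x p, σ.Follows k (m k) τ ∧ C τ.mor := by
    intro k
    induction k with
    | zero =>
      intro hk p hp
      refine hstep 0 hk 0 (m 0) σ.zero_mem (hmk 0 hk) (m 0).2.1 x σ.f_zero.symm p hp
        ⟨PathSystem.const x, ⟨fun _ => 0, fun _ => 0, continuous_const, monotone_const, rfl, rfl,
          rfl, rfl, fun j hj => ⟨Nat.zero_le _, ?_⟩, fun j hj t _ => ⟨σ.zero_mem, ?_⟩,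
          fun j hj => Or.inl ⟨rfl, ?_⟩⟩, hpath _ continuous_const rfl rfl⟩
      · rw [σ.chart_zero]
        change (if _ then _ else _) = _
        split_ifs <;> rfl
      · rw [σ.f_zero]
        change (if j = 0 then _ else _ : unitInterval → 𝒳.Pt) _ = _
        split_ifs <;> rfl
      · have hj : j < 1 := hj
        obtain rfl : j = 0 := by omega
        rfl
    | succ k ih =>
      intro hk p hp
      obtain ⟨τ, hτ, hC⟩ := ih (Nat.le_of_succ_le hk) (ptBase _) rfl
      obtain ⟨h1, h2⟩ := hm k hk
      have hs := σ.ρ_sends k hk _ ⟨h1, h2⟩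
      have hlt : m k ≤ m (k + 1) := by
        rcases (show k + 1 ≤ σ.n from hk).eq_or_lt with e | e
        · rw [hmn _ e]; exact (m k).2.2
        · exact (σ.lt_of_mem (Nat.lt_succ_self _) e h1 (hm (k + 1) e).2).le
      refine hstep (k + 1) hk (m k) _ h2 (hmk _ hk) hlt (ptBase (σ.f (k + 1) (m k))) rfl p hp
        ⟨τ.concat (PathSystem.elem (σ.ρ k) (fun _ => σ.f k (m k)) (fun _ => σ.f (k + 1) (m k))
          continuous_const continuous_const (fun _ => hs) rfl rfl), ?_, hcomp _ _ hC
          (harr (x := ptBase _) (y := ptBase _) _ hs)⟩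
      exact hτ.concat le_rfl rfl hk (σ.ρ_tgt k hk) (Or.inr ⟨rfl, rfl⟩)
        (fun t => by rw [lerp_self]; exact ⟨h1, rfl⟩) fun t => by rw [lerp_self]; exact ⟨h2, rfl⟩
  obtain ⟨τ, h1, h2⟩ := key σ.n le_rfl y (by rw [hmn _ rfl, σ.f_one])
  rw [hmn _ rfl] at h1
  rwa [← h1.mor_eq]

instance isIso_hom {x y : 𝒳.BasePoint} (α : x ⟶ y) : IsIso α :=
  hom_induction (C := fun α => IsIso α) (fun _ _ _ _ => inferInstance)
    (fun _ h => isIso_arrHom h) (fun f hf h₁ h₂ => isIso_pathHom f hf h₁ h₂) α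

end Generation

/-! ### Representations of the fundamental groupoid as local systems. -/

section OfFunctor

variable {X : Type u} [TopologicalSpace X] {𝒳 : Orbispace X} {H : Type v} [Group H]

/-- A multiplicative map from the fundamental groupoid to a group. -/
structure GroupoidRep (𝒳 : Orbispace X) (H : Type v) [Group H] where
  map : ∀ {x y : 𝒳.BasePoint}, (x ⟶ y) → H
  map_comp : ∀ {x y z : 𝒳.BasePoint} (α : x ⟶ y) (β : y ⟶ z), map (α ≫ β) = map α * map β

namespace GroupoidRep

variable (V : 𝒳.GroupoidRep H)

open Classical in
/-- The value on a transition map at a point. -/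
noncomputable def onArr (a : 𝒳.Arr) (x : 𝒳.Pt) : H :=
  if h : ∃ y, 𝒳.Sends a x y then
    V.map (arrHom (x := ptBase x) (y := ptBase h.choose) a h.choose_spec) else 1

open Classical in
/-- The value on a path. -/
noncomputable def onPath (f : unitInterval → 𝒳.Pt) : H :=
  if h : Continuous f then V.map (pathHom (x := ptBase (f 0)) (y := ptBase (f 1)) f h rfl rfl) else 1

theorem onArr_eq {x y : 𝒳.BasePoint} {a : 𝒳.Arr} (h : 𝒳.Sends a x.point y.point) :
    V.onArr a x.point = V.map (arrHom a h) := by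
  have h' : ∃ y, 𝒳.Sends a x.point y := ⟨_, h⟩
  rw [onArr, dif_pos h']
  obtain rfl : ptBase h'.choose = y := BasePoint.eq_of_point_eq (h'.choose_spec.unique h)
  obtain ⟨_, i, l, rfl⟩ := x
  rfl

theorem onPath_eq {x y : 𝒳.BasePoint} (f : unitInterval → 𝒳.Pt) (hf : Continuous f)
    (h₁ : f 0 = x.point) (h₂ : f 1 = y.point) : V.onPath f = V.map (pathHom f hf h₁ h₂) := by
  obtain rfl : ptBase (f 0) = x := BasePoint.eq_of_point_eq h₁
  obtain rfl : ptBase (f 1) = y := BasePoint.eq_of_point_eq h₂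
  rw [onPath, dif_pos hf]

/-- The local system of a representation of the fundamental groupoid. -/
noncomputable def localSystem : LocalSystem 𝒳 univ H where
  T := V.onArr
  P := V.onPath
  square Q hQ _ := by
    rw [V.onPath_eq (x := ptBase (Q (0, 0))) (y := ptBase (Q (1, 0))) (fun t => Q (t, 0))
        (hQ.comp (Continuous.prodMk_left 0)) rfl rfl,
      V.onPath_eq (x := ptBase (Q (1, 0))) (y := ptBase (Q (1, 1))) (fun t => Q (1, t))
        (hQ.comp (Continuous.prodMk_right 1)) rfl rfl,
      V.onPath_eq (x := ptBase (Q (0, 0))) (y := ptBase (Q (0, 1))) (fun t => Q (0, t))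
        (hQ.comp (Continuous.prodMk_right 0)) rfl rfl,
      V.onPath_eq (x := ptBase (Q (0, 1))) (y := ptBase (Q (1, 1))) (fun t => Q (t, 1))
        (hQ.comp (Continuous.prodMk_left 1)) rfl rfl, ← V.map_comp, ← V.map_comp]
    exact congrArg V.map (pathHom_square Q hQ rfl rfl rfl rfl)
  arr a f g hf hg _ _ h := by
    have e0 := V.onArr_eq (x := ptBase (f 0)) (y := ptBase (g 0)) (h 0)
    have e1 := V.onArr_eq (x := ptBase (f 1)) (y := ptBase (g 1)) (h 1)
    simp only [ptBase_point] at e0 e1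
    rw [V.onPath_eq (x := ptBase (f 0)) (y := ptBase (f 1)) f hf rfl rfl,
      V.onPath_eq (x := ptBase (g 0)) (y := ptBase (g 1)) g hg rfl rfl, e0, e1, ← V.map_comp,
      ← V.map_comp]
    exact congrArg V.map ((pathHom_comp_arrHom (x := ptBase (f 0)) (y := ptBase (f 1))
      (z := ptBase (g 1)) a f g hf hg h rfl rfl rfl (h 1)).trans
      (arrHom_comp_pathHom (x := ptBase (f 0)) (y := ptBase (g 0)) (z := ptBase (g 1)) a f g hf hg h
        rfl rfl rfl (h 0)).symm)
  comp {a b x y z} _ _ _ h h' := by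
    have e0 := V.onArr_eq (x := ptBase x) (y := ptBase y) h
    have e1 := V.onArr_eq (x := ptBase y) (y := ptBase z) h'
    have e2 := V.onArr_eq (x := ptBase x) (y := ptBase z) (h.mul h')
    simp only [ptBase_point] at e0 e1 e2
    rw [e0, e1, e2, ← V.map_comp]
    exact congrArg V.map (arrHom_comp_arrHom (x := ptBase x) (y := ptBase y) (z := ptBase z) h h').symm
  grp i _ p h hh := by
    have hc : Continuous fun t => (⟨i, h t • p⟩ : 𝒳.Pt) :=
      continuous_sigmaMk.comp (hh.smul continuous_const)
    have e0 := V.onArr_eq (x := ptBase ⟨i, p⟩) (y := ptBase ⟨i, h 0 • p⟩)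
      (sends_grpArr i (h 0) p)
    have e1 := V.onArr_eq (x := ptBase ⟨i, p⟩) (y := ptBase ⟨i, h 1 • p⟩)
      (sends_grpArr i (h 1) p)
    simp only [ptBase_point] at e0 e1
    rw [V.onPath_eq (x := ptBase ⟨i, h 0 • p⟩) (y := ptBase ⟨i, h 1 • p⟩) _ hc rfl rfl, e0, e1,
      eq_inv_mul_iff_mul_eq, ← V.map_comp]
    exact congrArg V.map (arrHom_comp_pathHom_smul (x := ptBase ⟨i, p⟩) (y := ptBase ⟨i, h 0 • p⟩)
      (z := ptBase ⟨i, h 1 • p⟩) p h hh rfl rfl rfl (sends_grpArr i (h 0) p)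
      (sends_grpArr i (h 1) p) hc)

/-- An explicit parallel section: transport along `f`, followed in the second chart by the jump
along `a`. That it is parallel there is naturality. -/
theorem hol_elem (D : LocalSystem 𝒳 univ H) {x y : 𝒳.BasePoint} (a : 𝒳.Arr)
    (f g : unitInterval → 𝒳.Pt) (hf : Continuous f) (hg : Continuous g)
    (h : ∀ t, 𝒳.Sends a (f t) (g t)) (h₁ : f 0 = x.point) (h₂ : g 1 = y.point) :
    D.hol (PathSystem.elem a f g hf hg h h₁ h₂) = D.P f * D.T a (f 1) := by
  have hadd : ∀ {f : unitInterval → 𝒳.Pt}, Continuous f → ∀ r s t,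
      D.P (seg f r s) * D.P (seg f s t) = D.P (seg f r t) := fun hf r s t =>
    D.P_seg_mul hf.continuousOn ordConnected_univ (fun _ _ => trivial) (mem_univ r) (mem_univ s)
      (mem_univ t)
  have hu : D.IsTransport (PathSystem.elem a f g hf hg h h₁ h₂) fun k t =>
      if k = 0 then D.P (seg f 0 t) else D.P (seg f 0 t) * D.T a (f t) := by
    refine ⟨fun k hk s _ t _ => ?_, fun k hk t _ _ => ?_⟩
    · rcases Nat.eq_zero_or_pos k with rfl | hk'
      · exact (hadd hf 0 s t).symm
      · simp only [if_neg hk'.ne', PathSystem.elem]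
        have := D.arr a (seg f s t) (seg g s t)
          (hf.comp (continuous_const.lerp continuous_const continuous_id))
          (hg.comp (continuous_const.lerp continuous_const continuous_id)) (fun _ => trivial)
          (fun _ => trivial) fun t => h _
        simp only [seg, lerp_zero, lerp_one] at this
        rw [← hadd hf 0 s t, mul_assoc, mul_assoc]
        exact congrArg _ this
    · obtain rfl : k = 0 := Nat.lt_one_iff.1 hk
      rfl
  have hin : (PathSystem.elem a f g hf hg h h₁ h₂).InCharts univ := fun _ _ => trivial
  rw [hu.hol_eq hin]
  have e0 : seg f 0 0 = fun _ => f 0 := funext fun r => by rw [seg, lerp_self]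
  have e1 : seg f 0 1 = f := funext fun r => by
    rw [seg]; congr 1; ext; simp [coe_lerp]
  change (D.P (seg f 0 0))⁻¹ * (D.P (seg f 0 1) * D.T a (f 1)) = _
  rw [e0, e1, D.P_const trivial, inv_one, _root_.one_mul]

/-- Both sides are multiplicative on the groupoid, the holonomy because it is homotopy invariant and
compatible with concatenation. They agree on transition maps and on paths, which generate. -/
theorem hol_eq {x y : 𝒳.BasePoint} (σ : 𝒳.PathSystem x y) :
    V.localSystem.hol σ = V.map σ.mor := by
  have hin : ∀ {x y : 𝒳.BasePoint} (σ : 𝒳.PathSystem x y), σ.InCharts univ :=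
    fun _ _ _ => trivial
  have hS : ∀ p : X, ∃ i ∈ (univ : Set 𝒳.Idx), p ∈ 𝒳.U i := fun p => by
    obtain ⟨_, ⟨i, rfl⟩, hi, -⟩ := 𝒳.isBasis.exists_subset_of_mem_open (mem_univ p) isOpen_univ
    exact ⟨i, trivial, hi⟩
  let hol' : ∀ {x y : 𝒳.BasePoint}, (x ⟶ y) → H := fun {x y} =>
    Quot.lift (fun σ : 𝒳.PathSystem x y => V.localSystem.hol σ) fun σ τ h => by
      rw [← LocalSystem.holCls_cls (hin σ), ← LocalSystem.holCls_cls (hin τ)]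
      exact LocalSystem.holCls_eq_of_joined hS (fun _ _ _ _ => trivial) trivial trivial h.joined
  refine hom_induction (C := fun α => hol' α = V.map α) (fun α β hα hβ => ?_) (fun a h => ?_)
    (fun f hf h₁ h₂ => ?_) σ.mor
  · obtain ⟨σ, rfl⟩ := PathSystem.mor_surjective α
    obtain ⟨τ, rfl⟩ := PathSystem.mor_surjective β
    rw [V.map_comp, ← hα, ← hβ]
    exact LocalSystem.hol_concat (hin σ) (hin τ)
  · refine (hol_elem V.localSystem ..).trans ?_
    rw [V.localSystem.P_const trivial, _root_.one_mul]
    exact V.onArr_eq h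
  · refine (hol_elem V.localSystem ..).trans ?_
    rename_i x y
    have e : f 1 = (ptBase (f 1)).point := rfl
    have ex : x.idx = (f 1).1 := by
      rw [fst_eq_of_continuous hf 1 0, h₁]; rfl
    rw [ex, V.localSystem.T_one trivial, _root_.mul_one]
    exact V.onPath_eq f hf h₁ h₂

end GroupoidRep

end OfFunctor

end Orbispace

/-! ### Local systems on open sub-orbispaces. -/

namespace Orbispace

section Restrict

variable {X : Type u} [TopologicalSpace X] {𝒳 : Orbispace X} {Y : Opens X} {H : Type v} [Group H]

theorem inclusion_pt_injective : Function.Injective (𝒳.inclusion Y).pt := by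
  rintro ⟨⟨i, hi⟩, p⟩ ⟨⟨j, hj⟩, q⟩ h
  obtain ⟨h1, h2⟩ := Sigma.mk.inj_iff.1 h
  obtain rfl : i = j := h1
  obtain rfl := eq_of_heq h2
  rfl

theorem inclusion_arr_injective : Function.Injective (𝒳.inclusion Y).arr := by
  rintro ⟨⟨i, hi⟩, ⟨j, hj⟩, t⟩ ⟨⟨i', hi'⟩, ⟨j', hj'⟩, t'⟩ h
  obtain ⟨h1, h2, h3⟩ := (Arr.mk.injEq ..).mp h
  obtain rfl : i = i' := h1
  obtain rfl : j = j' := h2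
  obtain rfl := eq_of_heq h3
  rfl

theorem exists_inclusion_pt {x : 𝒳.Pt} (h : 𝒳.U x.1 ≤ Y) :
    ∃ x' : (𝒳.restrict Y).Pt, (𝒳.inclusion Y).pt x' = x := ⟨⟨⟨x.1, h⟩, x.2⟩, rfl⟩

theorem exists_inclusion_arr {a : 𝒳.Arr} (h : 𝒳.U a.src ≤ Y) (h' : 𝒳.U a.tgt ≤ Y) :
    ∃ a' : (𝒳.restrict Y).Arr, (𝒳.inclusion Y).arr a' = a :=
  ⟨⟨⟨a.src, h⟩, ⟨a.tgt, h'⟩, a.tran⟩, rfl⟩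

theorem sends_of_inclusion {a : (𝒳.restrict Y).Arr} {x y : (𝒳.restrict Y).Pt}
    (h : 𝒳.Sends ((𝒳.inclusion Y).arr a) ((𝒳.inclusion Y).pt x) ((𝒳.inclusion Y).pt y)) :
    (𝒳.restrict Y).Sends a x y := by
  obtain ⟨⟨i, hi⟩, ⟨j, hj⟩, t⟩ := a
  obtain ⟨⟨k, hk⟩, p⟩ := x
  have e : k = i := h.src_eq
  subst e
  have key : ∀ z, 𝒳.Sends ⟨k, j, t⟩ ⟨k, p⟩ z → p ∈ (𝒳.iso t).φ.source ∧
      z = ⟨j, (𝒳.iso t).φ p⟩ := by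
    intro z hz
    cases hz with | mk _ _ hx => exact ⟨hx, rfl⟩
  obtain ⟨h1, h2⟩ := key _ h
  obtain rfl : y = ⟨⟨j, hj⟩, (𝒳.iso t).φ p⟩ := inclusion_pt_injective h2
  exact Sends.mk (𝒳 := 𝒳.restrict Y) (i := ⟨k, hk⟩) (j := ⟨j, hj⟩) t p h1

theorem exists_sends_inclusion {a : 𝒳.Arr} {x y : 𝒳.Pt} (h : 𝒳.Sends a x y) (hx : 𝒳.U x.1 ≤ Y)
    (hy : 𝒳.U y.1 ≤ Y) : ∃ a' x' y', (𝒳.restrict Y).Sends a' x' y' ∧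
      (𝒳.inclusion Y).arr a' = a ∧ (𝒳.inclusion Y).pt x' = x ∧ (𝒳.inclusion Y).pt y' = y := by
  obtain ⟨a', rfl⟩ := exists_inclusion_arr (a := a) (h.src_eq ▸ hx) (h.tgt_eq ▸ hy)
  obtain ⟨x', rfl⟩ := exists_inclusion_pt hx
  obtain ⟨y', rfl⟩ := exists_inclusion_pt hy
  exact ⟨a', x', y', sends_of_inclusion h, rfl, rfl, rfl⟩

theorem Sends.inclusion_mul {a b : (𝒳.restrict Y).Arr} {x y z : (𝒳.restrict Y).Pt}
    (h : (𝒳.restrict Y).Sends a x y) (h' : (𝒳.restrict Y).Sends b y z) :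
    (𝒳.inclusion Y).arr ((𝒳.restrict Y).mul b a x) =
      𝒳.mul ((𝒳.inclusion Y).arr b) ((𝒳.inclusion Y).arr a) ((𝒳.inclusion Y).pt x) :=
  ((h.compAt h').push (𝒳.inclusion Y)).mul_eq.symm

/-- The disjoint union of the covers belonging to `Y` is embedded in the disjoint union of all
covers. -/
theorem exists_continuous_inclusion {Z : Type*} [TopologicalSpace Z] {f : Z → 𝒳.Pt}
    (hf : Continuous f) (h : ∀ z, 𝒳.U (f z).1 ≤ Y) :
    ∃ f' : Z → (𝒳.restrict Y).Pt, Continuous f' ∧ ∀ z, (𝒳.inclusion Y).pt (f' z) = f z := by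
  refine ⟨fun z => ⟨⟨(f z).1, h z⟩, (f z).2⟩, ?_, fun z => rfl⟩
  have he : IsEmbedding (𝒳.inclusion Y).pt := (isEmbedding_sigmaMap
    (σ := fun i : {i : 𝒳.Idx // 𝒳.U i ≤ Y} => (𝒳.str i.1).Cov) (τ := fun i => (𝒳.str i).Cov)
    (f₂ := fun _ => id) Subtype.val_injective).2 fun _ => IsEmbedding.id
  exact he.continuous_iff.2 hf

namespace LocalSystem

variable [Nonempty (𝒳.restrict Y).Pt]

instance : Nonempty (𝒳.restrict Y).Arr :=
  ⟨(𝒳.restrict Y).oneArr (Classical.arbitrary (𝒳.restrict Y).Pt).1⟩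

/-- A local system on an open sub-orbispace, as a local system on the charts contained in it. -/
noncomputable def ofRestrict (D : LocalSystem (𝒳.restrict Y) univ H) :
    LocalSystem 𝒳 {i | 𝒳.U i ≤ Y} H where
  -- The chosen inverse of the injective inclusion has meaningless values off the image; the axioms
  -- involve only charts contained in `Y`, hence only values on the image.
  T a x := D.T (Function.invFun (𝒳.inclusion Y).arr a) (Function.invFun (𝒳.inclusion Y).pt x)
  P f := D.P fun t => Function.invFun (𝒳.inclusion Y).pt (f t)
  square Q hQ hS := by
    obtain ⟨Q, hQ', e⟩ := exists_continuous_inclusion hQ hS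
    simp only [← e, Function.leftInverse_invFun inclusion_pt_injective _]
    exact D.square Q hQ' fun _ => trivial
  arr a f g hf hg hfS hgS h := by
    obtain ⟨f, hf', e⟩ := exists_continuous_inclusion hf hfS
    obtain ⟨g, hg', e'⟩ := exists_continuous_inclusion hg hgS
    obtain ⟨a, rfl⟩ := exists_inclusion_arr (a := a) ((h 0).src_eq ▸ hfS 0) ((h 0).tgt_eq ▸ hgS 0)
    simp only [← e, ← e'] at h ⊢
    simp only [Function.leftInverse_invFun inclusion_pt_injective _,
      Function.leftInverse_invFun inclusion_arr_injective _]
    exact D.arr a f g hf' hg' (fun _ => trivial) (fun _ => trivial) fun t =>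
      sends_of_inclusion (h t)
  comp {a b x y z} hx hy hz h h' := by
    obtain ⟨x, rfl⟩ := exists_inclusion_pt hx
    obtain ⟨y, rfl⟩ := exists_inclusion_pt hy
    obtain ⟨z, rfl⟩ := exists_inclusion_pt hz
    obtain ⟨a, rfl⟩ := exists_inclusion_arr (a := a) (h.src_eq ▸ hx) (h.tgt_eq ▸ hy)
    obtain ⟨b, rfl⟩ := exists_inclusion_arr (a := b) (h'.src_eq ▸ hy) (h'.tgt_eq ▸ hz)
    have s := sends_of_inclusion h
    have s' := sends_of_inclusion h'
    rw [← s.inclusion_mul s']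
    simp only [Function.leftInverse_invFun inclusion_pt_injective _,
      Function.leftInverse_invFun inclusion_arr_injective _]
    exact D.comp trivial trivial trivial s s'
  grp i hi p h hh := by
    have e : ∀ q : (𝒳.str i).Cov, (⟨i, q⟩ : 𝒳.Pt) =
      (𝒳.inclusion Y).pt ⟨⟨i, hi⟩, q⟩ := fun _ => rfl
    have e' : ∀ g : (𝒳.str i).Grp, 𝒳.grpArr i g =
      (𝒳.inclusion Y).arr ((𝒳.restrict Y).grpArr ⟨i, hi⟩ g) := fun _ => rfl
    simp only [e, e', Function.leftInverse_invFun inclusion_pt_injective _,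
      Function.leftInverse_invFun inclusion_arr_injective _]
    exact D.grp ⟨i, hi⟩ trivial p h hh

theorem ofRestrict_T (D : LocalSystem (𝒳.restrict Y) univ H) (a : (𝒳.restrict Y).Arr)
    (x : (𝒳.restrict Y).Pt) :
    D.ofRestrict.T ((𝒳.inclusion Y).arr a) ((𝒳.inclusion Y).pt x) = D.T a x := by
  simp only [ofRestrict, Function.leftInverse_invFun inclusion_pt_injective _,
    Function.leftInverse_invFun inclusion_arr_injective _]

theorem ofRestrict_P (D : LocalSystem (𝒳.restrict Y) univ H)
    (f : unitInterval → (𝒳.restrict Y).Pt) :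
    D.ofRestrict.P (fun t => (𝒳.inclusion Y).pt (f t)) = D.P f := by
  simp only [ofRestrict, Function.leftInverse_invFun inclusion_pt_injective _]

end LocalSystem

end Restrict

/-! ### Gluing of local systems. -/

section Gluing

variable {X : Type u} [TopologicalSpace X] {𝒳 : Orbispace X} {H : Type v} [Group H] {ι : Type*}

/-- A path lying over the smaller chart stays in one component of its preimage, so a transition map
defined at the start of the path is defined all along it. -/
theorem exists_sends_along {f : unitInterval → 𝒳.Pt} (hf : Continuous f) {k : 𝒳.Idx}
    (hk : 𝒳.U k ≤ 𝒳.U (f 0).1) (h : ∀ t, 𝒳.base (f t) ∈ 𝒳.U k) :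
    ∃ (e : 𝒳.Arr) (g : unitInterval → 𝒳.Pt), Continuous g ∧ (∀ t, (g t).1 = k) ∧
      ∀ t, 𝒳.Sends e (f t) (g t) := by
  obtain ⟨i, p, hp⟩ := ContinuousMap.exists_lift_sigma ⟨f, hf⟩
  obtain rfl : f = fun t => ⟨i, p t⟩ := funext fun t => DFunLike.congr_fun hp t
  obtain ⟨e, y, he, rfl⟩ := exists_sends_of_le _ hk (h 0)
  have hy := he.tgt_eq
  obtain ⟨i', j, t⟩ := e
  obtain rfl : i = i' := he.src_eq
  obtain ⟨C, hC, hS, -⟩ := source_component t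
  have hy : y.1 = j := hy
  rw [hy] at hk h
  have hj : 𝒳.U j ≤ 𝒳.U i := hk
  rw [inter_eq_right.2 hj] at hC
  obtain rfl := IsComponentOf.eq_self hC (𝒳.isConnected_U j).isPreconnected
  have h0 : p 0 ∈ (𝒳.iso t).φ.source := by
    have := he.mem_dom
    rw [dom_eq_image] at this
    obtain ⟨q, hq, e⟩ := this
    obtain rfl := eq_of_heq (Sigma.mk.inj_iff.1 e).2
    exact hq
  have hmem : ∀ s, p s ∈ (𝒳.iso t).φ.source := by
    obtain ⟨c, hc, hcS⟩ := hS
    rw [hcS] at h0 ⊢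
    rw [connectedComponentIn_eq h0]
    intro s
    refine (isPreconnected_range p.continuous).subset_connectedComponentIn (mem_range_self 0) ?_
      (mem_range_self s)
    rintro _ ⟨s, rfl⟩
    exact h s
  refine ⟨⟨i, j, t⟩, fun s => ⟨j, (𝒳.iso t).φ (p s)⟩, ?_, fun s => hy.symm, fun s =>
    Sends.mk t (p s) (hmem s)⟩
  exact continuous_sigmaMk.comp ((𝒳.iso t).φ.continuousOn.comp_continuous p.continuous hmem)

/-- The second factor is `a ∘ e⁻¹`, formed at the points of the intermediate path; it is locally
constant, hence one and the same transition map along the path. -/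
theorem exists_factor_along {a e : 𝒳.Arr} {f g w : unitInterval → 𝒳.Pt}
    (hw : Continuous w) (h : ∀ t, 𝒳.Sends a (f t) (g t)) (h' : ∀ t, 𝒳.Sends e (f t) (w t)) :
    ∃ b, ∀ t, 𝒳.Sends b (w t) (g t) ∧ 𝒳.mul b e (f t) = a := by
  have hb : ∀ t, 𝒳.Sends (𝒳.mul a (𝒳.inv e) (w t)) (w t) (g t) := fun t => (h' t).inv.mul (h t)
  have hc : ∀ t, 𝒳.mul a (𝒳.inv e) (w t) = 𝒳.mul a (𝒳.inv e) (w 0) := fun t =>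
    isPreconnected_univ.eq_of_eventually_eq (f := fun t => 𝒳.mul a (𝒳.inv e) (w t)) (fun t _ => by
      rw [nhdsWithin_univ]
      exact (hw.continuousAt.eventually ((h' t).inv.compAt (h t)).eventually).mono
        fun s hs => hs.mul_eq) (mem_univ t) (mem_univ 0)
  refine ⟨𝒳.mul a (𝒳.inv e) (w 0), fun t => ?_⟩
  rw [← hc t]
  refine ⟨hb t, ?_⟩
  rw [← mul_assoc' (h' t) (h' t).inv (h t), (h' t).inv_mul, (h t).mul_one]

variable (𝒳 H ι) in
/-- Local systems on open sub-orbispaces that agree on the intersection. -/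
structure GluingData where
  Y : ι → Opens X
  W : Opens X
  inf_le : ∀ α β, α ≠ β → Y α ⊓ Y β ≤ W
  W_le : ∀ α, W ≤ Y α
  D : ∀ α, LocalSystem 𝒳 {i | 𝒳.U i ≤ Y α} H
  T_eq : ∀ α β {a x y}, 𝒳.Sends a x y → 𝒳.U x.1 ≤ W → 𝒳.U y.1 ≤ W → (D α).T a x = (D β).T a x
  P_eq : ∀ α β {f : unitInterval → 𝒳.Pt}, Continuous f → (∀ t, 𝒳.U (f t).1 ≤ W) →
    (D α).P f = (D β).P f

namespace GluingData

variable (G : 𝒳.GluingData H ι)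

theorem T_eq' {α β : ι} {a : 𝒳.Arr} {x y : 𝒳.Pt} (h : 𝒳.Sends a x y) (hx : 𝒳.U x.1 ≤ G.Y α)
    (hx' : 𝒳.U x.1 ≤ G.Y β) (hy : 𝒳.U y.1 ≤ G.Y α) (hy' : 𝒳.U y.1 ≤ G.Y β) :
    (G.D α).T a x = (G.D β).T a x := by
  by_cases e : α = β
  · rw [e]
  · exact G.T_eq α β h ((le_inf hx hx').trans (G.inf_le α β e))
      ((le_inf hy hy').trans (G.inf_le α β e))

/-- Different members of the cover meet only inside `W`, so outside `W` the charts over a point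
belong to a single member and nothing has to be glued. -/
theorem eq_of_base_notMem {α β : ι} {x y : 𝒳.Pt} (h : 𝒳.base x ∉ G.W)
    (hxy : 𝒳.base y = 𝒳.base x) (hx : 𝒳.U x.1 ≤ G.Y α) (hy : 𝒳.U y.1 ≤ G.Y β) : α = β := by
  by_contra e
  exact h (G.inf_le α β e ⟨hx (base_mem x), hxy ▸ hy (base_mem y)⟩)

theorem exists_sends_W {x : 𝒳.Pt} (h : 𝒳.base x ∈ G.W) :
    ∃ e w, 𝒳.Sends e x w ∧ 𝒳.U w.1 ≤ G.W := by
  obtain ⟨_, ⟨k, rfl⟩, hp, hk⟩ := 𝒳.isBasis.exists_subset_of_mem_open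
    (show 𝒳.base x ∈ (𝒳.U x.1 ⊓ G.W : Opens X) from ⟨base_mem x, h⟩) (Opens.isOpen _)
  obtain ⟨e, w, he, rfl⟩ := exists_sends_of_le x (hk.trans inter_subset_left) hp
  exact ⟨e, w, he, hk.trans inter_subset_right⟩

/-- The transport along a transition map `a` at `x` equals `v`. -/
def Val (a : 𝒳.Arr) (x : 𝒳.Pt) (v : H) : Prop :=
  (𝒳.base x ∉ G.W ∧ ∃ α, 𝒳.U x.1 ≤ G.Y α ∧ v = (G.D α).T a x) ∨
    ∃ (α β : ι) (w y : 𝒳.Pt) (e b : 𝒳.Arr), 𝒳.Sends e x w ∧ 𝒳.Sends b w y ∧ 𝒳.mul b e x = a ∧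
      𝒳.U x.1 ≤ G.Y α ∧ 𝒳.U w.1 ≤ G.W ∧ 𝒳.U y.1 ≤ G.Y β ∧ v = (G.D α).T e x * (G.D β).T b w

theorem val_mul {α β : ι} {x w y : 𝒳.Pt} {e b : 𝒳.Arr} (he : 𝒳.Sends e x w) (hb : 𝒳.Sends b w y)
    (hx : 𝒳.U x.1 ≤ G.Y α) (hw : 𝒳.U w.1 ≤ G.W) (hy : 𝒳.U y.1 ≤ G.Y β) :
    G.Val (𝒳.mul b e x) x ((G.D α).T e x * (G.D β).T b w) :=
  Or.inr ⟨α, β, w, y, e, b, he, hb, rfl, hx, hw, hy, rfl⟩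

variable {G}

theorem Val.base_mem {x w : 𝒳.Pt} {e : 𝒳.Arr} (he : 𝒳.Sends e x w) (hw : 𝒳.U w.1 ≤ G.W) :
    𝒳.base x ∈ G.W := by
  rw [← he.base_eq]; exact hw (Orbispace.base_mem w)

/-- Two factorisations of `a` differ by the transition map `c = e' ∘ e⁻¹` between charts contained
in `W`. All the given local systems agree on `c`, so its transport cancels. -/
theorem Val.unique {a : 𝒳.Arr} {x : 𝒳.Pt} {v v' : H} (h : G.Val a x v) (h' : G.Val a x v') :
    v = v' := by
  obtain ⟨h0, α, hα, rfl⟩ | ⟨α, β, w, y, e, b, he, hb, rfl, hx, hw, hy, rfl⟩ := h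
  · obtain ⟨-, β, hβ, rfl⟩ | ⟨α', β', w', y', e', b', he', hb', -, hx', hw', hy', rfl⟩ := h'
    · rw [G.eq_of_base_notMem h0 rfl hα hβ]
    · exact absurd (Val.base_mem he' hw') h0
  · obtain ⟨h0, -⟩ | ⟨α', β', w', y', e', b', he', hb', heq, hx', hw', hy', rfl⟩ := h'
    · exact absurd (Val.base_mem he hw) h0
    · have hc := he.inv.mul he'
      set c := 𝒳.mul e' (𝒳.inv e) w
      have hce : 𝒳.mul c e x = e' := by
        rw [← mul_assoc' he he.inv he', he.inv_mul, he'.mul_one]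
      obtain rfl : y' = y := by
        have h1 := he'.mul hb'
        rw [heq] at h1
        exact h1.unique (he.mul hb)
      have hbc : 𝒳.mul b' c w = b := by
        refine he.cancel_right (hc.mul hb') hb ?_
        rw [← mul_assoc' he hc hb', hce, heq]
      have e1 : (G.D α').T e' x = (G.D α).T e x * (G.D α).T c w := by
        rw [G.T_eq' he' hx' hx (hw'.trans (G.W_le _)) (hw'.trans (G.W_le _)), ← hce,
          (G.D α).comp hx (hw.trans (G.W_le _)) (hw'.trans (G.W_le _)) he hc]
      have e2 : (G.D β).T b w = (G.D α).T c w * (G.D β').T b' w' := by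
        rw [← hbc, (G.D β).comp (hw.trans (G.W_le _)) (hw'.trans (G.W_le _)) hy hc hb',
          G.T_eq' hb' (hw'.trans (G.W_le _)) (hw'.trans (G.W_le _)) hy hy',
          G.T_eq β α hc hw hw']
      rw [e1, e2, _root_.mul_assoc]

/-- Over `W` the factorisation can be taken inside `Y α`, where the given system is already
multiplicative. So the glued system extends each of the given ones. -/
theorem val_of_sends {α : ι} {a : 𝒳.Arr} {x y : 𝒳.Pt} (h : 𝒳.Sends a x y)
    (hx : 𝒳.U x.1 ≤ G.Y α) (hy : 𝒳.U y.1 ≤ G.Y α) : G.Val a x ((G.D α).T a x) := by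
  by_cases h0 : 𝒳.base x ∈ G.W
  · obtain ⟨e, w, he, hw⟩ := G.exists_sends_W h0
    have hb := he.inv.mul h
    have e1 : 𝒳.mul (𝒳.mul a (𝒳.inv e) w) e x = a := by
      rw [← mul_assoc' he he.inv h, he.inv_mul, h.mul_one]
    have := G.val_mul he hb hx hw hy
    rwa [← (G.D α).comp hx (hw.trans (G.W_le _)) hy he hb, e1] at this
  · exact Or.inl ⟨h0, α, hx, rfl⟩

variable (G)

/-- The charts of the glued local system. -/
def charts : Set 𝒳.Idx := {i | ∃ α, 𝒳.U i ≤ G.Y α}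

open Classical in
/-- The transport along transition maps of the glued local system. -/
noncomputable def T (a : 𝒳.Arr) (x : 𝒳.Pt) : H := if h : ∃ v, G.Val a x v then h.choose else 1

open Classical in
/-- The transport along paths of the glued local system. -/
noncomputable def P (f : unitInterval → 𝒳.Pt) : H :=
  if h : ∃ α, ∀ t, 𝒳.U (f t).1 ≤ G.Y α then (G.D h.choose).P f else 1

variable {G}

theorem Val.T_eq {a : 𝒳.Arr} {x : 𝒳.Pt} {v : H} (h : G.Val a x v) : G.T a x = v := by
  have h' : ∃ v, G.Val a x v := ⟨v, h⟩
  rw [T, dif_pos h']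
  exact h'.choose_spec.unique h

theorem P_of_le {f : unitInterval → 𝒳.Pt} (hf : Continuous f) {α : ι}
    (h : ∀ t, 𝒳.U (f t).1 ≤ G.Y α) : G.P f = (G.D α).P f := by
  have h' : ∃ α, ∀ t, 𝒳.U (f t).1 ≤ G.Y α := ⟨α, h⟩
  rw [P, dif_pos h']
  by_cases e : h'.choose = α
  · rw [e]
  · exact G.P_eq _ _ hf fun t => (le_inf (h'.choose_spec t) (h t)).trans (G.inf_le _ _ e)

theorem exists_forall_le {f : unitInterval → 𝒳.Pt} (hf : Continuous f)
    (h : ∀ t, (f t).1 ∈ G.charts) : ∃ α, ∀ t, 𝒳.U (f t).1 ≤ G.Y α := by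
  obtain ⟨α, hα⟩ := h 0
  exact ⟨α, fun t => by rw [fst_eq_of_continuous hf t 0]; exact hα⟩

variable (G) in
/-- The glued local system. -/
noncomputable def glue : LocalSystem 𝒳 G.charts H where
  T := G.T
  P := G.P
  square Q hQ hS := by
    obtain ⟨α, hα⟩ := hS (0, 0)
    have h : ∀ p, 𝒳.U (Q p).1 ≤ G.Y α := fun p => by
      have h1 := fst_eq_of_continuous (f := fun t => Q (t, p.2))
        (hQ.comp (Continuous.prodMk_left _)) p.1 0
      have h2 := fst_eq_of_continuous (f := fun t => Q (0, t))
        (hQ.comp (Continuous.prodMk_right _)) p.2 0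
      rw [show Q p = Q (p.1, p.2) from rfl, h1, h2]
      exact hα
    rw [P_of_le (f := fun t => Q (t, 0)) (hQ.comp (Continuous.prodMk_left _)) fun t => h _,
      P_of_le (f := fun t => Q (1, t)) (hQ.comp (Continuous.prodMk_right _)) fun t => h _,
      P_of_le (f := fun t => Q (0, t)) (hQ.comp (Continuous.prodMk_right _)) fun t => h _,
      P_of_le (f := fun t => Q (t, 1)) (hQ.comp (Continuous.prodMk_left _)) fun t => h _]
    exact (G.D α).square Q hQ h
  arr a f g hf hg hfS hgS h := by
    obtain ⟨α, hα⟩ := exists_forall_le hf hfS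
    obtain ⟨β, hβ⟩ := exists_forall_le hg hgS
    rw [P_of_le hf hα, P_of_le hg hβ]
    by_cases e : α = β
    · subst e
      rw [(val_of_sends (h 0) (hα 0) (hβ 0)).T_eq, (val_of_sends (h 1) (hα 1) (hβ 1)).T_eq]
      exact (G.D α).arr a f g hf hg hα hβ h
    -- The charts belong to different members, so the path lies over their intersection, indeed over
    -- one component of it. This component is a chart contained in `W`, and `a` is factored through
    -- it along the whole path.
    · have hfb : ∀ t, 𝒳.base (f t) ∈ 𝒳.U (f 0).1 := fun t => by
        rw [← fst_eq_of_continuous hf t 0]; exact base_mem _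
      have hgb : ∀ t, 𝒳.base (f t) ∈ 𝒳.U (g 0).1 := fun t => by
        rw [← fst_eq_of_continuous hg t 0, ← (h t).base_eq]; exact base_mem _
      obtain ⟨k, hk, hki, hkj, -⟩ := exists_idx_component _ _ (hfb 0) (hgb 0)
      have hkW : 𝒳.U k ≤ G.W :=
        (le_inf (hki.trans (hα 0)) (hkj.trans (hβ 0))).trans (G.inf_le α β e)
      have hbase : Continuous fun t => 𝒳.base (f t) := by
        have : Continuous 𝒳.base := continuous_sigma fun i => (𝒳.str i).continuous_proj
        exact this.comp hf
      have hmem : ∀ t, 𝒳.base (f t) ∈ 𝒳.U k := fun t => by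
        rw [← SetLike.mem_coe, hk]
        refine (isPreconnected_range hbase).subset_connectedComponentIn (mem_range_self 0) ?_
          (mem_range_self t)
        rintro _ ⟨s, rfl⟩
        exact ⟨hfb s, hgb s⟩
      obtain ⟨ε, w, hw, hwk, hε⟩ := exists_sends_along hf hki hmem
      obtain ⟨b, hb⟩ := exists_factor_along hw h hε
      have hwW : ∀ t, 𝒳.U (w t).1 ≤ G.W := fun t => by rw [hwk]; exact hkW
      have hT : ∀ t, G.T a (f t) = (G.D α).T ε (f t) * (G.D β).T b (w t) := fun t => by
        have := G.val_mul (hε t) (hb t).1 (hα t) (hwW t) (hβ t)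
        rw [(hb t).2] at this
        exact this.T_eq
      have e1 := (G.D α).arr ε f w hf hw hα (fun t => (hwW t).trans (G.W_le _)) hε
      have e2 := (G.D β).arr b w g hw hg (fun t => (hwW t).trans (G.W_le _)) hβ fun t => (hb t).1
      rw [hT, hT, ← _root_.mul_assoc, e1, _root_.mul_assoc, G.P_eq α β hw hwW, e2,
        _root_.mul_assoc]
  comp {a b x y z} hx hy hz h h' := by
    obtain ⟨α, hx⟩ := hx
    obtain ⟨β, hy⟩ := hy
    obtain ⟨γ, hz⟩ := hz
    by_cases h0 : 𝒳.base x ∈ G.W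
    -- All three transition maps are factored through the same point `w` in a chart contained in
    -- `W`; the two transports between `w` and `y` are inverse to each other and cancel.
    · obtain ⟨e, w, he, hw⟩ := G.exists_sends_W h0
      have hwY := fun α => hw.trans (G.W_le α)
      have k1 := he.inv.mul h
      have k2 := h.inv.mul he
      have k3 := k1.mul h'
      have m1 : 𝒳.mul (𝒳.mul a (𝒳.inv e) w) e x = a := by
        rw [← mul_assoc' he he.inv h, he.inv_mul, h.mul_one]
      have m2 : 𝒳.mul (𝒳.mul e (𝒳.inv a) y) (𝒳.mul a (𝒳.inv e) w) w = 𝒳.oneArr w.1 := by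
        rw [mul_assoc' he.inv h k2, ← mul_assoc' h h.inv he, h.inv_mul, he.mul_one, he.mul_inv]
      have m3 : 𝒳.mul (𝒳.mul a (𝒳.inv e) w) (𝒳.mul e (𝒳.inv a) y) y = 𝒳.oneArr y.1 := by
        rw [mul_assoc' h.inv he k1, m1, h.mul_inv]
      have v1 := (G.val_mul he k1 hx hw hy).T_eq
      have v2 := (G.val_mul k2 k3 hy hw hz).T_eq
      have v3 := (G.val_mul he k3 hx hw hz).T_eq
      rw [m1] at v1
      rw [← mul_assoc' k2 k1 h', m3, h'.mul_one] at v2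
      rw [← mul_assoc' he k1 h', m1] at v3
      have v4 := (G.D β).comp (hwY β) hy (hwY β) k1 k2
      rw [m2, (G.D β).T_one (hwY β)] at v4
      rw [v1, v2, v3, _root_.mul_assoc, ← _root_.mul_assoc ((G.D β).T _ w), ← v4,
        _root_.one_mul]
    · obtain rfl := G.eq_of_base_notMem h0 h.base_eq hx hy
      obtain rfl := G.eq_of_base_notMem h0 (h'.base_eq.trans h.base_eq) hx hz
      rw [(val_of_sends h hx hy).T_eq, (val_of_sends h' hy hz).T_eq,
        (val_of_sends (h.mul h') hx hz).T_eq]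
      exact (G.D α).comp hx hy hz h h'
  grp i hi p h hh := by
    obtain ⟨α, hα⟩ := hi
    have hc : Continuous fun t => (⟨i, h t • p⟩ : 𝒳.Pt) :=
      continuous_sigmaMk.comp (hh.smul continuous_const)
    rw [P_of_le hc fun _ => hα, (val_of_sends (sends_grpArr i (h 0) p) hα hα).T_eq,
      (val_of_sends (sends_grpArr i (h 1) p) hα hα).T_eq]
    exact (G.D α).grp i hα p h hh

end GluingData

end Gluing

end Orbispace

/-! ### The extension theorem: compatible representations, their glued local system, its holonomy.
-/

namespace Orbispace

open CategoryTheory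

section Push

variable {X : Type u} [TopologicalSpace X] {𝒳 : Orbispace X} {Y Z : Opens X} (hYZ : Y ≤ Z)

theorem inclusionOfLE_pt_injective : Function.Injective (𝒳.inclusionOfLE hYZ).pt := by
  rintro ⟨⟨i, hi⟩, p⟩ ⟨⟨j, hj⟩, q⟩ h
  obtain ⟨h1, h2⟩ := Sigma.mk.inj_iff.1 h
  obtain rfl : i = j := congrArg Subtype.val h1
  obtain rfl := eq_of_heq h2
  rfl

open Classical in
/-- The extension of an element of the gauge group by the identity. -/
noncomputable def extendGau (h : (𝒳.restrict Y).Gau) : (𝒳.restrict Z).Gau := fun j =>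
  if hj : 𝒳.U j.1 ≤ Y then (show (𝒳.str j.1).Grp from h ⟨j.1, hj⟩) else 1

theorem continuous_extendGau : Continuous (extendGau : (𝒳.restrict Y).Gau → (𝒳.restrict Z).Gau) := by
  refine continuous_pi fun j => ?_
  by_cases hj : 𝒳.U j.1 ≤ Y
  · exact (continuous_apply (A := fun i : (𝒳.restrict Y).Idx => ((𝒳.restrict Y).str i).Grp)
      ⟨j.1, hj⟩).congr fun h =>
        (show (extendGau h : (𝒳.restrict Z).Gau) j = h ⟨j.1, hj⟩ from dif_pos hj).symm
  · exact (continuous_const (y := (1 : (𝒳.str j.1).Grp))).congr fun h =>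
        (show (extendGau h : (𝒳.restrict Z).Gau) j = 1 from dif_neg hj).symm

theorem extendGau_one : (extendGau (1 : (𝒳.restrict Y).Gau) : (𝒳.restrict Z).Gau) = 1 := by
  funext j
  by_cases hj : 𝒳.U j.1 ≤ Y
  · exact dif_pos hj
  · exact dif_neg hj

theorem arr_lact (h : (𝒳.restrict Y).Gau) (a : (𝒳.restrict Y).Arr) :
    (𝒳.inclusionOfLE hYZ).arr (lact h a 1) =
      lact (extendGau h) ((𝒳.inclusionOfLE hYZ).arr a) 1 := by
  have e : (extendGau h : (𝒳.restrict Z).Gau) ((𝒳.inclusionOfLE hYZ).ind a.tgt) = h a.tgt :=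
    dif_pos a.tgt.2
  refine congrArg (Arr.mk (𝒳 := 𝒳.restrict Z) _ _) ?_
  exact congrArg (fun g : (𝒳.str a.tgt.1).Grp => 𝒳.act g a.tran (1 : (𝒳.str a.src.1).Grp)) e.symm

namespace PathSystem

variable {x y : (𝒳.restrict Y).BasePoint} {p q : (𝒳.restrict Z).BasePoint}
  (h₁ : (𝒳.inclusionOfLE hYZ).pt x.point = p.point)
  (h₂ : (𝒳.inclusionOfLE hYZ).pt y.point = q.point)

/-- The gauge group of `Y` has fewer factors than that of `Z`. Extension by `1` is continuous and
preserves `1`, which is what the condition on the transition maps needs. -/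
theorem Tends.push {ι : Type*} {F : Filter ι} {Φ : ι → (𝒳.restrict Y).PathSystem x y}
    {σ : (𝒳.restrict Y).PathSystem x y} (h : Tends F Φ σ) :
    Tends F (fun i => (Φ i).push (𝒳.inclusionOfLE hYZ) h₁ h₂)
      (σ.push (𝒳.inclusionOfLE hYZ) h₁ h₂) where
  shape := h.shape.mono fun i hi => ⟨hi.1, fun k hk => congrArg (𝒳.inclusionOfLE hYZ).ind (hi.2 k hk)⟩
  rho M hM := by
    have hM' := (continuous_extendGau (𝒳 := 𝒳) (Y := Y) (Z := Z)).continuousAt.preimage_mem_nhds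
      (x := 1) (by rwa [extendGau_one])
    refine (h.rho _ hM').mono fun i hi k hk => ?_
    obtain ⟨g, hg, e⟩ := hi k hk
    exact ⟨extendGau g, hg, (congrArg (𝒳.inclusionOfLE hYZ).arr e).trans (arr_lact hYZ g _)⟩
  maps k hk K hK hKI V hV hfV := by
    exact h.maps k hk K hK hKI _ (hV.preimage (𝒳.inclusionOfLE hYZ).continuous_pt) hfV

theorem HtpyStep.push {σ τ : (𝒳.restrict Y).PathSystem x y} (h : σ.HtpyStep τ) :
    (σ.push (𝒳.inclusionOfLE hYZ) h₁ h₂).HtpyStep (τ.push (𝒳.inclusionOfLE hYZ) h₁ h₂) := by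
  obtain h | ⟨Φ, rfl, rfl, h⟩ := h
  · exact Or.inl (h.push _ h₁ h₂)
  · exact Or.inr ⟨fun s => (Φ s).push _ h₁ h₂, rfl, rfl, fun s => (h s).push hYZ h₁ h₂⟩

end PathSystem

variable {x y z : (𝒳.restrict Y).BasePoint} {p q r : (𝒳.restrict Z).BasePoint}
  (h₁ : (𝒳.inclusionOfLE hYZ).pt x.point = p.point)
  (h₂ : (𝒳.inclusionOfLE hYZ).pt y.point = q.point)
  (h₃ : (𝒳.inclusionOfLE hYZ).pt z.point = r.point)

/-- The map of the fundamental groupoids induced by an inclusion. -/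
def pushHom : (x ⟶ y) → (p ⟶ q) :=
  Quot.map (fun σ : (𝒳.restrict Y).PathSystem x y => σ.push (𝒳.inclusionOfLE hYZ) h₁ h₂)
    fun _ _ h => h.push hYZ h₁ h₂

theorem pushHom_comp (α : x ⟶ y) (β : y ⟶ z) :
    pushHom hYZ h₁ h₃ (α ≫ β) = pushHom hYZ h₁ h₂ α ≫ pushHom hYZ h₂ h₃ β := by
  obtain ⟨σ, rfl⟩ := PathSystem.mor_surjective α
  obtain ⟨τ, rfl⟩ := PathSystem.mor_surjective β
  refine PathSystem.Refines.hom_eq (PathSystem.refines_of_subset rfl (fun _ _ => subset_rfl)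
    (fun k _ => ?_) (fun k _ t _ => ?_) fun k _ => ?_)
  · exact apply_ite (𝒳.inclusionOfLE hYZ).ind _ _ _
  · exact apply_ite (𝒳.inclusionOfLE hYZ).pt _ _ _
  · exact apply_ite (𝒳.inclusionOfLE hYZ).arr _ _ _

/-- The image of an identity is idempotent, and all morphisms are invertible. -/
theorem pushHom_id : pushHom hYZ h₁ h₁ (𝟙 x) = 𝟙 p := by
  have := pushHom_comp hYZ h₁ h₁ h₁ (𝟙 x) (𝟙 x)
  rw [Category.comp_id] at this
  rw [← cancel_epi (pushHom hYZ h₁ h₁ (𝟙 x)), ← this, Category.comp_id]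

theorem pushHom_conj {w : (𝒳.restrict Y).BasePoint} {s : (𝒳.restrict Z).BasePoint}
    (h₄ : (𝒳.inclusionOfLE hYZ).pt w.point = s.point) (γ : x ⟶ y) (α : y ⟶ z) (δ : w ⟶ z) :
    pushHom hYZ h₁ h₄ (γ ≫ α ≫ CategoryTheory.inv δ) = pushHom hYZ h₁ h₂ γ ≫
      pushHom hYZ h₂ h₃ α ≫ CategoryTheory.inv (pushHom hYZ h₄ h₃ δ) := by
  rw [← Category.assoc (pushHom hYZ h₁ h₂ γ), IsIso.eq_comp_inv, ← pushHom_comp, ← pushHom_comp]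
  simp only [Category.assoc, IsIso.inv_hom_id, Category.comp_id]

theorem pushHom_elemHom (a : (𝒳.restrict Y).Arr) (f g : unitInterval → (𝒳.restrict Y).Pt)
    (hf : Continuous f) (hg : Continuous g) (h : ∀ t, (𝒳.restrict Y).Sends a (f t) (g t))
    (e₁ : f 0 = x.point) (e₂ : g 1 = y.point) :
    pushHom hYZ h₁ h₂ (elemHom a f g hf hg h e₁ e₂) =
      elemHom ((𝒳.inclusionOfLE hYZ).arr a) _ _ ((𝒳.inclusionOfLE hYZ).continuous_pt.comp hf)
        ((𝒳.inclusionOfLE hYZ).continuous_pt.comp hg) (fun t => (h t).push _)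
        ((congrArg _ e₁).trans h₁) ((congrArg _ e₂).trans h₂) := by
  refine PathSystem.Refines.hom_eq (PathSystem.refines_of_subset rfl (fun _ _ => subset_rfl)
    (fun k _ => ?_) (fun k _ t _ => ?_) fun k _ => rfl)
  · exact apply_ite (𝒳.inclusionOfLE hYZ).ind _ _ _
  · change (𝒳.inclusionOfLE hYZ).pt ((if k = 0 then f else g) t) =
      (if k = 0 then (𝒳.inclusionOfLE hYZ).pt ∘ f else (𝒳.inclusionOfLE hYZ).pt ∘ g) t
    split_ifs <;> rfl

end Push

section Representations

variable {X : Type u} [TopologicalSpace X] {𝒳 : Orbispace X} {H : Type v} [Group H]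

/-- Path-connectedness only provides some base-point structures over the two points; these are
linked to the given ones by transition maps. -/
theorem PathConnected.nonempty_hom (h : 𝒳.PathConnected) (x y : 𝒳.BasePoint) :
    Nonempty (x ⟶ y) := by
  obtain ⟨p, q, hp, hq, ⟨σ⟩⟩ := h.2 x.pt y.pt
  have hb : ∀ z : 𝒳.BasePoint, 𝒳.base z.point = z.pt := fun z => z.proj_lift
  obtain ⟨a, ha⟩ := exists_sends (x := x.point) (y := p.point) (by rw [hb, hb, hp])
  obtain ⟨b, hb⟩ := exists_sends (x := q.point) (y := y.point) (by rw [hb, hb, hq])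
  exact ⟨arrHom a ha ≫ σ.mor ≫ arrHom b hb⟩

variable {o : 𝒳.BasePoint}

/-- A homomorphism from the fundamental group, as a map on the endomorphisms in the fundamental
groupoid. -/
def Pi1Hom.onEnd (R : 𝒳.Pi1Hom o H) : (o ⟶ o) → H :=
  Quot.lift (fun σ : 𝒳.PathSystem o o => R σ.cls.toPi1) fun _ _ h =>
    congrArg R.toFun (Quotient.sound h.joined)

theorem Pi1Hom.onEnd_comp (R : 𝒳.Pi1Hom o H) (α β : o ⟶ o) :
    R.onEnd (α ≫ β) = R.onEnd α * R.onEnd β := by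
  obtain ⟨σ, rfl⟩ := PathSystem.mor_surjective α
  obtain ⟨τ, rfl⟩ := PathSystem.mor_surjective β
  exact R.map_mul σ.cls τ.cls

/-- The representation of the fundamental groupoid given by one of the fundamental group and a
choice of morphisms from the base point. -/
noncomputable def Pi1Hom.rep (R : 𝒳.Pi1Hom o H) (c : ∀ x : 𝒳.BasePoint, o ⟶ x) :
    𝒳.GroupoidRep H where
  map {x y} α := R.onEnd (c x ≫ α ≫ CategoryTheory.inv (c y))
  map_comp {x y z} α β := by
    rw [← R.onEnd_comp]
    simp only [Category.assoc, IsIso.inv_hom_id_assoc]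

theorem Pi1Hom.rep_map (R : 𝒳.Pi1Hom o H) (c : ∀ x : 𝒳.BasePoint, o ⟶ x) {x y : 𝒳.BasePoint}
    (α : x ⟶ y) : (R.rep c).map α = R.onEnd (c x ≫ α ≫ CategoryTheory.inv (c y)) := rfl

/-- The same parallel section serves for both systems, since the two transports agree on everything
coming from `Y`. -/
theorem hol_push {Y : Opens X} {S : Set 𝒳.Idx} (D : LocalSystem (𝒳.restrict Y) univ H)
    (D' : LocalSystem 𝒳 S H) (hS : ∀ i, 𝒳.U i ≤ Y → i ∈ S)
    (hT : ∀ {a x y}, (𝒳.restrict Y).Sends a x y →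
      D'.T ((𝒳.inclusion Y).arr a) ((𝒳.inclusion Y).pt x) = D.T a x)
    (hP : ∀ f : unitInterval → (𝒳.restrict Y).Pt, Continuous f →
      D'.P (fun t => (𝒳.inclusion Y).pt (f t)) = D.P f)
    {x y : (𝒳.restrict Y).BasePoint} {p q : 𝒳.BasePoint}
    (h₁ : (𝒳.inclusion Y).pt x.point = p.point) (h₂ : (𝒳.inclusion Y).pt y.point = q.point)
    (σ : (𝒳.restrict Y).PathSystem x y) :
    D'.hol (σ.push (𝒳.inclusion Y) h₁ h₂) = D.hol σ := by
  have hσ : σ.InCharts univ := fun _ _ => trivial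
  obtain ⟨u, hu, -⟩ := LocalSystem.exists_isTransport (D := D) hσ
  have hu' : D'.IsTransport (σ.push (𝒳.inclusion Y) h₁ h₂) u := by
    refine ⟨fun k hk s hs t ht => ?_, fun k hk t ht ht' => ?_⟩
    · rw [hu.path k hk s hs t ht, ← hP _ (continuous_seg (σ.continuousOn_f k hk)
        (σ.ordConnected_I k hk) hs ht)]
      rfl
    · rw [hu.jump k hk t ht ht', ← hT (σ.ρ_sends k hk t ⟨ht, ht'⟩)]
      rfl
  rw [hu.hol_eq hσ, hu'.hol_eq fun k _ => hS _ (σ.chart k).2]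
  rfl

end Representations

section VanKampen

variable {X : Type u} [TopologicalSpace X] {𝒳 : Orbispace X} {H : Type v} [Group H]

/-- Push the given morphism forward wherever the base-point structure comes from `W`, and choose
arbitrarily elsewhere. The first rule is unambiguous because the inclusion is injective on points.
-/
theorem exists_compatible_hom {Y W : Opens X} (hWY : W ≤ Y) {o : 𝒳.BasePoint}
    (ho : 𝒳.U o.idx ≤ W) (hY : (𝒳.restrict Y).PathConnected)
    (c : ∀ x : (𝒳.restrict W).BasePoint, o.restrict W ho ⟶ x) :
    ∃ c' : ∀ x : (𝒳.restrict Y).BasePoint, o.restrict Y (ho.trans hWY) ⟶ x,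
      ∀ (x : (𝒳.restrict W).BasePoint) (p : (𝒳.restrict Y).BasePoint)
        (h : (𝒳.inclusionOfLE hWY).pt x.point = p.point), c' p = pushHom hWY rfl h (c x) := by
  classical
  refine ⟨fun p => if h : ∃ x : (𝒳.restrict W).BasePoint,
    (𝒳.inclusionOfLE hWY).pt x.point = p.point then pushHom hWY rfl h.choose_spec (c h.choose)
    else (hY.nonempty_hom _ p).some, fun x p h => ?_⟩
  have h' : ∃ x : (𝒳.restrict W).BasePoint, (𝒳.inclusionOfLE hWY).pt x.point = p.point := ⟨x, h⟩
  have e : h'.choose = x := BasePoint.eq_of_point_eq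
    (inclusionOfLE_pt_injective hWY (h'.choose_spec.trans h.symm))
  refine (dif_pos h').trans ?_
  subst e
  rfl

/-- With compatible choices, the loop at `o` associated with a pushed morphism is itself pushed from
`W`, where the two homomorphisms agree by assumption. -/
theorem rep_map_pushHom {Y W : Opens X} (hWY : W ≤ Y) {o : 𝒳.BasePoint} (ho : 𝒳.U o.idx ≤ W)
    (R : (𝒳.restrict Y).Pi1Hom (o.restrict Y (ho.trans hWY)) H)
    (R' : (𝒳.restrict W).Pi1Hom (o.restrict W ho) H)
    (hR : ∀ a : (𝒳.restrict W).LoopSpace (o.restrict W ho),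
      R (LoopSpace.inclOfLE hWY ho a).toPi1 = R' a.toPi1)
    {c : ∀ x : (𝒳.restrict W).BasePoint, o.restrict W ho ⟶ x}
    {c' : ∀ x : (𝒳.restrict Y).BasePoint, o.restrict Y (ho.trans hWY) ⟶ x}
    (hc : ∀ (x : (𝒳.restrict W).BasePoint) (p : (𝒳.restrict Y).BasePoint)
      (h : (𝒳.inclusionOfLE hWY).pt x.point = p.point), c' p = pushHom hWY rfl h (c x))
    {x y : (𝒳.restrict W).BasePoint} {p q : (𝒳.restrict Y).BasePoint}
    (h₁ : (𝒳.inclusionOfLE hWY).pt x.point = p.point)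
    (h₂ : (𝒳.inclusionOfLE hWY).pt y.point = q.point) (α : x ⟶ y) :
    (R.rep c').map (pushHom hWY h₁ h₂ α) = (R'.rep c).map α := by
  rw [Pi1Hom.rep_map, Pi1Hom.rep_map, hc x p h₁, hc y q h₂]
  refine (congrArg R.onEnd (pushHom_conj hWY (p := o.restrict Y (ho.trans hWY))
    (s := o.restrict Y (ho.trans hWY)) rfl h₁ h₂ rfl (c x) α (c y)).symm).trans ?_
  obtain ⟨σ, hσ⟩ := PathSystem.mor_surjective (c x ≫ α ≫ CategoryTheory.inv (c y))
  rw [← hσ]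
  exact hR σ.cls

/-- Homomorphisms from the fundamental groups of the members of an open cover extend to the whole
space if all the pairwise intersections are the same path-connected open set. -/
theorem exists_pi1Hom_of_cover {ι : Type*} (Y : ι → Opens X) (W : Opens X)
    (hY : ∀ p, ∃ α, p ∈ Y α) (hYW : ∀ α β, α ≠ β → Y α ⊓ Y β ≤ W) (hWY : ∀ α, W ≤ Y α)
    (h : ∀ α, (𝒳.restrict (Y α)).PathConnected) (hW : (𝒳.restrict W).PathConnected)
    (o : 𝒳.BasePoint) (ho : 𝒳.U o.idx ≤ W)
    (R : ∀ α, (𝒳.restrict (Y α)).Pi1Hom (o.restrict (Y α) (ho.trans (hWY α))) H)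
    (R' : (𝒳.restrict W).Pi1Hom (o.restrict W ho) H)
    (hR : ∀ α, ∀ a : (𝒳.restrict W).LoopSpace (o.restrict W ho),
      R α (LoopSpace.inclOfLE (hWY α) ho a).toPi1 = R' a.toPi1) :
    ∃ s : 𝒳.Pi1Hom o H, ∀ α,
      ∀ a : (𝒳.restrict (Y α)).LoopSpace (o.restrict (Y α) (ho.trans (hWY α))),
        s (LoopSpace.incl (ho.trans (hWY α)) a).toPi1 = R α a.toPi1 := by
  classical
  -- The choice at the base point is the identity, so that the groupoid representations restrict to
  -- the given homomorphisms exactly and not only up to conjugation.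
  obtain ⟨c, hc⟩ : ∃ c : ∀ x : (𝒳.restrict W).BasePoint, o.restrict W ho ⟶ x,
      c (o.restrict W ho) = 𝟙 _ :=
    ⟨fun x => if hx : o.restrict W ho = x then eqToHom hx else (hW.nonempty_hom _ x).some,
      dif_pos rfl⟩
  choose c' hc' using fun α => exists_compatible_hom (hWY α) ho (h α) c
  have hne : ∀ α, Nonempty (𝒳.restrict (Y α)).Pt := fun α =>
    ⟨(o.restrict (Y α) (ho.trans (hWY α))).point⟩
  let V := fun α => (R α).rep (c' α)
  have hV : ∀ α {x y : (𝒳.restrict W).BasePoint} {p q : (𝒳.restrict (Y α)).BasePoint}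
      (h₁ : (𝒳.inclusionOfLE (hWY α)).pt x.point = p.point)
      (h₂ : (𝒳.inclusionOfLE (hWY α)).pt y.point = q.point) (γ : x ⟶ y),
      (V α).map (pushHom (hWY α) h₁ h₂ γ) = (R'.rep c).map γ := fun α _ _ _ _ h₁ h₂ γ =>
    rep_map_pushHom (hWY α) ho (R α) R' (hR α) (hc' α) h₁ h₂ γ
  -- On charts contained in `W` all the local systems equal the one coming from `R'`; this is their
  -- agreement required for gluing.
  have hT : ∀ α {a x y}, (𝒳.restrict W).Sends a x y →
      ((V α).localSystem.ofRestrict (𝒳 := 𝒳)).T ((𝒳.inclusion W).arr a) ((𝒳.inclusion W).pt x) =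
        (R'.rep c).onArr a x := by
    intro α a x y hs
    have e := (R'.rep c).onArr_eq (x := ptBase x) (y := ptBase y) hs
    have e' := (V α).onArr_eq (x := ptBase ((𝒳.inclusionOfLE (hWY α)).pt x))
      (y := ptBase ((𝒳.inclusionOfLE (hWY α)).pt y)) (hs.push (𝒳.inclusionOfLE (hWY α)))
    refine ((V α).localSystem.ofRestrict_T ((𝒳.inclusionOfLE (hWY α)).arr a)
      ((𝒳.inclusionOfLE (hWY α)).pt x)).trans (e'.trans (Eq.trans ?_ e.symm))
    rw [← hV α (p := ptBase ((𝒳.inclusionOfLE (hWY α)).pt x))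
      (q := ptBase ((𝒳.inclusionOfLE (hWY α)).pt y)) rfl rfl]
    refine congrArg (V α).map ?_
    exact (pushHom_elemHom (hWY α) rfl rfl ..).symm
  have hP : ∀ α {f : unitInterval → (𝒳.restrict W).Pt}, Continuous f →
      ((V α).localSystem.ofRestrict (𝒳 := 𝒳)).P (fun t => (𝒳.inclusion W).pt (f t)) =
        (R'.rep c).onPath f := by
    intro α f hf
    have e := (R'.rep c).onPath_eq (x := ptBase (f 0)) (y := ptBase (f 1)) f hf rfl rfl
    have e' := (V α).onPath_eq (x := ptBase ((𝒳.inclusionOfLE (hWY α)).pt (f 0)))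
      (y := ptBase ((𝒳.inclusionOfLE (hWY α)).pt (f 1))) _
      ((𝒳.inclusionOfLE (hWY α)).continuous_pt.comp hf) rfl rfl
    refine ((V α).localSystem.ofRestrict_P fun t => (𝒳.inclusionOfLE (hWY α)).pt (f t)).trans
      (e'.trans (Eq.trans ?_ e.symm))
    rw [← hV α (p := ptBase ((𝒳.inclusionOfLE (hWY α)).pt (f 0)))
      (q := ptBase ((𝒳.inclusionOfLE (hWY α)).pt (f 1))) rfl rfl]
    refine congrArg (V α).map ?_
    exact (pushHom_elemHom (hWY α) (x := ptBase (f 0)) (y := ptBase (f 1))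
      (p := ptBase ((𝒳.inclusionOfLE (hWY α)).pt (f 0)))
      (q := ptBase ((𝒳.inclusionOfLE (hWY α)).pt (f 1))) rfl rfl ((𝒳.restrict W).oneArr (f 0).1) f f hf hf
      (fun t => sends_oneArr (fst_eq_of_continuous hf t 0)) rfl rfl).symm
  let G : 𝒳.GluingData H ι :=
    { Y := Y
      W := W
      inf_le := hYW
      W_le := hWY
      D := fun α => (V α).localSystem.ofRestrict
      T_eq := fun α β {a x y} hs hx hy => by
        obtain ⟨a, x, y, hs', rfl, rfl, rfl⟩ := exists_sends_inclusion hs hx hy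
        rw [hT α hs', hT β hs']
      P_eq := fun α β {f} hf hfW => by
        obtain ⟨f, hf', e⟩ := exists_continuous_inclusion hf hfW
        obtain rfl := funext e
        rw [hP α hf', hP β hf'] }
  have hS : ∀ p : X, ∃ i ∈ G.charts, p ∈ 𝒳.U i := fun p => by
    obtain ⟨α, hα⟩ := hY p
    obtain ⟨_, ⟨i, rfl⟩, hi, hi'⟩ := 𝒳.isBasis.exists_subset_of_mem_open hα (Y α).isOpen
    exact ⟨i, ⟨α, hi'⟩, hi⟩
  have hS' : ∀ i ∈ G.charts, ∀ j, 𝒳.U j ≤ 𝒳.U i → j ∈ G.charts := fun i ⟨α, hα⟩ j hj =>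
    ⟨α, hj.trans hα⟩
  have hoS : o.idx ∈ G.charts := by
    obtain ⟨α, -⟩ := hY o.pt
    exact ⟨α, ho.trans (hWY α)⟩
  have hrep : ∀ a : 𝒳.LoopSpace o, ∃ κ : 𝒳.PathSystem o o, κ.cls = a ∧ κ.InCharts G.charts := by
    rintro ⟨σ⟩
    obtain ⟨κ, h1, h2⟩ := PathSystem.exists_inCharts_refinement hS hS' hoS hoS σ
    exact ⟨κ, PathSystem.cls_eq_of_refines h1, h2⟩
  -- The extension is the holonomy of the glued local system, well defined on path components by
  -- homotopy invariance.
  refine ⟨⟨Quotient.lift (fun a => G.glue.holCls a) fun a b hab =>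
    LocalSystem.holCls_eq_of_joined hS hS' hoS hoS hab, fun a b => ?_⟩, fun α a => ?_⟩
  · obtain ⟨κ, rfl, hκ⟩ := hrep a
    obtain ⟨τ, rfl, hτ⟩ := hrep b
    change G.glue.holCls (κ.concat τ).cls = G.glue.holCls κ.cls * G.glue.holCls τ.cls
    rw [LocalSystem.holCls_cls hκ, LocalSystem.holCls_cls hτ,
      LocalSystem.holCls_cls (LocalSystem.inCharts_concat hκ hτ), LocalSystem.hol_concat hκ hτ]
  · obtain ⟨σ⟩ := a
    change G.glue.holCls (σ.push (𝒳.inclusion (Y α)) rfl rfl).cls = _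
    have hin : (σ.push (𝒳.inclusion (Y α)) rfl rfl : 𝒳.PathSystem o o).InCharts G.charts :=
      fun k _ => ⟨α, (σ.chart k).2⟩
    rw [LocalSystem.holCls_cls hin]
    -- For a system in `Y α` the glued transport is the one of `Y α`, whose holonomy is the value of
    -- the groupoid representation.
    have e := hol_push (V α).localSystem G.glue (fun i hi => ⟨α, hi⟩) (fun {a x y} hs =>
      (GluingData.val_of_sends (G := G) (α := α) (hs.push (𝒳.inclusion (Y α))) x.1.2
        y.1.2).T_eq.trans ((V α).localSystem.ofRestrict_T a x)) (fun f hf =>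
      (GluingData.P_of_le (G := G) (α := α) ((𝒳.inclusion (Y α)).continuous_pt.comp hf)
        fun t => (f t).1.2).trans ((V α).localSystem.ofRestrict_P f))
      (p := o) (q := o) rfl rfl σ
    rw [e, GroupoidRep.hol_eq]
    have hco : c' α (o.restrict (Y α) (ho.trans (hWY α))) = 𝟙 _ := by
      rw [hc' α (o.restrict W ho) _ rfl, hc]
      exact pushHom_id (hWY α) (p := o.restrict (Y α) (ho.trans (hWY α))) rfl
    change (R α).onEnd (c' α _ ≫ σ.mor ≫ CategoryTheory.inv (c' α _)) = _
    rw [hco, IsIso.inv_id, Category.comp_id, Category.id_comp]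
    rfl

end VanKampen

end Orbispace

theorem theorem4p3p1 {X : Type u} [TopologicalSpace X] (𝒳 : Orbispace X) (X₁ X₂ : Opens X)
    (hX : X₁ ⊔ X₂ = ⊤)
    (h₁ : (𝒳.restrict X₁).PathConnected) (h₂ : (𝒳.restrict X₂).PathConnected)
    (h₁₂ : (𝒳.restrict (X₁ ⊓ X₂)).PathConnected)
    (o : 𝒳.BasePoint) (ho : 𝒳.U o.idx ≤ X₁ ⊓ X₂)
    {H : Type v} [Group H]
    (ρ₁ : (𝒳.restrict X₁).Pi1Hom (o.restrict X₁ (ho.trans inf_le_left)) H)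
    (ρ₂ : (𝒳.restrict X₂).Pi1Hom (o.restrict X₂ (ho.trans inf_le_right)) H)
    (ρ₁₂ : (𝒳.restrict (X₁ ⊓ X₂)).Pi1Hom (o.restrict (X₁ ⊓ X₂) ho) H)
    (hρ₁ : ∀ a : (𝒳.restrict (X₁ ⊓ X₂)).LoopSpace (o.restrict (X₁ ⊓ X₂) ho),
      ρ₁ (Orbispace.LoopSpace.inclOfLE inf_le_left ho a).toPi1 = ρ₁₂ a.toPi1)
    (hρ₂ : ∀ a : (𝒳.restrict (X₁ ⊓ X₂)).LoopSpace (o.restrict (X₁ ⊓ X₂) ho),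
      ρ₂ (Orbispace.LoopSpace.inclOfLE inf_le_right ho a).toPi1 = ρ₁₂ a.toPi1) :
    ∃ s : 𝒳.Pi1Hom o H,
      (∀ a : (𝒳.restrict X₁).LoopSpace (o.restrict X₁ (ho.trans inf_le_left)),
        s (Orbispace.LoopSpace.incl (ho.trans inf_le_left) a).toPi1 = ρ₁ a.toPi1) ∧
      (∀ a : (𝒳.restrict X₂).LoopSpace (o.restrict X₂ (ho.trans inf_le_right)),
        s (Orbispace.LoopSpace.incl (ho.trans inf_le_right) a).toPi1 = ρ₂ a.toPi1) ∧
      ∀ a : (𝒳.restrict (X₁ ⊓ X₂)).LoopSpace (o.restrict (X₁ ⊓ X₂) ho),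
        s (Orbispace.LoopSpace.incl ho a).toPi1 = ρ₁₂ a.toPi1 := by
  -- The cover is indexed by `Bool`, with `W` the intersection of its two members.
  obtain ⟨s, hs⟩ := Orbispace.exists_pi1Hom_of_cover
    (fun α => Bool.rec (motive := fun _ => Opens X) X₁ X₂ α) (X₁ ⊓ X₂)
    (fun p => by
      have hp : p ∈ X₁ ⊔ X₂ := hX ▸ trivial
      exact hp.elim (fun h => ⟨false, h⟩) fun h => ⟨true, h⟩)
    (by
      rintro (_ | _) (_ | _) h
      · exact absurd rfl h
      · exact le_rfl
      · exact inf_comm X₂ X₁ |>.le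
      · exact absurd rfl h)
    (Bool.rec inf_le_left inf_le_right) (Bool.rec h₁ h₂) h₁₂ o ho (Bool.rec ρ₁ ρ₂) ρ₁₂
    (Bool.rec hρ₁ hρ₂)
  refine ⟨s, hs false, hs true, fun a => ?_⟩
  -- The inclusion of the intersection factors through `X₁`, so the last equation follows from the
  -- first one.
  rw [← hρ₁ a, ← hs false]
  congr 2
  obtain ⟨σ⟩ := a
  rfl
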